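/- **Setting.** Let $f:\mathbb{R}^n\times\mathbb{R}^d\to\mathbb{R}^n$ and $\Lambda:\mathbb{R}\to\mathbb{R}^d$ be $C^1$. For a rate $r>0$ consider $$x'=f(x,\Lambda(\tau))/r. \qquad (1)$$ Assume that $\Lambda$ is exponentially asymptotically constant to $\lambda^+$ with decay coefficient $\rho>0$: $\Lambda(\tau)\to\lambda^+$ and $\lim_{\tau\to+\infty}\Lambda'(\tau)/e^{-\rho\tau}$ exists. Let $\eta^+$ be an equilibrium regular edge state of the future limit system $\dot x=f(x,\lambda^+)$, that is, a hyperbolic equilibrium with exactly one unstable direction (exactly one eigenvalue, counted with multiplicity, with positive real part). Fix $\alpha\in(0,\rho]$ and $r_c>0$. Put $s=g_\alpha(\tau)=\tanh(\alpha\tau/2)$. The compactified system is $$x'=f(x,\Lambda_\alpha(s))/r,\qquad s'=\alpha(1-s^2)/2,$$ where $\Lambda_\alpha(s)=\Lambda(g_\alpha^{-1}(s))$ for $|s|<1$ and $\Lambda_\alpha(1)=\lambda^+$. Write $\tilde\eta^+=(\eta^+,1)$. Consider either of two cases. 1. The phase space is $\mathbb{R}^n\times(-1,1]$. The solution $x^{[r]}$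 of (1) is the one with $x^{[r]}(\tau_0)=x_0$, for a fixed $(x_0,\tau_0)$, and $\mathrm{trj}^{[r]}_\alpha$ is the forward trajectory of $(x_0,g_\alpha(\tau_0))$. 2. In addition, $\Lambda(\tau)\to\lambda^-$ as $\tau\to-\infty$, the limit $\lim_{\tau\to-\infty}\Lambda'(\tau)/e^{\rho\tau}$ exists, and $e^-$ is a hyperbolic sink of $\dot x=f(x,\lambda^-)$. The phase space is $\mathbb{R}^n\times[-1,1]$ with $\Lambda_\alpha(-1)=\lambda^-$. Either $x^{[r]}$ and $\mathrm{trj}^{[r]}_\alpha$ are as in case 1, or $x^{[r]}$ is the solution with $x^{[r]}(\tau)\to e^-$ as $\tau\to-\infty$ and $\mathrm{trj}^{[r]}_\alpha$ is the trajectory with $s>-1$ in the unstable manifold of $(e^-,-1)$. Solutions need not exist for all later times; "$x^{[r]}\to\eta^+$" includes that $x^{[r]}$ exists for all later times. **Attractors and connections.** For an autonomous system on a phase space $X$, an attractor is a nonempty compact invariant set that is the $\omega$-limit set $\bigcap_{T>0}\overline{\{\psi(\tau,D):\tau>T\}}$ of some neighbourhood $D$ of itself (closure and neighbourhood in $X$)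 and has no nonempty proper subset with this property. A connecting orbit from an equilibrium $p$ to an attractor $A$, where $p\notin A$, is a solution on $\mathbb{R}$ that converges to $p$ in backward time and has $\omega$-limit set $A$. A set is a connection from $p$ to an attractor if it is the union of $\{p\}$, the image of a connecting orbit from $p$ to an attractor $A\not\ni p$, and $A$. A branch of the unstable manifold $W^u(p)$ is a trajectory in $W^u(p)$ other than $\{p\}$; it is a connection from $p$ to an attractor if it is the image of a connecting orbit from $p$ to an attractor not containing $p$. **Non-degenerate R-tipping.** The upper edge tail is $x^{[r_c^+]}=\bigcap_{T,\delta>0}\overline{\{x^{[r]}(\tau):\tau>T,\ r\in(r_c,r_c+\delta)\}}$, and the lower edge tail $x^{[r_c^-]}$ is defined in the same way with positive $r\in(r_c-\delta,r_c)$. System (1) undergoes non-degenerate R-tipping at $\eta^+$ with critical rate $r_c$ if $x^{[r_c]}(\tau)\to\eta^+$ as $\tau\to+\infty$; there is $\delta>0$ such that $x^{[r]}(\tau)\not\to\eta^+$ for all $r>0$ with $0<|r-r_c|<\delta$; $x^{[r_c^+]}\neq x^{[r_c^-]}$; and each of the two edge tails is a connection from $\eta^+$ to an attractor of the future limit system.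 **Sides of the stable manifold.** For an open neighbourhood $N$ of $\tilde\eta^+$, let $W^{s,[r]}_N(\tilde\eta^+)$ be the set of points whose forward trajectories stay in $N$ and converge to $\tilde\eta^+$. We say that $\mathrm{trj}^{[r]}_\alpha$ lies on different sides of $W^{s,[r]}_\alpha(\tilde\eta^+)$ for $r\in(r_c-\delta,r_c)$ and for $r\in(r_c,r_c+\delta)$, where $0<\delta\le r_c$, if for some such $N$ the set of all $(q,r)$ with $q$ in $N$ and in the phase space, $|r-r_c|<\delta$ and $q\notin W^{s,[r]}_N(\tilde\eta^+)$ has exactly two connected components $S_-\neq S_+$, the set $\mathrm{trj}^{[r]}_\alpha\cap N$ is nonempty whenever $0<|r-r_c|<\delta$, and $(q,r)\in S_-$ for all $q\in\mathrm{trj}^{[r]}_\alpha\cap N$, $r\in(r_c-\delta,r_c)$, while $(q,r)\in S_+$ for all $q\in\mathrm{trj}^{[r]}_\alpha\cap N$, $r\in(r_c,r_c+\delta)$. **Proposition.** In each of these cases, system (1) undergoes non-degenerate R-tipping at $\eta^+$ with critical rate $r_c$ if and only if, in the compactified system: (a) for $r=r_c$, $\mathrm{trj}^{[r_c]}_\alpha$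 is contained in the stable manifold $W^{s,[r_c]}_\alpha(\tilde\eta^+)$; (b) there is a $\delta>0$ such that for $r\in(r_c-\delta,r_c)$ and $r\in(r_c,r_c+\delta)$, $\mathrm{trj}^{[r]}_\alpha$ lies on different sides of $W^{s,[r]}_\alpha(\tilde\eta^+)$; (c) each branch of $W^u(\tilde\eta^+)$ is a connection from $\tilde\eta^+$ to an attractor of the compactified system. -/

import Mathlib

open Set Filter Topology

noncomputable section

namespace RTip

/-- The space `ℝⁿ` with its Euclidean norm. -/
abbrev E (n : ℕ) := EuclideanSpace ℝ (Fin n)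

section Autonomous

variable {V : Type*} [NormedAddCommGroup V] [NormedSpace ℝ V]

/-- `y` solves the autonomous equation `y' = F y` on the time set `I` and stays in the phase
space `X` there (one-sided derivatives at end points of `I`). -/
def IsSolution (F : V → V) (X : Set V) (I : Set ℝ) (y : ℝ → V) : Prop :=
  IsIntegralCurveOn y (fun _ => F) I ∧ ∀ t ∈ I, y t ∈ X

/-- The solution started from `p` exists on `[0,t]` and is equal to `q` at time `t`. -/
def Reaches (F : V → V) (X : Set V) (t : ℝ) (p q : V) : Prop :=
  0 ≤ t ∧ ∃ y : ℝ → V, IsSolution F X (Icc 0 t) y ∧ y 0 = p ∧ y t = q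

/-- The forward trajectory of `p`. -/
def forwardTrj (F : V → V) (X : Set V) (p : V) : Set V :=
  {q | ∃ t, Reaches F X t p q}

/-- The full trajectory of `p`, on its maximal interval of existence. -/
def fullTrj (F : V → V) (X : Set V) (p : V) : Set V :=
  {q | ∃ t, Reaches F X t p q ∨ Reaches F X t q p}

/-- The `ω`-limit set of a set `D`: the intersection over `T > 0` of the closures (in `X`) of the
set of all points that are reached from `D` at times larger than `T`. -/
def omegaLimitSet (F : V → V) (X D : Set V) : Set V :=
  {q | q ∈ X ∧ ∀ T > 0, q ∈ closure {z | ∃ τ > T, ∃ p ∈ D, Reaches F X τ p z}}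

/-- `A` is nonempty and is the `ω`-limit set of one of its neighbourhoods in `X`. -/
def IsOmegaLimitOfNhd (F : V → V) (X A : Set V) : Prop :=
  A.Nonempty ∧ ∃ U : Set V, U ⊆ X ∧ (∃ O : Set V, IsOpen O ∧ A ⊆ O ∧ O ∩ X ⊆ U) ∧
    omegaLimitSet F X U = A

/-- Through each point of `A` passes a solution that exists for all times and stays in `A`. -/
def IsInvariantSet (F : V → V) (X A : Set V) : Prop :=
  ∀ p ∈ A, ∃ y : ℝ → V, IsSolution F X univ y ∧ y 0 = p ∧ ∀ t, y t ∈ A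

/-- Attractor: a nonempty compact invariant set that is the `ω`-limit set of a neighbourhood of
itself and has no nonempty proper subset with this last property. -/
structure IsAttractor (F : V → V) (X A : Set V) : Prop where
  subset : A ⊆ X
  compact : IsCompact A
  invariant : IsInvariantSet F X A
  omega : IsOmegaLimitOfNhd F X A
  minimal : ∀ A', A' ⊆ A → IsOmegaLimitOfNhd F X A' → A' = A

/-- `y` is a connecting orbit from the equilibrium `p` to the set `A`: a solution for all times
that converges to `p` in backward time and whose (forward) `ω`-limit set is `A`. -/
structure IsConnectingOrbit (F : V → V) (X : Set V) (p : V) (A : Set V) (y : ℝ → V) : Prop where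
  solution : IsSolution F X univ y
  source : Tendsto y atBot (𝓝 p)
  target : {q | q ∈ X ∧ MapClusterPt q atTop y} = A

/-- The stable set (stable manifold) of the equilibrium `p`. -/
def stableSet (F : V → V) (X : Set V) (p : V) : Set V :=
  {q | ∃ y : ℝ → V, IsSolution F X (Ici 0) y ∧ y 0 = q ∧ Tendsto y atTop (𝓝 p)}

/-- The local stable set (local stable manifold) of the equilibrium `p` in `N`: the points whose
forward trajectory stays in `N` and converges to `p`. -/
def localStableSet (F : V → V) (X N : Set V) (p : V) : Set V :=
  {q | ∃ y : ℝ → V, IsSolution F X (Ici 0) y ∧ y 0 = q ∧ (∀ t ≥ 0, y t ∈ N) ∧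
    Tendsto y atTop (𝓝 p)}

/-- The unstable set (unstable manifold) of the equilibrium `p`. -/
def unstableSet (F : V → V) (X : Set V) (p : V) : Set V :=
  {q | ∃ y : ℝ → V, IsSolution F X (Iic 0) y ∧ y 0 = q ∧ Tendsto y atBot (𝓝 p)}

/-- A branch of the unstable manifold of `p`: a trajectory in it other than `p` itself. -/
def IsUnstableBranch (F : V → V) (X : Set V) (p : V) (B : Set V) : Prop :=
  ∃ q ∈ unstableSet F X p, q ≠ p ∧ B = fullTrj F X q

/-- The branch `B` is a connection from `p` to an attractor (that does not contain `p`). -/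
def BranchConnects (F : V → V) (X : Set V) (p : V) (B : Set V) : Prop :=
  ∃ A : Set V, IsAttractor F X A ∧ p ∉ A ∧
    ∃ y : ℝ → V, IsConnectingOrbit F X p A y ∧ B = range y

/-- The set `K` is a connection from `p` to an attractor: it consists of `p`, a connecting orbit,
and the attractor (that does not contain `p`). -/
def SetConnects (F : V → V) (X : Set V) (p : V) (K : Set V) : Prop :=
  ∃ A : Set V, IsAttractor F X A ∧ p ∉ A ∧
    ∃ y : ℝ → V, IsConnectingOrbit F X p A y ∧ K = {p} ∪ range y ∪ A

/-- All pairs (point of `N`, rate in `(rc - δ, rc + δ)`) for which the point is not on the local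
stable manifold of `p` for that rate. -/
def offStable (F : ℝ → V → V) (X N : Set V) (p : V) (rc δ : ℝ) : Set (V × ℝ) :=
  {z | z.1 ∈ N ∩ X ∧ z.2 ∈ Ioo (rc - δ) (rc + δ) ∧ z.1 ∉ localStableSet (F z.2) X N p}

/-- For the rates `r` below and above `rc` (and close to `rc`) the trajectory `trj r` lies on
different sides of the stable manifold of `p` for the vector field `F r`.

Near `p` the local stable manifolds for all rates near `rc` form a hypersurface that cuts (a
neighbourhood of `p`) × (an interval of rates) into exactly two connected components: these are
the sides `Sm` and `Sp`, labelled consistently in `r`. -/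
def LiesOnDifferentSides (F : ℝ → V → V) (X : Set V) (p : V) (trj : ℝ → Set V) (rc : ℝ) : Prop :=
  ∃ δ : ℝ, 0 < δ ∧ δ ≤ rc ∧ ∃ N : Set V, IsOpen N ∧ p ∈ N ∧ ∃ Sm Sp : Set (V × ℝ), Sm ≠ Sp ∧
    (fun z => connectedComponentIn (offStable F X N p rc δ) z) '' (offStable F X N p rc δ)
      = {Sm, Sp} ∧
    (∀ r ∈ Ioo (rc - δ) rc, (trj r ∩ N).Nonempty ∧ ∀ q ∈ trj r ∩ N, (q, r) ∈ Sm) ∧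
    (∀ r ∈ Ioo rc (rc + δ), (trj r ∩ N).Nonempty ∧ ∀ q ∈ trj r ∩ N, (q, r) ∈ Sp)

/-- The three conditions in the compactified system, for a rate-dependent vector field `F`, an
equilibrium `p` and a rate-dependent trajectory `trj`. -/
structure IsNondegenerateConnection (F : ℝ → V → V) (X : Set V) (p : V) (trj : ℝ → Set V)
    (rc : ℝ) : Prop where
  connection : trj rc ⊆ stableSet (F rc) X p
  sides : LiesOnDifferentSides F X p trj rc
  branches : ∀ B, IsUnstableBranch (F rc) X p B → BranchConnects (F rc) X p B

end Autonomous

section Equilibria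

variable {n : ℕ}

/-- The eigenvalues (complex, with algebraic multiplicity) of the linearisation of `g` at `p`. -/
def eigenvaluesAt (g : E n → E n) (p : E n) : Multiset ℂ :=
  ((LinearMap.charpoly (fderiv ℝ g p : E n →ₗ[ℝ] E n)).map (algebraMap ℝ ℂ)).roots

/-- Hyperbolic sink of `x' = g x`. -/
def IsHyperbolicSink (g : E n → E n) (p : E n) : Prop :=
  g p = 0 ∧ ∀ z ∈ eigenvaluesAt g p, z.re < 0

open Classical in
/-- Equilibrium regular edge state of `x' = g x`: a hyperbolic equilibrium with exactly one
unstable direction. -/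
def IsRegularEdgeEquilibrium (g : E n → E n) (p : E n) : Prop :=
  g p = 0 ∧ (∀ z ∈ eigenvaluesAt g p, z.re ≠ 0) ∧
    Multiset.card ((eigenvaluesAt g p).filter (fun z => 0 < z.re)) = 1

end Equilibria

section Nonautonomous

variable {n d : ℕ}

/-- What singles out the solution `x^{[r]}`: an initial state `(x₀, τ₀)`, or the equilibrium `e⁻`
of the past limit system to which it converges as `τ → -∞`. -/
inductive Start (n : ℕ) where
  | point (x₀ : E n) (τ₀ : ℝ) : Start n
  | past (e : E n) : Start n

/-- The times on which the solution is considered. -/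
def Start.times : Start n → Set ℝ
  | .point _ τ₀ => Ici τ₀
  | .past _ => univ

/-- The condition that singles out the solution. -/
def Start.Condition : Start n → (ℝ → E n) → Prop
  | .point x₀ τ₀, x => x τ₀ = x₀
  | .past e, x => Tendsto x atBot (𝓝 e)

/-- The nonautonomous vector field `f (x, Λ(τ)) / r`. -/
def nonautField (f : E n × E d → E n) (Λ : ℝ → E d) (r : ℝ) : ℝ → E n → E n :=
  fun τ x => r⁻¹ • f (x, Λ τ)

/-- `x^{[r]}(τ)` exists and equals `p`. -/
def SolAt (f : E n × E d → E n) (Λ : ℝ → E d) (S : Start n) (r τ : ℝ) (p : E n) : Prop :=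
  τ ∈ S.times ∧ ∃ x : ℝ → E n,
    IsIntegralCurveOn x (nonautField f Λ r) (S.times ∩ Iic τ) ∧ S.Condition x ∧ x τ = p

/-- `x^{[r]}(τ)` exists for all (later) times and converges to `η` as `τ → +∞`. -/
def SolConverges (f : E n × E d → E n) (Λ : ℝ → E d) (S : Start n) (r : ℝ) (η : E n) : Prop :=
  ∃ x : ℝ → E n, IsIntegralCurveOn x (nonautField f Λ r) S.times ∧ S.Condition x ∧
    Tendsto x atTop (𝓝 η)

/-- `rc > 0` is a critical rate for R-tipping at `η`. -/
def IsCriticalRate (f : E n × E d → E n) (Λ : ℝ → E d) (S : Start n) (η : E n) (rc : ℝ) : Prop :=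
  0 < rc ∧ SolConverges f Λ S rc η ∧
    ∃ δ > 0, ∀ r > 0, 0 < |r - rc| → |r - rc| < δ → ¬ SolConverges f Λ S r η

/-- The upper edge tail `x^{[rc⁺]}`. -/
def upperEdgeTail (f : E n × E d → E n) (Λ : ℝ → E d) (S : Start n) (rc : ℝ) : Set (E n) :=
  {q | ∀ T > 0, ∀ δ > 0, q ∈ closure {p | ∃ τ > T, ∃ r ∈ Ioo rc (rc + δ), SolAt f Λ S r τ p}}

/-- The lower edge tail `x^{[rc⁻]}`. -/
def lowerEdgeTail (f : E n × E d → E n) (Λ : ℝ → E d) (S : Start n) (rc : ℝ) : Set (E n) :=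
  {q | ∀ T > 0, ∀ δ > 0,
    q ∈ closure {p | ∃ τ > T, ∃ r ∈ Ioo (rc - δ) rc, 0 < r ∧ SolAt f Λ S r τ p}}

/-- Non-degenerate R-tipping at the equilibrium `η` of the future limit system (input `lp`) with
critical rate `rc`. -/
structure NondegenerateRTipping (f : E n × E d → E n) (Λ : ℝ → E d) (lp : E d) (S : Start n)
    (η : E n) (rc : ℝ) : Prop where
  critical : IsCriticalRate f Λ S η rc
  edge : IsRegularEdgeEquilibrium (fun x => f (x, lp)) η
  different : upperEdgeTail f Λ S rc ≠ lowerEdgeTail f Λ S rc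
  upper : SetConnects (fun x => f (x, lp)) univ η (upperEdgeTail f Λ S rc)
  lower : SetConnects (fun x => f (x, lp)) univ η (lowerEdgeTail f Λ S rc)

/-- `Λ` is exponentially asymptotically constant to `lp` as `τ → +∞`, with decay coefficient
`ρ`. -/
def ExpConstFuture (Λ : ℝ → E d) (ρ : ℝ) (lp : E d) : Prop :=
  Tendsto Λ atTop (𝓝 lp) ∧ ∃ L, Tendsto (fun τ => (Real.exp (-ρ * τ))⁻¹ • deriv Λ τ) atTop (𝓝 L)

/-- `Λ` is exponentially asymptotically constant to `lm` as `τ → -∞`, with decay coefficient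
`ρ`. -/
def ExpConstPast (Λ : ℝ → E d) (ρ : ℝ) (lm : E d) : Prop :=
  Tendsto Λ atBot (𝓝 lm) ∧ ∃ L, Tendsto (fun τ => (Real.exp (ρ * τ))⁻¹ • deriv Λ τ) atBot (𝓝 L)

end Nonautonomous

section Compactification

variable {n d : ℕ}

/-- The time transformation `s = g_α(τ)`. -/
def gα (α τ : ℝ) : ℝ := Real.tanh (α / 2 * τ)

/-- Its inverse `τ = h_α(s)`. -/
def hα (α s : ℝ) : ℝ := 1 / α * Real.log ((1 + s) / (1 - s))

open Classical in
/-- The input as a function of `s ∈ (-1,1]`, extended to `s = 1` by the future limit. -/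
def inputOne (Λ : ℝ → E d) (α : ℝ) (lp : E d) (s : ℝ) : E d :=
  if s = 1 then lp else Λ (hα α s)

open Classical in
/-- The input as a function of `s ∈ [-1,1]`, extended to `s = ±1` by the two limits. -/
def inputTwo (Λ : ℝ → E d) (α : ℝ) (lm lp : E d) (s : ℝ) : E d :=
  if s = -1 then lm else inputOne Λ α lp s

/-- The compactified vector field `x' = f (x, L(s)) / r`, `s' = α (1 - s²) / 2`. -/
def compactField (f : E n × E d → E n) (L : ℝ → E d) (α r : ℝ) : E n × ℝ → E n × ℝ :=
  fun q => (r⁻¹ • f (q.1, L q.2), α * (1 - q.2 ^ 2) / 2)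

/-- The phase space `ℝⁿ × (-1,1]`. -/
def phaseOne (n : ℕ) : Set (E n × ℝ) := {q | q.2 ∈ Ioc (-1) 1}

/-- The phase space `ℝⁿ × [-1,1]`. -/
def phaseTwo (n : ℕ) : Set (E n × ℝ) := {q | q.2 ∈ Icc (-1) 1}

/-- The trajectory of the compactified system from `(x₀, g_α(τ₀))`, respectively the trajectory
with `s > -1` in the unstable manifold of `(e⁻, -1)`. -/
def compactTrj (F : E n × ℝ → E n × ℝ) (X : Set (E n × ℝ)) (α : ℝ) : Start n → Set (E n × ℝ)
  | .point x₀ τ₀ => forwardTrj F X (x₀, gα α τ₀)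
  | .past e => {q | q ∈ unstableSet F X (e, -1) ∧ -1 < q.2}

end Compactification

end RTip

end

/-!
Both systems are instances of one family. The equation `x' = f (x, Λ) / r` and the state component of
the compactified system are driven by the signal `t ↦ (r⁻¹, Λ_α (s (t)))`, which is continuous in `t`
and depends continuously on the rate and on the compactified starting time (`Sys.sig`). The time
component is explicit, so that solutions of the two systems correspond to each other
(`Cpt.sol_of_isSolution`, `Cpt.isSolution_of_sol`), and the slice `s = 1` carries the future limit
system. As the signals converge to a constant, the whole argument takes place near the limit system at
the rate `r_c`. No stable or unstable manifold theorem is used; only isolating blocks are.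

**Blocks.** The linearisation at the edge state splits into an expanding functional `ℓ` and a map `S`
whose norm contracts; this is a `Chart` in the block `|ℓ|, ‖S‖ ≤ b`. For signals close to their limit, a
solution that starts in the open block either stays there, and then converges to the edge state
(`Chart.tendsto_atTop_of_stays`), or leaves through exactly one of the two faces `ℓ = ± b`
(`Chart.stays_or_exits`, `Chart.not_exits_both`). Hence the complement of the local stable manifold
consists of the states that leave through the one face or the other. Moving a state in the unstable
direction preserves its exit, so that each of these two sets is connected, and exits persist under
perturbation, so that the two are separated (`Chart.isPreconnected_exitSet`,
`Chart.disjoint_closure_exitSet`). They are therefore the two components, and lying on different sides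
of the stable manifold means leaving through different faces (`sides_of_exits`, `leaves_of_sides`).

**Branches and attractors.** The unstable manifold lies in the slice `s = 1` and has, up to a shift of
time, one orbit on each side (`Chart.Emanates.exists_shift`), which is a branch (`Cpt.branches_iff`). The
attractors in the slice are those of the future limit system (`Cpt.isAttractor_iff`). An attractor
attracts a neighbourhood uniformly for all signals close to their limit (`Traps.exists_nhd`,
`Traps.mem_of_tendsto`).

**Edge tails.** If the solution for `r_c` converges to the edge state and those for nearby rates leave
through the face `ℓ = b`, then the exits accumulate on the branch on this side
(`Leaves.exists_exitSeq`). From there the solutions follow the branch and are trapped by its attractor,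
so that the edge tail is the union of the edge state, the branch and the attractor
(`Leaves.exists_tail_eq`).

**From tipping to the connection.** Connections on the same side coincide (`connection_congr`), so the
edge tails, being different, belong to opposite sides. Near the edge state each of them has points on
its own side only, which prevents the solutions from leaving through the wrong face
(`exists_exits_of_tail`).

**From the connection to tipping.** Solutions that leave the block follow a branch to an attractor that
does not contain the edge state, and do not come back (`not_tendsto_of_exits`). Hence no solution for a
noncritical rate converges to the edge state, the rates above and below `r_c` leave through different
faces, and the two tails are different connections, because the branch on one side is not contained in
the connection on the other side (`notMem_of_opposite`).
-/

noncomputable section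

set_option linter.unusedSectionVars false

namespace RTip

/-! ### Ordinary differential equations driven by a signal -/

section Flow

variable {E W : Type*} [NormedAddCommGroup E] [NormedSpace ℝ E]
  [NormedAddCommGroup W] [NormedSpace ℝ W]

/-- `x` solves `x' = G (x, ν t)` on the time set `I`. -/
def Sol (G : E × W → E) (ν : ℝ → W) (I : Set ℝ) (x : ℝ → E) : Prop :=
  IsIntegralCurveOn x (fun t x => G (x, ν t)) I

theorem Sol.mono {G : E × W → E} {ν : ℝ → W} {I J : Set ℝ} {x : ℝ → E}
    (h : Sol G ν I x) (hJ : J ⊆ I) : Sol G ν J x := IsIntegralCurveOn.mono h hJ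

theorem Sol.continuousOn {G : E × W → E} {ν : ℝ → W} {I : Set ℝ} {x : ℝ → E}
    (h : Sol G ν I x) : ContinuousOn x I := IsIntegralCurveOn.continuousOn h

theorem Sol.congr_signal {G : E × W → E} {ν ν' : ℝ → W} {I : Set ℝ} {x : ℝ → E}
    (h : Sol G ν I x) (hν : ∀ t ∈ I, ν t = ν' t) : Sol G ν' I x := by
  intro t ht
  have := h t ht
  simp only [hν t ht] at this
  exact this

theorem Sol.shift {G : E × W → E} {ν : ℝ → W} {I : Set ℝ} {x : ℝ → E}
    (h : Sol G ν I x) (c : ℝ) {J : Set ℝ} (hJ : ∀ t ∈ J, t + c ∈ I) :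
    Sol G (fun t => ν (t + c)) J (fun t => x (t + c)) := by
  intro t ht
  have h1 : HasDerivWithinAt (fun t : ℝ => t + c) 1 J t :=
    ((hasDerivAt_id t).add_const c).hasDerivWithinAt
  simpa [Function.comp_def] using (h (t + c) (hJ t ht)).scomp t h1 hJ

theorem IsIntegralCurveOn.glue {v : ℝ → E → E} {I : Set ℝ} {b : ℝ} {x y : ℝ → E}
    (hx : IsIntegralCurveOn x v (I ∩ Iic b)) (hy : IsIntegralCurveOn y v (I ∩ Ici b))
    (hxy : x b = y b) :
    IsIntegralCurveOn (fun t => if t ≤ b then x t else y t) v I := by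
  intro t ht
  have ex : ∀ s ∈ I ∩ Iic b, (if s ≤ b then x s else y s) = x s := fun s hs => if_pos hs.2
  have ey : ∀ s ∈ I ∩ Ici b, (if s ≤ b then x s else y s) = y s := by
    intro s hs
    rcases eq_or_lt_of_le (show b ≤ s from hs.2) with h | h
    · subst h; simp [hxy]
    · exact if_neg (not_le.2 h)
  have hI : I = (I ∩ Iic b) ∪ (I ∩ Ici b) := by
    rw [← inter_union_distrib_left, Iic_union_Ici, inter_univ]
  rcases lt_trichotomy t b with h | h | h
  · have h1 := ((hx t ⟨ht, h.le⟩).congr ex (ex t ⟨ht, h.le⟩))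
    have h2 := h1.mono_of_mem_nhdsWithin
      (inter_mem self_mem_nhdsWithin (mem_nhdsWithin_of_mem_nhds (Iic_mem_nhds h)) : I ∩ Iic b ∈ 𝓝[I] t)
    simpa [h.le] using h2
  · subst h
    have h1 := ((hx t ⟨ht, self_mem_Iic⟩).congr ex (ex t ⟨ht, self_mem_Iic⟩))
    have h2 := ((hy t ⟨ht, self_mem_Ici⟩).congr ey (ey t ⟨ht, self_mem_Ici⟩))
    rw [hI]
    rw [← hxy] at h2
    simpa using h1.union h2
  · have h1 := ((hy t ⟨ht, h.le⟩).congr ey (ey t ⟨ht, h.le⟩))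
    have h2 := h1.mono_of_mem_nhdsWithin
      (inter_mem self_mem_nhdsWithin (mem_nhdsWithin_of_mem_nhds (Ici_mem_nhds h)) : I ∩ Ici b ∈ 𝓝[I] t)
    simpa [not_le.2 h] using h2

theorem IsIntegralCurveOn.eqOn_of_lipschitz {v : ℝ → E → E} {K : NNReal}
    {I : Set ℝ} (hI : I.OrdConnected) (hv : ∀ t ∈ I, LipschitzWith K (v t)) {x y : ℝ → E}
    (hx : IsIntegralCurveOn x v I) (hy : IsIntegralCurveOn y v I) {t₀ : ℝ} (h₀ : t₀ ∈ I)
    (h : x t₀ = y t₀) : ∀ t ∈ I, x t = y t := by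
  intro t ht
  rcases le_total t₀ t with h1 | h1
  · have hs : Icc t₀ t ⊆ I := hI.out h₀ ht
    refine ODE_solution_unique_of_mem_Icc_right (v := v) (K := K) (s := fun _ => univ)
      (a := t₀) (b := t)
      (fun s hs' => (hv s (hs (Ico_subset_Icc_self hs'))).lipschitzOnWith)
      (hx.continuousOn.mono hs) (fun s hs' => ?_) (fun _ _ => trivial)
      (hy.continuousOn.mono hs) (fun s hs' => ?_) (fun _ _ => trivial) h ⟨h1, le_rfl⟩
    · exact ((hx s (hs (Ico_subset_Icc_self hs'))).mono hs).mono_of_mem_nhdsWithin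
        (Icc_mem_nhdsGE_of_mem hs')
    · exact ((hy s (hs (Ico_subset_Icc_self hs'))).mono hs).mono_of_mem_nhdsWithin
        (Icc_mem_nhdsGE_of_mem hs')
  · have hs : Icc t t₀ ⊆ I := hI.out ht h₀
    refine ODE_solution_unique_of_mem_Icc_left (v := v) (K := K) (s := fun _ => univ)
      (a := t) (b := t₀)
      (fun s hs' => (hv s (hs (Ioc_subset_Icc_self hs'))).lipschitzOnWith)
      (hx.continuousOn.mono hs) (fun s hs' => ?_) (fun _ _ => trivial)
      (hy.continuousOn.mono hs) (fun s hs' => ?_) (fun _ _ => trivial) h ⟨le_rfl, h1⟩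
    · exact ((hx s (hs (Ioc_subset_Icc_self hs'))).mono hs).mono_of_mem_nhdsWithin
        (Icc_mem_nhdsLE_of_mem hs')
    · exact ((hy s (hs (Ioc_subset_Icc_self hs'))).mono hs).mono_of_mem_nhdsWithin
        (Icc_mem_nhdsLE_of_mem hs')

/-- `g` is a bounded and globally Lipschitz field that agrees with `G` on the ball of radius
`R`. -/
structure IsCutoff (G g : E × W → E) (R : ℝ) : Prop where
  lip : ∃ K, LipschitzWith K g
  bdd : ∃ M, ∀ z, ‖g z‖ ≤ M
  eq : ∀ z, ‖z‖ ≤ R → g z = G z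

theorem exists_isCutoff [FiniteDimensional ℝ E] [FiniteDimensional ℝ W] {G : E × W → E}
    (hG : ContDiff ℝ 1 G) (R : ℝ) : ∃ g, IsCutoff G g R := by
  let b : ContDiffBump (0 : E × W) := ⟨|R| + 1, |R| + 2, by positivity, by linarith⟩
  have hb : ContDiff ℝ 1 (fun z => b z • G z) := (b.contDiff).smul hG
  have hc : HasCompactSupport (fun z => b z • G z) := b.hasCompactSupport.smul_right
  refine ⟨fun z => b z • G z, ?_, ?_, fun z hz => ?_⟩
  · exact hb.lipschitzWith_of_hasCompactSupport hc one_ne_zero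
  · exact hc.exists_bound_of_continuous hb.continuous
  · rw [b.one_of_mem_closedBall, one_smul]
    rw [mem_closedBall_zero_iff]
    show _ ≤ |R| + 1
    linarith [le_abs_self R]

theorem lipschitzWith_slice {g : E × W → E} {K : NNReal} (hK : LipschitzWith K g) (w : W) :
    LipschitzWith K (fun x => g (x, w)) := by
  refine LipschitzWith.of_dist_le_mul fun x y => ?_
  simpa [Prod.dist_eq] using hK.dist_le_mul (x, w) (y, w)

/-- A bounded globally Lipschitz field has global solutions for every continuous signal: solutions on
the intervals `[-T, T]` are glued by uniqueness. -/
theorem exists_integralCurve [CompleteSpace E] {g : E × W → E} {K : NNReal}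
    (hK : LipschitzWith K g) {M : ℝ} (hM : ∀ z, ‖g z‖ ≤ M) (ν : C(ℝ, W)) (p : E) :
    ∃ x : ℝ → E, x 0 = p ∧ IsIntegralCurve x (fun t x => g (x, ν t)) := by
  have hM0 : 0 ≤ M := (norm_nonneg _).trans (hM 0)
  -- the field is bounded by `M`, so that a ball of radius `M T` serves for the times `[-T, T]`
  have key : ∀ T : ℕ, ∃ x : ℝ → E, x 0 = p ∧
      IsIntegralCurveOn x (fun t x => g (x, ν t)) (Icc (-(T + 1 : ℝ)) (T + 1)) := by
    intro T
    have hT : (0 : ℝ) ∈ Icc (-(T + 1 : ℝ)) (T + 1) := ⟨by linarith [T.cast_nonneg (α := ℝ)], by positivity⟩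
    have hPL : IsPicardLindelof (fun t x => g (x, ν t)) (⟨0, hT⟩ : Icc (-(T + 1 : ℝ)) (T + 1)) p
        ⟨M * (T + 1), by positivity⟩ 0 ⟨M, hM0⟩ K :=
      { lipschitzOnWith := fun t _ => (lipschitzWith_slice hK (ν t)).lipschitzOnWith
        continuousOn := fun x _ =>
          (hK.continuous.comp (continuous_const.prodMk ν.continuous)).continuousOn
        norm_le := fun t _ x _ => hM _
        mul_max_le := by
          simp only [sub_zero, zero_sub, neg_neg, max_self, NNReal.coe_zero]
          exact le_rfl }
    obtain ⟨x, hx0, hx⟩ := hPL.exists_eq_forall_mem_Icc_hasDerivWithinAt₀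
    exact ⟨x, hx0, hx⟩
  choose X hX0 hX using key
  have huniq : ∀ (T T' : ℕ), T ≤ T' → ∀ t ∈ Icc (-(T + 1 : ℝ)) (T + 1), X T t = X T' t := by
    intro T T' hTT t ht
    have hTT' : (T : ℝ) ≤ T' := by exact_mod_cast hTT
    have hT := T.cast_nonneg (α := ℝ)
    refine IsIntegralCurveOn.eqOn_of_lipschitz (v := fun t x => g (x, ν t)) ordConnected_Icc
      (fun t _ => lipschitzWith_slice hK (ν t)) (hX T)
      ((hX T').mono (Icc_subset_Icc (by linarith) (by linarith)))
      (t₀ := 0) ⟨by linarith, by linarith⟩ ((hX0 T).trans (hX0 T').symm) t ht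
  refine ⟨fun t => X ⌈|t|⌉₊ t, ?_, fun t => ?_⟩
  · simp [hX0]
  · set T : ℕ := ⌈|t|⌉₊ with hTdef
    have hT : |t| ≤ T := Nat.le_ceil _
    have hloc : (fun s : ℝ => X ⌈|s|⌉₊ s) =ᶠ[𝓝 t] X (T + 1) := by
      have : ∀ᶠ s : ℝ in 𝓝 t, |s| < (T : ℝ) + 1 :=
        (continuous_abs.tendsto t).eventually_lt_const (by linarith)
      filter_upwards [this] with s hs
      have h1 : ⌈|s|⌉₊ ≤ T + 1 := by
        rw [Nat.ceil_le]; push_cast; exact hs.le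
      have h2 : |s| ≤ (⌈|s|⌉₊ : ℝ) := Nat.le_ceil _
      exact huniq _ _ h1 s ⟨by linarith [neg_abs_le s], by linarith [le_abs_self s]⟩
    have h3 : HasDerivAt (X (T + 1)) (g (X (T + 1) t, ν t)) t := by
      refine (hX (T + 1) t ?_).hasDerivAt (Icc_mem_nhds ?_ ?_)
      · push_cast; exact ⟨by linarith [neg_abs_le t], by linarith [le_abs_self t]⟩
      · push_cast; linarith [neg_abs_le t]
      · push_cast; linarith [le_abs_self t]
    have h4 := h3.congr_of_eventuallyEq hloc
    show HasDerivAt _ (g (X T t, ν t)) t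
    have h5 := hloc.self_of_nhds
    simp only at h5
    rw [← hTdef] at h5
    rw [h5]
    exact h4

open Classical in
/-- The solution of `x' = g (x, ν t)`, `x 0 = p`, for a bounded and globally Lipschitz field `g`
(and the constant `p` if there is no such solution). -/
def flow (g : E × W → E) (ν : C(ℝ, W)) (p : E) : ℝ → E :=
  if h : ∃ x : ℝ → E, x 0 = p ∧ IsIntegralCurve x (fun t x => g (x, ν t)) then h.choose
  else fun _ => p

namespace IsCutoff

variable {G g : E × W → E} {R : ℝ} (hg : IsCutoff G g R)
include hg

theorem flow_spec [CompleteSpace E] (ν : C(ℝ, W)) (p : E) : flow g ν p 0 = p ∧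
    IsIntegralCurve (flow g ν p) (fun t x => g (x, ν t)) := by
  obtain ⟨K, hK⟩ := hg.lip
  obtain ⟨M, hM⟩ := hg.bdd
  have h := exists_integralCurve hK hM ν p
  rw [flow, dif_pos h]
  exact h.choose_spec

theorem eqOn_flow [CompleteSpace E] {ν : C(ℝ, W)} {I : Set ℝ} (hI : I.OrdConnected) (h0 : (0 : ℝ) ∈ I)
    {x : ℝ → E} (hx : Sol G ν I x) (hR : ∀ t ∈ I, ‖x t‖ ≤ R) (hν : ∀ t ∈ I, ‖ν t‖ ≤ R) :
    ∀ t ∈ I, x t = flow g ν (x 0) t := by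
  obtain ⟨K, hK⟩ := hg.lip
  refine IsIntegralCurveOn.eqOn_of_lipschitz (v := fun t x => g (x, ν t)) hI
    (fun t _ => lipschitzWith_slice hK (ν t)) ?_
    ((hg.flow_spec ν (x 0)).2.isIntegralCurveOn I) h0 (hg.flow_spec ν (x 0)).1.symm
  intro t ht
  have := hx t ht
  simp only at this ⊢
  rwa [hg.eq]
  exact max_le (hR t ht) (hν t ht)

theorem sol_flow [CompleteSpace E] {ν : C(ℝ, W)} {p : E} {I : Set ℝ} (hR : ∀ t ∈ I, ‖flow g ν p t‖ ≤ R)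
    (hν : ∀ t ∈ I, ‖ν t‖ ≤ R) : Sol G ν I (flow g ν p) := by
  intro t ht
  have := ((hg.flow_spec ν p).2 t).hasDerivWithinAt (s := I)
  simp only at this ⊢
  rwa [← hg.eq]
  exact max_le (hR t ht) (hν t ht)

end IsCutoff

theorem dist_le_gronwall {g : E × W → E} {K : NNReal} (hK : LipschitzWith K g) {ν ν' : ℝ → W}
    {x y : ℝ → E} (hx : IsIntegralCurve x (fun t x => g (x, ν t)))
    (hy : IsIntegralCurve y (fun t x => g (x, ν' t))) {T δ : ℝ}
    (hδ : ∀ t ∈ Icc 0 T, dist (ν t) (ν' t) ≤ δ) :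
    ∀ t ∈ Icc 0 T, dist (x t) (y t) ≤ gronwallBound (dist (x 0) (y 0)) K (0 + K * δ) (t - 0) := by
  refine dist_le_of_approx_trajectories_ODE (v := fun t x => g (x, ν t)) (K := K)
    (fun t => lipschitzWith_slice hK (ν t)) hx.continuous.continuousOn
    (fun t _ => (hx t).hasDerivWithinAt) (fun t _ => by simp) hy.continuous.continuousOn
    (fun t _ => (hy t).hasDerivWithinAt) (fun t ht => ?_) le_rfl
  refine (hK.dist_le_mul _ _).trans ?_
  gcongr
  rw [Prod.dist_eq]
  refine max_le ?_ ?_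
  · simp only [dist_self]; exact dist_nonneg.trans (hδ t (Ico_subset_Icc_self ht))
  · rw [dist_comm]; exact hδ t (Ico_subset_Icc_self ht)

theorem dist_le_gronwall_abs {g : E × W → E} {K : NNReal} (hK : LipschitzWith K g) {ν ν' : ℝ → W}
    {x y : ℝ → E} (hx : IsIntegralCurve x (fun t x => g (x, ν t)))
    (hy : IsIntegralCurve y (fun t x => g (x, ν' t))) {T δ : ℝ}
    (hδ : ∀ t ∈ Icc (-T) T, dist (ν t) (ν' t) ≤ δ) {t : ℝ} (ht : |t| ≤ T) :
    dist (x t) (y t) ≤ gronwallBound (dist (x 0) (y 0)) K (K * δ) |t| := by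
  have hT : 0 ≤ T := (abs_nonneg t).trans ht
  rcases le_total 0 t with h | h
  · rw [abs_of_nonneg h] at ht ⊢
    simpa using dist_le_gronwall hK hx hy (T := T) (δ := δ)
      (fun s hs => hδ s ⟨by linarith [hs.1], hs.2⟩) t ⟨h, ht⟩
  · rw [abs_of_nonpos h] at ht ⊢
    have hneg : ∀ {ν : ℝ → W} {x : ℝ → E}, IsIntegralCurve x (fun t x => g (x, ν t)) →
        IsIntegralCurve (fun t => x (-t)) (fun t x => (fun z => - g z) (x, ν (-t))) := by
      intro ν x hx s
      simpa [Function.comp_def] using (hx (-s)).scomp s (hasDerivAt_neg s)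
    have hK' : LipschitzWith K (fun z => - g z) := by
      refine LipschitzWith.of_dist_le_mul fun a b => ?_
      rw [dist_neg_neg]; exact hK.dist_le_mul a b
    simpa using dist_le_gronwall hK' (ν := fun t => ν (-t)) (ν' := fun t => ν' (-t))
      (hneg hx) (hneg hy) (T := T) (δ := δ)
      (fun s hs => hδ (-s) ⟨by linarith [hs.2], by linarith [hs.1]⟩) (-t) ⟨by linarith, ht⟩

/-- The flow of a field that is cut off depends jointly continuously on the signal (in the
compact-open topology), the initial state and the time. -/
theorem IsCutoff.tendsto_flow [CompleteSpace E] {G g : E × W → E} {R : ℝ} (hg : IsCutoff G g R)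
    {ι : Type*} {l : Filter ι} {ν : ι → C(ℝ, W)} {ν₀ : C(ℝ, W)} (hν : Tendsto ν l (𝓝 ν₀))
    {p : ι → E} {p₀ : E} (hp : Tendsto p l (𝓝 p₀)) {t : ι → ℝ} {t₀ : ℝ}
    (ht : Tendsto t l (𝓝 t₀)) :
    Tendsto (fun i => flow g (ν i) (p i) (t i)) l (𝓝 (flow g ν₀ p₀ t₀)) := by
  obtain ⟨K, hK⟩ := hg.lip
  set T := |t₀| + 1 with hT
  rw [ContinuousMap.tendsto_iff_forall_isCompact_tendstoUniformlyOn] at hν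
  have hu := hν (Icc (-T) T) isCompact_Icc
  rw [Metric.tendstoUniformlyOn_iff] at hu
  have h1 : Tendsto (fun i => flow g ν₀ p₀ (t i)) l (𝓝 (flow g ν₀ p₀ t₀)) :=
    ((hg.flow_spec ν₀ p₀).2.continuous.tendsto t₀).comp ht
  have h2 : Tendsto (fun i => dist (flow g ν₀ p₀ (t i)) (flow g (ν i) (p i) (t i))) l (𝓝 0) := by
    rw [Metric.tendsto_nhds]
    intro ε hε
    -- the bound of Grönwall's inequality is continuous in the error at the start and in the field
    have hc : Continuous fun q : ℝ × ℝ => gronwallBound q.1 K (K * q.2) T := by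
      unfold gronwallBound
      split_ifs
      · fun_prop
      · fun_prop
    have hc0 : Tendsto (fun q : ℝ × ℝ => gronwallBound q.1 K (K * q.2) T) (𝓝 (0, 0)) (𝓝 0) := by
      have := hc.tendsto (0, 0)
      simpa [gronwallBound_ε0_δ0] using this
    obtain ⟨δ, hδ, hδ'⟩ := Metric.eventually_nhds_iff.1 (hc0.eventually_lt_const hε)
    have ht' : ∀ᶠ i in l, |t i| < T :=
      ((continuous_abs.tendsto t₀).comp ht).eventually_lt_const (by simp [hT])
    have hp' : ∀ᶠ i in l, dist (p i) p₀ < δ := Metric.tendsto_nhds.1 hp δ hδ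
    filter_upwards [hu (δ / 2) (by positivity), ht', hp'] with i hi1 hi2 hi3
    have := dist_le_gronwall_abs hK (hg.flow_spec ν₀ p₀).2 (hg.flow_spec (ν i) (p i)).2
      (T := T) (δ := δ / 2) (fun s hs => (hi1 s hs).le) hi2.le
    rw [(hg.flow_spec ν₀ p₀).1, (hg.flow_spec (ν i) (p i)).1] at this
    rw [Real.dist_0_eq_abs, abs_of_nonneg dist_nonneg]
    refine this.trans_lt (lt_of_le_of_lt ?_ (hδ' (y := (dist p₀ (p i), δ / 2)) ?_))
    · exact gronwallBound_mono dist_nonneg (by positivity) K.2 hi2.le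
    · rw [Prod.dist_eq, max_lt_iff]
      simp only [Real.dist_0_eq_abs]
      rw [abs_of_nonneg dist_nonneg, dist_comm, abs_of_pos (by positivity)]
      exact ⟨hi3, by linarith⟩
  exact (tendsto_iff_of_dist h2).1 h1

theorem IsCutoff.continuous_flow [CompleteSpace E] {G g : E × W → E} {R : ℝ} (hg : IsCutoff G g R)
    (ν : C(ℝ, W)) (p : E) : Continuous (flow g ν p) := (hg.flow_spec ν p).2.continuous

/-- Solutions of the same initial value problem agree. -/
theorem Sol.unique [FiniteDimensional ℝ E] [FiniteDimensional ℝ W] {G : E × W → E}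
    (hG : ContDiff ℝ 1 G) {ν : ℝ → W} {I : Set ℝ} (hI : I.OrdConnected)
    (hν : ContinuousOn ν I) {x y : ℝ → E} (hx : Sol G ν I x) (hy : Sol G ν I y) {t₀ : ℝ}
    (h₀ : t₀ ∈ I) (h : x t₀ = y t₀) : ∀ t ∈ I, x t = y t := by
  intro t ht
  have hs : uIcc t₀ t ⊆ I := hI.uIcc_subset h₀ ht
  obtain ⟨Rx, hRx⟩ := isCompact_uIcc.exists_bound_of_continuousOn (hx.continuousOn.mono hs)
  obtain ⟨Ry, hRy⟩ := isCompact_uIcc.exists_bound_of_continuousOn (hy.continuousOn.mono hs)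
  obtain ⟨Rν, hRν⟩ := isCompact_uIcc.exists_bound_of_continuousOn (hν.mono hs)
  obtain ⟨g, hg⟩ := exists_isCutoff hG (max (max Rx Ry) Rν)
  obtain ⟨K, hK⟩ := hg.lip
  refine IsIntegralCurveOn.eqOn_of_lipschitz (v := fun t x => g (x, ν t)) ordConnected_uIcc
    (fun t _ => lipschitzWith_slice hK (ν t)) (x := x) (y := y) ?_ ?_
    left_mem_uIcc h t right_mem_uIcc
  · intro s hs'
    have := (hx.mono hs) s hs'
    simp only at this ⊢
    rwa [hg.eq]
    exact max_le ((hRx s hs').trans (by simp)) ((hRν s hs').trans (by simp))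
  · intro s hs'
    have := (hy.mono hs) s hs'
    simp only at this ⊢
    rwa [hg.eq]
    exact max_le ((hRy s hs').trans (by simp)) ((hRν s hs').trans (by simp))

theorem Sol.glue {G : E × W → E} {ν : ℝ → W} {I : Set ℝ} {b : ℝ} {x y : ℝ → E}
    (hx : Sol G ν (I ∩ Iic b) x) (hy : Sol G ν (I ∩ Ici b) y) (hxy : x b = y b) :
    Sol G ν I (fun t => if t ≤ b then x t else y t) := IsIntegralCurveOn.glue hx hy hxy

/-- The signal `ν` read from the time `c` on. -/
def shiftSig (c : ℝ) (ν : C(ℝ, W)) : C(ℝ, W) := ν.comp ⟨fun t => t + c, by fun_prop⟩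

@[simp] theorem shiftSig_apply (c : ℝ) (ν : C(ℝ, W)) (t : ℝ) : shiftSig c ν t = ν (t + c) := rfl

theorem tendsto_shiftSig_of_tendsto {ι : Type*} {l : Filter ι} {ν : C(ℝ, W)} {w : W} {m : Filter ℝ}
    (hm : Tendsto ν m (𝓝 w)) {c : ι → ℝ}
    (hc : ∀ T : ℝ, ∀ s ∈ m, ∀ᶠ i in l, ∀ t ∈ Icc (-T) T, t + c i ∈ s) :
    Tendsto (fun i => shiftSig (c i) ν) l (𝓝 (ContinuousMap.const ℝ w)) := by
  rw [ContinuousMap.tendsto_iff_forall_isCompact_tendstoUniformlyOn]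
  intro K hK
  obtain ⟨T, hT⟩ := hK.isBounded.subset_closedBall 0
  rw [Metric.tendstoUniformlyOn_iff]
  intro ε hε
  filter_upwards [hc T _ (Metric.tendsto_nhds.1 hm ε hε)] with i hi t ht
  have := hT ht
  rw [Real.closedBall_eq_Icc] at this
  rw [dist_comm]
  exact hi t (by simpa using this)

theorem tendsto_shiftSig_atTop {ι : Type*} {l : Filter ι} {ν : C(ℝ, W)} {w : W}
    (hm : Tendsto ν atTop (𝓝 w)) {c : ι → ℝ} (hc : Tendsto c l atTop) :
    Tendsto (fun i => shiftSig (c i) ν) l (𝓝 (ContinuousMap.const ℝ w)) := by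
  refine tendsto_shiftSig_of_tendsto hm fun T s hs => ?_
  obtain ⟨a, ha⟩ := mem_atTop_sets.1 hs
  filter_upwards [hc.eventually_ge_atTop (a + T)] with i hi t ht
  exact ha _ (by linarith [ht.1])

theorem tendsto_shiftSig_atBot {ι : Type*} {l : Filter ι} {ν : C(ℝ, W)} {w : W}
    (hm : Tendsto ν atBot (𝓝 w)) {c : ι → ℝ} (hc : Tendsto c l atBot) :
    Tendsto (fun i => shiftSig (c i) ν) l (𝓝 (ContinuousMap.const ℝ w)) := by
  refine tendsto_shiftSig_of_tendsto hm fun T s hs => ?_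
  obtain ⟨a, ha⟩ := mem_atBot_sets.1 hs
  filter_upwards [hc.eventually_le_atBot (a - T)] with i hi t ht
  exact ha _ (by linarith [ht.2])

end Flow

/-! ### Quadratic forms adapted to a hyperbolic linear map -/

section Linear

variable {n : ℕ}

/-- The real and imaginary parts `v₁`, `v₂` of an eigenvector of (the complexification of) `B` for
the eigenvalue `z`. -/
def IsEigenPair (B : E n →L[ℝ] E n) (z : ℂ) (v₁ v₂ : E n) : Prop :=
  (v₁ ≠ 0 ∨ v₂ ≠ 0) ∧ B v₁ = z.re • v₁ - z.im • v₂ ∧ B v₂ = z.im • v₁ + z.re • v₂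

/-- The matrix of a linear map in the standard basis. -/
def stdMatrix (B : E n →L[ℝ] E n) : Matrix (Fin n) (Fin n) ℝ :=
  LinearMap.toMatrix (EuclideanSpace.basisFun (Fin n) ℝ).toBasis
    (EuclideanSpace.basisFun (Fin n) ℝ).toBasis (B : E n →ₗ[ℝ] E n)

theorem stdMatrix_mulVec (B : E n →L[ℝ] E n) (v : E n) (i : Fin n) :
    (stdMatrix B).mulVec (fun j => v j) i = B v i := by
  have := congrFun (LinearMap.toMatrix_mulVec_repr (EuclideanSpace.basisFun (Fin n) ℝ).toBasis
    (EuclideanSpace.basisFun (Fin n) ℝ).toBasis (B : E n →ₗ[ℝ] E n) v) i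
  have h2 : (⇑((EuclideanSpace.basisFun (Fin n) ℝ).toBasis.repr v) : Fin n → ℝ) = fun j => v j := by
    ext j; simp
  rw [h2] at this
  simpa [stdMatrix] using this

theorem isEigenPair_iff (B : E n →L[ℝ] E n) (z : ℂ) (v : Fin n → ℂ) :
    IsEigenPair B z (WithLp.toLp 2 fun i => (v i).re) (WithLp.toLp 2 fun i => (v i).im) ↔
      v ≠ 0 ∧ ((stdMatrix B).map (algebraMap ℝ ℂ)).mulVec v = z • v := by
  set v₁ : E n := WithLp.toLp 2 fun i => (v i).re with hv₁
  set v₂ : E n := WithLp.toLp 2 fun i => (v i).im with hv₂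
  have h1 : ∀ i, (((stdMatrix B).map (algebraMap ℝ ℂ)).mulVec v i).re = B v₁ i := by
    intro i
    rw [← stdMatrix_mulVec]
    simp [Matrix.mulVec, dotProduct, hv₁]
  have h2 : ∀ i, (((stdMatrix B).map (algebraMap ℝ ℂ)).mulVec v i).im = B v₂ i := by
    intro i
    rw [← stdMatrix_mulVec]
    simp [Matrix.mulVec, dotProduct, hv₂]
  unfold IsEigenPair
  refine and_congr ?_ ?_
  · constructor
    · rintro h rfl
      rcases h with h | h <;> exact h (by ext i; simp [hv₁, hv₂])
    · intro h
      by_contra hc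
      push Not at hc
      apply h
      ext i
      apply Complex.ext
      · simpa [hv₁] using congrArg (fun w : E n => w i) hc.1
      · simpa [hv₂] using congrArg (fun w : E n => w i) hc.2
  · constructor
    · rintro ⟨ha, hb⟩
      ext i
      apply Complex.ext
      · rw [h1, ha]; simp [hv₁, hv₂]
      · rw [h2, hb]; simp [hv₁, hv₂]; ring
    · intro h
      constructor
      · ext i
        rw [← h1, h]; simp [hv₁, hv₂]
      · ext i
        rw [← h2, h]; simp [hv₁, hv₂]; ring

/-- The roots of the characteristic polynomial, as a multiset of complex numbers. -/
def complexRoots (B : E n →L[ℝ] E n) : Multiset ℂ :=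
  ((LinearMap.charpoly (B : E n →ₗ[ℝ] E n)).map (algebraMap ℝ ℂ)).roots

theorem charpoly_stdMatrix (B : E n →L[ℝ] E n) :
    ((stdMatrix B).map (algebraMap ℝ ℂ)).charpoly =
      (LinearMap.charpoly (B : E n →ₗ[ℝ] E n)).map (algebraMap ℝ ℂ) := by
  rw [← LinearMap.charpoly_toMatrix (B : E n →ₗ[ℝ] E n) (EuclideanSpace.basisFun (Fin n) ℝ).toBasis,
    ← Matrix.charpoly_map]
  rfl

theorem mem_spectrum_stdMatrix_iff (B : E n →L[ℝ] E n) (z : ℂ) :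
    z ∈ spectrum ℂ ((stdMatrix B).map (algebraMap ℝ ℂ)) ↔ z ∈ complexRoots B := by
  rw [Matrix.mem_spectrum_iff_isRoot_charpoly, charpoly_stdMatrix, complexRoots,
    Polynomial.mem_roots]
  exact ((LinearMap.charpoly_monic _).map _).ne_zero

theorem mem_complexRoots_iff (B : E n →L[ℝ] E n) (z : ℂ) :
    z ∈ complexRoots B ↔ ∃ v₁ v₂, IsEigenPair B z v₁ v₂ := by
  have key : z ∈ complexRoots B ↔
      ∃ v : Fin n → ℂ, v ≠ 0 ∧ ((stdMatrix B).map (algebraMap ℝ ℂ)).mulVec v = z • v := by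
    rw [complexRoots, Polynomial.mem_roots ((LinearMap.charpoly_monic _).map _).ne_zero,
      ← charpoly_stdMatrix, ← Matrix.charpoly_toLin',
      ← Module.End.hasEigenvalue_iff_isRoot_charpoly]
    constructor
    · intro h
      obtain ⟨v, hv⟩ := h.exists_hasEigenvector
      exact ⟨v, hv.2, by simpa using hv.apply_eq_smul⟩
    · rintro ⟨v, hv, h⟩
      exact Module.End.hasEigenvalue_of_hasEigenvector
        (x := v) ⟨Module.End.mem_eigenspace_iff.2 (by simpa using h), hv⟩
  rw [key]
  constructor
  · rintro ⟨v, hv⟩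
    exact ⟨_, _, (isEigenPair_iff B z v).2 hv⟩
  · rintro ⟨v₁, v₂, h⟩
    refine ⟨fun i => ⟨v₁ i, v₂ i⟩, (isEigenPair_iff B z _).1 ?_⟩
    simpa using h

section

attribute [local instance] Matrix.linftyOpNormedRing Matrix.linftyOpNormedAlgebra

theorem tendsto_pow_entry [Nonempty (Fin n)] {Q : Matrix (Fin n) (Fin n) ℂ}
    (hQ : ∀ z ∈ spectrum ℂ Q, ‖z‖ < 1) (i j : Fin n) :
    Tendsto (fun m => (Q ^ m) i j) atTop (𝓝 0) := by
  have hspec : spectralRadius ℂ Q < (1 : NNReal) := by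
    apply spectrum.spectralRadius_lt_of_forall_lt
    intro z hz
    simpa [← NNReal.coe_lt_coe] using hQ z hz
  obtain ⟨θ, hθ1, hθ2⟩ := ENNReal.lt_iff_exists_nnreal_btwn.1 hspec
  have hθ2' : θ < 1 := by exact_mod_cast hθ2
  have hev := (spectrum.pow_nnnorm_pow_one_div_tendsto_nhds_spectralRadius Q).eventually_lt_const hθ1
  rw [tendsto_zero_iff_norm_tendsto_zero]
  refine squeeze_zero' (Eventually.of_forall fun m => norm_nonneg _) ?_
    (tendsto_pow_atTop_nhds_zero_of_lt_one θ.2 (by exact_mod_cast hθ2'))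
  filter_upwards [hev, eventually_gt_atTop 0] with m hm hm0
  have h1 : ((‖Q ^ m‖₊ : ENNReal) ^ (1 / m : ℝ)) ^ (m : ℝ) ≤ (θ : ENNReal) ^ (m : ℝ) :=
    ENNReal.rpow_le_rpow hm.le (by positivity)
  rw [← ENNReal.rpow_mul, one_div, inv_mul_cancel₀ (by positivity), ENNReal.rpow_one,
    ENNReal.rpow_natCast] at h1
  have h2 : ‖Q ^ m‖₊ ≤ θ ^ m := by exact_mod_cast h1
  have h3 : ‖(Q ^ m) i j‖₊ ≤ ‖Q ^ m‖₊ := by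
    rw [Matrix.linfty_opNNNorm_def]
    refine le_trans ?_ (Finset.le_sup (Finset.mem_univ i))
    exact Finset.single_le_sum (f := fun j => ‖(Q ^ m) i j‖₊) (fun _ _ => zero_le)
      (Finset.mem_univ j)
  exact_mod_cast h3.trans h2

end

/-- If all eigenvalues of `B` have negative real part, then some power of `1 + h B` is a
contraction, for small `h > 0`: the eigenvalues `1 + h z` lie in the open unit disc. -/
theorem exists_pow_contraction (hn : 0 < n) {B : E n →L[ℝ] E n}
    (hB : ∀ z ∈ complexRoots B, z.re < 0) :
    ∃ h : ℝ, 0 < h ∧ ∃ m : ℕ, 0 < m ∧ ‖(1 + h • B) ^ m‖ < 1 := by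
  classical
  have : Nonempty (Fin n) := ⟨⟨0, hn⟩⟩
  obtain ⟨h, hh0, hh⟩ : ∃ h : ℝ, 0 < h ∧ ∀ z ∈ complexRoots B, ‖1 + (h : ℂ) * z‖ < 1 := by
    have h1 : ∀ᶠ h : ℝ in 𝓝[>] (0 : ℝ), ∀ z ∈ (complexRoots B).toFinset, ‖1 + (h : ℂ) * z‖ < 1 := by
      rw [Filter.eventually_all_finset]
      intro z hz
      have hz' := hB z (Multiset.mem_toFinset.1 hz)
      have ht : Tendsto (fun h : ℝ => 2 * z.re + h * (z.re ^ 2 + z.im ^ 2)) (𝓝[>] 0)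
          (𝓝 (2 * z.re + 0 * (z.re ^ 2 + z.im ^ 2))) :=
        (Continuous.tendsto (by fun_prop) 0).mono_left nhdsWithin_le_nhds
      filter_upwards [ht.eventually_lt_const (u := 0) (by linarith), self_mem_nhdsWithin] with h h2 h3
      have h3' : 0 < h := h3
      rw [← sq_lt_one_iff₀ (norm_nonneg _), ← Complex.normSq_eq_norm_sq, Complex.normSq_apply]
      simp
      nlinarith
    obtain ⟨h, h2, h3⟩ := (h1.and self_mem_nhdsWithin).exists
    exact ⟨h, h3, fun z hz => h2 z (Multiset.mem_toFinset.2 hz)⟩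
  refine ⟨h, hh0, ?_⟩
  set Mc : Matrix (Fin n) (Fin n) ℂ := (stdMatrix B).map (algebraMap ℝ ℂ) with hMc
  set Q : Matrix (Fin n) (Fin n) ℂ := 1 + (h : ℂ) • Mc with hQ
  have hentry : ∀ i j, Tendsto (fun m => (Q ^ m) i j) atTop (𝓝 0) := by
    refine tendsto_pow_entry fun z hz => ?_
    have hz' : (z - 1) / h ∈ spectrum ℂ Mc := by
      have h1 : Q = algebraMap ℂ _ 1 + (h : ℂ) • Mc := by simp [hQ]
      rw [h1, ← spectrum.singleton_add_eq, Set.singleton_add, Set.mem_image] at hz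
      obtain ⟨w, hw, rfl⟩ := hz
      have hu : IsUnit (h : ℂ) := isUnit_iff_ne_zero.2 (by exact_mod_cast hh0.ne')
      have h3 := spectrum.unit_smul_eq_smul (a := Mc) hu.unit
      have h4 : hu.unit • Mc = (h : ℂ) • Mc := rfl
      rw [h4] at h3
      rw [h3] at hw
      obtain ⟨w', hw', hw''⟩ := hw
      have h5 : (h : ℂ) * w' = w := hw''
      rw [← h5]
      have : (h : ℂ) ≠ 0 := by exact_mod_cast hh0.ne'
      convert hw' using 1
      field_simp
      ring
    have := hh _ ((mem_spectrum_stdMatrix_iff B _).1 hz')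
    have hne : (h : ℂ) ≠ 0 := by exact_mod_cast hh0.ne'
    rw [mul_div_cancel₀ _ hne] at this
    simpa using this
  -- the entries of the powers of `1 + h B` are those of the powers of `Q`
  set N : Matrix (Fin n) (Fin n) ℝ := 1 + h • stdMatrix B with hN
  have hNQ : ∀ m, Q ^ m = (N ^ m).map (algebraMap ℝ ℂ) := by
    intro m
    have : Q = (algebraMap ℝ ℂ).mapMatrix N := by
      ext i j
      simp [hQ, hN, hMc, Matrix.one_apply, RingHom.mapMatrix_apply, apply_ite]
    rw [this, ← map_pow]
    rfl
  have hNpow : Tendsto (fun m => N ^ m) atTop (𝓝 0) := by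
    refine tendsto_pi_nhds.2 fun i => tendsto_pi_nhds.2 fun j => ?_
    have h2 := (Complex.continuous_re.tendsto 0).comp (hentry i j)
    simp only [hNQ] at h2
    simpa [Function.comp_def] using h2
  let b := (EuclideanSpace.basisFun (Fin n) ℝ).toBasis
  let φ : Matrix (Fin n) (Fin n) ℝ →ₗ[ℝ] (E n →L[ℝ] E n) :=
    (LinearMap.toContinuousLinearMap (𝕜 := ℝ) (E := E n) (F' := E n)).toLinearMap ∘ₗ
      (Matrix.toLin b b).toLinearMap
  have hφ : Tendsto (fun m => φ (N ^ m)) atTop (𝓝 0) := by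
    have := (LinearMap.continuous_of_finiteDimensional φ).tendsto 0
    rw [map_zero] at this
    exact this.comp hNpow
  have hφm : ∀ m, φ (N ^ m) = (1 + h • B) ^ m := by
    have h1 : ∀ m, Matrix.toLin b b (N ^ m) = ((1 + h • B : E n →L[ℝ] E n) : E n →ₗ[ℝ] E n) ^ m := by
      intro m
      have hN1 : Matrix.toLin b b N = ((1 + h • B : E n →L[ℝ] E n) : E n →ₗ[ℝ] E n) := by
        rw [hN, map_add, map_smul, Matrix.toLin_one, stdMatrix, Matrix.toLin_toMatrix]
        rfl
      rw [← hN1]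
      induction m with
      | zero => simp [Matrix.toLin_one]; rfl
      | succ k ih => rw [pow_succ, pow_succ, Matrix.toLin_mul b b b, ih]; rfl
    intro m
    ext1 v
    show Matrix.toLin b b (N ^ m) v = _
    rw [h1]
    have : ∀ k (v : E n), (((1 + h • B : E n →L[ℝ] E n) : E n →ₗ[ℝ] E n) ^ k) v =
        ((1 + h • B) ^ k : E n →L[ℝ] E n) v := by
      intro k
      induction k with
      | zero => intro v; simp
      | succ k ih => intro v; rw [pow_succ, pow_succ]; exact ih _
    exact this m v
  have hfin : ∀ᶠ m in atTop, ‖φ (N ^ m)‖ < 1 := by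
    have := hφ.norm
    rw [norm_zero] at this
    exact this.eventually_lt_const one_pos
  obtain ⟨m, hm1, hm2⟩ := (hfin.and (eventually_gt_atTop 0)).exists
  exact ⟨m, hm2, by rw [← hφm]; exact hm1⟩

end Linear

section Linear

variable {n : ℕ}

/-- The target of the adapted norm: finitely many copies of `ℝⁿ`. -/
abbrev Copies (n m : ℕ) := PiLp 2 (fun _ : Fin m => E n)

/-- The map `v ↦ (v, M v, …, M^(m-1) v)`. -/
def orbitMap (M : E n →L[ℝ] E n) (m : ℕ) : E n →L[ℝ] Copies n m :=
  (PiLp.continuousLinearEquiv 2 ℝ (fun _ : Fin m => E n)).symm.toContinuousLinearMap ∘L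
    ContinuousLinearMap.pi fun k : Fin m => M ^ (k : ℕ)

theorem norm_sq_orbitMap (M : E n →L[ℝ] E n) (m : ℕ) (v : E n) :
    ‖orbitMap M m v‖ ^ 2 = ∑ k ∈ Finset.range m, ‖(M ^ k) v‖ ^ 2 := by
  rw [PiLp.norm_sq_eq_of_L2, Finset.sum_range]
  rfl

/-- A quadratic Lyapunov function of a linear map whose eigenvalues have negative real part, in the
form of the norm of a linear image. -/
theorem exists_lyapunov (hn : 0 < n) {B : E n →L[ℝ] E n} (hB : ∀ z ∈ complexRoots B, z.re < 0) :
    ∃ (m : ℕ) (S : E n →L[ℝ] Copies n m) (κ : ℝ), 0 < κ ∧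
      (∀ v, inner ℝ (S v) (S (B v)) ≤ -κ * ‖S v‖ ^ 2) ∧ ∀ v, ‖v‖ ≤ ‖S v‖ := by
  obtain ⟨h, hh, m, hm, hlt⟩ := exists_pow_contraction hn hB
  set M := 1 + h • B with hM
  set S := orbitMap M m with hS
  set θ := ‖M ^ m‖ with hθ
  have hθ0 : 0 ≤ θ := norm_nonneg _
  have hMv : ∀ v, M v = v + h • B v := fun v => by simp [hM]
  have key : ∀ v, ‖S (M v)‖ ^ 2 = ‖S v‖ ^ 2 - ‖v‖ ^ 2 + ‖(M ^ m) v‖ ^ 2 := by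
    intro v
    rw [norm_sq_orbitMap, norm_sq_orbitMap]
    have h1 : ∀ k, (M ^ k) (M v) = (M ^ (k + 1)) v := fun k => by rw [pow_succ]; rfl
    simp only [h1]
    have h2 := Finset.sum_range_succ' (fun k => ‖(M ^ k) v‖ ^ 2) m
    rw [Finset.sum_range_succ] at h2
    simp only [pow_zero, one_apply_eq_self] at h2
    linarith
  have hSle : ∀ v, ‖S v‖ ^ 2 ≤ (‖S‖ ^ 2 + 1) * ‖v‖ ^ 2 := by
    intro v
    have := pow_le_pow_left₀ (norm_nonneg _) (S.le_opNorm v) 2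
    nlinarith [sq_nonneg ‖v‖]
  have hc : 0 < ‖S‖ ^ 2 + 1 := by positivity
  refine ⟨m, S, (1 - θ ^ 2) / (2 * h * (‖S‖ ^ 2 + 1)), ?_, fun v => ?_, fun v => ?_⟩
  · have : θ ^ 2 < 1 := by nlinarith
    exact div_pos (by linarith) (by positivity)
  · have h1 := key v
    rw [hMv, map_add, map_smul, norm_add_sq_real, inner_smul_right, norm_smul] at h1
    have h2 : ‖(M ^ m) v‖ ^ 2 ≤ θ ^ 2 * ‖v‖ ^ 2 := by
      rw [← mul_pow]
      exact pow_le_pow_left₀ (norm_nonneg _) ((M ^ m).le_opNorm v) 2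
    have h3 : 2 * h * inner ℝ (S v) (S (B v)) ≤ -((1 - θ ^ 2) * ‖v‖ ^ 2) := by
      nlinarith [sq_nonneg (‖h‖ * ‖S (B v)‖)]
    have h4 : (1 - θ ^ 2) * ‖S v‖ ^ 2 ≤ (1 - θ ^ 2) * ((‖S‖ ^ 2 + 1) * ‖v‖ ^ 2) :=
      mul_le_mul_of_nonneg_left (hSle v) (by nlinarith)
    rw [neg_mul, div_mul_eq_mul_div, le_neg, div_le_iff₀ (by positivity)]
    nlinarith
  · have h1 := norm_sq_orbitMap M m v
    have h2 : ‖v‖ ^ 2 ≤ ∑ k ∈ Finset.range m, ‖(M ^ k) v‖ ^ 2 := by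
      have := Finset.single_le_sum (f := fun k => ‖(M ^ k) v‖ ^ 2) (fun _ _ => by positivity)
        (Finset.mem_range.2 hm)
      simpa using this
    rw [← h1] at h2
    exact le_of_sq_le_sq h2 (norm_nonneg _)

/-- Coordinates adapted to a hyperbolic linear map `A`: an expanding linear functional `ℓ` and a
linear map `S` whose norm contracts. The functional is `0` if `A` has no unstable direction. -/
structure Splitting (A : E n →L[ℝ] E n) where
  m : ℕ
  ℓ : E n →L[ℝ] ℝ
  S : E n →L[ℝ] Copies n m
  κ : ℝ
  K : ℝ
  κ_pos : 0 < κ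
  K_pos : 0 < K
  growth : ∀ v, κ * (ℓ v) ^ 2 ≤ ℓ v * ℓ (A v)
  decay : ∀ v, inner ℝ (S v) (S (A v)) ≤ -κ * ‖S v‖ ^ 2
  bound : ∀ v, ‖v‖ ^ 2 ≤ K * ((ℓ v) ^ 2 + ‖S v‖ ^ 2)

theorem exists_splitting_of_sink (hn : 0 < n) {A : E n →L[ℝ] E n}
    (hA : ∀ z ∈ complexRoots A, z.re < 0) : ∃ σ : Splitting A, σ.ℓ = 0 := by
  obtain ⟨m, S, κ, hκ, h1, h2⟩ := exists_lyapunov hn hA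
  refine ⟨⟨m, 0, S, κ, 1, hκ, one_pos, by simp, h1, fun v => ?_⟩, rfl⟩
  have := pow_le_pow_left₀ (norm_nonneg _) (h2 v) 2
  simpa using this

open Classical in
/-- The unstable eigenvalue `μ` of a hyperbolic map with one unstable direction is real and simple,
so that the eigenline splits off; moving `μ` to `-1` leaves a map without unstable directions. -/
theorem exists_splitting_of_edge {A : E n →L[ℝ] E n} (h0 : ∀ z ∈ complexRoots A, z.re ≠ 0)
    (h1 : Multiset.card ((complexRoots A).filter (fun z => 0 < z.re)) = 1) :
    ∃ (σ : Splitting A) (w : E n), σ.ℓ w = 1 ∧ σ.S w = 0 := by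
  obtain ⟨z, hz⟩ := Multiset.card_eq_one.1 h1
  have hz1 : z ∈ (complexRoots A).filter (fun z => 0 < z.re) := by rw [hz]; simp
  rw [Multiset.mem_filter] at hz1
  have huniq : ∀ z' ∈ complexRoots A, 0 < z'.re → z' = z := by
    intro z' h2 h3
    have : z' ∈ (complexRoots A).filter (fun z => 0 < z.re) := Multiset.mem_filter.2 ⟨h2, h3⟩
    rw [hz] at this
    exact Multiset.mem_singleton.1 this
  -- the conjugate of an eigenvalue is an eigenvalue
  have hreal : z.im = 0 := by
    obtain ⟨v₁, v₂, hne, ha, hb⟩ := (mem_complexRoots_iff A z).1 hz1.1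
    have : (starRingEnd ℂ) z ∈ complexRoots A := by
      refine (mem_complexRoots_iff A _).2 ⟨v₁, -v₂, by simpa using hne, ?_, ?_⟩
      · rw [ha]; simp
      · rw [map_neg, hb]; simp; abel
    have := congrArg Complex.im (huniq _ this (by simpa using hz1.2))
    simp at this
    linarith
  set μ := z.re with hμ
  have hzμ : z = (μ : ℂ) := Complex.ext (by simp [hμ]) (by simp [hreal])
  have hμ0 : 0 < μ := hz1.2
  let L : Module.End ℝ (E n) := (A : E n →ₗ[ℝ] E n)
  have hmult : Module.finrank ℝ (L.maxGenEigenspace μ) = 1 := by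
    rw [LinearMap.finrank_maxGenEigenspace_eq,
      Polynomial.eq_rootMultiplicity_map (f := algebraMap ℝ ℂ) (algebraMap ℝ ℂ).injective,
      ← Polynomial.count_roots]
    have : (complexRoots A).count z = 1 := by
      have h2 := Multiset.count_filter_of_pos (p := fun z : ℂ => 0 < z.re) (s := complexRoots A) hz1.2
      rw [← h2, hz]
      simp
    rw [hzμ] at this
    exact this
  obtain ⟨w, hw0, hAw⟩ : ∃ w : E n, w ≠ 0 ∧ A w = μ • w := by
    obtain ⟨v₁, v₂, hne, ha, hb⟩ := (mem_complexRoots_iff A z).1 hz1.1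
    rw [hreal] at ha hb
    rcases hne with h | h
    · exact ⟨v₁, h, by simpa using ha⟩
    · exact ⟨v₂, h, by simpa using hb⟩
  have hwgen : w ∈ L.maxGenEigenspace μ := by
    rw [Module.End.mem_maxGenEigenspace]
    exact ⟨1, by simp [L, hAw]⟩
  have hspan : ∀ v ∈ L.maxGenEigenspace μ, ∃ c : ℝ, v = c • w := by
    intro v hv
    have h2 := (finrank_eq_one_iff_of_nonzero' (⟨w, hwgen⟩ : L.maxGenEigenspace μ)
      (by simpa [Subtype.ext_iff] using hw0)).1 hmult ⟨v, hv⟩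
    obtain ⟨c, hc⟩ := h2
    exact ⟨c, by simpa [Subtype.ext_iff, eq_comm] using hc⟩
  have hker : ∀ v, A v = μ • v → ∃ c : ℝ, v = c • w := by
    intro v hv
    refine hspan v ?_
    rw [Module.End.mem_maxGenEigenspace]
    exact ⟨1, by simp [L, hv]⟩
  have hrange : w ∉ LinearMap.range (L - μ • (1 : Module.End ℝ (E n))) := by
    rintro ⟨v, hv⟩
    have hv' : A v - μ • v = w := by simpa [L] using hv
    obtain ⟨c, rfl⟩ := hspan v (by
      rw [Module.End.mem_maxGenEigenspace]
      refine ⟨2, ?_⟩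
      rw [pow_two, Module.End.mul_apply, hv]
      simp [L, hAw])
    rw [map_smul, hAw, smul_comm, sub_self] at hv'
    exact hw0 hv'.symm
  obtain ⟨φ, hφw, hφ⟩ := Submodule.exists_dual_map_eq_bot_of_notMem hrange inferInstance
  have hφ' : ∀ v, φ (A v) = μ * φ v := by
    intro v
    have : φ ((L - μ • (1 : Module.End ℝ (E n))) v) ∈
        (LinearMap.range (L - μ • (1 : Module.End ℝ (E n)))).map φ :=
      Submodule.mem_map_of_mem (LinearMap.mem_range_self _ v)
    rw [hφ, Submodule.mem_bot] at this
    have h2 : φ (A v) - μ * φ v = 0 := by simpa [L] using this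
    linarith
  let ℓ : E n →L[ℝ] ℝ := LinearMap.toContinuousLinearMap ((φ w)⁻¹ • φ)
  have hℓw : ℓ w = 1 := by simp [ℓ, hφw]
  have hℓA : ∀ v, ℓ (A v) = μ * ℓ v := by intro v; simp [ℓ, hφ']; ring
  let P : E n →L[ℝ] E n := ℓ.smulRight w
  have hP : ∀ v, P v = ℓ v • w := fun v => rfl
  let B : E n →L[ℝ] E n := A - (μ + 1) • P
  have hBv : ∀ v, B v = A v - (μ + 1) • (ℓ v • w) := fun v => rfl
  have hℓB : ∀ v, ℓ (B v) = - ℓ v := by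
    intro v; rw [hBv, map_sub, map_smul, map_smul, hℓA, hℓw]; simp; ring
  have hB : ∀ z ∈ complexRoots B, z.re < 0 := by
    intro ζ hζ
    obtain ⟨v₁, v₂, hne, ha, hb⟩ := (mem_complexRoots_iff B ζ).1 hζ
    by_contra hre
    push Not at hre
    have e1 := congrArg ℓ ha
    have e2 := congrArg ℓ hb
    rw [hℓB, map_sub, map_smul, map_smul, smul_eq_mul, smul_eq_mul] at e1
    rw [hℓB, map_add, map_smul, map_smul, smul_eq_mul, smul_eq_mul] at e2
    have e3 : ℓ v₁ = 0 ∧ ℓ v₂ = 0 := by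
      have e4 : ((ζ.re + 1) ^ 2 + ζ.im ^ 2) * (ℓ v₁ ^ 2 + ℓ v₂ ^ 2) = 0 := by
        have a1 : (ζ.re + 1) * ℓ v₁ = ζ.im * ℓ v₂ := by linarith
        have a2 : (ζ.re + 1) * ℓ v₂ = - (ζ.im * ℓ v₁) := by linarith
        have a3 : ((ζ.re + 1) ^ 2 + ζ.im ^ 2) * ℓ v₁ = 0 := by
          linear_combination (ζ.re + 1) * a1 + ζ.im * a2
        have a4 : ((ζ.re + 1) ^ 2 + ζ.im ^ 2) * ℓ v₂ = 0 := by
          linear_combination (ζ.re + 1) * a2 - ζ.im * a1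
        linear_combination ℓ v₁ * a3 + ℓ v₂ * a4
      have e5 : 0 < (ζ.re + 1) ^ 2 + ζ.im ^ 2 := by positivity
      have e6 : ℓ v₁ ^ 2 + ℓ v₂ ^ 2 = 0 := (mul_eq_zero.1 e4).resolve_left e5.ne'
      exact ⟨by nlinarith [sq_nonneg (ℓ v₁), sq_nonneg (ℓ v₂)],
        by nlinarith [sq_nonneg (ℓ v₁), sq_nonneg (ℓ v₂)]⟩
    rw [hBv, e3.1, zero_smul, smul_zero, sub_zero] at ha
    rw [hBv, e3.2, zero_smul, smul_zero, sub_zero] at hb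
    have hζA : ζ ∈ complexRoots A := (mem_complexRoots_iff A ζ).2 ⟨v₁, v₂, hne, ha, hb⟩
    have hζz := huniq ζ hζA (lt_of_le_of_ne hre (h0 ζ hζA).symm)
    rw [hζz, hreal] at ha hb
    have f1 : ∀ v, A v = μ • v → ℓ v = 0 → v = 0 := by
      intro v hv hv'
      obtain ⟨c, rfl⟩ := hker v hv
      rw [map_smul, hℓw] at hv'
      have : c = 0 := by simpa using hv'
      simp [this]
    rcases hne with h | h
    · exact h (f1 v₁ (by simpa using ha) e3.1)
    · exact h (f1 v₂ (by simpa using hb) e3.2)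
  have hn : 0 < n := by
    rcases Nat.eq_zero_or_pos n with h | h
    · subst h; exact absurd (Subsingleton.elim w 0) hw0
    · exact h
  obtain ⟨m, S, κ, hκ, hS1, hS2⟩ := exists_lyapunov hn hB
  let T : E n →L[ℝ] Copies n m := S ∘L (1 - P)
  have hT : ∀ v, T v = S (v - ℓ v • w) := fun v => rfl
  refine ⟨⟨m, ℓ, T, min κ μ, 2 * (‖w‖ ^ 2 + 1), lt_min hκ hμ0, by positivity, fun v => ?_,
    fun v => ?_, fun v => ?_⟩, w, hℓw, ?_⟩
  · rw [hℓA]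
    nlinarith [min_le_right κ μ, sq_nonneg (ℓ v)]
  · have e1 : T (A v) = S (B (v - ℓ v • w)) := by
      have e0 : B (v - ℓ v • w) = A v - (μ * ℓ v) • w := by
        rw [hBv, map_sub A, map_sub ℓ, map_smul A, map_smul ℓ, hAw, hℓw]
        simp [smul_smul, mul_comm]
      rw [hT, hℓA, e0]
    rw [e1, hT]
    refine (hS1 _).trans ?_
    nlinarith [min_le_left κ μ, sq_nonneg ‖S (v - ℓ v • w)‖]
  · have e1 : ‖v‖ ≤ ‖T v‖ + |ℓ v| * ‖w‖ := by
      calc ‖v‖ = ‖(v - ℓ v • w) + ℓ v • w‖ := by rw [sub_add_cancel]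
        _ ≤ ‖v - ℓ v • w‖ + ‖ℓ v • w‖ := norm_add_le _ _
        _ ≤ ‖T v‖ + |ℓ v| * ‖w‖ := by
          rw [norm_smul, Real.norm_eq_abs]
          exact add_le_add (hS2 _) le_rfl
    have e2 := pow_le_pow_left₀ (norm_nonneg _) e1 2
    have e3 : (‖T v‖ + |ℓ v| * ‖w‖) ^ 2 ≤ 2 * (‖T v‖ ^ 2 + (ℓ v) ^ 2 * ‖w‖ ^ 2) := by
      have : (|ℓ v| * ‖w‖) ^ 2 = (ℓ v) ^ 2 * ‖w‖ ^ 2 := by rw [mul_pow, sq_abs]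
      nlinarith [sq_nonneg (‖T v‖ - |ℓ v| * ‖w‖)]
    nlinarith [sq_nonneg (ℓ v), sq_nonneg ‖w‖, sq_nonneg ‖T v‖,
      mul_nonneg (sq_nonneg ‖T v‖) (sq_nonneg ‖w‖)]
  · show T w = 0
    rw [hT, hℓw]; simp

end Linear

/-! ### Limits of solutions and continuous dependence -/

section Limits

variable {E W : Type*} [NormedAddCommGroup E] [NormedSpace ℝ E] [FiniteDimensional ℝ E]
  [NormedAddCommGroup W] [NormedSpace ℝ W] [FiniteDimensional ℝ W]

/-- Uniformly bounded solutions whose signals and initial states converge have a limit, which is a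
solution for the limit signal on every set of limits of times in the domains. -/
theorem exists_limit_solution {G : E × W → E} (hG : ContDiff ℝ 1 G) {ν : ℕ → C(ℝ, W)} {ν₀ : C(ℝ, W)}
    (hν : Tendsto ν atTop (𝓝 ν₀)) {I : ℕ → Set ℝ} (hI : ∀ k, (I k).OrdConnected)
    (h0 : ∀ k, (0 : ℝ) ∈ I k) {x : ℕ → ℝ → E} (hx : ∀ k, Sol G (ν k) (I k) (x k)) {R : ℝ}
    (hR : ∀ k, ∀ t ∈ I k, ‖x k t‖ ≤ R) (hνR : ∀ k, ∀ t ∈ I k, ‖ν k t‖ ≤ R) {q : E}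
    (hq : Tendsto (fun k => x k 0) atTop (𝓝 q)) :
    ∃ y : ℝ → E, y 0 = q ∧ Continuous y ∧
      (∀ (τ : ℕ → ℝ) (t : ℝ), Tendsto τ atTop (𝓝 t) → (∀ᶠ k in atTop, τ k ∈ I k) →
        Tendsto (fun k => x k (τ k)) atTop (𝓝 (y t))) ∧
      ∀ J : Set ℝ, (∀ t ∈ J, ∃ τ : ℕ → ℝ, Tendsto τ atTop (𝓝 t) ∧ ∀ᶠ k in atTop, τ k ∈ I k) →
        Sol G ν₀ J y := by
  have := FiniteDimensional.complete ℝ E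
  obtain ⟨g, hg⟩ := exists_isCutoff hG R
  have hlim : ∀ (τ : ℕ → ℝ) (t : ℝ), Tendsto τ atTop (𝓝 t) → (∀ᶠ k in atTop, τ k ∈ I k) →
        Tendsto (fun k => x k (τ k)) atTop (𝓝 (flow g ν₀ q t)) := by
    intro τ t hτ hτI
    refine (hg.tendsto_flow hν hq hτ).congr' ?_
    filter_upwards [hτI] with k hk
    exact (hg.eqOn_flow (hI k) (h0 k) (hx k) (hR k) (hνR k) _ hk).symm
  refine ⟨flow g ν₀ q, (hg.flow_spec ν₀ q).1, hg.continuous_flow _ _, hlim, fun J hJ => ?_⟩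
  refine hg.sol_flow (fun t ht => ?_) (fun t ht => ?_)
  · obtain ⟨τ, hτ, hτI⟩ := hJ t ht
    refine le_of_tendsto (hlim τ t hτ hτI).norm ?_
    filter_upwards [hτI] with k hk using hR k _ hk
  · obtain ⟨τ, hτ, hτI⟩ := hJ t ht
    have h1 : Tendsto (fun k => ν k (τ k)) atTop (𝓝 (ν₀ t)) :=
      ((continuous_eval (F := C(ℝ, W))).tendsto (ν₀, t)).comp (hν.prodMk_nhds hτ)
    refine le_of_tendsto h1.norm ?_
    filter_upwards [hτI] with k hk using hνR k _ hk

/-- Continuous dependence: near a solution on a compact time interval there are solutions for all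
nearby signals and initial states. -/
theorem exists_nearby_solution {G : E × W → E} (hG : ContDiff ℝ 1 G) {ν : ℕ → C(ℝ, W)} {ν₀ : C(ℝ, W)}
    (hν : Tendsto ν atTop (𝓝 ν₀)) {S T : ℝ} (h0 : (0 : ℝ) ∈ Icc S T) {x : ℝ → E}
    (hx : Sol G ν₀ (Icc S T) x) {p : ℕ → E} (hp : Tendsto p atTop (𝓝 (x 0))) :
    ∃ y : ℕ → ℝ → E, (∀ k, y k 0 = p k) ∧ (∀ᶠ k in atTop, Sol G (ν k) (Icc S T) (y k)) ∧
      ∀ (τ : ℕ → ℝ) (t : ℝ), t ∈ Icc S T → Tendsto τ atTop (𝓝 t) →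
        Tendsto (fun k => y k (τ k)) atTop (𝓝 (x t)) := by
  have := FiniteDimensional.complete ℝ E
  obtain ⟨R₁, hR₁⟩ := isCompact_Icc.exists_bound_of_continuousOn hx.continuousOn
  obtain ⟨R₂, hR₂⟩ := (isCompact_Icc (a := S) (b := T)).exists_bound_of_continuousOn
    ν₀.continuous.continuousOn
  obtain ⟨g, hg⟩ := exists_isCutoff hG (max R₁ R₂ + 1)
  have hxf := hg.eqOn_flow (ν := ν₀) ordConnected_Icc h0 hx
    (fun t ht => (hR₁ t ht).trans (by linarith [le_max_left R₁ R₂]))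
    (fun t ht => (hR₂ t ht).trans (by linarith [le_max_right R₁ R₂]))
  have hlim : ∀ (φ : ℕ → ℕ), Tendsto φ atTop atTop → ∀ (τ : ℕ → ℝ) (t : ℝ), t ∈ Icc S T →
      Tendsto τ atTop (𝓝 t) →
        Tendsto (fun k => flow g (ν (φ k)) (p (φ k)) (τ k)) atTop (𝓝 (x t)) := by
    intro φ hφ τ t ht hτ
    rw [hxf t ht]
    exact hg.tendsto_flow (hν.comp hφ) (hp.comp hφ) hτ
  refine ⟨fun k => flow g (ν k) (p k), fun k => (hg.flow_spec _ _).1, ?_,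
    fun τ t ht hτ => hlim id tendsto_id τ t ht hτ⟩
  -- otherwise some flow at times in the interval would leave the ball in the limit
  have hball : ∀ᶠ k in atTop, ∀ t ∈ Icc S T, ‖flow g (ν k) (p k) t‖ ≤ max R₁ R₂ + 1 := by
    by_contra hcon
    rw [not_eventually] at hcon
    obtain ⟨φ, hφ, hφ'⟩ := extraction_of_frequently_atTop hcon
    push Not at hφ'
    choose s hs hs' using hφ'
    obtain ⟨t, ht, ψ, hψ, hψt⟩ := isCompact_Icc.tendsto_subseq hs
    have h1 := hlim (φ ∘ ψ) (hφ.comp hψ).tendsto_atTop (s ∘ ψ) t ht hψt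
    have h2 := ge_of_tendsto' h1.norm (fun k => (hs' (ψ k)).le)
    linarith [hR₁ t ht, le_max_left R₁ R₂]
  have hνball : ∀ᶠ k in atTop, ∀ t ∈ Icc S T, ‖ν k t‖ ≤ max R₁ R₂ + 1 := by
    have h1 := (ContinuousMap.tendsto_iff_forall_isCompact_tendstoUniformlyOn.1 hν)
      (Icc S T) isCompact_Icc
    filter_upwards [Metric.tendstoUniformlyOn_iff.1 h1 1 one_pos] with k hk t ht
    have h2 := hk t ht
    rw [dist_eq_norm] at h2
    have h3 : ‖ν k t‖ ≤ ‖ν₀ t‖ + ‖ν₀ t - ν k t‖ := by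
      have := norm_sub_norm_le (ν k t) (ν₀ t)
      rw [norm_sub_rev] at this
      linarith
    linarith [hR₂ t ht, le_max_right R₁ R₂]
  filter_upwards [hball, hνball] with k h1 h2
  exact hg.sol_flow h1 h2

end Limits

/-! ### Differential inequalities -/

section Scalar

theorem mul_sub_le_of_deriv_ge {I : Set ℝ} (hI : Convex ℝ I) {φ φ' : ℝ → ℝ}
    (h : ∀ t ∈ I, HasDerivWithinAt φ (φ' t) I t) {k : ℝ} (hk : ∀ t ∈ I, k ≤ φ' t) {s t : ℝ}
    (hs : s ∈ I) (ht : t ∈ I) (hst : s ≤ t) : k * (t - s) ≤ φ t - φ s := by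
  refine hI.mul_sub_le_image_sub_of_le_deriv (fun t ht => (h t ht).continuousWithinAt) ?_ ?_
    s hs t ht hst
  · intro t ht
    exact ((h t (interior_subset ht)).hasDerivAt (mem_interior_iff_mem_nhds.1 ht)).differentiableAt.differentiableWithinAt
  · intro t ht
    rw [((h t (interior_subset ht)).hasDerivAt (mem_interior_iff_mem_nhds.1 ht)).deriv]
    exact hk t (interior_subset ht)

theorem eventually_gt_of_deriv_pos {φ : ℝ → ℝ} {c t b : ℝ} (h : HasDerivWithinAt φ c (Icc t b) t)
    (htb : t < b) (hc : 0 < c) : ∀ᶠ s in 𝓝[>] t, φ t < φ s := by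
  have h1 : HasDerivWithinAt φ c (Ioi t) t :=
    (h.mono_of_mem_nhdsWithin (Icc_mem_nhdsGE htb)).mono Ioi_subset_Ici_self
  rw [hasDerivWithinAt_iff_tendsto_slope' self_notMem_Ioi] at h1
  filter_upwards [h1.eventually_const_lt hc, self_mem_nhdsWithin] with s hs hs'
  have hs'' : t < s := hs'
  rw [slope_def_field] at hs
  have := (div_pos_iff_of_pos_right (sub_pos.2 hs'')).1 hs
  linarith

theorem eventually_gt_of_deriv_neg {φ : ℝ → ℝ} {c t a : ℝ} (h : HasDerivWithinAt φ c (Icc a t) t)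
    (hat : a < t) (hc : c < 0) : ∀ᶠ s in 𝓝[<] t, φ t < φ s := by
  have h1 : HasDerivWithinAt φ c (Iio t) t :=
    (h.mono_of_mem_nhdsWithin (Icc_mem_nhdsLE hat)).mono Iio_subset_Iic_self
  rw [hasDerivWithinAt_iff_tendsto_slope' self_notMem_Iio] at h1
  filter_upwards [h1.eventually_lt_const hc, self_mem_nhdsWithin] with s hs hs'
  have hs'' : s < t := hs'
  rw [slope_def_field] at hs
  rcases div_neg_iff.1 hs with h | h <;> linarith

/-- Two quantities that both grow as long as both are nonnegative stay nonnegative. -/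
theorem nonneg_of_deriv_pos {T : ℝ} {φ₁ φ₂ φ₁' φ₂' : ℝ → ℝ}
    (h₁ : ∀ t ∈ Icc 0 T, HasDerivWithinAt φ₁ (φ₁' t) (Icc 0 T) t)
    (h₂ : ∀ t ∈ Icc 0 T, HasDerivWithinAt φ₂ (φ₂' t) (Icc 0 T) t)
    (h : ∀ t ∈ Icc 0 T, 0 ≤ φ₁ t → 0 ≤ φ₂ t → 0 < φ₁' t ∧ 0 < φ₂' t)
    (h10 : 0 ≤ φ₁ 0) (h20 : 0 ≤ φ₂ 0) : ∀ t ∈ Icc 0 T, 0 ≤ φ₁ t ∧ 0 ≤ φ₂ t := by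
  by_cases hT : 0 ≤ T
  swap
  · intro t ht; exact absurd (ht.1.trans ht.2) hT
  have c1 : ContinuousOn φ₁ (Icc 0 T) := fun t ht => (h₁ t ht).continuousWithinAt
  have c2 : ContinuousOn φ₂ (Icc 0 T) := fun t ht => (h₂ t ht).continuousWithinAt
  have key : Icc 0 T ⊆ {t | t ∈ Icc 0 T ∧ 0 ≤ φ₁ t ∧ 0 ≤ φ₂ t} := by
    refine IsClosed.Icc_subset_of_forall_mem_nhdsWithin ?_ ⟨⟨le_rfl, hT⟩, h10, h20⟩ ?_
    · have e : {t | t ∈ Icc 0 T ∧ 0 ≤ φ₁ t ∧ 0 ≤ φ₂ t} ∩ Icc 0 T =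
          (Icc 0 T ∩ φ₁ ⁻¹' Ici 0) ∩ (Icc 0 T ∩ φ₂ ⁻¹' Ici 0) := by
        ext t; simp only [mem_inter_iff, mem_ofPred_eq, mem_preimage, mem_Ici]; tauto
      rw [e]
      exact (c1.preimage_isClosed_of_isClosed isClosed_Icc isClosed_Ici).inter
        (c2.preimage_isClosed_of_isClosed isClosed_Icc isClosed_Ici)
    · rintro t ⟨⟨ht, p1, p2⟩, ht'⟩
      obtain ⟨d1, d2⟩ := h t ht p1 p2
      have hsub : Icc t T ⊆ Icc 0 T := Icc_subset_Icc_left ht.1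
      filter_upwards [eventually_gt_of_deriv_pos ((h₁ t ht).mono hsub) ht'.2 d1,
        eventually_gt_of_deriv_pos ((h₂ t ht).mono hsub) ht'.2 d2,
        Ioc_mem_nhdsGT ht'.2] with s s1 s2 s3
      exact ⟨⟨ht.1.trans s3.1.le, s3.2⟩, p1.trans s1.le, p2.trans s2.le⟩
  exact fun t ht => (key ht).2

/-- A bounded function on the line whose derivative dominates a multiple of its absolute value
vanishes. -/
theorem eq_zero_of_abs_le_deriv {φ φ' : ℝ → ℝ} (h : ∀ t, HasDerivAt φ (φ' t) t) {k : ℝ} (hk : 0 < k)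
    (h' : ∀ t, k * |φ t| ≤ φ' t) {C : ℝ} (hC : ∀ t, |φ t| ≤ C) : ∀ t, φ t = 0 := by
  have hmono : Monotone φ := monotone_of_deriv_nonneg (fun t => (h t).differentiableAt)
    (fun t => by rw [(h t).deriv]; exact (by positivity : 0 ≤ k * |φ t|).trans (h' t))
  intro t
  rcases lt_trichotomy (φ t) 0 with hneg | h0 | hpos
  · exfalso
    -- where `φ` is negative it decreases at least linearly in backward time
    have hc : 0 < k * |φ t| := by have := abs_pos.2 hneg.ne; positivity
    have hC0 : 0 ≤ C := (abs_nonneg _).trans (hC t)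
    have hd : 0 ≤ (C + 1) / (k * |φ t|) := by positivity
    have := mul_sub_le_of_deriv_ge (I := Iic t) (convex_Iic t) (φ := φ) (φ' := φ')
      (fun s _ => (h s).hasDerivWithinAt) (k := k * |φ t|) (fun s hs => ?_)
      (s := t - (C + 1) / (k * |φ t|)) (t := t) (by simpa using hd) self_mem_Iic (by linarith)
    · rw [sub_sub_cancel, mul_div_cancel₀ _ hc.ne'] at this
      have h3 := hC (t - (C + 1) / (k * |φ t|))
      linarith [neg_abs_le (φ (t - (C + 1) / (k * |φ t|)))]
    · refine le_trans ?_ (h' s)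
      have := hmono (show s ≤ t from hs)
      rw [abs_of_neg hneg, abs_of_neg (this.trans_lt hneg)]
      gcongr
  · exact h0
  · exfalso
    -- where `φ` is positive it increases at least linearly in forward time
    have hc : 0 < k * |φ t| := by have := abs_pos.2 hpos.ne'; positivity
    have hC0 : 0 ≤ C := (abs_nonneg _).trans (hC t)
    have hd : 0 ≤ (C + 1) / (k * |φ t|) := by positivity
    have := mul_sub_le_of_deriv_ge (I := Ici t) (convex_Ici t) (φ := φ) (φ' := φ')
      (fun s _ => (h s).hasDerivWithinAt) (k := k * |φ t|) (fun s hs => ?_)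
      (s := t) (t := t + (C + 1) / (k * |φ t|)) self_mem_Ici (by simpa using hd) (by linarith)
    · rw [add_sub_cancel_left, mul_div_cancel₀ _ hc.ne'] at this
      have h3 := hC (t + (C + 1) / (k * |φ t|))
      linarith [le_abs_self (φ (t + (C + 1) / (k * |φ t|)))]
    · refine le_trans ?_ (h' s)
      have := hmono (show t ≤ s from hs)
      rw [abs_of_pos hpos, abs_of_pos (hpos.trans_le this)]
      gcongr

end Scalar

/-! ### Isolating blocks at a hyperbolic equilibrium -/

section ChartSection

variable {n : ℕ} {W : Type*} [NormedAddCommGroup W] [NormedSpace ℝ W]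

/-- Adapted coordinates for `x' = G (x, ν)` near the equilibrium `η` and the input `ν₀`: on the
block `|ℓ (x - η)|, ‖S (x - η)‖ ≤ a` and for inputs `ε`-close to `ν₀`, the difference of two states
grows in the direction of `ℓ` and decays in the directions of `S`, up to a small error. -/
structure Chart (G : E n × W → E n) (η : E n) (ν₀ : W) where
  m : ℕ
  ℓ : E n →L[ℝ] ℝ
  S : E n →L[ℝ] Copies n m
  κ : ℝ
  K : ℝ
  a : ℝ
  ε : ℝ
  κ_pos : 0 < κ
  K_pos : 0 < K
  a_pos : 0 < a
  ε_pos : 0 < ε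
  bound : ∀ v, ‖v‖ ^ 2 ≤ K * ((ℓ v) ^ 2 + ‖S v‖ ^ 2)
  growth : ∀ x y ν, |ℓ (x - η)| ≤ a ∧ ‖S (x - η)‖ ≤ a → |ℓ (y - η)| ≤ a ∧ ‖S (y - η)‖ ≤ a →
    ‖ν - ν₀‖ ≤ ε → κ * (ℓ (x - y)) ^ 2 - κ / 16 * ((ℓ (x - y)) ^ 2 + ‖S (x - y)‖ ^ 2) ≤
      ℓ (x - y) * ℓ (G (x, ν) - G (y, ν))
  decay : ∀ x y ν, |ℓ (x - η)| ≤ a ∧ ‖S (x - η)‖ ≤ a → |ℓ (y - η)| ≤ a ∧ ‖S (y - η)‖ ≤ a →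
    ‖ν - ν₀‖ ≤ ε → inner ℝ (S (x - y)) (S (G (x, ν) - G (y, ν))) ≤
      -κ * ‖S (x - y)‖ ^ 2 + κ / 16 * ((ℓ (x - y)) ^ 2 + ‖S (x - y)‖ ^ 2)

/-- Strict differentiability turns adapted coordinates of the linearisation into a chart. -/
theorem exists_chart {G : E n × W → E n} (hG : ContDiff ℝ 1 G) {η : E n} {ν₀ : W}
    {A : E n →L[ℝ] E n} (hA : ∀ ξ, fderiv ℝ G (η, ν₀) (ξ, 0) = A ξ) (σ : Splitting A) :
    ∃ c : Chart G η ν₀, c.ℓ = σ.ℓ ∧ ∀ w, σ.S w = 0 → c.S w = 0 := by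
  have hstrict : HasStrictFDerivAt G (fderiv ℝ G (η, ν₀)) (η, ν₀) :=
    hG.contDiffAt.hasStrictFDerivAt (by norm_num)
  have hκ := σ.κ_pos
  have hK := σ.K_pos
  set θ : ℝ := σ.κ / (16 * σ.K * (‖σ.ℓ‖ ^ 2 + ‖σ.S‖ ^ 2 + 1)) with hθ
  have hθ0 : 0 < θ := by positivity
  have hlit := hstrict.isLittleO
  rw [Asymptotics.isLittleO_iff] at hlit
  have hev := hlit hθ0
  obtain ⟨δ, hδ, hδ'⟩ := Metric.eventually_nhds_iff.1 hev
  -- `bound` converts the size of the coordinates into that of the state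
  have hbox : ∀ x, |σ.ℓ (x - η)| ≤ δ / (2 * (σ.K + 1)) ∧ ‖σ.S (x - η)‖ ≤ δ / (2 * (σ.K + 1)) →
      ‖x - η‖ < δ := by
    rintro x ⟨h1, h2⟩
    have h3 := σ.bound (x - η)
    have h4 : (σ.ℓ (x - η)) ^ 2 ≤ (δ / (2 * (σ.K + 1))) ^ 2 := by
      rw [← sq_abs]; exact pow_le_pow_left₀ (abs_nonneg _) h1 2
    have h5 : ‖σ.S (x - η)‖ ^ 2 ≤ (δ / (2 * (σ.K + 1))) ^ 2 := pow_le_pow_left₀ (norm_nonneg _) h2 2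
    have h6 : ‖x - η‖ ^ 2 < δ ^ 2 := by
      have h7 : (δ / (2 * (σ.K + 1))) ^ 2 * (4 * (σ.K + 1) ^ 2) = δ ^ 2 := by
        field_simp; ring
      have h8 : 0 < (δ / (2 * (σ.K + 1))) ^ 2 := by positivity
      nlinarith
    exact lt_of_pow_lt_pow_left₀ 2 hδ.le h6
  have herr : ∀ x y ν, |σ.ℓ (x - η)| ≤ δ / (2 * (σ.K + 1)) ∧ ‖σ.S (x - η)‖ ≤ δ / (2 * (σ.K + 1)) →
      |σ.ℓ (y - η)| ≤ δ / (2 * (σ.K + 1)) ∧ ‖σ.S (y - η)‖ ≤ δ / (2 * (σ.K + 1)) → ‖ν - ν₀‖ ≤ δ / 2 →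
      ‖G (x, ν) - G (y, ν) - A (x - y)‖ ≤ θ * ‖x - y‖ := by
    intro x y ν hx hy hν
    have hν' : ‖ν - ν₀‖ < δ := by linarith
    have := @hδ' ((x, ν), (y, ν)) (by
      simp only [dist_eq_norm]
      exact max_lt (max_lt (hbox x hx) hν') (max_lt (hbox y hy) hν'))
    have e : ((x, ν) : E n × W) - (y, ν) = (x - y, 0) := by simp
    simp only [e, hA] at this
    simpa [Prod.norm_def] using this
  have hNθ : ∀ ξ : E n, (‖σ.ℓ‖ ^ 2 + ‖σ.S‖ ^ 2) * (θ * ‖ξ‖ ^ 2) ≤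
      σ.κ / 16 * ((σ.ℓ ξ) ^ 2 + ‖σ.S ξ‖ ^ 2) := by
    intro ξ
    have h1 := σ.bound ξ
    have h2 : θ * (16 * σ.K * (‖σ.ℓ‖ ^ 2 + ‖σ.S‖ ^ 2 + 1)) = σ.κ := by
      rw [hθ]; field_simp
    have h3 : (‖σ.ℓ‖ ^ 2 + ‖σ.S‖ ^ 2) * (θ * ‖ξ‖ ^ 2) ≤ (‖σ.ℓ‖ ^ 2 + ‖σ.S‖ ^ 2 + 1) *
        (θ * (σ.K * ((σ.ℓ ξ) ^ 2 + ‖σ.S ξ‖ ^ 2))) := by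
      exact mul_le_mul (by linarith) (mul_le_mul_of_nonneg_left h1 hθ0.le) (by positivity)
        (by positivity)
    refine h3.trans (le_of_eq ?_)
    rw [← h2]; ring
  refine ⟨⟨σ.m, σ.ℓ, σ.S, σ.κ, σ.K, δ / (2 * (σ.K + 1)), δ / 2, hκ, hK, by positivity,
    by positivity, σ.bound, fun x y ν hx hy hν => ?_, fun x y ν hx hy hν => ?_⟩,
    rfl, fun w h => h⟩
  · have h1 := herr x y ν hx hy hν
    set ξ := x - y
    set r := G (x, ν) - G (y, ν) - A ξ with hr
    have e : G (x, ν) - G (y, ν) = A ξ + r := by rw [hr]; abel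
    rw [e, map_add, mul_add]
    have h2 := σ.growth ξ
    have h3 : |σ.ℓ ξ * σ.ℓ r| ≤ ‖σ.ℓ‖ ^ 2 * (θ * ‖ξ‖ ^ 2) := by
      rw [abs_mul]
      have a1 : |σ.ℓ ξ| ≤ ‖σ.ℓ‖ * ‖ξ‖ := σ.ℓ.le_opNorm ξ
      have a2 : |σ.ℓ r| ≤ ‖σ.ℓ‖ * (θ * ‖ξ‖) :=
        (σ.ℓ.le_opNorm r).trans (mul_le_mul_of_nonneg_left h1 (norm_nonneg _))
      calc |σ.ℓ ξ| * |σ.ℓ r| ≤ (‖σ.ℓ‖ * ‖ξ‖) * (‖σ.ℓ‖ * (θ * ‖ξ‖)) := by gcongr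
        _ = _ := by ring
    have h4 := hNθ ξ
    have h5 : 0 ≤ ‖σ.S‖ ^ 2 * (θ * ‖ξ‖ ^ 2) := by positivity
    have h6 := neg_abs_le (σ.ℓ ξ * σ.ℓ r)
    linarith
  · have h1 := herr x y ν hx hy hν
    set ξ := x - y
    set r := G (x, ν) - G (y, ν) - A ξ with hr
    have e : G (x, ν) - G (y, ν) = A ξ + r := by rw [hr]; abel
    rw [e, map_add, inner_add_right]
    have h2 := σ.decay ξ
    have h3 : inner ℝ (σ.S ξ) (σ.S r) ≤ ‖σ.S‖ ^ 2 * (θ * ‖ξ‖ ^ 2) := by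
      have a1 : ‖σ.S ξ‖ ≤ ‖σ.S‖ * ‖ξ‖ := σ.S.le_opNorm ξ
      have a2 : ‖σ.S r‖ ≤ ‖σ.S‖ * (θ * ‖ξ‖) :=
        (σ.S.le_opNorm r).trans (mul_le_mul_of_nonneg_left h1 (norm_nonneg _))
      calc inner ℝ (σ.S ξ) (σ.S r) ≤ ‖σ.S ξ‖ * ‖σ.S r‖ := real_inner_le_norm _ _
        _ ≤ (‖σ.S‖ * ‖ξ‖) * (‖σ.S‖ * (θ * ‖ξ‖)) := by gcongr
        _ = _ := by ring
    have h4 := hNθ ξ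
    have h5 : 0 ≤ ‖σ.ℓ‖ ^ 2 * (θ * ‖ξ‖ ^ 2) := by positivity
    linarith

namespace Chart

variable {G : E n × W → E n} {η : E n} {ν₀ : W} (c : Chart G η ν₀)

/-- The chart with the orientation of the unstable direction reversed. -/
def neg : Chart G η ν₀ where
  m := c.m
  ℓ := -c.ℓ
  S := c.S
  κ := c.κ
  K := c.K
  a := c.a
  ε := c.ε
  κ_pos := c.κ_pos
  K_pos := c.K_pos
  a_pos := c.a_pos
  ε_pos := c.ε_pos
  bound := by
    simpa only [neg_apply, abs_neg, neg_sq, neg_mul_neg] using c.bound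
  growth := by
    simpa only [neg_apply, abs_neg, neg_sq, neg_mul_neg] using c.growth
  decay := by
    simpa only [neg_apply, abs_neg, neg_sq, neg_mul_neg] using c.decay

/-- The closed block of size `b` around the equilibrium. -/
def box (b : ℝ) : Set (E n) := {x | |c.ℓ (x - η)| ≤ b ∧ ‖c.S (x - η)‖ ≤ b}

/-- The open block of size `b` around the equilibrium. -/
def obox (b : ℝ) : Set (E n) := {x | |c.ℓ (x - η)| < b ∧ ‖c.S (x - η)‖ < b}

@[simp] theorem box_neg (b : ℝ) : c.neg.box b = c.box b := by
  ext x
  show |-(c.ℓ (x - η))| ≤ b ∧ _ ↔ _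
  rw [abs_neg]
  rfl

@[simp] theorem obox_neg (b : ℝ) : c.neg.obox b = c.obox b := by
  ext x
  show |-(c.ℓ (x - η))| < b ∧ _ ↔ _
  rw [abs_neg]
  rfl

theorem obox_subset_box (b : ℝ) : c.obox b ⊆ c.box b := fun _ h => ⟨h.1.le, h.2.le⟩

theorem box_mono {b b' : ℝ} (h : b ≤ b') : c.box b ⊆ c.box b' :=
  fun _ hx => ⟨hx.1.trans h, hx.2.trans h⟩

theorem obox_mono {b b' : ℝ} (h : b ≤ b') : c.obox b ⊆ c.obox b' :=
  fun _ hx => ⟨hx.1.trans_le h, hx.2.trans_le h⟩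

theorem isOpen_obox (b : ℝ) : IsOpen (c.obox b) := by
  have h1 : IsOpen {x | |c.ℓ (x - η)| < b} := isOpen_lt (by fun_prop) continuous_const
  have h2 : IsOpen {x | ‖c.S (x - η)‖ < b} := isOpen_lt (by fun_prop) continuous_const
  exact h1.inter h2

theorem isClosed_box (b : ℝ) : IsClosed (c.box b) := by
  have h1 : IsClosed {x | |c.ℓ (x - η)| ≤ b} := isClosed_le (by fun_prop) continuous_const
  have h2 : IsClosed {x | ‖c.S (x - η)‖ ≤ b} := isClosed_le (by fun_prop) continuous_const
  exact h1.inter h2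

theorem mem_obox_self {b : ℝ} (hb : 0 < b) : η ∈ c.obox b := by simp [obox, hb]

theorem norm_sq_le_of_mem_box {b : ℝ} {x : E n} (hx : x ∈ c.box b) :
    ‖x - η‖ ^ 2 ≤ 2 * c.K * b ^ 2 := by
  have h1 := c.bound (x - η)
  have h2 : (c.ℓ (x - η)) ^ 2 ≤ b ^ 2 := by
    rw [← sq_abs]; exact pow_le_pow_left₀ (abs_nonneg _) hx.1 2
  have h3 : ‖c.S (x - η)‖ ^ 2 ≤ b ^ 2 := pow_le_pow_left₀ (norm_nonneg _) hx.2 2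
  nlinarith [c.K_pos]

theorem isCompact_box (b : ℝ) : IsCompact (c.box b) := by
  refine Metric.isCompact_of_isClosed_isBounded (c.isClosed_box b) ?_
  refine (Metric.isBounded_closedBall (x := η) (r := 2 * c.K * b ^ 2 + 1)).subset fun x hx => ?_
  rw [mem_closedBall_iff_norm]
  nlinarith [c.norm_sq_le_of_mem_box hx, sq_nonneg (‖x - η‖ - 1), norm_nonneg (x - η)]

/-- The blocks form a basis of neighbourhoods of the equilibrium. -/
theorem exists_box_subset {O : Set (E n)} (hO : O ∈ 𝓝 η) : ∃ b > 0, b ≤ c.a ∧ c.box b ⊆ O := by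
  obtain ⟨δ, hδ, h⟩ := Metric.mem_nhds_iff.1 hO
  have hK := c.K_pos
  refine ⟨min c.a (δ / (2 * (c.K + 1))), lt_min c.a_pos (by positivity), min_le_left _ _,
    fun x hx => h ?_⟩
  have h1 := c.norm_sq_le_of_mem_box (c.box_mono (min_le_right _ _) hx)
  rw [mem_ball_iff_norm]
  refine lt_of_pow_lt_pow_left₀ 2 hδ.le (h1.trans_lt ?_)
  have h7 : (δ / (2 * (c.K + 1))) ^ 2 * (4 * (c.K + 1) ^ 2) = δ ^ 2 := by
    field_simp; ring
  have h8 : 0 < (δ / (2 * (c.K + 1))) ^ 2 := by positivity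
  nlinarith

/-- An input for which the field at `η` is small compared with the block of size `b`. -/
def Good (b : ℝ) (ν : W) : Prop :=
  ‖ν - ν₀‖ ≤ c.ε ∧ |c.ℓ (G (η, ν))| ≤ c.κ * b / 16 ∧ ‖c.S (G (η, ν))‖ ≤ c.κ * b / 16

theorem Good.mono {b b' : ℝ} {ν : W} (h : c.Good b ν) (hb : b ≤ b') : c.Good b' ν := by
  have hκ := c.κ_pos
  refine ⟨h.1, h.2.1.trans ?_, h.2.2.trans ?_⟩ <;> gcongr

@[simp] theorem good_neg {b : ℝ} {ν : W} : c.neg.Good b ν ↔ c.Good b ν := by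
  show _ ∧ |-(c.ℓ (G (η, ν)))| ≤ _ ∧ _ ↔ _
  rw [abs_neg]
  rfl

theorem eventually_good (hG : Continuous G) (h0 : G (η, ν₀) = 0) {b : ℝ} (hb : 0 < b) :
    ∀ᶠ ν in 𝓝 ν₀, c.Good b ν := by
  have hκ := c.κ_pos
  have h1 : Tendsto (fun ν => ‖ν - ν₀‖) (𝓝 ν₀) (𝓝 0) := by
    have : Continuous fun ν : W => ‖ν - ν₀‖ := by fun_prop
    simpa using this.tendsto ν₀
  have h2 : Tendsto (fun ν => |c.ℓ (G (η, ν))|) (𝓝 ν₀) (𝓝 0) := by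
    have : Continuous fun ν : W => |c.ℓ (G (η, ν))| := by fun_prop
    simpa [h0] using this.tendsto ν₀
  have h3 : Tendsto (fun ν => ‖c.S (G (η, ν))‖) (𝓝 ν₀) (𝓝 0) := by
    have : Continuous fun ν : W => ‖c.S (G (η, ν))‖ := by fun_prop
    simpa [h0] using this.tendsto ν₀
  have hp : 0 < c.κ * b / 16 := by positivity
  filter_upwards [h1.eventually_lt_const c.ε_pos, h2.eventually_lt_const hp,
    h3.eventually_lt_const hp] with ν a1 a2 a3
  exact ⟨a1.le, a2.le, a3.le⟩

theorem mem_box_self {b : ℝ} (hb : 0 ≤ b) : η ∈ c.box b := by simp [box, hb]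

/-- In the cone around the unstable direction and away from the centre of the block, `|ℓ (x - η)|`
grows: the field at `η`, which need not vanish for the input `ν`, is dominated. -/
theorem unstable_growth {b : ℝ} {x : E n} {ν : W} (hx : x ∈ c.box c.a) (hν : c.Good b ν)
    (h1 : ‖c.S (x - η)‖ ≤ 2 * |c.ℓ (x - η)|) (h2 : b / 2 ≤ |c.ℓ (x - η)|) :
    9 / 16 * c.κ * (c.ℓ (x - η)) ^ 2 ≤ c.ℓ (x - η) * c.ℓ (G (x, ν)) := by
  have hκ := c.κ_pos
  have h3 := c.growth x η ν hx (c.mem_box_self c.a_pos.le) hν.1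
  rw [map_sub c.ℓ (G (x, ν))] at h3
  set u := c.ℓ (x - η)
  set v := ‖c.S (x - η)‖
  have h4 : |u * c.ℓ (G (η, ν))| ≤ |u| * (c.κ * b / 16) := by
    rw [abs_mul]; exact mul_le_mul_of_nonneg_left hν.2.1 (abs_nonneg _)
  have h5 := neg_abs_le (u * c.ℓ (G (η, ν)))
  have h6 : v ^ 2 ≤ 4 * u ^ 2 := by
    rw [← sq_abs u]; nlinarith [norm_nonneg (c.S (x - η)), abs_nonneg u]
  have h7 : |u| * (c.κ * b / 16) ≤ c.κ / 8 * u ^ 2 := by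
    rw [← sq_abs u]
    have : |u| * c.κ * (b / 2) ≤ |u| * c.κ * |u| := by gcongr
    nlinarith
  nlinarith

/-- Outside the cone around the unstable direction and away from the centre of the block,
`‖S (x - η)‖` decays. -/
theorem stable_decay {b : ℝ} {x : E n} {ν : W} (hx : x ∈ c.box c.a) (hν : c.Good b ν)
    (h1 : |c.ℓ (x - η)| ≤ ‖c.S (x - η)‖) (h2 : b / 2 ≤ ‖c.S (x - η)‖) :
    inner ℝ (c.S (x - η)) (c.S (G (x, ν))) ≤ -(c.κ / 4) * ‖c.S (x - η)‖ ^ 2 := by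
  have hκ := c.κ_pos
  have h3 := c.decay x η ν hx (c.mem_box_self c.a_pos.le) hν.1
  rw [map_sub c.S (G (x, ν)), inner_sub_right] at h3
  have h4 : inner ℝ (c.S (x - η)) (c.S (G (η, ν))) ≤ ‖c.S (x - η)‖ * (c.κ * b / 16) :=
    (real_inner_le_norm _ _).trans (mul_le_mul_of_nonneg_left hν.2.2 (norm_nonneg _))
  set u := c.ℓ (x - η)
  set v := ‖c.S (x - η)‖ with hv
  have hv0 : 0 ≤ v := norm_nonneg _
  have h6 : u ^ 2 ≤ v ^ 2 := by
    rw [← sq_abs u]; exact pow_le_pow_left₀ (abs_nonneg _) h1 2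
  have h7 : v * (c.κ * b / 16) ≤ c.κ / 8 * v ^ 2 := by
    have : v * c.κ * (b / 2) ≤ v * c.κ * v := by gcongr
    nlinarith
  nlinarith

/-- In the cone `‖S (x - η)‖ ≤ 2 |ℓ (x - η)|` and away from the centre of the block, half the
derivative of `ℓ ² - ‖S‖ ² / 4` is positive, which makes the cone forward invariant. -/
theorem cone_growth {b : ℝ} (hb : 0 < b) {x : E n} {ν : W} (hx : x ∈ c.box c.a) (hν : c.Good b ν)
    (h1 : ‖c.S (x - η)‖ ≤ 2 * |c.ℓ (x - η)|) (h2 : b / 2 ≤ |c.ℓ (x - η)|) :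
    0 < c.ℓ (x - η) * c.ℓ (G (x, ν)) - inner ℝ (c.S (x - η)) (c.S (G (x, ν))) / 4 := by
  have hκ := c.κ_pos
  have h0 := c.unstable_growth hx hν h1 h2
  have h3 := c.decay x η ν hx (c.mem_box_self c.a_pos.le) hν.1
  rw [map_sub c.S (G (x, ν)), inner_sub_right] at h3
  have h4 : inner ℝ (c.S (x - η)) (c.S (G (η, ν))) ≤ ‖c.S (x - η)‖ * (c.κ * b / 16) :=
    (real_inner_le_norm _ _).trans (mul_le_mul_of_nonneg_left hν.2.2 (norm_nonneg _))
  set u := c.ℓ (x - η)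
  set v := ‖c.S (x - η)‖ with hv
  have hv0 : 0 ≤ v := norm_nonneg _
  have hu0 : 0 < |u| := by linarith
  have h6 : v ^ 2 ≤ 4 * u ^ 2 := by
    rw [← sq_abs u]; nlinarith
  have h7 : v * (c.κ * b / 16) ≤ c.κ / 4 * u ^ 2 := by
    rw [← sq_abs u]
    have : v * c.κ * (b / 2) ≤ (2 * |u|) * c.κ * |u| := by gcongr
    nlinarith
  have h8 : 0 < c.κ * u ^ 2 := by
    rw [← sq_abs u]; positivity
  nlinarith [mul_nonneg hκ.le (sq_nonneg v)]

/-- The quadratic form that increases along differences of solutions. -/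
def D (ξ : E n) : ℝ := (c.ℓ ξ) ^ 2 - ‖c.S ξ‖ ^ 2

/-- The square of the adapted norm. -/
def N (ξ : E n) : ℝ := (c.ℓ ξ) ^ 2 + ‖c.S ξ‖ ^ 2

theorem abs_D_le (ξ : E n) : |c.D ξ| ≤ c.N ξ := by
  unfold D N
  rw [abs_le]
  constructor <;> nlinarith [sq_nonneg (c.ℓ ξ), sq_nonneg ‖c.S ξ‖]

theorem N_nonneg (ξ : E n) : 0 ≤ c.N ξ := by unfold N; positivity

theorem eq_zero_of_N {ξ : E n} (h : c.N ξ ≤ 0) : ξ = 0 := by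
  have h1 : c.N ξ = 0 := le_antisymm h (c.N_nonneg ξ)
  have h2 := c.bound ξ
  change ‖ξ‖ ^ 2 ≤ c.K * c.N ξ at h2
  rw [h1, mul_zero] at h2
  have : ‖ξ‖ = 0 := by nlinarith [norm_nonneg ξ]
  exact norm_eq_zero.1 this

theorem continuous_D : Continuous c.D := by unfold D; fun_prop

theorem hasDerivWithinAt_ell {x : ℝ → E n} {x' : E n} {I : Set ℝ} {t : ℝ}
    (h : HasDerivWithinAt x x' I t) (p : E n) :
    HasDerivWithinAt (fun t => c.ℓ (x t - p)) (c.ℓ x') I t :=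
  c.ℓ.hasFDerivAt.comp_hasDerivWithinAt t (h.sub_const p)

theorem hasDerivWithinAt_S_sq {x : ℝ → E n} {x' : E n} {I : Set ℝ} {t : ℝ}
    (h : HasDerivWithinAt x x' I t) :
    HasDerivWithinAt (fun t => ‖c.S (x t)‖ ^ 2) (2 * inner ℝ (c.S (x t)) (c.S x')) I t :=
  (c.S.hasFDerivAt.comp_hasDerivWithinAt t h).norm_sq

theorem hasDerivWithinAt_D {x y : ℝ → E n} {ν : ℝ → W} {I : Set ℝ} (hx : Sol G ν I x)
    (hy : Sol G ν I y) {t : ℝ} (ht : t ∈ I) :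
    HasDerivWithinAt (fun t => c.D (x t - y t))
      (2 * (c.ℓ (x t - y t) * c.ℓ (G (x t, ν t) - G (y t, ν t)) -
        inner ℝ (c.S (x t - y t)) (c.S (G (x t, ν t) - G (y t, ν t))))) I t := by
  have h := (hx t ht).sub (hy t ht)
  have h1 := (c.ℓ.hasFDerivAt.comp_hasDerivWithinAt t h).pow 2
  have h2 := c.hasDerivWithinAt_S_sq h
  refine (h1.sub h2).congr_deriv ?_
  simp
  ring

/-- The derivative of `D` along the difference of two states dominates the adapted norm. The field at
`η` cancels, so that no smallness of the input beyond `ε` is needed. -/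
theorem D_deriv_ge {x y : E n} {ν : W} (hx : x ∈ c.box c.a) (hy : y ∈ c.box c.a)
    (hν : ‖ν - ν₀‖ ≤ c.ε) : c.κ * c.N (x - y) ≤
      2 * (c.ℓ (x - y) * c.ℓ (G (x, ν) - G (y, ν)) -
        inner ℝ (c.S (x - y)) (c.S (G (x, ν) - G (y, ν)))) := by
  have h1 := c.growth x y ν hx hy hν
  have h2 := c.decay x y ν hx hy hν
  have hκ := c.κ_pos
  unfold N
  nlinarith [mul_nonneg hκ.le (sq_nonneg (c.ℓ (x - y))), mul_nonneg hκ.le (sq_nonneg ‖c.S (x - y)‖)]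

/-- `D` increases along the difference of two solutions in the block. -/
theorem D_mono {x y : ℝ → E n} {ν : ℝ → W} {I : Set ℝ} (hI : I.OrdConnected) (hx : Sol G ν I x)
    (hy : Sol G ν I y) (hxb : ∀ t ∈ I, x t ∈ c.box c.a) (hyb : ∀ t ∈ I, y t ∈ c.box c.a)
    (hν : ∀ t ∈ I, ‖ν t - ν₀‖ ≤ c.ε) {s t : ℝ} (hs : s ∈ I) (ht : t ∈ I) (hst : s ≤ t) :
    c.D (x s - y s) ≤ c.D (x t - y t) := by
  have := mul_sub_le_of_deriv_ge hI.convex (fun t ht => c.hasDerivWithinAt_D hx hy ht) (k := 0)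
    (fun t ht => (mul_nonneg c.κ_pos.le (c.N_nonneg _)).trans
      (c.D_deriv_ge (hxb t ht) (hyb t ht) (hν t ht))) hs ht hst
  linarith

/-- Two solutions in the block are equal if the quadratic form of their difference does not
increase. -/
theorem eq_of_D_le {x y : ℝ → E n} {ν : ℝ → W} {s t : ℝ} (hst : s < t) (hx : Sol G ν (Icc s t) x)
    (hy : Sol G ν (Icc s t) y) (hxb : ∀ t' ∈ Icc s t, x t' ∈ c.box c.a)
    (hyb : ∀ t' ∈ Icc s t, y t' ∈ c.box c.a) (hν : ∀ t' ∈ Icc s t, ‖ν t' - ν₀‖ ≤ c.ε)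
    (h : c.D (x t - y t) ≤ c.D (x s - y s)) : x s = y s := by
  have hs : s ∈ Icc s t := ⟨le_rfl, hst.le⟩
  have ht : t ∈ Icc s t := ⟨hst.le, le_rfl⟩
  by_contra hne
  have hN : 0 < c.κ * c.N (x s - y s) := by
    refine mul_pos c.κ_pos (lt_of_not_ge fun h0 => hne (sub_eq_zero.1 (c.eq_zero_of_N h0)))
  have hd := c.hasDerivWithinAt_D hx hy hs
  obtain ⟨r, hr1, hr2⟩ := ((eventually_gt_of_deriv_pos hd hst (hN.trans_le
    (c.D_deriv_ge (hxb s hs) (hyb s hs) (hν s hs)))).and (Ioc_mem_nhdsGT hst)).exists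
  have := c.D_mono ordConnected_Icc hx hy hxb hyb hν (s := r) (t := t) ⟨hr2.1.le, hr2.2⟩ ht hr2.2
  linarith

/-- A solution for all times that stays in the block, for a constant input with the same
equilibrium, is the equilibrium. -/
theorem eq_of_full_solution {ν : W} (hν : ‖ν - ν₀‖ ≤ c.ε) (h0 : G (η, ν) = 0) {x : ℝ → E n}
    (hx : Sol G (fun _ => ν) univ x) (hb : ∀ t, x t ∈ c.box c.a) : ∀ t, x t = η := by
  have hη : Sol G (fun _ => ν) univ (fun _ => η) := by
    intro t _
    simpa [h0] using hasDerivAt_const t η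
  have hd : ∀ t, HasDerivAt (fun t => c.D (x t - η)) _ t :=
    fun t => (c.hasDerivWithinAt_D hx hη (mem_univ t)).hasDerivAt univ_mem
  have hge : ∀ t, c.κ * c.N (x t - η) ≤ _ := fun t =>
    c.D_deriv_ge (hb t) (c.mem_box_self c.a_pos.le) hν
  have hN : ∀ t, c.N (x t - η) ≤ 2 * c.a ^ 2 := by
    intro t
    have h1 := pow_le_pow_left₀ (abs_nonneg _) (hb t).1 2
    have h2 := pow_le_pow_left₀ (norm_nonneg _) (hb t).2 2
    rw [sq_abs] at h1
    unfold N; linarith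
  have hz := eq_zero_of_abs_le_deriv hd c.κ_pos
    (fun t => (mul_le_mul_of_nonneg_left (c.abs_D_le _) c.κ_pos.le).trans (hge t))
    (fun t => (c.abs_D_le _).trans (hN t))
  intro t
  refine c.eq_of_D_le (s := t) (t := t + 1) (by linarith) (hx.mono (subset_univ _))
    (hη.mono (subset_univ _)) (fun t _ => hb t) (fun _ _ => c.mem_box_self c.a_pos.le)
    (fun _ _ => hν) ?_
  rw [hz, hz]

end Chart

end ChartSection

section ChartDynamics

variable {n : ℕ} {W : Type*} [NormedAddCommGroup W] [NormedSpace ℝ W]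

namespace Chart

variable {G : E n × W → E n} {η : E n} {ν₀ : W} (c : Chart G η ν₀)

@[simp] theorem neg_neg : c.neg.neg = c := by
  cases c; simp [neg]

theorem exists_radius : ∃ R, (∀ x ∈ c.box c.a, ‖x‖ ≤ R) ∧ ∀ ν, ‖ν - ν₀‖ ≤ c.ε → ‖ν‖ ≤ R := by
  obtain ⟨R, hR⟩ := (c.isCompact_box c.a).isBounded.exists_norm_le
  refine ⟨max R (‖ν₀‖ + c.ε), fun x hx => (hR x hx).trans (le_max_left _ _), fun ν hν => ?_⟩
  refine le_trans ?_ (le_max_right _ _)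
  have := norm_sub_norm_le ν ν₀
  linarith

/-- In the block, the cone around the unstable direction is forward invariant outside a
neighbourhood of the equilibrium, and the unstable coordinate grows there. -/
theorem cone_invariant {x : ℝ → E n} {ν : ℝ → W} {T b : ℝ} (hb : 0 < b)
    (hx : Sol G ν (Icc 0 T) x) (hxb : ∀ t ∈ Icc 0 T, x t ∈ c.box c.a)
    (hν : ∀ t ∈ Icc 0 T, c.Good b (ν t)) (h1 : ‖c.S (x 0 - η)‖ ≤ 2 * c.ℓ (x 0 - η))
    (h2 : b / 2 ≤ c.ℓ (x 0 - η)) : ∀ t ∈ Icc 0 T, ‖c.S (x t - η)‖ ≤ 2 * c.ℓ (x t - η) ∧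
      c.ℓ (x 0 - η) + c.κ * b / 8 * t ≤ c.ℓ (x t - η) := by
  have hκ := c.κ_pos
  have d1 : ∀ t ∈ Icc 0 T, HasDerivWithinAt (fun t => c.ℓ (x t - η) - b / 2)
      (c.ℓ (G (x t, ν t))) (Icc 0 T) t := fun t ht =>
    (c.hasDerivWithinAt_ell (hx t ht) η).sub_const _
  have d2 : ∀ t ∈ Icc 0 T, HasDerivWithinAt
      (fun t => (c.ℓ (x t - η)) ^ 2 - ‖c.S (x t - η)‖ ^ 2 / 4)
      (2 * (c.ℓ (x t - η) * c.ℓ (G (x t, ν t)) -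
        inner ℝ (c.S (x t - η)) (c.S (G (x t, ν t))) / 4)) (Icc 0 T) t := by
    intro t ht
    have e1 := (c.hasDerivWithinAt_ell (hx t ht) η).pow 2
    have e2 := c.hasDerivWithinAt_S_sq ((hx t ht).sub_const η)
    refine (e1.sub (e2.div_const 4)).congr_deriv ?_
    simp
    ring
  have cone : ∀ x, 0 ≤ c.ℓ (x - η) - b / 2 →
      0 ≤ (c.ℓ (x - η)) ^ 2 - ‖c.S (x - η)‖ ^ 2 / 4 → ‖c.S (x - η)‖ ≤ 2 * |c.ℓ (x - η)| ∧
        b / 2 ≤ |c.ℓ (x - η)| ∧ |c.ℓ (x - η)| = c.ℓ (x - η) := by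
    intro x p1 p2
    have hpos : 0 < c.ℓ (x - η) := by linarith
    rw [abs_of_pos hpos]
    refine ⟨?_, by linarith, rfl⟩
    refine le_of_sq_le_sq (a := ‖c.S (x - η)‖) ?_ (by linarith)
    nlinarith
  have slope : ∀ t ∈ Icc 0 T, 0 ≤ c.ℓ (x t - η) - b / 2 →
      0 ≤ (c.ℓ (x t - η)) ^ 2 - ‖c.S (x t - η)‖ ^ 2 / 4 →
        c.κ * b / 8 ≤ c.ℓ (G (x t, ν t)) := by
    intro t ht p1 p2
    obtain ⟨q1, q2, q3⟩ := cone _ p1 p2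
    have := c.unstable_growth (hxb t ht) (hν t ht) q1 q2
    have hpos : 0 < c.ℓ (x t - η) := by linarith
    have h3 : 9 / 16 * c.κ * c.ℓ (x t - η) ≤ c.ℓ (G (x t, ν t)) := by
      refine le_of_mul_le_mul_left ?_ hpos
      nlinarith
    nlinarith
  have key := nonneg_of_deriv_pos d1 d2 (fun t ht p1 p2 => by
    obtain ⟨q1, q2, q3⟩ := cone _ p1 p2
    refine ⟨lt_of_lt_of_le (by positivity) (slope t ht p1 p2), ?_⟩
    have := c.cone_growth hb (hxb t ht) (hν t ht) q1 q2
    linarith) (by simpa using h2) (by nlinarith [norm_nonneg (c.S (x 0 - η))])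
  intro t ht
  obtain ⟨p1, p2⟩ := key t ht
  obtain ⟨q1, q2, q3⟩ := cone _ p1 p2
  refine ⟨by rwa [q3] at q1, ?_⟩
  have := mul_sub_le_of_deriv_ge (convex_Icc 0 T) d1 (k := c.κ * b / 8)
    (fun s hs => slope s hs (key s hs).1 (key s hs).2) (s := 0) (t := t)
    ⟨le_rfl, ht.1.trans ht.2⟩ ht ht.1
  linarith

/-- The solution from `p` stays in the closed block of size `b` up to the time `t`, when it reaches
the face in the direction of `ℓ`. -/
def ExitsAt (ν : ℝ → W) (p : E n) (b t : ℝ) : Prop :=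
  0 ≤ t ∧ ∃ x : ℝ → E n, Sol G ν (Icc 0 t) x ∧ x 0 = p ∧ (∀ s ∈ Icc 0 t, x s ∈ c.box b) ∧
    c.ℓ (x t - η) = b

variable [FiniteDimensional ℝ W]

/-- Starting in the open block, either it is never left, or it is left through one of the two faces
in the unstable direction: the field points inwards on the other part of the boundary. -/
theorem stays_or_exits_of_time (hG : ContDiff ℝ 1 G) {ν : C(ℝ, W)} {b : ℝ} (hb : 0 < b) (hba : b ≤ c.a)
    (hν : ∀ t ≥ 0, c.Good b (ν t)) {p : E n} (hp : p ∈ c.obox b) :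
    ∃ y : ℝ → E n, y 0 = p ∧ ∀ T ≥ 0, (Sol G ν (Icc 0 T) y ∧ ∀ t ∈ Icc 0 T, y t ∈ c.obox b) ∨
      (∃ t ≤ T, c.ExitsAt ν p b t) ∨ ∃ t ≤ T, c.neg.ExitsAt ν p b t := by
  obtain ⟨R, hR1, hR2⟩ := c.exists_radius
  obtain ⟨g, hg⟩ := exists_isCutoff hG R
  set y := flow g ν p with hy
  have hy0 : y 0 = p := (hg.flow_spec ν p).1
  have hyc : Continuous y := hg.continuous_flow ν p
  have hsol : ∀ T, (∀ t ∈ Icc 0 T, y t ∈ c.box b) → Sol G ν (Icc 0 T) y := fun T hT =>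
    hg.sol_flow (fun t ht => hR1 _ (c.box_mono hba (hT t ht)))
      (fun t ht => hR2 _ (hν t ht.1).1)
  refine ⟨y, hy0, fun T hT => ?_⟩
  by_cases hstay : ∀ t ∈ Icc 0 T, y t ∈ c.obox b
  · exact Or.inl ⟨hsol T fun t ht => c.obox_subset_box b (hstay t ht), hstay⟩
  right
  push Not at hstay
  obtain ⟨t₁, ht₁, hout⟩ := hstay
  set Z := {t | t ∈ Icc 0 T ∧ y t ∉ c.obox b} with hZ
  have hZc : IsCompact Z := by
    have : Z = Icc 0 T ∩ y ⁻¹' (c.obox b)ᶜ := rfl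
    rw [this]
    exact isCompact_Icc.inter_right ((c.isOpen_obox b).isClosed_compl.preimage hyc)
  -- the first time outside the open block
  obtain ⟨t₀, ht₀, hmin⟩ := hZc.exists_isLeast ⟨t₁, ht₁, hout⟩
  have hpos : 0 < t₀ := by
    rcases eq_or_lt_of_le ht₀.1.1 with h | h
    · exact absurd (by rw [← h, hy0]; exact hp) ht₀.2
    · exact h
  have hbefore : ∀ t ∈ Ico 0 t₀, y t ∈ c.obox b := by
    intro t ht
    by_contra hc
    exact absurd (hmin ⟨⟨ht.1, ht.2.le.trans ht₀.1.2⟩, hc⟩) (not_le.2 ht.2)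
  have hbox : ∀ t ∈ Icc 0 t₀, y t ∈ c.box b := by
    intro t ht
    have h1 : Icc 0 t₀ ⊆ closure (Ico 0 t₀) := by rw [closure_Ico hpos.ne]
    have h2 := map_mem_closure hyc (h1 ht) (fun s hs => c.obox_subset_box b (hbefore s hs))
    rwa [(c.isClosed_box b).closure_eq] at h2
  have hS := hsol t₀ hbox
  have hend : t₀ ∈ Icc 0 t₀ := ⟨hpos.le, le_rfl⟩
  have hface := hbox t₀ hend
  by_cases hu : |c.ℓ (y t₀ - η)| < b
  · exfalso
    have hv : ‖c.S (y t₀ - η)‖ = b := by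
      refine le_antisymm hface.2 (not_lt.1 fun h => ht₀.2 ⟨hu, h⟩)
    -- on the part of the boundary where `‖S‖ = b` the field points inwards
    have h1 := c.stable_decay (c.box_mono hba hface) (hν t₀ hpos.le) (by rw [hv]; exact hu.le)
      (by rw [hv]; linarith)
    have h2 := c.hasDerivWithinAt_S_sq ((hS t₀ hend).sub_const η)
    have h3 : 2 * inner ℝ (c.S (y t₀ - η)) (c.S (G (y t₀, ν t₀))) < 0 := by
      rw [hv] at h1
      have : 0 < c.κ / 4 * b ^ 2 := by have := c.κ_pos; positivity
      linarith
    obtain ⟨s, hs1, hs2⟩ := ((eventually_gt_of_deriv_neg h2 hpos h3).and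
      (Ico_mem_nhdsLT hpos)).exists
    have h4 := (hbefore s hs2).2
    rw [hv] at hs1
    have := pow_lt_pow_left₀ h4 (norm_nonneg _) two_ne_zero
    linarith
  · have hu' : |c.ℓ (y t₀ - η)| = b := le_antisymm hface.1 (not_lt.1 hu)
    rcases abs_eq hb.le |>.1 hu' with h | h
    · exact Or.inl ⟨t₀, ht₀.1.2, hpos.le, y, hS, hy0, hbox, h⟩
    · refine Or.inr ⟨t₀, ht₀.1.2, hpos.le, y, hS, hy0, by simpa using hbox, ?_⟩
      show -(c.ℓ (y t₀ - η)) = b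
      rw [h, _root_.neg_neg]

/-- `stays_or_exits_of_time` for all times at once. -/
theorem stays_or_exits (hG : ContDiff ℝ 1 G) {ν : C(ℝ, W)} {b : ℝ} (hb : 0 < b) (hba : b ≤ c.a)
    (hν : ∀ t ≥ 0, c.Good b (ν t)) {p : E n} (hp : p ∈ c.obox b) :
    (∃ y : ℝ → E n, Sol G ν (Ici 0) y ∧ y 0 = p ∧ ∀ t ≥ 0, y t ∈ c.obox b) ∨
      (∃ t, c.ExitsAt ν p b t) ∨ ∃ t, c.neg.ExitsAt ν p b t := by
  obtain ⟨y, hy0, hy⟩ := c.stays_or_exits_of_time hG hb hba hν hp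
  by_cases h : ∀ T ≥ 0, Sol G ν (Icc 0 T) y ∧ ∀ t ∈ Icc 0 T, y t ∈ c.obox b
  · refine Or.inl ⟨y, fun t ht => ?_, hy0, fun t ht => (h t ht).2 t ⟨ht, le_rfl⟩⟩
    have ht' : (0 : ℝ) ≤ t := ht
    refine ((h (t + 1) (by linarith)).1 t ⟨ht', by linarith⟩).mono_of_mem_nhdsWithin ?_
    rw [← Ici_inter_Iic]
    exact inter_mem self_mem_nhdsWithin (mem_nhdsWithin_of_mem_nhds (Iic_mem_nhds (by linarith)))
  · push Not at h
    obtain ⟨T, hT, hT'⟩ := h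
    rcases hy T hT with h1 | ⟨t, -, h1⟩ | ⟨t, -, h1⟩
    · obtain ⟨t, ht, h2⟩ := hT' h1.1
      exact absurd (h1.2 t ht) h2
    · exact Or.inr (Or.inl ⟨t, h1⟩)
    · exact Or.inr (Or.inr ⟨t, h1⟩)

/-- After the exit through one face the solution cannot turn around within the block and reach the
other one, because `ℓ` grows in the cone around the unstable direction. -/
theorem not_exits_both_of_le (hG : ContDiff ℝ 1 G) {ν : C(ℝ, W)} {b : ℝ} (hb : 0 < b) (hba : b ≤ c.a)
    (hν : ∀ t ≥ 0, c.Good b (ν t)) {p : E n} {t₁ t₂ : ℝ} (h₁ : c.ExitsAt ν p b t₁)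
    (h₂ : c.neg.ExitsAt ν p b t₂) (h : t₁ ≤ t₂) : False := by
  obtain ⟨ht1, x, hx, hx0, hxb, hxe⟩ := h₁
  obtain ⟨ht2, y, hy, hy0, hyb, hye⟩ := h₂
  have hsub : Icc 0 t₁ ⊆ Icc 0 t₂ := Icc_subset_Icc_right h
  have heq := Sol.unique hG ordConnected_Icc ν.continuous.continuousOn hx (hy.mono hsub)
    (t₀ := 0) ⟨le_rfl, ht1⟩ (hx0.trans hy0.symm) t₁ ⟨ht1, le_rfl⟩
  have hz := hy.shift t₁ (J := Icc 0 (t₂ - t₁)) (fun t ht => ⟨by linarith [ht.1], by linarith [ht.2]⟩)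
  have hu : c.ℓ (y t₁ - η) = b := by rw [← heq]; exact hxe
  have := (c.cone_invariant hb hz (fun t ht => c.box_mono hba (by
      simpa using hyb (t + t₁) ⟨by linarith [ht.1], by linarith [ht.2]⟩))
    (fun t ht => hν _ (by linarith [ht.1])) (by
      rw [zero_add, hu]
      have := hxb t₁ ⟨ht1, le_rfl⟩
      rw [heq] at this
      linarith [this.2]) (by rw [zero_add, hu]; linarith) (t₂ - t₁) ⟨by linarith, le_rfl⟩).2
  rw [sub_add_cancel, zero_add, hu] at this
  have hye' : -(c.ℓ (y t₂ - η)) = b := hye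
  have h3 : 0 ≤ c.κ * b / 8 * (t₂ - t₁) :=
    mul_nonneg (by have := c.κ_pos; positivity) (by linarith)
  linarith

/-- A solution does not leave through both faces. -/
theorem not_exits_both (hG : ContDiff ℝ 1 G) {ν : C(ℝ, W)} {b : ℝ} (hb : 0 < b) (hba : b ≤ c.a)
    (hν : ∀ t ≥ 0, c.Good b (ν t)) {p : E n} {t₁ t₂ : ℝ} (h₁ : c.ExitsAt ν p b t₁)
    (h₂ : c.neg.ExitsAt ν p b t₂) : False := by
  rcases le_total t₁ t₂ with h | h
  · exact c.not_exits_both_of_le hG hb hba hν h₁ h₂ h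
  · refine c.neg.not_exits_both_of_le hG hb hba (fun t ht => (c.good_neg).2 (hν t ht)) h₂ ?_ h
    simpa using h₁

theorem not_stays_of_exits (hG : ContDiff ℝ 1 G) {ν : C(ℝ, W)} {b : ℝ} {p : E n} {t : ℝ}
    (h : c.ExitsAt ν p b t) {y : ℝ → E n} (hy : Sol G ν (Ici 0) y)
    (hy0 : y 0 = p) (hyb : ∀ t ≥ 0, y t ∈ c.obox b) : False := by
  obtain ⟨ht, x, hx, hx0, hxb, hxe⟩ := h
  have heq := Sol.unique hG ordConnected_Icc ν.continuous.continuousOn hx (hy.mono Icc_subset_Ici_self)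
    (t₀ := 0) ⟨le_rfl, ht⟩ (hx0.trans hy0.symm) t ⟨ht, le_rfl⟩
  have := (hyb t ht).1
  rw [← heq, hxe] at this
  exact absurd (le_abs_self b) (not_le.2 this)

/-- States in the cone leave a block through the face in the direction of the cone. -/
theorem exits_of_cone (hG : ContDiff ℝ 1 G) {ν : C(ℝ, W)} {b b' : ℝ} (hb : 0 < b) (hbb : b ≤ b')
    (hba : b' ≤ c.a) (hν : ∀ t ≥ 0, c.Good b (ν t)) {p : E n} (hp : p ∈ c.obox b')
    (h1 : ‖c.S (p - η)‖ ≤ 2 * c.ℓ (p - η)) (h2 : b / 2 ≤ c.ℓ (p - η)) :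
    ∃ t, c.ExitsAt ν p b' t := by
  have hκ := c.κ_pos
  rcases c.stays_or_exits hG (hb.trans_le hbb) hba (fun t ht => (hν t ht).mono c hbb) hp with
    ⟨y, hy, hy0, hyb⟩ | h | ⟨t, ht, y, hy, hy0, hyb, hye⟩
  · exfalso
    have hk : 0 < c.κ * b / 8 := by positivity
    set T := b' / (c.κ * b / 8) with hT
    have hT0 : 0 ≤ T := div_nonneg (hb.le.trans hbb) hk.le
    have := (c.cone_invariant hb (hy.mono (Icc_subset_Ici_self : Icc 0 T ⊆ _))
      (fun t ht => c.box_mono hba (c.obox_subset_box _ (hyb t ht.1))) (fun t ht => hν t ht.1)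
      (by rwa [hy0]) (by rwa [hy0]) T ⟨hT0, le_rfl⟩).2
    rw [hT, mul_div_cancel₀ _ hk.ne', hy0, ← hT] at this
    have h3 := (abs_lt.1 (hyb T hT0).1).2
    linarith
  · exact h
  · exfalso
    have := (c.cone_invariant hb hy (fun t ht => c.box_mono hba (by simpa using hyb t ht))
      (fun t ht => hν t ht.1) (by rwa [hy0]) (by rwa [hy0]) t ⟨ht, le_rfl⟩).2
    have hye' : -(c.ℓ (y t - η)) = b' := hye
    have : 0 ≤ c.κ * b / 8 * t := by positivity
    rw [hy0] at *
    linarith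

/-- Moving a state in the unstable direction `w` keeps it on the same side: the difference of the two
solutions stays in the cone where the unstable coordinate cannot vanish. -/
theorem exits_of_add (hG : ContDiff ℝ 1 G) {ν : C(ℝ, W)} {b : ℝ} (hb : 0 < b)
    (hba : b ≤ c.a) (hν : ∀ t ≥ 0, c.Good b (ν t)) {p w : E n} (hw1 : c.ℓ w = 1) (hw2 : c.S w = 0)
    {r : ℝ} (hr : 0 ≤ r) (hpr : p + r • w ∈ c.obox b) {t : ℝ} (h : c.ExitsAt ν p b t) :
    ∃ t, c.ExitsAt ν (p + r • w) b t := by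
  rcases eq_or_lt_of_le hr with rfl | hr
  · exact ⟨t, by simpa using h⟩
  obtain ⟨ht, x, hx, hx0, hxb, hxe⟩ := h
  -- as long as both solutions stay in the block, their order in the unstable direction is kept
  have order : ∀ (T : ℝ) (y : ℝ → E n), 0 ≤ T → T ≤ t → Sol G ν (Icc 0 T) y → y 0 = p + r • w →
      (∀ s ∈ Icc 0 T, y s ∈ c.box b) → c.ℓ (x T - η) < c.ℓ (y T - η) := by
    intro T y hT hTt hy hy0 hyb
    have hsub : Icc 0 T ⊆ Icc 0 t := Icc_subset_Icc_right hTt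
    have hD : ∀ s ∈ Icc 0 T, 0 < c.D (y s - x s) := by
      intro s hs
      have := c.D_mono ordConnected_Icc hy (hx.mono hsub) (fun s hs => c.box_mono hba (hyb s hs))
        (fun s hs => c.box_mono hba (hxb s (hsub hs))) (fun s hs => (hν s hs.1).1) (s := 0) (t := s)
        ⟨le_rfl, hT⟩ hs hs.1
      refine lt_of_lt_of_le ?_ this
      rw [hy0, hx0, add_sub_cancel_left, D, map_smul, map_smul, hw1, hw2]
      simpa using by positivity
    by_contra hcon
    push Not at hcon
    have hcont : ContinuousOn (fun s => c.ℓ (y s - x s)) (Icc 0 T) :=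
      c.ℓ.continuous.comp_continuousOn (hy.continuousOn.sub (hx.mono hsub).continuousOn)
    have h0 : (0 : ℝ) ≤ c.ℓ (y 0 - x 0) := by
      rw [hy0, hx0, add_sub_cancel_left, map_smul, hw1]; simpa using hr.le
    have h1 : c.ℓ (y T - x T) ≤ 0 := by
      have : y T - x T = (y T - η) - (x T - η) := by abel
      rw [this, map_sub]; linarith
    obtain ⟨s, hs, hs0⟩ := intermediate_value_Icc' hT hcont ⟨h1, h0⟩
    have h2 := hD s hs
    have hs0' : c.ℓ (y s - x s) = 0 := hs0
    rw [D, hs0'] at h2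
    nlinarith [sq_nonneg ‖c.S (y s - x s)‖]
  rcases c.stays_or_exits hG hb hba hν hpr with
    ⟨y, hy, hy0, hyb⟩ | h | ⟨t', ht', y, hy, hy0, hyb, hye⟩
  · exfalso
    have := order t y ht le_rfl (hy.mono Icc_subset_Ici_self) hy0
      (fun s hs => c.obox_subset_box b (hyb s hs.1))
    linarith [(abs_lt.1 (hyb t ht).1).2]
  · exact h
  · exfalso
    simp only [box_neg] at hyb
    have hye' : -(c.ℓ (y t' - η)) = b := hye
    rcases le_total t t' with h1 | h1
    · have := order t y ht le_rfl (hy.mono (Icc_subset_Icc_right h1)) hy0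
        (fun s hs => hyb s ⟨hs.1, hs.2.trans h1⟩)
      linarith [(abs_le.1 (hyb t ⟨ht, h1⟩).1).2]
    · have := order t' y ht' h1 hy hy0 hyb
      linarith [(abs_le.1 (hxb t' ⟨ht', h1⟩).1).1]

/-- Limits of exits, with convergent exit times, are exits. -/
theorem exitsAt_of_tendsto (hG : ContDiff ℝ 1 G) {ν : ℕ → C(ℝ, W)} {ν₁ : C(ℝ, W)}
    (hν : Tendsto ν atTop (𝓝 ν₁)) {b : ℝ} (hba : b ≤ c.a)
    (hgood : ∀ k, ∀ t ≥ 0, ‖ν k t - ν₀‖ ≤ c.ε) {p : ℕ → E n} {p₀ : E n}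
    (hp : Tendsto p atTop (𝓝 p₀)) {t : ℕ → ℝ} {t₀ : ℝ} (ht : Tendsto t atTop (𝓝 t₀))
    (h : ∀ k, c.ExitsAt (ν k) (p k) b (t k)) : c.ExitsAt ν₁ p₀ b t₀ := by
  obtain ⟨R, hR1, hR2⟩ := c.exists_radius
  have ht0 : 0 ≤ t₀ := ge_of_tendsto' ht fun k => (h k).1
  choose hpos x hx hx0 hxb hxe using h
  obtain ⟨y, hy0, hyc, hylim, hysol⟩ := exists_limit_solution hG hν (I := fun k => Icc 0 (t k))
    (fun k => ordConnected_Icc) (fun k => ⟨le_rfl, hpos k⟩) hx (R := R)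
    (fun k s hs => hR1 _ (c.box_mono hba (hxb k s hs))) (fun k s hs => hR2 _ (hgood k s hs.1))
    (q := p₀) (by simpa [hx0] using hp)
  have hτ : ∀ s ∈ Icc 0 t₀, ∃ τ : ℕ → ℝ, Tendsto τ atTop (𝓝 s) ∧ ∀ k, τ k ∈ Icc 0 (t k) := by
    intro s hs
    refine ⟨fun k => min s (t k), ?_, fun k => ⟨le_min hs.1 (hpos k), min_le_right _ _⟩⟩
    have := (tendsto_const_nhds (x := s)).min ht
    rwa [min_eq_left hs.2] at this
  refine ⟨ht0, y, hysol _ fun s hs => ?_, hy0, fun s hs => ?_, ?_⟩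
  · obtain ⟨τ, h1, h2⟩ := hτ s hs
    exact ⟨τ, h1, Eventually.of_forall h2⟩
  · obtain ⟨τ, h1, h2⟩ := hτ s hs
    exact (c.isClosed_box b).mem_of_tendsto (hylim τ s h1 (Eventually.of_forall h2))
      (Eventually.of_forall fun k => hxb k _ (h2 k))
  · have h1 := hylim t t₀ ht (Eventually.of_forall fun k => ⟨hpos k, le_rfl⟩)
    have h2 : Tendsto (fun k => c.ℓ (x k (t k) - η)) atTop (𝓝 (c.ℓ (y t₀ - η))) :=
      (c.ℓ.continuous.tendsto _).comp (h1.sub_const η)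
    simp only [hxe] at h2
    exact (tendsto_nhds_unique h2 tendsto_const_nhds)

/-- A state that leaves through one face is not a limit of states that leave through the other
face. -/
theorem not_tendsto_exits_neg (hG : ContDiff ℝ 1 G) {ν : ℕ → C(ℝ, W)} {ν₁ : C(ℝ, W)}
    (hν : Tendsto ν atTop (𝓝 ν₁)) {b : ℝ} (hb : 0 < b) (hba : b < c.a)
    (hgood : ∀ k, ∀ t ≥ 0, c.Good b (ν k t)) (hgood₁ : ∀ t ≥ 0, c.Good b (ν₁ t))
    {p : ℕ → E n} {p₀ : E n} (hp : Tendsto p atTop (𝓝 p₀)) {t₀ : ℝ}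
    (h₀ : c.ExitsAt ν₁ p₀ b t₀) {t : ℕ → ℝ} (h : ∀ k, c.neg.ExitsAt (ν k) (p k) b (t k)) :
    False := by
  obtain ⟨R, hR1, hR2⟩ := c.exists_radius
  obtain ⟨g, hg⟩ := exists_isCutoff hG R
  set y := flow g ν₁ p₀ with hy
  have hyc : Continuous y := hg.continuous_flow ν₁ p₀
  obtain ⟨ht0, x, hx, hx0, hxb, hxe⟩ := h₀
  have hxy : ∀ s ∈ Icc 0 t₀, x s = y s := by
    intro s hs
    have := hg.eqOn_flow ordConnected_Icc (⟨le_rfl, ht0⟩ : (0 : ℝ) ∈ Icc 0 t₀) hx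
      (fun s hs => hR1 _ (c.box_mono hba.le (hxb s hs)))
      (fun s hs => hR2 _ (hgood₁ s hs.1).1) s hs
    rwa [hx0] at this
  have hend : y t₀ ∈ c.obox c.a := by
    rw [← hxy t₀ ⟨ht0, le_rfl⟩]
    have := hxb t₀ ⟨ht0, le_rfl⟩
    exact ⟨this.1.trans_lt hba, this.2.trans_lt hba⟩
  have hue : c.ℓ (y t₀ - η) = b := by rw [← hxy t₀ ⟨ht0, le_rfl⟩]; exact hxe
  -- a little later the solution is beyond the face
  obtain ⟨δ, hδ, hδ'⟩ := Metric.eventually_nhds_iff.1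
    (hyc.continuousAt.eventually_mem ((c.isOpen_obox c.a).mem_nhds hend))
  have hbox : ∀ s ∈ Icc 0 (δ / 2), y (s + t₀) ∈ c.box c.a := by
    intro s hs
    refine c.obox_subset_box _ (hδ' ?_)
    rw [Real.dist_eq, add_sub_cancel_right, abs_of_nonneg hs.1]
    linarith [hs.2]
  have hsol : Sol G ν₁ (Icc t₀ (t₀ + δ / 2)) y := hg.sol_flow
    (fun s hs => hR1 _ (by
      simpa using hbox (s - t₀) ⟨by linarith [hs.1], by linarith [hs.2]⟩))
    (fun s hs => hR2 _ (hgood₁ s (ht0.trans hs.1)).1)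
  have hsh := hsol.shift t₀ (J := Icc 0 (δ / 2)) (fun s hs => ⟨by linarith [hs.1], by linarith [hs.2]⟩)
  have hbeyond : b < c.ℓ (y (δ / 2 + t₀) - η) := by
    have := (c.cone_invariant hb hsh hbox (fun s hs => hgood₁ _ (by linarith [hs.1])) (by
        rw [zero_add, hue]
        have := (hxb t₀ ⟨ht0, le_rfl⟩).2
        rw [hxy t₀ ⟨ht0, le_rfl⟩] at this
        linarith) (by rw [zero_add, hue]; linarith) (δ / 2) ⟨by positivity, le_rfl⟩).2
    rw [zero_add, hue] at this
    have hp : 0 < c.κ * b / 8 * (δ / 2) := by have := c.κ_pos; positivity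
    linarith
  have hnear : ∀ᶠ k in atTop, b < c.ℓ (flow g (ν k) (p k) (δ / 2 + t₀) - η) := by
    have h1 := hg.tendsto_flow hν hp (tendsto_const_nhds (x := δ / 2 + t₀))
    have h2 : Tendsto (fun k => c.ℓ (flow g (ν k) (p k) (δ / 2 + t₀) - η)) atTop
        (𝓝 (c.ℓ (y (δ / 2 + t₀) - η))) := (c.ℓ.continuous.tendsto _).comp (h1.sub_const η)
    exact h2.eventually_const_lt hbeyond
  have hbd : ∀ᶠ k in atTop, t k ∈ Icc 0 (δ / 2 + t₀) := by
    filter_upwards [hnear] with k hk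
    refine ⟨(h k).1, not_lt.1 fun hlt => ?_⟩
    obtain ⟨htk, z, hz, hz0, hzb, hze⟩ := h k
    simp only [box_neg] at hzb
    have hmem : δ / 2 + t₀ ∈ Icc 0 (t k) := ⟨by positivity, hlt.le⟩
    have := hg.eqOn_flow ordConnected_Icc (⟨le_rfl, htk⟩ : (0 : ℝ) ∈ Icc 0 (t k)) hz
      (fun s hs => hR1 _ (c.box_mono hba.le (hzb s hs)))
      (fun s hs => hR2 _ (hgood k s hs.1).1) _ hmem
    rw [hz0] at this
    rw [← this] at hk
    linarith [(abs_le.1 (hzb _ hmem).1).2]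
  obtain ⟨t', -, φ, hφ, hφt⟩ := isCompact_Icc.tendsto_subseq' hbd.frequently
  have hlim := c.neg.exitsAt_of_tendsto hG (hν.comp hφ.tendsto_atTop) (b := b) hba.le
    (fun k t ht => (hgood (φ k) t ht).1) (hp.comp hφ.tendsto_atTop) hφt (fun k => h (φ k))
  exact c.not_exits_both hG hb hba.le hgood₁ ⟨ht0, x, hx, hx0, hxb, hxe⟩ hlim

/-- Solutions that stay in the block on longer and longer time intervals around `0`, with signals
that converge to a constant with the same equilibrium, converge to the equilibrium. -/
theorem limit_eq (hG : ContDiff ℝ 1 G) {ν : ℕ → C(ℝ, W)} {ν₁ : W}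
    (hν : Tendsto ν atTop (𝓝 (ContinuousMap.const ℝ ν₁))) (hν₁ : ‖ν₁ - ν₀‖ ≤ c.ε)
    (h0 : G (η, ν₁) = 0) {I : ℕ → Set ℝ} (hI : ∀ k, (I k).OrdConnected)
    (hI0 : ∀ k, (0 : ℝ) ∈ I k) (hIt : ∀ t : ℝ, ∀ᶠ k in atTop, t ∈ I k) {x : ℕ → ℝ → E n}
    (hx : ∀ k, Sol G (ν k) (I k) (x k)) (hxb : ∀ k, ∀ t ∈ I k, x k t ∈ c.box c.a)
    (hgood : ∀ k, ∀ t ∈ I k, ‖ν k t - ν₀‖ ≤ c.ε) {q : E n}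
    (hq : Tendsto (fun k => x k 0) atTop (𝓝 q)) : q = η := by
  obtain ⟨R, hR1, hR2⟩ := c.exists_radius
  obtain ⟨y, hy0, hyc, hylim, hysol⟩ := exists_limit_solution hG hν hI hI0 hx (R := R)
    (fun k s hs => hR1 _ (hxb k s hs)) (fun k s hs => hR2 _ (hgood k s hs)) hq
  have hsol : Sol G (fun _ => ν₁) univ y :=
    hysol univ fun t _ => ⟨fun _ => t, tendsto_const_nhds, hIt t⟩
  rw [← hy0]
  refine c.eq_of_full_solution hν₁ h0 hsol (fun t => ?_) 0
  exact (c.isClosed_box c.a).mem_of_tendsto (hylim (fun _ => t) t tendsto_const_nhds (hIt t))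
    ((hIt t).mono fun k hk => hxb k t hk)

/-- A solution that stays in the block in forward time converges to the equilibrium. -/
theorem tendsto_atTop_of_stays (hG : ContDiff ℝ 1 G) {ν : C(ℝ, W)} {ν₁ : W}
    (hν : Tendsto ν atTop (𝓝 ν₁)) (hν₁ : ‖ν₁ - ν₀‖ ≤ c.ε) (h0 : G (η, ν₁) = 0) {x : ℝ → E n}
    (hx : Sol G ν (Ici 0) x) (hxb : ∀ t ≥ 0, x t ∈ c.box c.a)
    (hgood : ∀ t ≥ 0, ‖ν t - ν₀‖ ≤ c.ε) : Tendsto x atTop (𝓝 η) := by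
  refine tendsto_of_seq_tendsto fun u hu => tendsto_of_subseq_tendsto fun ns hns => ?_
  have hu' : Tendsto (fun k => max (u (ns k)) 0) atTop atTop :=
    tendsto_atTop_mono (fun k => le_max_left _ _) (hu.comp hns)
  obtain ⟨q, -, φ, hφ, hφq⟩ := (c.isCompact_box c.a).tendsto_subseq
    (x := fun k => x (max (u (ns k)) 0)) (fun k => hxb _ (le_max_right _ _))
  have hv := hu'.comp hφ.tendsto_atTop
  have hq : q = η := by
    refine c.limit_eq hG (tendsto_shiftSig_atTop hν hv) hν₁ h0
      (I := fun k => Ici (-(max (u (ns (φ k))) 0)))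
      (x := fun k t => x (t + max (u (ns (φ k))) 0))
      (fun k => ordConnected_Ici) (fun k => ?_) (fun t => ?_) (fun k => ?_) (fun k t ht => ?_)
      (fun k t ht => ?_) ?_
    · simp
    · filter_upwards [hv.eventually_ge_atTop (-t)] with k hk
      simp only [Function.comp_apply] at hk
      simp only [mem_Ici]; linarith
    · refine (hx.shift (max (u (ns (φ k))) 0) (J := Ici (-(max (u (ns (φ k))) 0))) ?_)
      intro t ht
      simp only [mem_Ici] at ht ⊢; linarith
    · simp only [mem_Ici] at ht
      exact hxb _ (by linarith)
    · simp only [mem_Ici] at ht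
      exact hgood (t + max (u (ns (φ k))) 0) (by linarith)
    · simpa [Function.comp_def] using hφq
  refine ⟨φ, ?_⟩
  rw [← hq]
  refine hφq.congr' ?_
  filter_upwards [(hu.comp (hns.comp hφ.tendsto_atTop)).eventually_ge_atTop 0] with k hk
  simp only [Function.comp_apply] at hk ⊢
  rw [max_eq_left hk]

/-- A solution that stays in the block in backward time converges to the equilibrium. -/
theorem tendsto_atBot_of_stays (hG : ContDiff ℝ 1 G) {ν : C(ℝ, W)} {ν₁ : W}
    (hν : Tendsto ν atBot (𝓝 ν₁)) (hν₁ : ‖ν₁ - ν₀‖ ≤ c.ε) (h0 : G (η, ν₁) = 0) {x : ℝ → E n} {T : ℝ}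
    (hx : Sol G ν (Iic T) x) (hxb : ∀ t ≤ T, x t ∈ c.box c.a)
    (hgood : ∀ t ≤ T, ‖ν t - ν₀‖ ≤ c.ε) : Tendsto x atBot (𝓝 η) := by
  refine tendsto_of_seq_tendsto fun u hu => tendsto_of_subseq_tendsto fun ns hns => ?_
  have hu' : Tendsto (fun k => min (u (ns k)) T) atTop atBot :=
    tendsto_atBot_mono (fun k => min_le_left _ _) (hu.comp hns)
  -- limits of translates are full solutions of the limit equation in the block, hence at rest
  obtain ⟨q, -, φ, hφ, hφq⟩ := (c.isCompact_box c.a).tendsto_subseq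
    (x := fun k => x (min (u (ns k)) T)) (fun k => hxb _ (min_le_right _ _))
  have hv := hu'.comp hφ.tendsto_atTop
  have hq : q = η := by
    refine c.limit_eq hG (tendsto_shiftSig_atBot hν hv) hν₁ h0
      (I := fun k => Iic (T - min (u (ns (φ k))) T))
      (x := fun k t => x (t + min (u (ns (φ k))) T))
      (fun k => ordConnected_Iic) (fun k => ?_) (fun t => ?_) (fun k => ?_) (fun k t ht => ?_)
      (fun k t ht => ?_) ?_
    · simp
    · filter_upwards [hv.eventually_le_atBot (T - t)] with k hk
      simp only [Function.comp_apply] at hk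
      simp only [mem_Iic]; linarith
    · refine (hx.shift (min (u (ns (φ k))) T) (J := Iic (T - min (u (ns (φ k))) T)) ?_)
      intro t ht
      simp only [mem_Iic] at ht ⊢; linarith
    · simp only [mem_Iic] at ht
      exact hxb _ (by linarith)
    · simp only [mem_Iic] at ht
      exact hgood (t + min (u (ns (φ k))) T) (by linarith)
    · simpa [Function.comp_def] using hφq
  refine ⟨φ, ?_⟩
  rw [← hq]
  refine hφq.congr' ?_
  filter_upwards [(hu.comp (hns.comp hφ.tendsto_atTop)).eventually_le_atBot T] with k hk
  simp only [Function.comp_apply] at hk ⊢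
  rw [min_eq_left hk]

theorem sol_const {ν : W} (h0 : G (η, ν) = 0) (I : Set ℝ) : Sol G (fun _ => ν) I (fun _ => η) := by
  intro t _
  have := (hasDerivAt_const t η).hasDerivWithinAt (s := I)
  rw [← h0] at this
  exact this

/-- Solutions in the unstable manifold lie in the cone around the unstable direction. -/
theorem D_pos_of_backward (hG : ContDiff ℝ 1 G) {ν : W} (hν : ‖ν - ν₀‖ ≤ c.ε) (h0 : G (η, ν) = 0)
    {x : ℝ → E n} (hx : Sol G (fun _ => ν) (Iic 0) x) (hxb : ∀ t ≤ 0, x t ∈ c.box c.a)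
    (hlim : Tendsto x atBot (𝓝 η)) (hne : x 0 ≠ η) : 0 < c.D (x 0 - η) := by
  have hη := sol_const (G := G) h0 (Iic 0)
  have hge : ∀ t ≤ 0, 0 ≤ c.D (x t - η) := by
    intro t ht
    have h1 : Tendsto (fun s => c.D (x s - η)) atBot (𝓝 0) := by
      have := (c.continuous_D.tendsto (η - η)).comp (hlim.sub_const η)
      simpa [D, Function.comp_def] using this
    refine le_of_tendsto h1 ?_
    filter_upwards [eventually_le_atBot t] with s hs
    exact c.D_mono ordConnected_Iic hx hη hxb (fun _ _ => c.mem_box_self c.a_pos.le)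
      (fun _ _ => hν) (hs.trans ht) ht hs
  by_contra hcon
  push Not at hcon
  have hsub : Icc (-1 : ℝ) 0 ⊆ Iic 0 := fun t ht => ht.2
  have := c.eq_of_D_le (s := -1) (t := 0) (by norm_num) (hx.mono hsub) (hη.mono hsub)
    (fun t ht => hxb t ht.2) (fun _ _ => c.mem_box_self c.a_pos.le) (fun _ _ => hν)
    (hcon.trans (hge (-1) (by norm_num)))
  exact hne (Sol.unique hG ordConnected_Iic continuousOn_const hx hη
    (t₀ := -1) (by norm_num) this 0 (by simp))

/-- On each side the unstable manifold is a single orbit. -/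
theorem unstable_unique (hG : ContDiff ℝ 1 G) {ν : W} (hν : ‖ν - ν₀‖ ≤ c.ε)
    {x y : ℝ → E n} (hx : Sol G (fun _ => ν) (Iic 0) x) (hxb : ∀ t ≤ 0, x t ∈ c.box c.a)
    (hxlim : Tendsto x atBot (𝓝 η)) (hy : Sol G (fun _ => ν) (Iic 0) y)
    (hyb : ∀ t ≤ 0, y t ∈ c.box c.a) (hylim : Tendsto y atBot (𝓝 η))
    (hx0 : 0 < c.ℓ (x 0 - η)) (hxy : c.ℓ (x 0 - η) ≤ c.ℓ (y 0 - η)) :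
    ∃ s ≥ 0, x 0 = y (-s) := by
  have hcont : ContinuousOn (fun t => c.ℓ (y t - η)) (Iic 0) :=
    c.ℓ.continuous.comp_continuousOn (hy.continuousOn.sub continuousOn_const)
  have hl : Tendsto (fun t => c.ℓ (y t - η)) atBot (𝓝 0) := by
    have := (c.ℓ.continuous.tendsto (η - η)).comp (hylim.sub_const η)
    simpa [Function.comp_def] using this
  obtain ⟨T, hT1, hT2⟩ := ((hl.eventually_lt_const hx0).and (eventually_le_atBot 0)).exists
  -- shift `y` so that both have the same value of `ℓ` at time `0`
  obtain ⟨s, hs, hs'⟩ := intermediate_value_Icc hT2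
    (hcont.mono (fun t ht => ht.2 : Icc T 0 ⊆ Iic 0)) ⟨hT1.le, hxy⟩
  have hs'' : c.ℓ (y s - η) = c.ℓ (x 0 - η) := hs'
  refine ⟨-s, by simpa using hs.2, ?_⟩
  rw [_root_.neg_neg]
  have hz : Sol G (fun _ => ν) (Iic 0) (fun t => y (t + s)) := hy.shift s (J := Iic 0)
    (fun t ht => by simp only [mem_Iic] at ht ⊢; linarith [hs.2])
  have hzb : ∀ t ≤ 0, y (t + s) ∈ c.box c.a := fun t ht => hyb _ (by linarith [hs.2])
  have hzlim : Tendsto (fun t => y (t + s)) atBot (𝓝 η) :=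
    hylim.comp (tendsto_atBot_add_const_right _ _ tendsto_id)
  -- `D` of the difference vanishes at time `-∞` and increases, but is not positive at time `0`
  have hge : 0 ≤ c.D (x (-1) - y (-1 + s)) := by
    have h1 : Tendsto (fun t => c.D (x t - y (t + s))) atBot (𝓝 0) := by
      have := (c.continuous_D.tendsto (η - η)).comp (hxlim.sub hzlim)
      simpa [D, Function.comp_def] using this
    refine le_of_tendsto h1 ?_
    filter_upwards [eventually_le_atBot (-1 : ℝ)] with t ht
    exact c.D_mono ordConnected_Iic hx hz hxb hzb (fun _ _ => hν)
      (show t ≤ 0 by linarith) (show (-1 : ℝ) ≤ 0 by norm_num) ht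
  have hle : c.D (x 0 - y (0 + s)) ≤ 0 := by
    have : c.ℓ (x 0 - y (0 + s)) = 0 := by
      have : x 0 - y (0 + s) = (x 0 - η) - (y s - η) := by rw [zero_add]; abel
      rw [this, map_sub, hs'', sub_self]
    rw [D, this]
    nlinarith [sq_nonneg ‖c.S (x 0 - y (0 + s))‖]
  have hsub : Icc (-1 : ℝ) 0 ⊆ Iic 0 := fun t ht => ht.2
  have h1 := c.eq_of_D_le (s := -1) (t := 0) (by norm_num) (hx.mono hsub) (hz.mono hsub)
    (fun t ht => hxb t ht.2) (fun t ht => hzb t ht.2) (fun _ _ => hν) (hle.trans hge)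
  have := Sol.unique hG ordConnected_Iic continuousOn_const hx hz
    (t₀ := -1) (by norm_num) h1 0 (by simp)
  simpa using this

end Chart

end ChartDynamics

/-! ### The compactified time -/

section Time

/-- The flow of `s' = α (1 - s²) / 2` on `[-1, 1]`. -/
def theta (α t s : ℝ) : ℝ :=
  ((1 + s) * Real.exp (α * t) - (1 - s)) / ((1 + s) * Real.exp (α * t) + (1 - s))

theorem theta_den_pos (α t : ℝ) {s : ℝ} (hs : s ∈ Icc (-1 : ℝ) 1) :
    0 < (1 + s) * Real.exp (α * t) + (1 - s) := by
  have he := Real.exp_pos (α * t)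
  rcases eq_or_lt_of_le hs.1 with h | h
  · rw [← h]; norm_num
  · have : 0 < (1 + s) * Real.exp (α * t) := mul_pos (by linarith) he
    linarith [hs.2]

theorem theta_zero {α s : ℝ} : theta α 0 s = s := by
  rw [theta, mul_zero, Real.exp_zero]
  ring

theorem one_sub_theta (α t : ℝ) {s : ℝ} (hs : s ∈ Icc (-1 : ℝ) 1) :
    1 - theta α t s = 2 * (1 - s) / ((1 + s) * Real.exp (α * t) + (1 - s)) := by
  have := (theta_den_pos α t hs).ne'
  rw [theta]
  field_simp
  ring

theorem one_add_theta (α t : ℝ) {s : ℝ} (hs : s ∈ Icc (-1 : ℝ) 1) :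
    1 + theta α t s =
      2 * ((1 + s) * Real.exp (α * t)) / ((1 + s) * Real.exp (α * t) + (1 - s)) := by
  have := (theta_den_pos α t hs).ne'
  rw [theta]
  field_simp
  ring

theorem theta_mem_Icc (α t : ℝ) {s : ℝ} (hs : s ∈ Icc (-1 : ℝ) 1) : theta α t s ∈ Icc (-1 : ℝ) 1 := by
  have hd := theta_den_pos α t hs
  have h1 := one_sub_theta α t hs
  have h2 := one_add_theta α t hs
  have h3 : 0 ≤ 1 - theta α t s := by rw [h1]; exact div_nonneg (by linarith [hs.2]) hd.le
  have h4 : 0 ≤ 1 + theta α t s := by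
    rw [h2]
    exact div_nonneg (mul_nonneg two_pos.le (mul_nonneg (by linarith [hs.1]) (Real.exp_pos _).le)) hd.le
  exact ⟨by linarith, by linarith⟩

theorem theta_mem (α t : ℝ) {s : ℝ} (hs : s ∈ Ioc (-1 : ℝ) 1) : theta α t s ∈ Ioc (-1 : ℝ) 1 := by
  have hs' := Ioc_subset_Icc_self hs
  refine ⟨?_, (theta_mem_Icc α t hs').2⟩
  have h2 := one_add_theta α t hs'
  have h4 : 0 < 1 + theta α t s := by
    rw [h2]
    exact div_pos (mul_pos two_pos (mul_pos (by linarith [hs.1]) (Real.exp_pos _)))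
      (theta_den_pos α t hs')
  linarith

theorem theta_one (α t : ℝ) : theta α t 1 = 1 := by
  have := (Real.exp_pos (α * t)).ne'
  rw [theta]
  field_simp
  ring

theorem theta_neg_one (α t : ℝ) : theta α t (-1) = -1 := by
  rw [theta]
  norm_num

theorem theta_add (α t u : ℝ) {s : ℝ} (hs : s ∈ Icc (-1 : ℝ) 1) :
    theta α t (theta α u s) = theta α (u + t) s := by
  have h1 := (theta_den_pos α u hs).ne'
  have h2 := (theta_den_pos α (u + t) hs).ne'
  have h3 := (theta_den_pos α t (theta_mem_Icc α u hs)).ne'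
  have e1 := one_sub_theta α u hs
  have e2 := one_add_theta α u hs
  rw [mul_add, Real.exp_add] at h2
  rw [theta.eq_1 α t, theta.eq_1 α (u + t), mul_add, Real.exp_add]
  rw [div_eq_div_iff h3 (by convert h2 using 1), e1, e2]
  field_simp

theorem hasDerivAt_theta (α t : ℝ) {s : ℝ} (hs : s ∈ Icc (-1 : ℝ) 1) :
    HasDerivAt (fun t => theta α t s) (α * (1 - theta α t s ^ 2) / 2) t := by
  have hd := (theta_den_pos α t hs).ne'
  have he : HasDerivAt (fun t => Real.exp (α * t)) (Real.exp (α * t) * (α * 1)) t :=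
    ((hasDerivAt_id t).const_mul α).exp
  have h := ((he.const_mul (1 + s)).sub_const (1 - s)).div ((he.const_mul (1 + s)).add_const (1 - s)) hd
  refine h.congr_deriv ?_
  have : 1 - theta α t s ^ 2 = (1 - theta α t s) * (1 + theta α t s) := by ring
  rw [this, one_sub_theta α t hs, one_add_theta α t hs]
  field_simp
  ring

theorem le_theta {α : ℝ} (h0 : 0 < α) {t s : ℝ} (ht : 0 ≤ t) (hs : s ∈ Icc (-1 : ℝ) 1) :
    s ≤ theta α t s := by
  have hd := theta_den_pos α t hs
  have he : 1 ≤ Real.exp (α * t) := Real.one_le_exp (by positivity)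
  have h1 := one_sub_theta α t hs
  have : 1 - theta α t s ≤ 1 - s := by
    rw [h1, div_le_iff₀ hd]
    nlinarith [mul_nonneg (show 0 ≤ 1 - s by linarith [hs.2])
      (mul_nonneg (show 0 ≤ 1 + s by linarith [hs.1]) (sub_nonneg.2 he))]
  linarith

theorem theta_mono (α t : ℝ) {s s' : ℝ} (hs : s ∈ Icc (-1 : ℝ) 1) (hs' : s' ∈ Icc (-1 : ℝ) 1)
    (h : s ≤ s') : theta α t s ≤ theta α t s' := by
  have hd := theta_den_pos α t hs
  have hd' := theta_den_pos α t hs'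
  have he := Real.exp_pos (α * t)
  have : 1 - theta α t s' ≤ 1 - theta α t s := by
    rw [one_sub_theta α t hs, one_sub_theta α t hs', div_le_div_iff₀ hd' hd]
    nlinarith [mul_nonneg (sub_nonneg.2 h) he.le]
  linarith

theorem tendsto_theta_atTop {α : ℝ} (h0 : 0 < α) {s : ℝ} (hs : s ∈ Ioc (-1 : ℝ) 1) :
    Tendsto (fun t => theta α t s) atTop (𝓝 1) := by
  have h1 : Tendsto (fun t => (1 + s) * Real.exp (α * t) + (1 - s)) atTop atTop :=
    tendsto_atTop_add_const_right _ _ ((Real.tendsto_exp_atTop.comp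
      (tendsto_id.const_mul_atTop h0)).const_mul_atTop (by linarith [hs.1]))
  have h2 := (h1.const_div_atTop (2 * (1 - s))).const_sub 1
  rw [sub_zero] at h2
  refine h2.congr fun t => ?_
  rw [← one_sub_theta α t (Ioc_subset_Icc_self hs)]
  ring

theorem continuousOn_theta (α : ℝ) :
    ContinuousOn (fun z : ℝ × ℝ => theta α z.1 z.2) (univ ×ˢ Icc (-1 : ℝ) 1) := by
  unfold theta
  refine ContinuousOn.div (by fun_prop) (by fun_prop) ?_
  rintro ⟨t, s⟩ ⟨-, hs⟩
  exact (theta_den_pos α t hs).ne'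

theorem gα_eq_theta (α τ : ℝ) : gα α τ = theta α τ 0 := by
  rw [gα, theta, Real.tanh_eq]
  have h : α * τ = α / 2 * τ + α / 2 * τ := by ring
  rw [h, Real.exp_add, Real.exp_neg]
  have := (Real.exp_pos (α / 2 * τ))
  have h2 : 0 < Real.exp (α / 2 * τ) * Real.exp (α / 2 * τ) + 1 := by positivity
  field_simp
  ring

theorem gα_mem (α τ : ℝ) : gα α τ ∈ Ioo (-1 : ℝ) 1 := ⟨Real.neg_one_lt_tanh _, Real.tanh_lt_one _⟩

theorem gα_mem_Ioc (α τ : ℝ) : gα α τ ∈ Ioc (-1 : ℝ) 1 := Ioo_subset_Ioc_self (gα_mem α τ)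

theorem theta_gα (α t τ : ℝ) : theta α t (gα α τ) = gα α (τ + t) := by
  rw [gα_eq_theta, gα_eq_theta, theta_add α t τ (by norm_num)]

theorem hα_gα {α : ℝ} (h0 : 0 < α) (τ : ℝ) : hα α (gα α τ) = τ := by
  have he := Real.exp_pos (α * τ)
  have h1 := one_sub_theta α τ (s := 0) (by norm_num)
  have h2 := one_add_theta α τ (s := 0) (by norm_num)
  rw [← gα_eq_theta] at h1 h2
  rw [hα, h1, h2]
  have h3 : (2 * ((1 + 0) * Real.exp (α * τ)) / ((1 + 0) * Real.exp (α * τ) + (1 - 0))) /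
      (2 * (1 - 0) / ((1 + 0) * Real.exp (α * τ) + (1 - 0))) = Real.exp (α * τ) := by
    field_simp
    simp
  rw [h3, Real.log_exp]
  field_simp

theorem gα_hα {α : ℝ} (h0 : 0 < α) {s : ℝ} (hs : s ∈ Ioo (-1 : ℝ) 1) : gα α (hα α s) = s := by
  have h1 : 0 < 1 + s := by linarith [hs.1]
  have h2 : 0 < 1 - s := by linarith [hs.2]
  rw [gα_eq_theta, theta, hα]
  have : α * (1 / α * Real.log ((1 + s) / (1 - s))) = Real.log ((1 + s) / (1 - s)) := by
    field_simp
  rw [this, Real.exp_log (div_pos h1 h2)]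
  field_simp
  ring

theorem gα_lt {α : ℝ} (h0 : 0 < α) {τ τ' : ℝ} (h : τ < τ') : gα α τ < gα α τ' := by
  have h1 := one_sub_theta α τ (s := 0) (by norm_num)
  have h2 := one_sub_theta α τ' (s := 0) (by norm_num)
  rw [← gα_eq_theta] at h1 h2
  have he : Real.exp (α * τ) < Real.exp (α * τ') := Real.exp_lt_exp.2 (by nlinarith)
  have h3 : 1 - gα α τ' < 1 - gα α τ := by
    rw [h1, h2]
    apply div_lt_div_of_pos_left (by norm_num)
    · have := Real.exp_pos (α * τ); linarith
    · linarith
  linarith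

theorem gα_lt_iff {α : ℝ} (h0 : 0 < α) {τ τ' : ℝ} : gα α τ < gα α τ' ↔ τ < τ' := by
  refine ⟨fun h => ?_, gα_lt h0⟩
  by_contra hcon
  push Not at hcon
  rcases eq_or_lt_of_le hcon with h' | h'
  · rw [h'] at h; exact lt_irrefl _ h
  · exact lt_asymm h (gα_lt h0 h')

theorem tendsto_gα_atTop {α : ℝ} (h0 : 0 < α) : Tendsto (gα α) atTop (𝓝 1) :=
  (tendsto_theta_atTop h0 (s := 0) (by norm_num)).congr fun τ => (gα_eq_theta α τ).symm

theorem tendsto_gα_atBot {α : ℝ} (h0 : 0 < α) : Tendsto (gα α) atBot (𝓝 (-1)) := by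
  have h := ((tendsto_gα_atTop h0).comp tendsto_neg_atBot_atTop).neg
  refine h.congr fun τ => ?_
  simp [gα, Real.tanh_neg]

theorem continuousOn_hα (α : ℝ) : ContinuousOn (hα α) (Ioo (-1) 1) := by
  unfold hα
  refine continuousOn_const.mul (ContinuousOn.log (ContinuousOn.div (by fun_prop) (by fun_prop) ?_) ?_)
  · intro s hs; have := hs.2; linarith
  · intro s hs
    exact (div_pos (by linarith [hs.1]) (by linarith [hs.2])).ne'

theorem tendsto_hα {α : ℝ} (h0 : 0 < α) : Tendsto (hα α) (𝓝[<] 1) atTop := by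
  refine tendsto_atTop.2 fun b => ?_
  have h1 : ∀ᶠ s in 𝓝[<] (1 : ℝ), s ∈ Ioo (gα α b) 1 := Ioo_mem_nhdsLT (gα_mem α b).2
  filter_upwards [h1] with s hs
  have hs' : s ∈ Ioo (-1 : ℝ) 1 := ⟨(gα_mem α b).1.trans hs.1, hs.2⟩
  have h2 : gα α b < gα α (hα α s) := by rw [gα_hα h0 hs']; exact hs.1
  exact ((gα_lt_iff h0).1 h2).le

attribute [irreducible] theta

end Time

/-! ### The compactified system as a family of nonautonomous equations -/

section System

variable {n d : ℕ}

/-- The field `ρ • f (x, μ)`, with the input `(ρ, μ)`: the rate enters as a part of the input. -/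
def field (f : E n × E d → E n) : E n × (ℝ × E d) → E n := fun z => z.2.1 • f (z.1, z.2.2)

theorem contDiff_field {f : E n × E d → E n} (hf : ContDiff ℝ 1 f) : ContDiff ℝ 1 (field f) := by
  unfold field
  fun_prop

/-- A nonautonomous system `x' = f (x, Λ τ) / r` with an input that has a future limit, together
with the exponent of a compactification of time. -/
structure Sys (n d : ℕ) where
  f : E n × E d → E n
  contDiff_f : ContDiff ℝ 1 f
  Λ : ℝ → E d
  continuous_Λ : Continuous Λ
  lp : E d
  tendsto_Λ : Tendsto Λ atTop (𝓝 lp)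
  α : ℝ
  α_pos : 0 < α

namespace Sys

variable (P : Sys n d)

/-- The vector field of the system, with the rate as a part of the input. -/
abbrev G : E n × (ℝ × E d) → E n := field P.f

theorem contDiff_G : ContDiff ℝ 1 P.G := contDiff_field P.contDiff_f

/-- The input as a function of the compactified time. -/
abbrev L : ℝ → E d := inputOne P.Λ P.α P.lp

theorem L_one : P.L 1 = P.lp := if_pos rfl

theorem L_gα (τ : ℝ) : P.L (gα P.α τ) = P.Λ τ := by
  rw [L, inputOne, if_neg (gα_mem P.α τ).2.ne, hα_gα P.α_pos]

theorem continuousOn_L : ContinuousOn P.L (Ioc (-1) 1) := by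
  intro s hs
  rcases eq_or_lt_of_le hs.2 with rfl | h1
  · have h2 : Ioc (-1 : ℝ) 1 = insert 1 (Ioo (-1) 1) := by
      rw [Ioo_insert_right (by norm_num)]
    rw [h2, continuousWithinAt_insert_self]
    have h3 : Tendsto (fun s => P.Λ (hα P.α s)) (𝓝[Ioo (-1) 1] 1) (𝓝 P.lp) :=
      (P.tendsto_Λ.comp (tendsto_hα P.α_pos)).mono_left (nhdsWithin_mono _ fun x hx => hx.2)
    rw [ContinuousWithinAt, P.L_one]
    refine h3.congr' ?_
    filter_upwards [self_mem_nhdsWithin] with s hs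
    exact (if_neg hs.2.ne).symm
  · have h2 : ContinuousAt (fun s => P.Λ (hα P.α s)) s :=
      P.continuous_Λ.continuousAt.comp ((continuousOn_hα P.α).continuousAt (Ioo_mem_nhds hs.1 h1))
    refine (h2.congr ?_).continuousWithinAt
    filter_upwards [Iio_mem_nhds h1] with s hs
    exact (if_neg (ne_of_lt hs)).symm

theorem continuous_L_theta :
    Continuous fun z : (ℝ × Ioc (-1 : ℝ) 1) × ℝ => (z.1.1, P.L (theta P.α z.2 z.1.2)) := by
  refine Continuous.prodMk (by fun_prop) ?_
  refine P.continuousOn_L.comp_continuous ?_ (fun z => theta_mem _ _ z.1.2.2)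
  have : Continuous fun z : (ℝ × Ioc (-1 : ℝ) 1) × ℝ => (z.2, (z.1.2 : ℝ)) := by fun_prop
  exact (continuousOn_theta P.α).comp_continuous this
    fun z => ⟨trivial, Ioc_subset_Icc_self z.1.2.2⟩

/-- The signals `t ↦ (ρ, L (θ t s))`, as a continuous family with parameter `(ρ, s)`. -/
def sigFamily : C(ℝ × Ioc (-1 : ℝ) 1, C(ℝ, ℝ × E d)) := ContinuousMap.curry ⟨_, P.continuous_L_theta⟩

open Classical in
/-- The signal read from the compactified time `s` on, for the rate `1 / ρ`. -/
def sig (ρ s : ℝ) : C(ℝ, ℝ × E d) :=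
  if h : s ∈ Ioc (-1 : ℝ) 1 then P.sigFamily (ρ, ⟨s, h⟩) else ContinuousMap.const ℝ (ρ, P.lp)

theorem sig_apply (ρ : ℝ) {s : ℝ} (hs : s ∈ Ioc (-1 : ℝ) 1) (t : ℝ) :
    P.sig ρ s t = (ρ, P.L (theta P.α t s)) := by
  rw [sig, dif_pos hs]
  rfl

theorem sig_one (ρ : ℝ) : P.sig ρ 1 = ContinuousMap.const ℝ (ρ, P.lp) := by
  ext1 t
  rw [P.sig_apply ρ (by norm_num), theta_one, P.L_one]
  rfl

theorem sig_gα (ρ τ t : ℝ) : P.sig ρ (gα P.α τ) t = (ρ, P.Λ (τ + t)) := by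
  rw [P.sig_apply ρ (gα_mem_Ioc _ _), theta_gα, P.L_gα]

theorem shiftSig_sig (ρ t : ℝ) {s : ℝ} (hs : s ∈ Ioc (-1 : ℝ) 1) :
    shiftSig t (P.sig ρ s) = P.sig ρ (theta P.α t s) := by
  ext1 u
  rw [shiftSig_apply, P.sig_apply ρ hs, P.sig_apply ρ (theta_mem _ _ hs),
    theta_add _ _ _ (Ioc_subset_Icc_self hs), add_comm]

theorem tendsto_sig {ι : Type*} {l : Filter ι} {ρ s : ι → ℝ} {ρ₀ s₀ : ℝ}
    (hρ : Tendsto ρ l (𝓝 ρ₀)) (hs : Tendsto s l (𝓝 s₀)) (hmem : ∀ i, s i ∈ Ioc (-1 : ℝ) 1)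
    (hmem₀ : s₀ ∈ Ioc (-1 : ℝ) 1) : Tendsto (fun i => P.sig (ρ i) (s i)) l (𝓝 (P.sig ρ₀ s₀)) := by
  have h1 : Tendsto (fun i => (⟨s i, hmem i⟩ : Ioc (-1 : ℝ) 1)) l (𝓝 ⟨s₀, hmem₀⟩) :=
    tendsto_subtype_rng.2 hs
  have h2 := (P.sigFamily.continuous.tendsto (ρ₀, ⟨s₀, hmem₀⟩)).comp (hρ.prodMk_nhds h1)
  simpa [sig, hmem, hmem₀, Function.comp_def] using h2

theorem tendsto_sig_one {ι : Type*} {l : Filter ι} {ρ s : ι → ℝ} {ρ₀ : ℝ}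
    (hρ : Tendsto ρ l (𝓝 ρ₀)) (hs : Tendsto s l (𝓝 1)) (hmem : ∀ i, s i ∈ Ioc (-1 : ℝ) 1) :
    Tendsto (fun i => P.sig (ρ i) (s i)) l (𝓝 (ContinuousMap.const ℝ (ρ₀, P.lp))) := by
  rw [← P.sig_one]
  exact P.tendsto_sig hρ hs hmem (by norm_num)

theorem tendsto_sig_atTop (ρ : ℝ) {s : ℝ} (hs : s ∈ Ioc (-1 : ℝ) 1) :
    Tendsto (P.sig ρ s) atTop (𝓝 (ρ, P.lp)) := by
  have h1 : Tendsto (fun t => theta P.α t s) atTop (𝓝[Ioc (-1) 1] 1) :=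
    tendsto_nhdsWithin_iff.2 ⟨tendsto_theta_atTop P.α_pos hs,
      Eventually.of_forall fun t => theta_mem _ _ hs⟩
  have h2 : Tendsto P.L (𝓝[Ioc (-1) 1] 1) (𝓝 P.lp) := by
    have := P.continuousOn_L 1 (by norm_num)
    rwa [ContinuousWithinAt, P.L_one] at this
  have h3 := (tendsto_const_nhds (x := ρ)).prodMk_nhds (h2.comp h1)
  exact h3.congr fun t => (P.sig_apply ρ hs t).symm

/-- Properties that hold near `(ρ₀, λ⁺)` hold for the signals at all later times, if the rate is
near `1 / ρ₀` and the compactified time is near `1`. -/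
theorem eventually_sig {ρ₀ : ℝ} {p : ℝ × E d → Prop} (hp : ∀ᶠ ν in 𝓝 (ρ₀, P.lp), p ν) :
    ∃ ε > 0, ∀ ρ s, |ρ - ρ₀| < ε → 1 - ε < s → s ∈ Ioc (-1 : ℝ) 1 → ∀ t ≥ 0, p (P.sig ρ s t) := by
  have h2 : Tendsto (fun z : ℝ × ℝ => (z.1, P.L z.2)) (𝓝 ρ₀ ×ˢ 𝓝[Ioc (-1) 1] 1) (𝓝 (ρ₀, P.lp)) := by
    have := P.continuousOn_L 1 (by norm_num)
    rw [ContinuousWithinAt, P.L_one] at this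
    rw [nhds_prod_eq]
    exact tendsto_id.prodMap this
  obtain ⟨pa, ha, pb, hb, h⟩ := eventually_prod_iff.1 (h2.eventually hp)
  obtain ⟨ε₁, hε₁, h1⟩ := Metric.eventually_nhds_iff.1 ha
  obtain ⟨ε₂, hε₂, h2⟩ := Metric.eventually_nhds_iff.1 (eventually_nhdsWithin_iff.1 hb)
  refine ⟨min ε₁ ε₂, lt_min hε₁ hε₂, fun ρ s hρ hs hmem t ht => ?_⟩
  rw [P.sig_apply ρ hmem]
  refine h (h1 (by rw [Real.dist_eq]; exact hρ.trans_le (min_le_left _ _))) (h2 ?_ (theta_mem _ _ hmem))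
  have h3 := le_theta P.α_pos ht (Ioc_subset_Icc_self hmem)
  have h4 := (theta_mem P.α t hmem).2
  have h5 := min_le_right ε₁ ε₂
  rw [Real.dist_eq]
  exact abs_lt.2 ⟨by linarith, by linarith⟩

end Sys

/-- A compactified phase space of a system: the set of compactified times, which contains
`(-1, 1]` and at most one more point `-1`, and the extension of the input to it. -/
structure Cpt (P : Sys n d) where
  J : Set ℝ
  input : ℝ → E d
  Ioc_subset : Ioc (-1) 1 ⊆ J
  subset_Icc : J ⊆ Icc (-1) 1
  input_eq : ∀ s ∈ Ioc (-1 : ℝ) 1, input s = P.L s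

namespace Cpt

variable {P : Sys n d} (Q : Cpt P)

/-- The phase space. -/
def X : Set (E n × ℝ) := {q | q.2 ∈ Q.J}

/-- The vector field of the compactified system. -/
abbrev F (r : ℝ) : E n × ℝ → E n × ℝ := compactField P.f Q.input P.α r

theorem mem_X {p : E n} {s : ℝ} (hs : s ∈ Ioc (-1 : ℝ) 1) : (p, s) ∈ Q.X := Q.Ioc_subset hs

/-- The time component of a solution of the compactified system is explicit. -/
theorem snd_eq {r : ℝ} {I : Set ℝ} (hI : I.OrdConnected) (h0 : (0 : ℝ) ∈ I) {y : ℝ → E n × ℝ}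
    (hy : IsSolution (Q.F r) Q.X I y) : ∀ t ∈ I, (y t).2 = theta P.α t (y 0).2 := by
  have hG : ContDiff ℝ 1 (fun z : ℝ × ℝ => P.α * (1 - z.1 ^ 2) / 2) := by fun_prop
  have h1 : Sol (fun z : ℝ × ℝ => P.α * (1 - z.1 ^ 2) / 2) (fun _ => 0) I (fun t => (y t).2) := by
    intro t ht
    exact (hasFDerivAt_snd (p := y t)).comp_hasDerivWithinAt t (hy.1 t ht)
  have h2 : Sol (fun z : ℝ × ℝ => P.α * (1 - z.1 ^ 2) / 2) (fun _ => 0) I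
      (fun t => theta P.α t (y 0).2) := by
    intro t ht
    exact (hasDerivAt_theta P.α t (Q.subset_Icc (hy.2 0 h0))).hasDerivWithinAt
  exact Sol.unique hG hI continuousOn_const h1 h2 h0 theta_zero.symm

/-- The state component of a solution of the compactified system solves the equation driven by the
signal that starts at the compactified time `s`. -/
theorem sol_of_isSolution {r : ℝ} {I : Set ℝ} (hI : I.OrdConnected) (h0 : (0 : ℝ) ∈ I)
    {y : ℝ → E n × ℝ} (hy : IsSolution (Q.F r) Q.X I y) {s : ℝ} (hs : s ∈ Ioc (-1 : ℝ) 1)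
    (hy0 : (y 0).2 = s) : Sol P.G (P.sig r⁻¹ s) I (fun t => (y t).1) := by
  intro t ht
  have h := (hasFDerivAt_fst (p := y t)).comp_hasDerivWithinAt t (hy.1 t ht)
  have h2 := Q.snd_eq hI h0 hy t ht
  rw [hy0] at h2
  have h3 : P.G ((y t).1, P.sig r⁻¹ s t) = (Q.F r (y t)).1 := by
    rw [P.sig_apply _ hs]
    simp only [compactField, h2, Q.input_eq _ (theta_mem P.α t hs)]
    rfl
  simp only [h3]
  exact h

theorem isSolution_of_sol {r : ℝ} {I : Set ℝ} {s : ℝ} (hs : s ∈ Ioc (-1 : ℝ) 1) {x : ℝ → E n}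
    (hx : Sol P.G (P.sig r⁻¹ s) I x) :
    IsSolution (Q.F r) Q.X I (fun t => (x t, theta P.α t s)) := by
  refine ⟨fun t ht => ?_, fun t _ => Q.mem_X (theta_mem _ _ hs)⟩
  have h := (hx t ht).prodMk
    (hasDerivAt_theta P.α t (Ioc_subset_Icc_self hs)).hasDerivWithinAt (s := I)
  have h3 : (P.G (x t, P.sig r⁻¹ s t), P.α * (1 - theta P.α t s ^ 2) / 2) =
      Q.F r (x t, theta P.α t s) := by
    rw [P.sig_apply _ hs]
    simp only [compactField, Q.input_eq _ (theta_mem P.α t hs)]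
    rfl
  simp only [h3] at h
  exact h

theorem reaches_iff {r t : ℝ} {p q : E n} {s s' : ℝ} (hs : s ∈ Ioc (-1 : ℝ) 1) :
    Reaches (Q.F r) Q.X t (p, s) (q, s') ↔ 0 ≤ t ∧ s' = theta P.α t s ∧
      ∃ x : ℝ → E n, Sol P.G (P.sig r⁻¹ s) (Icc 0 t) x ∧ x 0 = p ∧ x t = q := by
  constructor
  · rintro ⟨ht, y, hy, hy0, hyt⟩
    have h2 := Q.snd_eq ordConnected_Icc ⟨le_rfl, ht⟩ hy t ⟨ht, le_rfl⟩
    refine ⟨ht, by rw [hyt, hy0] at h2; exact h2, fun t => (y t).1,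
      Q.sol_of_isSolution ordConnected_Icc ⟨le_rfl, ht⟩ hy hs (by rw [hy0]), by simp [hy0],
      by simp [hyt]⟩
  · rintro ⟨ht, rfl, x, hx, rfl, rfl⟩
    exact ⟨ht, _, Q.isSolution_of_sol hs hx, by simp [theta_zero], rfl⟩

end Cpt

end System

/-! ### Robust attraction -/

/-- Every real sequence has a subsequence with a limit in the extended reals. -/
theorem exists_subseq_tendsto (u : ℕ → ℝ) : ∃ φ : ℕ → ℕ, StrictMono φ ∧
    ((∃ a, Tendsto (u ∘ φ) atTop (𝓝 a)) ∨ Tendsto (u ∘ φ) atTop atTop ∨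
      Tendsto (u ∘ φ) atTop atBot) := by
  obtain ⟨e, φ, hφ, h⟩ := CompactSpace.tendsto_subseq (fun k => (u k : EReal))
  refine ⟨φ, hφ, ?_⟩
  induction e with
  | bot => exact Or.inr (Or.inr (EReal.tendsto_coe_nhds_bot_iff.1 h))
  | coe a => exact Or.inl ⟨a, EReal.tendsto_coe.1 h⟩
  | top => exact Or.inr (Or.inl (EReal.tendsto_coe_nhds_top_iff.1 h))

section Traps

variable {E W : Type*} [NormedAddCommGroup E] [NormedSpace ℝ E] [FiniteDimensional ℝ E]
  [NormedAddCommGroup W] [NormedSpace ℝ W] [FiniteDimensional ℝ W]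

theorem tendsto_const_of_dist_le {ν : ℕ → C(ℝ, W)} {ν₀ : W}
    (h : ∀ k : ℕ, ∀ t, ‖ν k t - ν₀‖ ≤ 1 / ((k : ℝ) + 1)) :
    Tendsto ν atTop (𝓝 (ContinuousMap.const ℝ ν₀)) := by
  rw [ContinuousMap.tendsto_iff_forall_isCompact_tendstoUniformlyOn]
  intro K _
  rw [Metric.tendstoUniformlyOn_iff]
  intro ε hε
  filter_upwards [tendsto_one_div_add_atTop_nhds_zero_nat.eventually_lt_const hε] with k hk t _
  rw [dist_comm, dist_eq_norm]
  exact (h k t).trans_lt hk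

theorem exists_first_exit {O : Set E} (hO : IsOpen O) {x : ℝ → E} {T : ℝ} (hT : 0 ≤ T)
    (hx : ContinuousOn x (Icc 0 T)) (h0 : x 0 ∈ O) (hxT : x T ∉ O) :
    ∃ t ∈ Icc 0 T, x t ∉ O ∧ ∀ s ∈ Icc 0 t, x s ∈ closure O := by
  have hc : IsCompact (Icc 0 T ∩ x ⁻¹' Oᶜ) := isCompact_Icc.of_isClosed_subset
    (hx.preimage_isClosed_of_isClosed isClosed_Icc hO.isClosed_compl) inter_subset_left
  obtain ⟨t, ⟨ht, htO⟩, hmin⟩ := hc.exists_isLeast ⟨T, ⟨hT, le_rfl⟩, hxT⟩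
  have hlt : ∀ s ∈ Ico 0 t, x s ∈ O := by
    intro s hs
    by_contra hcon
    exact not_le.2 hs.2 (hmin ⟨⟨hs.1, hs.2.le.trans ht.2⟩, hcon⟩)
  have ht0 : 0 < t := by
    rcases eq_or_lt_of_le ht.1 with h | h
    · rw [← h] at htO; exact absurd h0 htO
    · exact h
  refine ⟨t, ht, htO, fun s hs => ?_⟩
  rcases eq_or_lt_of_le hs.2 with rfl | h
  · have h1 : ContinuousWithinAt x (Ico 0 s) s :=
      (hx s ht).mono fun u hu => ⟨hu.1, hu.2.le.trans ht.2⟩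
    refine h1.mem_closure ?_ hlt
    rw [closure_Ico ht0.ne]
    exact ⟨ht0.le, le_rfl⟩
  · exact subset_closure (hlt s ⟨hs.1, h⟩)

/-- `A` is compact and forward invariant for the equation with the constant input `ν₀`, and each
backward solution that stays in the neighbourhood `U` of `A` lies in `A`. This is what makes an
attractor persist under perturbations of the equation. -/
structure Traps (G : E × W → E) (ν₀ : W) (A U : Set E) : Prop where
  compact : IsCompact A
  nhd : A ⊆ interior U
  forward : ∀ p ∈ A, ∃ y : ℝ → E, Sol G (fun _ => ν₀) (Ici 0) y ∧ y 0 = p ∧ ∀ t ≥ 0, y t ∈ A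
  backward : ∀ z : ℝ → E, Sol G (fun _ => ν₀) (Iic 0) z → (∀ t ≤ 0, z t ∈ U) → z 0 ∈ A

/-- Solutions that have spent long times in `U`, for inputs close to `ν₀`, accumulate at `A`. -/
theorem Traps.mem_of_tendsto {G : E × W → E} (hG : ContDiff ℝ 1 G) {ν₀ : W} {A U : Set E}
    (h : Traps G ν₀ A U) {C : Set E} (hC : IsCompact C) (hCU : C ⊆ U) {ν : ℕ → C(ℝ, W)}
    {T : ℕ → ℝ} (hT : Tendsto T atTop atTop) (hT0 : ∀ k, 0 ≤ T k)
    (hν : Tendsto (fun k => shiftSig (T k) (ν k)) atTop (𝓝 (ContinuousMap.const ℝ ν₀))) {R : ℝ}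
    (hνR : ∀ k, ∀ t ∈ Icc 0 (T k), ‖ν k t‖ ≤ R) {x : ℕ → ℝ → E}
    (hx : ∀ k, Sol G (ν k) (Icc 0 (T k)) (x k)) (hxC : ∀ k, ∀ t ∈ Icc 0 (T k), x k t ∈ C) {q : E}
    (hq : Tendsto (fun k => x k (T k)) atTop (𝓝 q)) : q ∈ A := by
  obtain ⟨R', hR'⟩ := hC.isBounded.exists_norm_le
  have hmap : ∀ k, ∀ t ∈ Icc (-T k) 0, t + T k ∈ Icc 0 (T k) := fun k t ht =>
    ⟨by linarith [ht.1], by linarith [ht.2]⟩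
  have hmem : ∀ t ≤ 0, ∀ᶠ k in atTop, t ∈ Icc (-T k) 0 := by
    intro t ht
    filter_upwards [hT.eventually_ge_atTop (-t)] with k hk
    exact ⟨by linarith, ht⟩
  obtain ⟨y, hy0, -, hlim, hsol⟩ := exists_limit_solution hG hν (I := fun k => Icc (-T k) 0)
    (fun k => ordConnected_Icc) (fun k => ⟨by linarith [hT0 k], le_rfl⟩)
    (x := fun k t => x k (t + T k)) (fun k => (hx k).shift (T k) (hmap k)) (R := max R R')
    (fun k t ht => (hR' _ (hxC k _ (hmap k t ht))).trans (le_max_right _ _))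
    (fun k t ht => (hνR k _ (hmap k t ht)).trans (le_max_left _ _)) (q := q) (by simpa using hq)
  rw [← hy0]
  refine h.backward y (hsol (Iic 0) fun t ht => ⟨fun _ => t, tendsto_const_nhds, hmem t ht⟩) ?_
  intro t ht
  refine hCU (hC.isClosed.mem_of_tendsto (hlim (fun _ => t) t tendsto_const_nhds (hmem t ht)) ?_)
  filter_upwards [hmem t ht] with k hk
  exact hxC k _ (hmap k t hk)

/-- Solutions that start close to `A` stay close to `A`, for all inputs close to `ν₀`. -/
theorem Traps.exists_nhd {G : E × W → E} (hG : ContDiff ℝ 1 G) {ν₀ : W} {A U : Set E}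
    (h : Traps G ν₀ A U) {O : Set E} (hO : IsOpen O) (hAO : A ⊆ O) :
    ∃ O' : Set E, IsOpen O' ∧ A ⊆ O' ∧ O' ⊆ O ∧ ∃ ε > 0, ∀ ν : C(ℝ, W),
      (∀ t ≥ 0, ‖ν t - ν₀‖ ≤ ε) → ∀ T ≥ 0, ∀ x : ℝ → E, Sol G ν (Icc 0 T) x → x 0 ∈ O' →
        x T ∈ O := by
  obtain ⟨O₁, hO₁, hAO₁, hO₁U, hO₁c⟩ := exists_open_between_and_isCompact_closure h.compact
    (hO.inter isOpen_interior) (subset_inter hAO h.nhd)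
  have hO₁U' : closure O₁ ⊆ U := hO₁U.trans (inter_subset_right.trans interior_subset)
  by_contra hcon
  have key : ∀ k : ℕ, ∃ ν : C(ℝ, W), (∀ t, ‖ν t - ν₀‖ ≤ 1 / ((k : ℝ) + 1)) ∧ ∃ T ≥ 0, ∃ x : ℝ → E,
      ∃ a ∈ A, dist (x 0) a < 1 / ((k : ℝ) + 1) ∧ Sol G ν (Icc 0 T) x ∧ x T ∉ O₁ ∧
      ∀ s ∈ Icc 0 T, x s ∈ closure O₁ := by
    intro k
    have hk : (0 : ℝ) < 1 / ((k : ℝ) + 1) := Nat.one_div_pos_of_nat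
    by_contra hno
    refine hcon ⟨Metric.thickening (1 / ((k : ℝ) + 1)) A ∩ O₁, Metric.isOpen_thickening.inter hO₁,
      subset_inter (Metric.self_subset_thickening hk A) hAO₁, ?_, _, hk, ?_⟩
    · exact fun x hx => (hO₁U (subset_closure hx.2)).1
    · intro ν hν T hT x hx hx0
      by_contra hxT
      have hxT' : x T ∉ O₁ := fun hm => hxT (hO₁U (subset_closure hm)).1
      obtain ⟨t, ht, htO, hs⟩ := exists_first_exit hO₁ hT hx.continuousOn hx0.2 hxT'
      obtain ⟨a, ha, hda⟩ := Metric.mem_thickening_iff.1 hx0.1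
      refine hno ⟨ν.comp ⟨fun t => max t 0, by fun_prop⟩, fun t => hν _ (le_max_right _ _), t, ht.1, x,
        a, ha, hda, ?_, htO, hs⟩
      refine (hx.mono (Icc_subset_Icc_right ht.2)).congr_signal fun s hs => ?_
      simp [max_eq_left hs.1]
  choose ν hν T hT x a haA hda hx hxT hxO using key
  obtain ⟨⟨p, q⟩, ⟨hpA, -⟩, ψ, hψ, hψlim⟩ := (h.compact.prod hO₁c).tendsto_subseq
    (x := fun k => (a k, x k (T k))) (fun k => ⟨haA k, hxO k _ ⟨hT k, le_rfl⟩⟩)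
  obtain ⟨φ, hφ, hT'⟩ := exists_subseq_tendsto (T ∘ ψ)
  have hχ : Tendsto (fun k => ψ (φ k)) atTop atTop := hψ.tendsto_atTop.comp hφ.tendsto_atTop
  have hlim := hψlim.comp hφ.tendsto_atTop
  have hp : Tendsto (fun k => a (ψ (φ k))) atTop (𝓝 p) :=
    (continuous_fst.tendsto (p, q)).comp hlim
  have hq : Tendsto (fun k => x (ψ (φ k)) (T (ψ (φ k)))) atTop (𝓝 q) :=
    (continuous_snd.tendsto (p, q)).comp hlim
  have hx0 : Tendsto (fun k => x (ψ (φ k)) 0) atTop (𝓝 p) := by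
    refine (tendsto_iff_of_dist ?_).2 hp
    refine squeeze_zero (fun _ => dist_nonneg) (fun k => (hda (ψ (φ k))).le) ?_
    exact tendsto_one_div_add_atTop_nhds_zero_nat.comp hχ
  have hqO : q ∉ O₁ := hO₁.isClosed_compl.mem_of_tendsto hq (Eventually.of_forall fun k => hxT _)
  obtain ⟨R, hR⟩ := hO₁c.isBounded.exists_norm_le
  have hνR : ∀ k t, ‖ν k t‖ ≤ ‖ν₀‖ + 1 := by
    intro k t
    have h1 := hν k t
    have h2 := norm_sub_norm_le (ν k t) ν₀
    have h3 : 1 / ((k : ℝ) + 1) ≤ 1 := by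
      rw [div_le_one (by positivity)]; linarith [(Nat.cast_nonneg k : (0 : ℝ) ≤ k)]
    linarith
  rcases hT' with ⟨t, ht⟩ | ht | ht
  · -- exit after a bounded time: the limit solution starts in `A` and leaves `A`
    have ht0 : 0 ≤ t := ge_of_tendsto' ht fun k => hT _
    obtain ⟨y, hy0, -, hylim, hysol⟩ := exists_limit_solution hG
      ((tendsto_const_of_dist_le hν).comp hχ) (I := fun k => Icc 0 (T (ψ (φ k))))
      (fun k => ordConnected_Icc) (fun k => ⟨le_rfl, hT _⟩) (fun k => hx _) (R := max R (‖ν₀‖ + 1))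
      (fun k s hs => (hR _ (hxO _ s hs)).trans (le_max_left _ _))
      (fun k s hs => (hνR _ s).trans (le_max_right _ _)) hx0
    have hyq : y t = q := tendsto_nhds_unique
      (hylim _ t ht (Eventually.of_forall fun k => ⟨hT _, le_rfl⟩)) hq
    have hys : Sol G (ContinuousMap.const ℝ ν₀) (Icc 0 t) y := by
      refine hysol (Icc 0 t) fun s hs => ⟨fun k => min s (T (ψ (φ k))), ?_,
        Eventually.of_forall fun k => ⟨le_min hs.1 (hT _), min_le_right _ _⟩⟩
      have := (tendsto_const_nhds (x := s)).min ht
      rwa [min_eq_left hs.2] at this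
    obtain ⟨z, hz, hz0, hzA⟩ := h.forward p hpA
    have := Sol.unique hG ordConnected_Icc continuousOn_const hys (hz.mono Icc_subset_Ici_self)
      (t₀ := 0) ⟨le_rfl, ht0⟩ (hy0.trans hz0.symm) t ⟨ht0, le_rfl⟩
    exact hqO (by rw [← hyq, this]; exact hAO₁ (hzA t ht0))
  · -- exit after long times: the limit of the recentred solutions is a backward solution
    refine hqO (hAO₁ (h.mem_of_tendsto hG hO₁c hO₁U' (T := fun k => T (ψ (φ k))) ht (fun k => hT _)
      (ν := fun k => ν (ψ (φ k))) ?_ (fun k t _ => hνR _ t) (fun k => hx _) (fun k => hxO _) hq))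
    have := tendsto_const_of_dist_le (ν := fun k => shiftSig (T k) (ν k)) (ν₀ := ν₀)
      (fun k t => hν k _)
    exact this.comp hχ
  · obtain ⟨k, hk⟩ := (ht.eventually_lt_atBot 0).exists
    exact absurd (hT (ψ (φ k))) (not_le.2 hk)

end Traps

/-! ### Attractors of the compactified system and of the future limit system -/

section TimeScale

variable {V : Type*} [NormedAddCommGroup V] [NormedSpace ℝ V]

theorem IsSolution.comp_mul {F : V → V} {X : Set V} {I J : Set ℝ} {y : ℝ → V}
    (h : IsSolution F X I y) (c : ℝ) (hJ : ∀ t ∈ J, c * t ∈ I) :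
    IsSolution (fun x => c • F x) X J (fun t => y (c * t)) := by
  refine ⟨fun t ht => ?_, fun t ht => h.2 _ (hJ t ht)⟩
  have h1 : HasDerivWithinAt (fun t : ℝ => c * t) c J t := by
    simpa using ((hasDerivAt_id t).const_mul c).hasDerivWithinAt
  simpa [Function.comp_def] using (h.1 (c * t) (hJ t ht)).scomp t h1 hJ

theorem Reaches.smul {F : V → V} {X : Set V} {c t : ℝ} (hc : 0 < c) {p q : V}
    (h : Reaches F X t p q) : Reaches (fun x => c • F x) X (t / c) p q := by
  obtain ⟨ht, y, hy, hy0, hyt⟩ := h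
  refine ⟨by positivity, fun s => y (c * s), hy.comp_mul c fun s hs => ⟨?_, ?_⟩, by simpa using hy0, ?_⟩
  · exact mul_nonneg hc.le hs.1
  · have := (le_div_iff₀ hc).1 hs.2
    linarith
  · simp only [mul_div_cancel₀ t hc.ne']
    exact hyt

theorem omegaLimitSet_subset_smul {F : V → V} {X D : Set V} {c : ℝ} (hc : 0 < c) :
    omegaLimitSet F X D ⊆ omegaLimitSet (fun x => c • F x) X D := by
  rintro q ⟨hq, h⟩
  refine ⟨hq, fun T hT => closure_mono ?_ (h (T * c) (by positivity))⟩
  rintro z ⟨τ, hτ, p, hp, hr⟩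
  exact ⟨τ / c, (lt_div_iff₀ hc).2 hτ, p, hp, hr.smul hc⟩

theorem smul_smul_field {F : V → V} {c : ℝ} (hc : 0 < c) :
    (fun x => c⁻¹ • (fun x => c • F x) x) = F := by
  funext x
  simp [smul_smul, inv_mul_cancel₀ hc.ne']

theorem omegaLimitSet_smul {F : V → V} {X D : Set V} {c : ℝ} (hc : 0 < c) :
    omegaLimitSet (fun x => c • F x) X D = omegaLimitSet F X D := by
  refine Subset.antisymm ?_ (omegaLimitSet_subset_smul hc)
  have := omegaLimitSet_subset_smul (F := fun x => c • F x) (X := X) (D := D) (inv_pos.2 hc)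
  rwa [smul_smul_field hc] at this

theorem isOmegaLimitOfNhd_smul {F : V → V} {X A : Set V} {c : ℝ} (hc : 0 < c) :
    IsOmegaLimitOfNhd (fun x => c • F x) X A ↔ IsOmegaLimitOfNhd F X A := by
  simp only [IsOmegaLimitOfNhd, omegaLimitSet_smul hc]

theorem IsAttractor.smul {F : V → V} {X A : Set V} {c : ℝ} (hc : 0 < c) (h : IsAttractor F X A) :
    IsAttractor (fun x => c • F x) X A where
  subset := h.subset
  compact := h.compact
  invariant p hp := by
    obtain ⟨y, hy, hy0, hyA⟩ := h.invariant p hp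
    exact ⟨_, hy.comp_mul c fun _ _ => mem_univ _, by simpa using hy0, fun t => hyA _⟩
  omega := (isOmegaLimitOfNhd_smul hc).2 h.omega
  minimal A' hA' h' := h.minimal A' hA' ((isOmegaLimitOfNhd_smul hc).1 h')

end TimeScale

namespace Sys

variable {n d : ℕ} (P : Sys n d)

/-- The future limit system, for the rate `1 / ρ`. -/
abbrev H (ρ : ℝ) : E n → E n := fun x => ρ • P.f (x, P.lp)

theorem isSolution_H_iff {ρ : ℝ} {I : Set ℝ} {x : ℝ → E n} :
    IsSolution (P.H ρ) univ I x ↔ Sol P.G (fun _ => (ρ, P.lp)) I x :=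
  ⟨fun h => h.1, fun h => ⟨h, fun _ _ => mem_univ _⟩⟩

theorem reaches_H_iff {ρ t : ℝ} {p q : E n} : Reaches (P.H ρ) univ t p q ↔ 0 ≤ t ∧
    ∃ x : ℝ → E n, Sol P.G (fun _ => (ρ, P.lp)) (Icc 0 t) x ∧ x 0 = p ∧ x t = q := by
  simp only [Reaches, isSolution_H_iff]

/-- The state `q`, with compactified time `s'`, is reached at the time `T` from `U`. -/
def Reach (ρ : ℝ) (U : Set (E n × ℝ)) (T : ℝ) (q : E n) (s' : ℝ) : Prop :=
  0 ≤ T ∧ ∃ p s, s ∈ Ioc (-1 : ℝ) 1 ∧ (p, s) ∈ U ∧ s' = theta P.α T s ∧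
    ∃ x : ℝ → E n, Sol P.G (P.sig ρ s) (Icc 0 T) x ∧ x 0 = p ∧ x T = q

variable {P}

theorem Reach.mono {ρ : ℝ} {U U' : Set (E n × ℝ)} (hU : U ⊆ U') {T : ℝ} {q : E n} {s' : ℝ}
    (h : P.Reach ρ U T q s') : P.Reach ρ U' T q s' := by
  obtain ⟨hT, p, s, hs, hp, h⟩ := h
  exact ⟨hT, p, s, hs, hU hp, h⟩

theorem Reach.mem_Ioc {ρ : ℝ} {U : Set (E n × ℝ)} {T : ℝ} {q : E n} {s' : ℝ}
    (h : P.Reach ρ U T q s') : s' ∈ Ioc (-1 : ℝ) 1 := by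
  obtain ⟨-, p, s, hs, -, rfl, -⟩ := h
  exact theta_mem _ _ hs

theorem Reach.extend {ρ : ℝ} {U : Set (E n × ℝ)} {T : ℝ} {q : E n} {s' : ℝ}
    (h : P.Reach ρ U T q s') {t : ℝ} (ht : 0 ≤ T + t) {y : ℝ → E n}
    (hy : Sol P.G (P.sig ρ s') (uIcc 0 t) y) (hy0 : y 0 = q) :
    P.Reach ρ U (T + t) (y t) (theta P.α t s') := by
  obtain ⟨hT, p, s, hs, hp, rfl, x, hx, hx0, hxT⟩ := h
  refine ⟨ht, p, s, hs, hp, theta_add _ _ _ (Ioc_subset_Icc_self hs), ?_⟩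
  rw [← P.shiftSig_sig ρ T hs] at hy
  rcases le_total 0 t with h0 | h0
  · rw [uIcc_of_le h0] at hy
    have h1 : Sol P.G (P.sig ρ s) (Icc 0 (T + t) ∩ Ici T) (fun u => y (u - T)) := by
      have := hy.shift (-T) (J := Icc 0 (T + t) ∩ Ici T)
        (fun u hu => ⟨by linarith [hu.2.out], by linarith [hu.1.2]⟩)
      simpa [sub_eq_add_neg] using this
    have h2 : Sol P.G (P.sig ρ s) (Icc 0 (T + t) ∩ Iic T) x := hx.mono fun u hu => ⟨hu.1.1, hu.2⟩
    refine ⟨_, h2.glue h1 (by simp [hxT, hy0]), by simp [hT, hx0], ?_⟩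
    rcases eq_or_lt_of_le h0 with rfl | h0
    · simp [hxT, hy0]
    · simp [h0]
  · rw [uIcc_of_ge h0] at hy
    have h1 : Sol P.G (shiftSig T (P.sig ρ s)) (Icc t 0) (fun u => x (u + T)) :=
      hx.shift T fun u hu => ⟨by linarith [hu.1], by linarith [hu.2]⟩
    have h2 := Sol.unique P.contDiff_G ordConnected_Icc
      (shiftSig T (P.sig ρ s)).continuous.continuousOn h1 hy (t₀ := 0) ⟨h0, le_rfl⟩
      (by simp [hxT, hy0]) t ⟨le_rfl, h0⟩
    exact ⟨x, hx.mono (Icc_subset_Icc_right (by linarith)), hx0, by rw [← h2, add_comm]⟩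

variable (P)

/-- The states `q` for which `(q, 1)` is an `ω`-limit point of `U`, in terms of sequences. -/
def omega (ρ : ℝ) (U : Set (E n × ℝ)) : Set (E n) :=
  {q | ∃ (T : ℕ → ℝ) (q' : ℕ → E n) (s' : ℕ → ℝ), Tendsto T atTop atTop ∧
    Tendsto q' atTop (𝓝 q) ∧ Tendsto s' atTop (𝓝 1) ∧ ∀ k, P.Reach ρ U (T k) (q' k) (s' k)}

theorem omega_mono {ρ : ℝ} {U U' : Set (E n × ℝ)} (h : U ⊆ U') : P.omega ρ U ⊆ P.omega ρ U' := by
  rintro q ⟨T, q', s', hT, hq, hs, hr⟩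
  exact ⟨T, q', s', hT, hq, hs, fun k => (hr k).mono h⟩

theorem mem_omega_of_eventually {ρ : ℝ} {U : Set (E n × ℝ)} {q : E n} {T : ℕ → ℝ} {q' : ℕ → E n}
    {s' : ℕ → ℝ} (hT : Tendsto T atTop atTop) (hq : Tendsto q' atTop (𝓝 q))
    (hs : Tendsto s' atTop (𝓝 1)) (h : ∀ᶠ k in atTop, P.Reach ρ U (T k) (q' k) (s' k)) :
    q ∈ P.omega ρ U := by
  obtain ⟨N, hN⟩ := eventually_atTop.1 h
  have := tendsto_add_atTop_nat N
  exact ⟨fun k => T (k + N), fun k => q' (k + N), fun k => s' (k + N), hT.comp this, hq.comp this,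
    hs.comp this, fun k => hN _ (Nat.le_add_left _ _)⟩

/-- Points on full solutions in `U` of the limit system are `ω`-limit points. -/
theorem mem_omega_of_backward {ρ : ℝ} {U : Set (E n)} {z : ℝ → E n}
    (hz : Sol P.G (fun _ => (ρ, P.lp)) (Iic 0) z) (hzU : ∀ t ≤ 0, z t ∈ U) :
    z 0 ∈ P.omega ρ (U ×ˢ {1}) := by
  refine ⟨fun k => (k : ℝ), fun _ => z 0, fun _ => 1, tendsto_natCast_atTop_atTop,
    tendsto_const_nhds, tendsto_const_nhds, fun k => ⟨Nat.cast_nonneg k, z (-k), 1, by norm_num,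
    ⟨hzU _ (by simp), rfl⟩, (theta_one _ _).symm, fun t => z (t + -k), ?_, by simp, by simp⟩⟩
  rw [P.sig_one]
  exact hz.shift (-k) fun t ht => by have := ht.2; simp only [mem_Iic]; linarith

/-- A compact `ω`-limit set in the slice at infinite time is invariant for the limit system. -/
theorem omega_invariant {ρ : ℝ} {U : Set (E n × ℝ)} (hc : IsCompact (P.omega ρ U)) :
    ∀ p ∈ P.omega ρ U, ∃ y : ℝ → E n, Sol P.G (fun _ => (ρ, P.lp)) univ y ∧ y 0 = p ∧
      ∀ t, y t ∈ P.omega ρ U := by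
  intro p hp
  obtain ⟨R₀, hR₀⟩ := hc.isBounded.exists_norm_le
  set R := max (R₀ + 1) ‖(ρ, P.lp)‖ with hR
  obtain ⟨g, hg⟩ := exists_isCutoff P.contDiff_G R
  set y := flow g (ContinuousMap.const ℝ (ρ, P.lp)) p with hy
  have hy0 : y 0 = p := (hg.flow_spec _ p).1
  have hyc : Continuous y := hg.continuous_flow _ p
  have hsol : ∀ I : Set ℝ, (∀ t ∈ I, ‖y t‖ ≤ R) → Sol P.G (fun _ => (ρ, P.lp)) I y := fun I hI =>
    hg.sol_flow (ν := ContinuousMap.const ℝ (ρ, P.lp)) hI fun _ _ => le_max_right _ _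
  -- as long as the solution stays bounded it consists of limit points
  have h1 : ∀ t, (∀ s ∈ uIcc 0 t, ‖y s‖ ≤ R) → y t ∈ P.omega ρ U := by
    intro t ht
    obtain ⟨T, q', s', hT, hq, hs, hr⟩ := hp
    rw [← hy0] at hq
    obtain ⟨x, hx0, hxs, hxl⟩ := exists_nearby_solution P.contDiff_G
      (P.tendsto_sig_one (tendsto_const_nhds (x := ρ)) hs fun k => (hr k).mem_Ioc)
      (S := min 0 t) (T := max 0 t) ⟨min_le_left _ _, le_max_left _ _⟩ (hsol _ ht) hq
    have hs' : Tendsto (fun k => theta P.α t (s' k)) atTop (𝓝 1) := by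
      have h2 : Tendsto (fun k => (t, s' k)) atTop (𝓝[univ ×ˢ Icc (-1) 1] (t, 1)) :=
        tendsto_nhdsWithin_iff.2 ⟨tendsto_const_nhds.prodMk_nhds hs,
          Eventually.of_forall fun k => ⟨trivial, Ioc_subset_Icc_self (hr k).mem_Ioc⟩⟩
      have h3 := (continuousOn_theta P.α (t, 1) ⟨trivial, by norm_num⟩).tendsto.comp h2
      simpa [theta_one, Function.comp_def] using h3
    refine P.mem_omega_of_eventually (T := fun k => T k + t) (q' := fun k => x k t)
      (tendsto_atTop_add_const_right _ _ hT)
      (hxl (fun _ => t) t ⟨min_le_right _ _, le_max_right _ _⟩ tendsto_const_nhds) hs' ?_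
    filter_upwards [hxs, hT.eventually_ge_atTop (-t)] with k hk hk'
    exact (hr k).extend (by linarith) hk (hx0 k)
  -- limit points satisfy a better bound, so that the solution stays bounded
  have h2 : ∀ t, ‖y t‖ ≤ R₀ := by
    intro t
    by_contra hcon
    push Not at hcon
    have hp0 : ‖y 0‖ ≤ R₀ := by rw [hy0]; exact hR₀ p hp
    set v := min ‖y t‖ (R₀ + 1)
    have hv : R₀ < v := lt_min hcon (by linarith)
    have hf : ContinuousOn (fun u : ℝ => ‖y (u * t)‖) (Icc 0 1) := by fun_prop
    have hcl : IsCompact (Icc (0 : ℝ) 1 ∩ (fun u : ℝ => ‖y (u * t)‖) ⁻¹' Ici v) :=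
      isCompact_Icc.of_isClosed_subset (hf.preimage_isClosed_of_isClosed isClosed_Icc isClosed_Ici)
        inter_subset_left
    obtain ⟨u, ⟨hu, huv⟩, hmin⟩ := hcl.exists_isLeast ⟨1, ⟨zero_le_one, le_rfl⟩,
      by rw [mem_preimage, one_mul]; exact min_le_left ‖y t‖ (R₀ + 1)⟩
    have huv' : v ≤ ‖y (u * t)‖ := huv
    have hlt : ∀ u' ∈ Ico 0 u, ‖y (u' * t)‖ ≤ v := by
      intro u' hu'
      by_contra hc'
      push Not at hc'
      exact not_le.2 hu'.2 (hmin ⟨⟨hu'.1, hu'.2.le.trans hu.2⟩, hc'.le⟩)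
    have hu0 : 0 < u := by
      rcases eq_or_lt_of_le hu.1 with h | h
      · rw [← h, zero_mul] at huv'; linarith
      · exact h
    have hle : ‖y (u * t)‖ ≤ v := by
      have hcw : ContinuousWithinAt (fun u : ℝ => ‖y (u * t)‖) (Ico 0 u) u :=
        (hf u hu).mono fun u' hu' => ⟨hu'.1, hu'.2.le.trans hu.2⟩
      have := hcw.mem_closure (t := Iic v) (by rw [closure_Ico hu0.ne]; exact ⟨hu0.le, le_rfl⟩) hlt
      rwa [isClosed_Iic.closure_eq] at this
    have hmem := h1 (u * t) fun s hs => by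
      have hs' : ∃ u' ∈ Icc 0 u, s = u' * t := by
        have : s ∈ (fun u' => u' * t) '' uIcc 0 u := by
          rw [image_mul_const_uIcc, zero_mul]; exact hs
        obtain ⟨u', hu', rfl⟩ := this
        rw [uIcc_of_le hu0.le] at hu'
        exact ⟨u', hu', rfl⟩
      obtain ⟨u', hu', rfl⟩ := hs'
      refine le_trans ?_ ((min_le_right _ _).trans (le_max_left _ _) : v ≤ R)
      rcases eq_or_lt_of_le hu'.2 with h | h
      · rw [h]; exact hle
      · exact hlt u' ⟨hu'.1, h⟩
    exact absurd (hR₀ _ hmem) (not_le.2 (hv.trans_le huv'))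
  have h3 : ∀ t, ‖y t‖ ≤ R := fun t => (h2 t).trans (le_trans (by linarith) (le_max_left _ _))
  exact ⟨y, hsol univ fun t _ => h3 t, hy0, fun t => h1 t fun s _ => h3 s⟩

/-- For the limit system, the `ω`-limit set is that of the slice at infinite time. -/
theorem omegaLimitSet_H (ρ : ℝ) (U : Set (E n)) :
    omegaLimitSet (P.H ρ) univ U = P.omega ρ (U ×ˢ {1}) := by
  have hr : ∀ T q, (∃ p ∈ U, Reaches (P.H ρ) univ T p q) ↔ P.Reach ρ (U ×ˢ {1}) T q 1 := by
    intro T q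
    constructor
    · rintro ⟨p, hp, h⟩
      obtain ⟨hT, x, hx, hx0, hxT⟩ := P.reaches_H_iff.1 h
      refine ⟨hT, p, 1, by norm_num, ⟨hp, rfl⟩, (theta_one _ _).symm, x, ?_, hx0, hxT⟩
      rw [P.sig_one]; exact hx
    · rintro ⟨hT, p, s, -, ⟨hp, hs⟩, -, x, hx, hx0, hxT⟩
      obtain rfl : s = 1 := hs
      rw [P.sig_one] at hx
      exact ⟨p, hp, P.reaches_H_iff.2 ⟨hT, x, hx, hx0, hxT⟩⟩
  ext q
  constructor
  · rintro ⟨-, h⟩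
    have key : ∀ k : ℕ, ∃ z, ∃ τ > (k : ℝ) + 1, P.Reach ρ (U ×ˢ {1}) τ z 1 ∧
        dist z q < 1 / ((k : ℝ) + 1) := by
      intro k
      obtain ⟨z, ⟨τ, hτ, hz⟩, hd⟩ := Metric.mem_closure_iff.1 (h ((k : ℝ) + 1) (by positivity))
        (1 / ((k : ℝ) + 1)) (by positivity)
      exact ⟨z, τ, hτ, (hr τ z).1 hz, by rwa [dist_comm]⟩
    choose z τ hτ hz hd using key
    refine ⟨τ, z, fun _ => 1, ?_, ?_, tendsto_const_nhds, hz⟩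
    · exact tendsto_atTop_mono (fun k => (by linarith [hτ k] : (k : ℝ) ≤ τ k))
        tendsto_natCast_atTop_atTop
    · exact tendsto_iff_dist_tendsto_zero.2 (squeeze_zero (fun _ => dist_nonneg)
        (fun k => (hd k).le) tendsto_one_div_add_atTop_nhds_zero_nat)
  · rintro ⟨T, q', s', hT, hq, -, hR⟩
    refine ⟨mem_univ _, fun T₀ _ => mem_closure_of_tendsto hq ?_⟩
    filter_upwards [hT.eventually_gt_atTop T₀] with k hk
    refine ⟨T k, hk, (hr _ _).2 ?_⟩
    obtain ⟨hT, p, s, hs, ⟨hp, hs1⟩, -, x, hx⟩ := hR k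
    obtain rfl : s = 1 := hs1
    exact ⟨hT, p, 1, hs, ⟨hp, rfl⟩, (theta_one _ _).symm, x, hx⟩

end Sys

namespace Cpt

variable {n d : ℕ} {P : Sys n d} (Q : Cpt P)

theorem mem_omegaLimitSet_iff {r : ℝ} {U : Set (E n × ℝ)} {q : E n} :
    (q, (1 : ℝ)) ∈ omegaLimitSet (Q.F r) Q.X U ↔ q ∈ P.omega r⁻¹ U := by
  constructor
  · rintro ⟨-, h⟩
    have key : ∀ k : ℕ, ∃ z s', ∃ τ > (k : ℝ) + 1, P.Reach r⁻¹ U τ z s' ∧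
        dist (z, s') (q, (1 : ℝ)) < 1 / ((k : ℝ) + 1) := by
      intro k
      obtain ⟨⟨z, s'⟩, ⟨τ, hτ, ⟨p, s⟩, hp, hr⟩, hd⟩ := Metric.mem_closure_iff.1
        (h ((k : ℝ) + 1) (by positivity)) (1 / ((k : ℝ) + 1)) (by positivity)
      rw [dist_comm] at hd
      have hs : s ∈ Ioc (-1 : ℝ) 1 := by
        obtain ⟨hτ0, y, hy, hy0, hyt⟩ := hr
        have hsJ : s ∈ Icc (-1 : ℝ) 1 := by
          have := Q.subset_Icc (hy.2 0 ⟨le_rfl, hτ0⟩)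
          rwa [hy0] at this
        rcases eq_or_lt_of_le hsJ.1 with h1 | h1
        · -- the boundary point `s = -1` is invariant, hence far from `s = 1`
          exfalso
          have h2 := Q.snd_eq ordConnected_Icc ⟨le_rfl, hτ0⟩ hy τ ⟨hτ0, le_rfl⟩
          rw [hyt, hy0] at h2
          simp only at h2
          rw [← h1, theta_neg_one] at h2
          have h3 : dist s' 1 ≤ dist (z, s') (q, (1 : ℝ)) := le_max_right _ _
          have h4 : 1 / ((k : ℝ) + 1) ≤ 1 := by
            rw [div_le_one (by positivity)]; linarith [(Nat.cast_nonneg k : (0 : ℝ) ≤ k)]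
          have h5 : dist s' 1 = 2 := by rw [h2, Real.dist_eq]; norm_num
          linarith
        · exact ⟨h1, hsJ.2⟩
      obtain ⟨h1, h2, h3⟩ := (Q.reaches_iff hs).1 hr
      exact ⟨z, s', τ, hτ, ⟨h1, p, s, hs, hp, h2, h3⟩, hd⟩
    choose z s' τ hτ hz hd using key
    have hlim : Tendsto (fun k => (z k, s' k)) atTop (𝓝 (q, 1)) :=
      tendsto_iff_dist_tendsto_zero.2 (squeeze_zero (fun _ => dist_nonneg)
        (fun k => (hd k).le) tendsto_one_div_add_atTop_nhds_zero_nat)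
    exact ⟨τ, z, s', tendsto_atTop_mono (fun k => (by linarith [hτ k] : (k : ℝ) ≤ τ k))
      tendsto_natCast_atTop_atTop, (continuous_fst.tendsto _).comp hlim,
      (continuous_snd.tendsto _).comp hlim, hz⟩
  · rintro ⟨T, q', s', hT, hq, hs, hR⟩
    refine ⟨Q.mem_X (by norm_num), fun T₀ _ => mem_closure_of_tendsto (hq.prodMk_nhds hs) ?_⟩
    filter_upwards [hT.eventually_gt_atTop T₀] with k hk
    obtain ⟨hT, p, s, hs, hp, hs', hx⟩ := hR k
    exact ⟨T k, hk, (p, s), hp, (Q.reaches_iff hs).2 ⟨hT, hs', hx⟩⟩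

/-- The neighbourhood of `A` from which `A` is the `ω`-limit set makes `A` robust. -/
theorem traps_of_omega {ρ : ℝ} {A U O : Set (E n)} (hA : IsCompact A) (hO : IsOpen O) (hAO : A ⊆ O)
    (hOU : O ⊆ U) (h : P.omega ρ (U ×ˢ {1}) = A) : Traps P.G (ρ, P.lp) A U where
  compact := hA
  nhd := hAO.trans (interior_maximal hOU hO)
  forward p hp := by
    rw [← h] at hA hp
    obtain ⟨y, hy, hy0, hyA⟩ := P.omega_invariant hA p hp
    rw [h] at hyA
    exact ⟨y, hy.mono (subset_univ _), hy0, fun t _ => hyA t⟩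
  backward z hz hzU := by
    rw [← h]
    exact P.mem_omega_of_backward hz hzU

/-- A compact set in the slice attracts a neighbourhood in the phase space once it attracts one within
the slice: by `Traps.exists_nhd` attraction persists for signals close to their limit. -/
theorem isOmegaLimitOfNhd_iff {r : ℝ} {A : Set (E n)} (hA : IsCompact A) :
    IsOmegaLimitOfNhd (Q.F r) Q.X (A ×ˢ {1}) ↔ IsOmegaLimitOfNhd (P.H r⁻¹) univ A := by
  constructor
  · rintro ⟨hne, U, hUX, ⟨O, hO, hAO, hOU⟩, h⟩
    have hΩ : P.omega r⁻¹ U = A := by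
      ext q
      rw [← Q.mem_omegaLimitSet_iff, h]
      simp
    have hi : Continuous fun p : E n => (p, (1 : ℝ)) := by fun_prop
    have hsub : ∀ p ∈ A, p ∈ (fun p : E n => (p, (1 : ℝ))) ⁻¹' O := fun p hp => hAO ⟨hp, rfl⟩
    refine ⟨by simpa using hne, (fun p => (p, (1 : ℝ))) ⁻¹' U, subset_univ _, ⟨_, hO.preimage hi, hsub,
      fun p hp => hOU ⟨hp.1, Q.mem_X (by norm_num)⟩⟩, ?_⟩
    rw [P.omegaLimitSet_H]
    refine Subset.antisymm ?_ fun q hq => ?_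
    · rw [← hΩ]
      refine P.omega_mono ?_
      rintro ⟨p, s⟩ ⟨hp, hs⟩
      obtain rfl : s = 1 := hs
      exact hp
    · obtain ⟨y, hy, hy0, hyA⟩ := P.omega_invariant (by rwa [hΩ]) q (by rwa [hΩ])
      rw [← hy0]
      refine P.mem_omega_of_backward (hy.mono (subset_univ _)) fun t _ => ?_
      have := hyA t
      rw [hΩ] at this
      exact hOU ⟨hsub _ this, Q.mem_X (by norm_num)⟩
  · rintro ⟨hne, U, -, ⟨O, hO, hAO, hOU⟩, h⟩
    rw [P.omegaLimitSet_H] at h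
    have hOU' : O ⊆ U := fun x hx => hOU ⟨hx, mem_univ _⟩
    -- a small neighbourhood in the phase space stays in the basin, as the signals are close to the limit
    have htr := traps_of_omega hA hO hAO hOU' h
    obtain ⟨O₁, hO₁, hAO₁, hO₁U, hO₁c⟩ := exists_open_between_and_isCompact_closure hA hO hAO
    obtain ⟨O', hO', hAO', -, ε, hε, hstay⟩ := htr.exists_nhd P.contDiff_G hO₁ hAO₁
    obtain ⟨δ₀, hδ₀, hsig₀⟩ := P.eventually_sig (ρ₀ := r⁻¹) (p := fun ν => ‖ν - (r⁻¹, P.lp)‖ ≤ ε) (by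
      filter_upwards [Metric.closedBall_mem_nhds (r⁻¹, P.lp) hε] with ν hν
      rwa [mem_closedBall_iff_norm] at hν)
    set δ := min δ₀ 1
    have hδ : 0 < δ := lt_min hδ₀ one_pos
    have hδ1 : δ ≤ 1 := min_le_right _ _
    have hsig : ∀ s, 1 - δ < s → s ∈ Ioc (-1 : ℝ) 1 → ∀ t ≥ 0,
        ‖P.sig r⁻¹ s t - (r⁻¹, P.lp)‖ ≤ ε := fun s hs =>
      hsig₀ r⁻¹ s (by simpa using hδ₀) (by linarith [min_le_left δ₀ 1])
    have hAU : A ×ˢ {1} ⊆ O' ×ˢ Ioi (1 - δ) := by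
      rintro ⟨p, s⟩ ⟨hp, hs⟩
      obtain rfl : s = 1 := hs
      exact ⟨hAO' hp, by simp [hδ]⟩
    have hAX : A ×ˢ {1} ⊆ Q.X := by
      rintro ⟨p, s⟩ ⟨hp, hs⟩
      obtain rfl : s = 1 := hs
      exact Q.mem_X (by norm_num)
    refine ⟨hne.prod (singleton_nonempty _), O' ×ˢ Ioi (1 - δ) ∩ Q.X, inter_subset_right,
      ⟨_, hO'.prod isOpen_Ioi, hAU, subset_rfl⟩, ?_⟩
    -- the time component of an `ω`-limit point is `1`
    have hsnd : ∀ z ∈ omegaLimitSet (Q.F r) Q.X (O' ×ˢ Ioi (1 - δ) ∩ Q.X), z.2 = 1 := by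
      rintro ⟨q, s⟩ ⟨hqX, hq⟩
      refine le_antisymm (Q.subset_Icc hqX).2 (le_of_forall_lt fun v hv => ?_)
      obtain ⟨T, hT, hT0⟩ := (((tendsto_gα_atTop P.α_pos).eventually_const_lt hv).and
        (eventually_gt_atTop 0)).exists
      refine hT.trans_le ?_
      have hcl : IsClosed {z : E n × ℝ | gα P.α T ≤ z.2} := isClosed_le (by fun_prop) (by fun_prop)
      refine hcl.closure_subset_iff.2 ?_ (hq T hT0)
      rintro ⟨z, s'⟩ ⟨τ, hτ, ⟨p, s₀⟩, ⟨⟨-, hs₀⟩, hX⟩, hr⟩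
      have hs₀' : 1 - δ < s₀ := hs₀
      have hs₀1 : s₀ ∈ Ioc (-1 : ℝ) 1 := ⟨by linarith, (Q.subset_Icc hX).2⟩
      have h1 := ((Q.reaches_iff hs₀1).1 hr).2.1
      have h2 := theta_mono P.α τ (s := 0) (by norm_num) (Ioc_subset_Icc_self hs₀1) (by linarith)
      rw [← gα_eq_theta] at h2
      show gα P.α T ≤ s'
      rw [h1]
      exact (gα_lt P.α_pos hτ).le.trans h2
    ext ⟨q, s⟩
    constructor
    · intro hq
      obtain rfl : s = 1 := hsnd _ hq
      rw [Q.mem_omegaLimitSet_iff] at hq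
      obtain ⟨T, q', s', hT, hq', hs', hR⟩ := hq
      choose hT0 p s hs hU hs'' x hx hx0 hxT using hR
      have hν : ∀ k, ∀ t ≥ 0, ‖P.sig r⁻¹ (s k) t - (r⁻¹, P.lp)‖ ≤ ε := fun k =>
        hsig _ (hU k).1.2 (hs k)
      have hxO : ∀ k, ∀ t ∈ Icc 0 (T k), x k t ∈ closure O₁ := fun k t ht =>
        subset_closure (hstay _ (hν k) t ht.1 _ ((hx k).mono (Icc_subset_Icc_right ht.2))
          (by rw [hx0]; exact (hU k).1.1))
      refine ⟨htr.mem_of_tendsto P.contDiff_G hO₁c (hO₁U.trans hOU') hT hT0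
        (ν := fun k => P.sig r⁻¹ (s k)) ?_ (R := ‖(r⁻¹, P.lp)‖ + ε) (fun k t ht => ?_) hx hxO
        (by simpa only [hxT] using hq'), rfl⟩
      · simp only [P.shiftSig_sig _ _ (hs _), ← hs'']
        exact P.tendsto_sig_one tendsto_const_nhds hs' fun k => by
          rw [hs'' k]; exact theta_mem _ _ (hs k)
      · have h1 := hν k t ht.1
        have h2 := norm_sub_norm_le (P.sig r⁻¹ (s k) t) (r⁻¹, P.lp)
        linarith
    · rintro ⟨hq, hs⟩
      obtain rfl : s = 1 := hs
      rw [Q.mem_omegaLimitSet_iff]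
      obtain ⟨y, hy, hy0, hyA⟩ := P.omega_invariant (by rwa [h]) q (by rwa [h])
      rw [h] at hyA
      rw [← hy0]
      exact P.omega_mono (subset_inter hAU hAX)
        (P.mem_omega_of_backward (hy.mono (subset_univ _)) fun t _ => hyA t)

theorem isClosed_omegaLimitSet_H (ρ : ℝ) (U : Set (E n)) :
    IsClosed (omegaLimitSet (P.H ρ) univ U) := by
  have : omegaLimitSet (P.H ρ) univ U = ⋂ T > (0 : ℝ),
      closure {z | ∃ τ > T, ∃ p ∈ U, Reaches (P.H ρ) univ τ p z} := by
    ext q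
    simp [omegaLimitSet]
  rw [this]
  exact isClosed_biInter fun _ _ => isClosed_closure

theorem isInvariantSet_iff {r : ℝ} {A : Set (E n)} :
    IsInvariantSet (Q.F r) Q.X (A ×ˢ {1}) ↔ IsInvariantSet (P.H r⁻¹) univ A := by
  constructor
  · intro h p hp
    obtain ⟨y, hy, hy0, hyA⟩ := h (p, 1) ⟨hp, rfl⟩
    refine ⟨fun t => (y t).1, P.isSolution_H_iff.2 ?_, by simp [hy0], fun t => (hyA t).1⟩
    have := Q.sol_of_isSolution ordConnected_univ (mem_univ 0) hy (s := 1) (by norm_num)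
      (by simp [hy0])
    rwa [P.sig_one] at this
  · rintro h ⟨p, s⟩ ⟨hp, hs⟩
    obtain rfl : s = 1 := hs
    obtain ⟨y, hy, hy0, hyA⟩ := h p hp
    refine ⟨_, Q.isSolution_of_sol (s := 1) (by norm_num) (x := y) ?_, by simp [hy0, theta_one],
      fun t => ⟨hyA t, theta_one _ _⟩⟩
    rw [P.sig_one]
    exact P.isSolution_H_iff.1 hy

/-- The attractors of the compactified system in the slice at infinite time are the attractors of
the future limit system. -/
theorem isAttractor_iff {r : ℝ} {A : Set (E n)} :
    IsAttractor (Q.F r) Q.X (A ×ˢ {1}) ↔ IsAttractor (P.H r⁻¹) univ A := by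
  -- every subset of the slice is a product
  have hslice : ∀ A' ⊆ A ×ˢ ({1} : Set ℝ), A' = ((fun p : E n => (p, (1 : ℝ))) ⁻¹' A') ×ˢ {1} := by
    intro A' hA'
    ext ⟨p, s⟩
    constructor
    · intro h
      obtain rfl : s = 1 := (hA' h).2
      exact ⟨h, rfl⟩
    · rintro ⟨h, hs⟩
      obtain rfl : s = 1 := hs
      exact h
  have hi : Continuous fun p : E n => (p, (1 : ℝ)) := by fun_prop
  constructor
  · intro h
    have hAc : IsCompact A := by
      have := h.compact.image continuous_fst
      rwa [fst_image_prod A (singleton_nonempty 1)] at this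
    refine ⟨subset_univ _, hAc, Q.isInvariantSet_iff.1 h.invariant,
      (Q.isOmegaLimitOfNhd_iff hAc).1 h.omega, fun A' hA' h' => ?_⟩
    have hA'c : IsCompact A' := by
      obtain ⟨-, U, -, -, hU⟩ := h'
      refine hAc.of_isClosed_subset ?_ hA'
      rw [← hU]
      exact isClosed_omegaLimitSet_H _ _
    have := h.minimal (A' ×ˢ {1}) (prod_mono_left hA') ((Q.isOmegaLimitOfNhd_iff hA'c).2 h')
    ext p
    have h2 := Set.ext_iff.1 this (p, 1)
    simpa using h2
  · intro h
    refine ⟨?_, h.compact.prod isCompact_singleton, Q.isInvariantSet_iff.2 h.invariant,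
      (Q.isOmegaLimitOfNhd_iff h.compact).2 h.omega, fun A' hA' h' => ?_⟩
    · rintro ⟨p, s⟩ ⟨hp, hs⟩
      obtain rfl : s = 1 := hs
      exact Q.mem_X (by norm_num)
    · rw [hslice A' hA'] at h' ⊢
      have hsub : (fun p : E n => (p, (1 : ℝ))) ⁻¹' A' ⊆ A := fun p hp => (hA' hp).1
      have hA'c : IsCompact ((fun p : E n => (p, (1 : ℝ))) ⁻¹' A') := by
        refine h.compact.of_isClosed_subset ?_ hsub
        obtain ⟨-, U, -, -, hU⟩ := h'
        -- closures are taken in the whole space, but points of the slice belong to the phase space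
        have h2 : (fun p : E n => (p, (1 : ℝ))) ⁻¹' A' = ⋂ T > (0 : ℝ),
            (fun p : E n => (p, (1 : ℝ))) ⁻¹'
              closure {z | ∃ τ > T, ∃ p ∈ U, Reaches (Q.F r) Q.X τ p z} := by
          ext p
          have h3 := Set.ext_iff.1 hU (p, 1)
          simp only [mem_prod, mem_preimage, mem_singleton_iff, and_true] at h3
          rw [mem_preimage, ← h3]
          simp only [omegaLimitSet, mem_iInter, mem_preimage]
          exact and_iff_right (Q.mem_X (by norm_num))
        rw [h2]
        exact isClosed_biInter fun _ _ => isClosed_closure.preimage hi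
      rw [h.minimal _ hsub ((Q.isOmegaLimitOfNhd_iff hA'c).1 h')]

/-- An attractor of the future limit system attracts robustly. -/
theorem exists_traps {ρ : ℝ} {A : Set (E n)} (h : IsAttractor (P.H ρ) univ A) :
    ∃ U, Traps P.G (ρ, P.lp) A U := by
  obtain ⟨-, U, -, ⟨O, hO, hAO, hOU⟩, hU⟩ := h.omega
  rw [P.omegaLimitSet_H] at hU
  exact ⟨U, traps_of_omega h.compact hO hAO (fun x hx => hOU ⟨hx, mem_univ _⟩) hU⟩

end Cpt

/-! ### The solution singled out by its start -/

/-- Adapted coordinates stay adapted when time is rescaled. -/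
def Splitting.smul {n : ℕ} {A : E n →L[ℝ] E n} (σ : Splitting A) {ρ : ℝ} (hρ : 0 < ρ) :
    Splitting (ρ • A) where
  m := σ.m
  ℓ := σ.ℓ
  S := σ.S
  κ := ρ * σ.κ
  K := σ.K
  κ_pos := mul_pos hρ σ.κ_pos
  K_pos := σ.K_pos
  growth v := by
    have := mul_le_mul_of_nonneg_left (σ.growth v) hρ.le
    simp only [smul_apply, map_smul, smul_eq_mul]
    linarith
  decay v := by
    have := mul_le_mul_of_nonneg_left (σ.decay v) hρ.le
    simp only [smul_apply, map_smul, inner_smul_right]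
    linarith
  bound := σ.bound

theorem fderiv_field {n d : ℕ} {f : E n × E d → E n} (hf : ContDiff ℝ 1 f) (η : E n) (ρ : ℝ) (μ : E d)
    (ξ : E n) : fderiv ℝ (field f) (η, (ρ, μ)) (ξ, 0) = (ρ • fderiv ℝ (fun x => f (x, μ)) η) ξ := by
  have h1 : HasFDerivAt (fun x : E n => (x, (ρ, μ))) (ContinuousLinearMap.inl ℝ (E n) (ℝ × E d)) η :=
    hasFDerivAt_prodMk_left η (ρ, μ)
  have h2 : HasFDerivAt (field f) (fderiv ℝ (field f) (η, (ρ, μ))) (η, (ρ, μ)) :=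
    ((contDiff_field hf).differentiable (by norm_num) _).hasFDerivAt
  have h3 := h2.comp η h1
  have h4 : DifferentiableAt ℝ (fun x => f (x, μ)) η := by
    have : ContDiff ℝ 1 (fun x => f (x, μ)) := by fun_prop
    exact this.differentiable (by norm_num) _
  have h5 : HasFDerivAt (fun x => ρ • f (x, μ)) (ρ • fderiv ℝ (fun x => f (x, μ)) η) η :=
    h4.hasFDerivAt.const_smul ρ
  have h6 := h3.unique h5
  rw [← h6]
  rfl

/-- Adapted coordinates at an edge state, with a vector `w` along which only `ℓ` varies. -/
theorem exists_edge_chart {n d : ℕ} {f : E n × E d → E n} (hf : ContDiff ℝ 1 f) {η : E n} {μ : E d}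
    (hη : IsRegularEdgeEquilibrium (fun x => f (x, μ)) η) {ρ : ℝ} (hρ : 0 < ρ) :
    ∃ (c : Chart (field f) η (ρ, μ)) (w : E n), c.ℓ w = 1 ∧ c.S w = 0 := by
  obtain ⟨σ, w, h1, h2⟩ := exists_splitting_of_edge hη.2.1 hη.2.2
  obtain ⟨c, hc1, hc2⟩ := exists_chart (contDiff_field hf) (fderiv_field hf η ρ μ) (σ.smul hρ)
  exact ⟨c, w, by rw [hc1]; exact h1, hc2 w h2⟩

theorem exists_sink_chart {n d : ℕ} (hn : 0 < n) {f : E n × E d → E n} (hf : ContDiff ℝ 1 f) {e : E n}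
    {μ : E d} (he : IsHyperbolicSink (fun x => f (x, μ)) e) {ρ : ℝ} (hρ : 0 < ρ) :
    ∃ c : Chart (field f) e (ρ, μ), c.ℓ = 0 := by
  obtain ⟨σ, hσ⟩ := exists_splitting_of_sink hn he.2
  obtain ⟨c, hc1, -⟩ := exists_chart (contDiff_field hf) (fderiv_field hf e ρ μ) (σ.smul hρ)
  exact ⟨c, hc1.trans hσ⟩

variable {n d : ℕ}

namespace Start

variable (S : Start n)

theorem ordConnected_times : S.times.OrdConnected := by
  cases S
  · exact ordConnected_Ici
  · exact ordConnected_univ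

theorem mem_times_of_le {S : Start n} {τ τ' : ℝ} (h : τ ∈ S.times) (hle : τ ≤ τ') : τ' ∈ S.times := by
  cases S
  · exact le_trans h hle
  · trivial

theorem condition_congr {S : Start n} {τ : ℝ} (hτ : τ ∈ S.times) {x y : ℝ → E n}
    (h : ∀ t ∈ S.times, t ≤ τ → y t = x t) (hx : S.Condition x) : S.Condition y := by
  cases S with
  | point x₀ τ₀ => exact (h τ₀ (le_refl τ₀) hτ).trans hx
  | past e =>
    refine Tendsto.congr' ?_ hx
    filter_upwards [eventually_le_atBot τ] with t ht
    exact (h t trivial ht).symm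

end Start

namespace Sys

variable (P : Sys n d)

/-- The signal of the original nonautonomous system, for the rate `1 / ρ`. -/
def base (ρ : ℝ) : C(ℝ, ℝ × E d) := P.sig ρ (gα P.α 0)

theorem base_apply (ρ t : ℝ) : P.base ρ t = (ρ, P.Λ t) := by
  rw [base, P.sig_gα, zero_add]

theorem shiftSig_base (ρ τ : ℝ) : shiftSig τ (P.base ρ) = P.sig ρ (gα P.α τ) := by
  rw [base, P.shiftSig_sig _ _ (gα_mem_Ioc _ _), theta_gα, zero_add]

theorem sol_base_iff {r : ℝ} {I : Set ℝ} {x : ℝ → E n} :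
    IsIntegralCurveOn x (nonautField P.f P.Λ r) I ↔ Sol P.G (P.base r⁻¹) I x := by
  have : (P.base r⁻¹ : ℝ → ℝ × E d) = fun t => (r⁻¹, P.Λ t) := by
    funext t; exact P.base_apply _ t
  rw [this]
  rfl

theorem solAt_iff {S : Start n} {r τ : ℝ} {p : E n} : SolAt P.f P.Λ S r τ p ↔ τ ∈ S.times ∧
    ∃ x : ℝ → E n, Sol P.G (P.base r⁻¹) (S.times ∩ Iic τ) x ∧ S.Condition x ∧ x τ = p := by
  simp only [SolAt, sol_base_iff]

/-- The start determines the solution for each rate; for the rate `rc` the solution exists, and it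
depends continuously on the rate. -/
structure Determined (S : Start n) (rc : ℝ) : Prop where
  unique : ∀ r > 0, ∀ τ ∈ S.times, ∀ x y : ℝ → E n, Sol P.G (P.base r⁻¹) (S.times ∩ Iic τ) x →
    Sol P.G (P.base r⁻¹) (S.times ∩ Iic τ) y → S.Condition x → S.Condition y →
      ∀ t ∈ S.times ∩ Iic τ, x t = y t
  exists_solAt : ∃ τ p, SolAt P.f P.Λ S rc τ p
  continuous : ∀ τ p, SolAt P.f P.Λ S rc τ p → ∀ O ∈ 𝓝 p, ∀ᶠ r in 𝓝 rc, ∃ q ∈ O,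
    SolAt P.f P.Λ S r τ q

variable {P}

theorem solAt_extend {S : Start n} {r τ t : ℝ} (ht : 0 ≤ t) (hτ : τ ∈ S.times) {x y : ℝ → E n}
    (hx : Sol P.G (P.base r⁻¹) (S.times ∩ Iic τ) x) (hc : S.Condition x)
    (hy : Sol P.G (P.sig r⁻¹ (gα P.α τ)) (Icc 0 t) y) (hxy : x τ = y 0) :
    SolAt P.f P.Λ S r (τ + t) (y t) := by
  refine P.solAt_iff.2 ⟨S.mem_times_of_le hτ (by linarith), ?_⟩
  have h1 : Sol P.G (P.base r⁻¹) (S.times ∩ Iic (τ + t) ∩ Ici τ) (fun u => y (u - τ)) := by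
    rw [← P.shiftSig_base] at hy
    have := hy.shift (-τ) (J := S.times ∩ Iic (τ + t) ∩ Ici τ)
      (fun u hu => ⟨by linarith [hu.2.out], by linarith [hu.1.2.out]⟩)
    simpa [sub_eq_add_neg] using this
  have h2 : Sol P.G (P.base r⁻¹) (S.times ∩ Iic (τ + t) ∩ Iic τ) x :=
    hx.mono fun u hu => ⟨hu.1.1, hu.2⟩
  refine ⟨_, h2.glue h1 (by simp [hxy]), S.condition_congr hτ (fun u _ hu => if_pos hu) hc, ?_⟩
  rcases eq_or_lt_of_le ht with rfl | h0
  · simp [hxy]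
  · simp [h0]

namespace Determined

variable {S : Start n} {rc : ℝ} (hS : P.Determined S rc)
include hS

theorem solAt_unique {r τ : ℝ} (hr : 0 < r) {p q : E n} (hp : SolAt P.f P.Λ S r τ p)
    (hq : SolAt P.f P.Λ S r τ q) : p = q := by
  obtain ⟨hτ, x, hx, hxc, rfl⟩ := P.solAt_iff.1 hp
  obtain ⟨-, y, hy, hyc, rfl⟩ := P.solAt_iff.1 hq
  exact hS.unique r hr τ hτ x y hx hy hxc hyc τ ⟨hτ, self_mem_Iic⟩

/-- The state at a later time is reached by the equation driven by the signal from `gα P.α τ` on. -/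
theorem solAt_add_iff {r τ t : ℝ} (hr : 0 < r) {p q : E n} (hp : SolAt P.f P.Λ S r τ p)
    (ht : 0 ≤ t) : SolAt P.f P.Λ S r (τ + t) q ↔
      ∃ x : ℝ → E n, Sol P.G (P.sig r⁻¹ (gα P.α τ)) (Icc 0 t) x ∧ x 0 = p ∧ x t = q := by
  obtain ⟨hτ, x, hx, hxc, rfl⟩ := P.solAt_iff.1 hp
  constructor
  · intro hq
    obtain ⟨hτt, y, hy, hyc, rfl⟩ := P.solAt_iff.1 hq
    refine ⟨fun u => y (u + τ), ?_, ?_, by rw [add_comm]⟩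
    · rw [← P.shiftSig_base]
      exact hy.shift τ fun u hu => ⟨S.mem_times_of_le hτ (by linarith [hu.1]),
        show u + τ ≤ τ + t by linarith [hu.2]⟩
    · simp only [zero_add]
      exact hS.unique r hr τ hτ y x (hy.mono fun u hu => ⟨hu.1, hu.2.out.trans (by linarith)⟩) hx hyc
        hxc τ ⟨hτ, self_mem_Iic⟩
  · rintro ⟨y, hy, hy0, rfl⟩
    exact solAt_extend ht hτ hx hxc hy hy0.symm

/-- Convergence of the distinguished solution, read from one of its states on. -/
theorem tendsto_of_solConverges {r τ : ℝ} (hr : 0 < r) {η p : E n}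
    (h : SolConverges P.f P.Λ S r η) (hp : SolAt P.f P.Λ S r τ p) :
    ∃ x : ℝ → E n, Sol P.G (P.sig r⁻¹ (gα P.α τ)) (Ici 0) x ∧ x 0 = p ∧ Tendsto x atTop (𝓝 η) := by
  obtain ⟨y, hy, hyc, hlim⟩ := h
  rw [P.sol_base_iff] at hy
  obtain ⟨hτ, x, hx, hxc, rfl⟩ := P.solAt_iff.1 hp
  refine ⟨fun u => y (u + τ), ?_, ?_, hlim.comp (tendsto_atTop_add_const_right _ _ tendsto_id)⟩
  · rw [← P.shiftSig_base]
    exact hy.shift τ fun u hu => S.mem_times_of_le hτ (by linarith [hu.out])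
  · simp only [zero_add]
    exact hS.unique r hr τ hτ y x (hy.mono fun u hu => hu.1) hx hyc hxc τ ⟨hτ, self_mem_Iic⟩

omit hS in
theorem solConverges_of_tendsto {r τ : ℝ} {η p : E n} (hp : SolAt P.f P.Λ S r τ p) {y : ℝ → E n}
    (hy : Sol P.G (P.sig r⁻¹ (gα P.α τ)) (Ici 0) y) (hy0 : y 0 = p)
    (hlim : Tendsto y atTop (𝓝 η)) : SolConverges P.f P.Λ S r η := by
  obtain ⟨hτ, x, hx, hxc, rfl⟩ := P.solAt_iff.1 hp
  have h1 : Sol P.G (P.base r⁻¹) (S.times ∩ Ici τ) (fun u => y (u - τ)) := by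
    rw [← P.shiftSig_base] at hy
    have := hy.shift (-τ) (J := S.times ∩ Ici τ)
      (fun u hu => by have := hu.2.out; simp only [mem_Ici]; linarith)
    simpa [sub_eq_add_neg] using this
  refine ⟨_, P.sol_base_iff.2 (hx.glue h1 (by simp [hy0])),
    S.condition_congr hτ (fun u _ hu => if_pos hu) hxc, ?_⟩
  refine (hlim.comp (tendsto_atTop_add_const_right _ (-τ) tendsto_id)).congr' ?_
  filter_upwards [eventually_gt_atTop τ] with u hu
  simp [not_le.2 hu, sub_eq_add_neg]

end Determined

end Sys

/-! ### Both kinds of start determine the solution -/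

variable {n d : ℕ}

namespace Sys

variable (P : Sys n d)

/-- Continuity in the rate can be tested along sequences; a solution needs to be compared only up
to some earlier time. -/
theorem solAt_continuous_of_seq {S : Start n} {rc : ℝ} (hrc : 0 < rc) {τ₁ τ : ℝ} (h₁ : τ₁ ≤ τ)
    {x : ℝ → E n} (hx : Sol P.G (P.base rc⁻¹) (S.times ∩ Iic τ) x) (hτ₁ : τ₁ ∈ S.times)
    (h : ∀ r : ℕ → ℝ, Tendsto r atTop (𝓝 rc) → ∃ (φ : ℕ → ℕ) (y : ℕ → ℝ → E n), StrictMono φ ∧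
      (∀ k, Sol P.G (P.base (r (φ k))⁻¹) (S.times ∩ Iic τ₁) (y k) ∧ S.Condition (y k)) ∧
      Tendsto (fun k => y k τ₁) atTop (𝓝 (x τ₁))) {O : Set (E n)} (hO : O ∈ 𝓝 (x τ)) :
    ∀ᶠ r in 𝓝 rc, ∃ q ∈ O, SolAt P.f P.Λ S r τ q := by
  by_contra hcon
  rw [not_eventually] at hcon
  obtain ⟨r, hr, hno⟩ := exists_seq_forall_of_frequently hcon
  obtain ⟨φ, y, hφ, hy, hlim⟩ := h r hr
  have hr' : Tendsto (fun k => (r (φ k))⁻¹) atTop (𝓝 rc⁻¹) :=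
    (hr.comp hφ.tendsto_atTop).inv₀ hrc.ne'
  have hz : Sol P.G (P.sig rc⁻¹ (gα P.α τ₁)) (Icc 0 (τ - τ₁)) (fun t => x (t + τ₁)) := by
    rw [← P.shiftSig_base]
    exact hx.shift τ₁ fun t ht => ⟨S.mem_times_of_le hτ₁ (by linarith [ht.1]),
      show t + τ₁ ≤ τ by linarith [ht.2]⟩
  obtain ⟨z, hz0, hzs, hzl⟩ := exists_nearby_solution P.contDiff_G
    (P.tendsto_sig hr' (tendsto_const_nhds (x := gα P.α τ₁)) (fun _ => gα_mem_Ioc _ _)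
      (gα_mem_Ioc _ _)) (S := 0) (T := τ - τ₁) ⟨le_rfl, by linarith⟩ hz (p := fun k => y k τ₁)
    (by simpa using hlim)
  have hend := hzl (fun _ => τ - τ₁) (τ - τ₁) ⟨by linarith, le_rfl⟩ tendsto_const_nhds
  simp only [sub_add_cancel] at hend
  obtain ⟨k, hk, hkO⟩ := (hzs.and (hend hO)).exists
  have := solAt_extend (by linarith) hτ₁ (hy k).1 (hy k).2 hk (hz0 k).symm
  rw [add_sub_cancel] at this
  exact hno (φ k) ⟨_, hkO, this⟩

theorem sol_start (x₀ : E n) (τ₀ ρ : ℝ) :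
    Sol P.G (P.base ρ) ((Start.point x₀ τ₀).times ∩ Iic τ₀) (fun _ => x₀) := by
  have h : (Start.point x₀ τ₀).times ∩ Iic τ₀ = {τ₀} := by
    show Ici τ₀ ∩ Iic τ₀ = {τ₀}
    rw [Ici_inter_Iic, Icc_self]
  rw [h]
  intro t ht
  obtain rfl : t = τ₀ := ht
  exact hasDerivWithinAt_iff_hasFDerivWithinAt.2 (.of_subsingleton subsingleton_singleton)

/-- A solution through a given point is determined and depends continuously on the rate. -/
theorem determined_point (x₀ : E n) (τ₀ : ℝ) {rc : ℝ} (hrc : 0 < rc) :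
    P.Determined (Start.point x₀ τ₀) rc where
  unique r _ τ hτ x y hx hy hxc hyc := by
    have : ((Start.point x₀ τ₀).times ∩ Iic τ).OrdConnected :=
      (Start.ordConnected_times _).inter ordConnected_Iic
    exact Sol.unique P.contDiff_G this (P.base r⁻¹).continuous.continuousOn hx hy
      ⟨self_mem_Ici, hτ⟩ (Eq.trans hxc (Eq.symm hyc))
  exists_solAt := by
    refine ⟨τ₀, x₀, self_mem_Ici, fun _ => x₀, ?_, rfl, rfl⟩
    exact P.sol_base_iff.2 (P.sol_start x₀ τ₀ rc⁻¹)
  continuous τ p hp O hO := by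
    obtain ⟨hτ, x, hx, hxc, rfl⟩ := P.solAt_iff.1 hp
    refine P.solAt_continuous_of_seq hrc (τ₁ := τ₀) hτ hx self_mem_Ici (fun r _ =>
      ⟨id, fun _ _ => x₀, strictMono_id, fun k => ⟨?_, rfl⟩, ?_⟩) hO
    · exact P.sol_start x₀ τ₀ _
    · rw [show x τ₀ = x₀ from hxc]
      exact tendsto_const_nhds

section Past

variable {lm : E d} (hlm : Tendsto P.Λ atBot (𝓝 lm)) {e : E n} (he : P.f (e, lm) = 0)
include hlm

theorem tendsto_base_atBot (ρ : ℝ) : Tendsto (P.base ρ) atBot (𝓝 (ρ, lm)) :=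
  ((tendsto_const_nhds (x := ρ)).prodMk_nhds hlm).congr fun t => (P.base_apply ρ t).symm

/-- Only one solution emanates from the sink of the past limit system: the difference of two such
solutions decreases in a norm, and tends to zero in the past. -/
theorem eq_of_tendsto_sink {ρ : ℝ} (c : Chart P.G e (ρ, lm)) (hc : c.ℓ = 0) {T : ℝ}
    {x y : ℝ → E n} (hx : Sol P.G (P.base ρ) (Iic T) x) (hy : Sol P.G (P.base ρ) (Iic T) y)
    (hxe : Tendsto x atBot (𝓝 e)) (hye : Tendsto y atBot (𝓝 e)) : ∀ t ≤ T, x t = y t := by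
  have hbox : c.box c.a ∈ 𝓝 e :=
    mem_of_superset ((c.isOpen_obox c.a).mem_nhds (c.mem_obox_self c.a_pos)) (c.obox_subset_box _)
  have hν : ∀ᶠ t in atBot, ‖P.base ρ t - (ρ, lm)‖ ≤ c.ε := by
    have := P.tendsto_base_atBot hlm ρ (Metric.closedBall_mem_nhds _ c.ε_pos)
    filter_upwards [this] with t ht
    rwa [mem_preimage, mem_closedBall_iff_norm] at ht
  obtain ⟨T', hT'⟩ := eventually_atBot.1 ((hxe.eventually hbox).and
    ((hye.eventually hbox).and hν))
  set T₁ := min T T'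
  have hge : 0 ≤ c.D (x T₁ - y T₁) := by
    have h1 : Tendsto (fun s => c.D (x s - y s)) atBot (𝓝 0) := by
      have := (c.continuous_D.tendsto (e - e)).comp (hxe.sub hye)
      simpa [Chart.D, Function.comp_def] using this
    refine le_of_tendsto h1 ?_
    filter_upwards [eventually_le_atBot T₁] with s hs
    have hsub : Iic T₁ ⊆ Iic T := Iic_subset_Iic.2 (min_le_left _ _)
    exact c.D_mono ordConnected_Iic (hx.mono hsub) (hy.mono hsub)
      (fun t ht => (hT' t (le_trans ht (min_le_right _ _))).1)
      (fun t ht => (hT' t (le_trans ht (min_le_right _ _))).2.1)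
      (fun t ht => (hT' t (le_trans ht (min_le_right _ _))).2.2) hs self_mem_Iic hs
  have heq : x T₁ = y T₁ := by
    have h2 : c.ℓ (x T₁ - y T₁) = 0 := by rw [hc]; simp
    refine sub_eq_zero.1 (c.eq_zero_of_N ?_)
    rw [Chart.D, h2] at hge
    rw [Chart.N, h2]
    nlinarith
  exact Sol.unique P.contDiff_G ordConnected_Iic (P.base ρ).continuous.continuousOn hx hy
    (t₀ := T₁) (mem_Iic.2 (min_le_left _ _)) heq

include he

/-- For all rates close to a given one, a solution stays close to the sink of the past limit
system for all early times. -/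
theorem exists_stay_sink {ρ₀ : ℝ} (c : Chart P.G e (ρ₀, lm)) (hc : c.ℓ = 0) : ∃ T, ∃ δ > 0,
    (∀ ρ, |ρ - ρ₀| < δ → ∀ t ≤ T, ‖P.base ρ t - (ρ₀, lm)‖ ≤ c.ε ∧ ‖(ρ, lm) - (ρ₀, lm)‖ ≤ c.ε) ∧
    ∀ ρ, |ρ - ρ₀| < δ → ∃ x : ℝ → E n, Sol P.G (P.base ρ) (Iic T) x ∧ ∀ t ≤ T, x t ∈ c.box c.a := by
  have h0 : ∀ ρ, P.G (e, (ρ, lm)) = 0 := fun ρ => by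
    show ρ • P.f (e, lm) = 0
    rw [he, smul_zero]
  have hev := c.eventually_good P.contDiff_G.continuous (h0 ρ₀) c.a_pos
  rw [nhds_prod_eq] at hev
  obtain ⟨pa, ha, pb, hb, hgood⟩ := eventually_prod_iff.1 hev
  obtain ⟨δ, hδ, hpa⟩ := Metric.eventually_nhds_iff.1 ha
  obtain ⟨T, hT⟩ := eventually_atBot.1 (hlm.eventually hb)
  have hG : ∀ ρ, |ρ - ρ₀| < δ → ∀ t ≤ T, c.Good c.a (P.base ρ t) := fun ρ hρ t ht => by
    rw [P.base_apply]
    exact hgood (hpa hρ) (hT t ht)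
  refine ⟨T, δ, hδ, fun ρ hρ t ht => ⟨(hG ρ hρ t ht).1, (hgood (hpa hρ) hb.self_of_nhds).1⟩,
    fun ρ hρ => ?_⟩
  -- solve from the time `T - k`, starting at the sink; there is no unstable direction to leave through
  have key : ∀ k : ℕ, ∃ y : ℝ → E n,
      Sol P.G (shiftSig T (P.base ρ)) (Icc (-k) 0) y ∧ ∀ t ∈ Icc (-(k : ℝ)) 0, y t ∈ c.box c.a := by
    intro k
    set μ : C(ℝ, ℝ × E d) := (P.base ρ).comp ⟨fun t => min (t + (T - k)) T, by fun_prop⟩ with hμ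
    rcases c.stays_or_exits P.contDiff_G c.a_pos le_rfl (ν := μ)
      (fun t _ => hG ρ hρ _ (min_le_right _ _)) (c.mem_obox_self c.a_pos) with
      ⟨y, hy, -, hyb⟩ | ⟨t, -, y, -, -, -, hexit⟩ | ⟨t, -, y, -, -, -, hexit⟩
    · refine ⟨fun u => y (u + k), ?_, fun t ht => c.obox_subset_box _ (hyb _ (by linarith [ht.1]))⟩
      refine ((hy.shift (k : ℝ) (J := Icc (-(k : ℝ)) 0) fun t ht => ?_)).congr_signal fun t ht => ?_
      · simp only [mem_Ici]; linarith [ht.1]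
      · have h1 : t + k + (T - k) = t + T := by ring
        have h2 : t + T ≤ T := by linarith [ht.2]
        simp [hμ, h1, min_eq_left h2]
    · rw [hc] at hexit
      exact absurd hexit c.a_pos.ne
    · have h1 : c.neg.ℓ = 0 := by show -c.ℓ = 0; rw [hc, _root_.neg_zero]
      rw [h1] at hexit
      exact absurd hexit c.a_pos.ne
  choose y hy hyb using key
  obtain ⟨q, -, φ, hφ, hφq⟩ := (c.isCompact_box c.a).tendsto_subseq (x := fun k => y k 0)
    (fun k => hyb k 0 ⟨by simp, le_rfl⟩)
  obtain ⟨R, hR1, hR2⟩ := c.exists_radius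
  have hmem : ∀ t ≤ 0, ∀ᶠ k in atTop, t ∈ Icc (-(φ k : ℝ)) 0 := by
    intro t ht
    have h1 : Tendsto (fun k => (φ k : ℝ)) atTop atTop :=
      tendsto_natCast_atTop_atTop.comp hφ.tendsto_atTop
    filter_upwards [h1.eventually_ge_atTop (-t)] with k hk
    exact ⟨by linarith, ht⟩
  -- let `k` tend to infinity
  obtain ⟨z, -, -, hzl, hzs⟩ := exists_limit_solution P.contDiff_G
    (tendsto_const_nhds (x := shiftSig T (P.base ρ))) (I := fun k => Icc (-(φ k : ℝ)) 0)
    (fun k => ordConnected_Icc) (fun k => ⟨by simp, le_rfl⟩) (fun k => hy (φ k)) (R := R)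
    (fun k t ht => hR1 _ (hyb _ t ht))
    (fun k t ht => hR2 _ (hG ρ hρ (t + T) (by linarith [ht.2])).1) hφq
  have hz := hzs (Iic 0) fun t ht => ⟨fun _ => t, tendsto_const_nhds, hmem t ht⟩
  have hzb : ∀ t ≤ 0, z t ∈ c.box c.a := fun t ht => by
    refine (c.isClosed_box c.a).mem_of_tendsto (hzl (fun _ => t) t tendsto_const_nhds (hmem t ht)) ?_
    filter_upwards [hmem t ht] with k hk
    exact hyb _ t hk
  refine ⟨fun t => z (t + -T), ?_, fun t ht => hzb _ (by linarith)⟩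
  have := hz.shift (-T) (J := Iic T) fun t ht => by have := ht.out; simp only [mem_Iic]; linarith
  simpa using this

theorem tendsto_sink_of_stay {ρ₀ ρ : ℝ} (c : Chart P.G e (ρ₀, lm)) {T : ℝ}
    (hν : ∀ t ≤ T, ‖P.base ρ t - (ρ₀, lm)‖ ≤ c.ε) (hν₁ : ‖(ρ, lm) - (ρ₀, lm)‖ ≤ c.ε) {x : ℝ → E n}
    (hx : Sol P.G (P.base ρ) (Iic T) x) (hxb : ∀ t ≤ T, x t ∈ c.box c.a) :
    Tendsto x atBot (𝓝 e) :=
  c.tendsto_atBot_of_stays P.contDiff_G (P.tendsto_base_atBot hlm ρ) hν₁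
    (by show ρ • P.f (e, lm) = 0; rw [he, smul_zero]) hx hxb hν

/-- The solution that emerges from a sink of the past limit system is determined and depends
continuously on the rate: a limit of such solutions stays near the sink for all early times, hence
emerges from it, and is therefore the solution for the limit rate. -/
theorem determined_past (hchart : ∀ ρ > 0, ∃ c : Chart P.G e (ρ, lm), c.ℓ = 0) {rc : ℝ}
    (hrc : 0 < rc) : P.Determined (Start.past e) rc := by
  have hset : ∀ τ, (Start.past e).times ∩ Iic τ = Iic τ := fun τ => univ_inter _
  obtain ⟨c, hc⟩ := hchart rc⁻¹ (inv_pos.2 hrc)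
  obtain ⟨T, δ, hδ, hν, hstay⟩ := P.exists_stay_sink hlm he c hc
  have huniq : ∀ r > 0, ∀ τ : ℝ, ∀ x y : ℝ → E n, Sol P.G (P.base r⁻¹) (Iic τ) x →
      Sol P.G (P.base r⁻¹) (Iic τ) y → Tendsto x atBot (𝓝 e) → Tendsto y atBot (𝓝 e) →
        ∀ t ≤ τ, x t = y t := by
    intro r hr τ x y hx hy hxe hye
    obtain ⟨c', hc'⟩ := hchart r⁻¹ (inv_pos.2 hr)
    exact P.eq_of_tendsto_sink hlm c' hc' hx hy hxe hye
  refine ⟨fun r hr τ _ x y hx hy hxc hyc t ht => ?_, ?_, fun τ p hp O hO => ?_⟩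
  · rw [hset] at hx hy
    exact huniq r hr τ x y hx hy hxc hyc t ht.2
  · have h1 : |rc⁻¹ - rc⁻¹| < δ := by simpa using hδ
    obtain ⟨x, hx, hxb⟩ := hstay rc⁻¹ h1
    refine ⟨T, x T, P.solAt_iff.2 ⟨trivial, x, by rw [hset]; exact hx, ?_, rfl⟩⟩
    exact P.tendsto_sink_of_stay hlm he c (fun t ht => (hν _ h1 t ht).1) (hν _ h1 T le_rfl).2 hx hxb
  · obtain ⟨hτ, x, hx, hxc, rfl⟩ := P.solAt_iff.1 hp
    refine P.solAt_continuous_of_seq hrc (τ₁ := min τ T) (min_le_left _ _) hx trivial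
      (fun r hr => ?_) hO
    rw [hset] at hx
    obtain ⟨N, hN⟩ := eventually_atTop.1 ((hr.inv₀ hrc.ne').eventually
      (Metric.ball_mem_nhds rc⁻¹ hδ))
    have hN' : ∀ k, |(r (k + N))⁻¹ - rc⁻¹| < δ := fun k => hN (k + N) (Nat.le_add_left _ _)
    choose y hy hyb using fun k => hstay _ (hN' k)
    obtain ⟨q, -, φ, hφ, hφq⟩ := (c.isCompact_box c.a).tendsto_subseq
      (x := fun k => y k (min τ T)) (fun k => hyb k _ (min_le_right _ _))
    have hφN : StrictMono fun k => φ k + N := fun a b h => Nat.add_lt_add_right (hφ h) N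
    refine ⟨fun k => φ k + N, fun k => y (φ k), hφN, fun k => ⟨?_, ?_⟩, ?_⟩
    · rw [hset]
      exact (hy (φ k)).mono (Iic_subset_Iic.2 (min_le_right _ _))
    · exact P.tendsto_sink_of_stay hlm he c (fun t ht => (hν _ (hN' _) t ht).1)
        (hν _ (hN' _) T le_rfl).2 (hy (φ k)) (hyb (φ k))
    · -- a limit of the solutions stays near the sink, so that it is the solution for the rate `rc`
      set T₁ := min τ T
      obtain ⟨R, hR1, hR2⟩ := c.exists_radius
      have hT₁ : ∀ t ≤ (0 : ℝ), t + T₁ ≤ T := fun t ht => by linarith [min_le_right τ T]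
      have hlim : Tendsto (fun k => shiftSig T₁ (P.base (r (φ k + N))⁻¹)) atTop
          (𝓝 (shiftSig T₁ (P.base rc⁻¹))) := by
        simp only [P.shiftSig_base]
        exact P.tendsto_sig ((hr.comp hφN.tendsto_atTop).inv₀ hrc.ne') tendsto_const_nhds
          (fun _ => gα_mem_Ioc _ _) (gα_mem_Ioc _ _)
      obtain ⟨z, hz0, -, hzl, hzs⟩ := exists_limit_solution P.contDiff_G hlim (I := fun _ => Iic 0)
        (fun k => ordConnected_Iic) (fun k => self_mem_Iic) (x := fun k t => y (φ k) (t + T₁))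
        (fun k => (hy (φ k)).shift T₁ fun t ht => hT₁ t ht) (R := R)
        (fun k t ht => hR1 _ (hyb _ _ (hT₁ t ht)))
        (fun k t ht => hR2 _ (hν _ (hN' _) (t + T₁) (hT₁ t ht)).1) (q := q)
        (by simpa [Function.comp_def] using hφq)
      have hz := hzs (Iic 0) fun t ht => ⟨fun _ => t, tendsto_const_nhds, Eventually.of_forall
        fun _ => ht⟩
      have hzb : ∀ t ≤ 0, z t ∈ c.box c.a := fun t ht =>
        (c.isClosed_box c.a).mem_of_tendsto (hzl (fun _ => t) t tendsto_const_nhds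
          (Eventually.of_forall fun _ => ht)) (Eventually.of_forall fun k => hyb _ _ (hT₁ t ht))
      have h1 : |rc⁻¹ - rc⁻¹| < δ := by simpa using hδ
      have hz' : Sol P.G (P.base rc⁻¹) (Iic T₁) (fun t => z (t + -T₁)) := by
        have := hz.shift (-T₁) (J := Iic T₁) fun t ht => by
          have := ht.out; simp only [mem_Iic]; linarith
        simpa using this
      have hze := P.tendsto_sink_of_stay hlm he c
        (fun t ht => (hν _ h1 t (ht.trans (min_le_right _ _))).1) (hν _ h1 T le_rfl).2 hz'
        (fun t ht => hzb _ (by linarith))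
      have := huniq rc hrc T₁ _ x hz' (hx.mono (Iic_subset_Iic.2 (min_le_left _ _))) hze hxc T₁ le_rfl
      rw [← this]
      simpa [hz0, Function.comp_def] using hφq

end Past

end Sys

/-! ### Trajectories and unstable branches of the compactified system -/

variable {n d : ℕ}

section TimeScale

variable {V : Type*} [NormedAddCommGroup V] [NormedSpace ℝ V]

theorem mapClusterPt_comp_mul {y : ℝ → V} {c : ℝ} (hc : 0 < c) (q : V) :
    MapClusterPt q atTop (fun t => y (c * t)) ↔ MapClusterPt q atTop y := by
  have h : map (fun t : ℝ => c * t) atTop = atTop := by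
    have h1 : Tendsto (fun t : ℝ => c * t) atTop atTop := tendsto_id.const_mul_atTop hc
    have h2 : Tendsto (fun t : ℝ => c⁻¹ * t) atTop atTop := tendsto_id.const_mul_atTop (inv_pos.2 hc)
    refine le_antisymm h1 ?_
    have h3 : map (fun t : ℝ => c * t) (map (fun t : ℝ => c⁻¹ * t) atTop) = atTop := by
      rw [map_map]
      convert map_id using 2
      funext t
      simp [mul_inv_cancel_left₀ hc.ne']
    calc (atTop : Filter ℝ) = _ := h3.symm
      _ ≤ _ := map_mono h2
  have h' : map (fun t => y (c * t)) atTop = map y atTop := by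
    conv_rhs => rw [← h, map_map]
    rfl
  simp only [MapClusterPt, h']

theorem range_comp_mul {y : ℝ → V} {c : ℝ} (hc : 0 < c) : range (fun t => y (c * t)) = range y := by
  ext q
  constructor
  · rintro ⟨t, rfl⟩; exact ⟨_, rfl⟩
  · rintro ⟨t, rfl⟩; exact ⟨c⁻¹ * t, by simp [mul_inv_cancel_left₀ hc.ne']⟩

theorem IsConnectingOrbit.smul {F : V → V} {X A : Set V} {p : V} {y : ℝ → V}
    (h : IsConnectingOrbit F X p A y) {c : ℝ} (hc : 0 < c) :
    IsConnectingOrbit (fun x => c • F x) X p A (fun t => y (c * t)) where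
  solution := h.solution.comp_mul c fun _ _ => mem_univ _
  source := h.source.comp (tendsto_id.const_mul_atBot hc)
  target := by simp only [mapClusterPt_comp_mul hc]; exact h.target

theorem SetConnects.smul {F : V → V} {X K : Set V} {p : V} (h : SetConnects F X p K) {c : ℝ}
    (hc : 0 < c) : SetConnects (fun x => c • F x) X p K := by
  obtain ⟨A, hA, hpA, y, hy, rfl⟩ := h
  exact ⟨A, hA.smul hc, hpA, _, hy.smul hc, by rw [range_comp_mul hc]⟩

theorem setConnects_smul {F : V → V} {X K : Set V} {p : V} {c : ℝ} (hc : 0 < c) :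
    SetConnects (fun x => c • F x) X p K ↔ SetConnects F X p K := by
  refine ⟨fun h => ?_, fun h => h.smul hc⟩
  have := h.smul (inv_pos.2 hc)
  rwa [smul_smul_field hc] at this

end TimeScale

theorem theta_eq_one {α t s : ℝ} (hs : s ∈ Icc (-1 : ℝ) 1) (h : theta α t s = 1) : s = 1 := by
  have := theta_add α (-t) t hs
  rwa [h, theta_one, add_neg_cancel, theta_zero, eq_comm] at this

/-- In backward time only the points at `s = 1` stay away from `s = -1`. -/
theorem eq_one_of_tendsto_theta {α : ℝ} (h0 : 0 < α) {s : ℝ} (hs : s ∈ Icc (-1 : ℝ) 1)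
    (h : Tendsto (fun t => theta α t s) atBot (𝓝 1)) : s = 1 := by
  by_contra hne
  rcases eq_or_lt_of_le hs.1 with h1 | h1
  · rw [← h1] at h
    simp only [theta_neg_one] at h
    have := tendsto_nhds_unique h tendsto_const_nhds
    norm_num at this
  · have hs' : s ∈ Ioo (-1 : ℝ) 1 := ⟨h1, lt_of_le_of_ne hs.2 hne⟩
    rw [← gα_hα h0 hs'] at h
    simp only [theta_gα] at h
    have h2 : Tendsto (fun t => gα α (hα α s + t)) atBot (𝓝 (-1)) :=
      (tendsto_gα_atBot h0).comp (tendsto_atBot_add_const_left _ _ tendsto_id)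
    have := tendsto_nhds_unique h h2
    norm_num at this

namespace Cpt

variable {P : Sys n d} (Q : Cpt P)

/-- The forward trajectory in the compactified system is the graph of the solution through the given
point. -/
theorem mem_compactTrj_point {x₀ : E n} {τ₀ rc : ℝ} (hS : P.Determined (.point x₀ τ₀) rc) {r : ℝ}
    (hr : 0 < r) {q : E n × ℝ} : q ∈ compactTrj (Q.F r) Q.X P.α (.point x₀ τ₀) ↔
      ∃ τ p, SolAt P.f P.Λ (.point x₀ τ₀) r τ p ∧ q = (p, gα P.α τ) := by
  have h0 : SolAt P.f P.Λ (.point x₀ τ₀) r τ₀ x₀ :=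
    P.solAt_iff.2 ⟨self_mem_Ici, _, P.sol_start x₀ τ₀ _, rfl, rfl⟩
  constructor
  · rintro ⟨t, ht⟩
    obtain ⟨h1, h2, h3⟩ := (Q.reaches_iff (gα_mem_Ioc _ _)).1 (show Reaches _ _ t _ (q.1, q.2) from ht)
    refine ⟨τ₀ + t, q.1, (hS.solAt_add_iff hr h0 h1).2 h3, ?_⟩
    rw [← theta_gα, ← h2]
  · rintro ⟨τ, p, hp, rfl⟩
    have hτ : τ₀ ≤ τ := hp.1
    have h1 : SolAt P.f P.Λ (.point x₀ τ₀) r (τ₀ + (τ - τ₀)) p := by rwa [add_sub_cancel]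
    refine ⟨τ - τ₀, (Q.reaches_iff (gα_mem_Ioc _ _)).2 ⟨by linarith, ?_,
      (hS.solAt_add_iff hr h0 (by linarith)).1 h1⟩⟩
    rw [theta_gα, add_sub_cancel]

/-- The trajectory with `s > -1` in the unstable manifold of the sink is the graph of the solution that
emerges from the sink. -/
theorem mem_compactTrj_past {e : E n} {r : ℝ} {q : E n × ℝ} :
    q ∈ compactTrj (Q.F r) Q.X P.α (.past e) ↔
      ∃ τ p, SolAt P.f P.Λ (.past e) r τ p ∧ q = (p, gα P.α τ) := by
  have hset : ∀ τ, (Start.past e).times ∩ Iic τ = Iic τ := fun τ => univ_inter _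
  constructor
  · rintro ⟨⟨y, hy, hy0, hlim⟩, hq⟩
    have h1 := Q.snd_eq ordConnected_Iic self_mem_Iic hy
    rw [hy0] at h1
    have hqX : q.2 ∈ Icc (-1 : ℝ) 1 := by
      have := Q.subset_Icc (hy.2 0 self_mem_Iic)
      rwa [hy0] at this
    have h2 : Tendsto (fun t => (y t).2) atBot (𝓝 (-1)) := (continuous_snd.tendsto (e, -1)).comp hlim
    have h3 : Tendsto (fun t => (y t).1) atBot (𝓝 e) := (continuous_fst.tendsto (e, -1)).comp hlim
    have hq1 : q.2 ≠ 1 := by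
      intro hq1
      have h4 : Tendsto (fun t => (y t).2) atBot (𝓝 1) := by
        refine tendsto_const_nhds.congr' ?_
        filter_upwards [eventually_le_atBot 0] with t ht
        rw [h1 t ht, hq1, theta_one]
      have := tendsto_nhds_unique h2 h4
      norm_num at this
    have hs : q.2 ∈ Ioo (-1 : ℝ) 1 := ⟨hq, lt_of_le_of_ne hqX.2 hq1⟩
    set τ := hα P.α q.2
    have hτ : gα P.α τ = q.2 := gα_hα P.α_pos hs
    refine ⟨τ, q.1, P.solAt_iff.2 ⟨trivial, fun t => (y (t + -τ)).1, ?_, ?_, by simp [hy0]⟩,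
      by rw [hτ]⟩
    · rw [hset]
      have h5 := Q.sol_of_isSolution ordConnected_Iic self_mem_Iic hy (s := gα P.α τ) (gα_mem_Ioc _ _)
        (by rw [hy0, hτ])
      rw [← P.shiftSig_base] at h5
      have := h5.shift (-τ) (J := Iic τ) fun t ht => by have := ht.out; simp only [mem_Iic]; linarith
      simpa using this
    · exact h3.comp (tendsto_atBot_add_const_right _ _ tendsto_id)
  · rintro ⟨τ, p, hp, rfl⟩
    obtain ⟨-, x, hx, hxc, rfl⟩ := P.solAt_iff.1 hp
    rw [hset] at hx
    have h1 : Sol P.G (P.sig r⁻¹ (gα P.α τ)) (Iic 0) (fun t => x (t + τ)) := by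
      rw [← P.shiftSig_base]
      exact hx.shift τ fun t ht => by have := ht.out; simp only [mem_Iic]; linarith
    refine ⟨⟨_, Q.isSolution_of_sol (gα_mem_Ioc _ _) h1, by simp [theta_zero], ?_⟩,
      (gα_mem _ _).1⟩
    have h2 : Tendsto (fun t => x (t + τ)) atBot (𝓝 e) :=
      Tendsto.comp hxc (tendsto_atBot_add_const_right _ _ tendsto_id)
    refine h2.prodMk_nhds ?_
    simp only [theta_gα]
    exact (tendsto_gα_atBot P.α_pos).comp (tendsto_atBot_add_const_left _ _ tendsto_id)

/-- Connecting orbits of the compactified system at infinite time are those of the limit system. -/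
theorem isConnectingOrbit_lift {r : ℝ} {η : E n} {A : Set (E n)} {y : ℝ → E n}
    (h : IsConnectingOrbit (P.H r⁻¹) univ η A y) :
    IsConnectingOrbit (Q.F r) Q.X (η, 1) (A ×ˢ {1}) (fun t => (y t, 1)) := by
  have h1 := Q.isSolution_of_sol (r := r) (s := 1) (by norm_num) (I := univ) (x := y)
    (by rw [P.sig_one]; exact P.isSolution_H_iff.1 h.solution)
  simp only [theta_one] at h1
  refine ⟨h1, h.source.prodMk_nhds tendsto_const_nhds, ?_⟩
  rw [← h.target]
  have hcl : ∀ q s, MapClusterPt (q, s) atTop (fun t => (y t, (1 : ℝ))) ↔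
      MapClusterPt q atTop y ∧ s = 1 := by
    intro q s
    constructor
    · intro h2
      have h3 : MapClusterPt q atTop y := h2.continuousAt_comp (f := Prod.fst) continuousAt_fst
      have h4 : MapClusterPt s atTop (fun _ : ℝ => (1 : ℝ)) :=
        h2.continuousAt_comp (f := Prod.snd) continuousAt_snd
      have h5 : s ∈ closure {(1 : ℝ)} := h4.mem_closure_of_mem _ (by simp)
      rw [closure_singleton] at h5
      exact ⟨h3, h5⟩
    · rintro ⟨h2, rfl⟩
      exact h2.continuousAt_comp (f := fun p : E n => (p, (1 : ℝ)))
        (show Continuous fun p : E n => (p, (1 : ℝ)) by fun_prop).continuousAt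
  ext ⟨q, s⟩
  simp only [mem_ofPred_eq, hcl]
  constructor
  · rintro ⟨-, h2, rfl⟩
    exact ⟨⟨trivial, h2⟩, rfl⟩
  · rintro ⟨⟨-, h2⟩, rfl⟩
    exact ⟨Q.mem_X (by norm_num), h2, rfl⟩

end Cpt

/-! ### The two halves of the unstable manifold -/

variable {n d : ℕ}

section Emanates

variable {W : Type*} [NormedAddCommGroup W] [NormedSpace ℝ W] [FiniteDimensional ℝ W]
  {G : E n × W → E n} {η : E n} {ν₀ : W}

namespace Chart

variable (c : Chart G η ν₀)

/-- The backward solution `y` emanates from the equilibrium on the side where `ℓ` is positive. -/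
structure Emanates (y : ℝ → E n) : Prop where
  sol : Sol G (fun _ => ν₀) (Iic 0) y
  tendsto : Tendsto y atBot (𝓝 η)
  pos : ∀ᶠ t in atBot, 0 < c.ℓ (y t - η)

theorem box_mem_nhds {b : ℝ} (hb : 0 < b) : c.box b ∈ 𝓝 η :=
  mem_of_superset ((c.isOpen_obox b).mem_nhds (c.mem_obox_self hb)) (c.obox_subset_box _)

theorem eventually_D_pos (hG : ContDiff ℝ 1 G) (h0 : G (η, ν₀) = 0) {y : ℝ → E n}
    (hy : Sol G (fun _ => ν₀) (Iic 0) y) (hlim : Tendsto y atBot (𝓝 η)) (hne : y 0 ≠ η) :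
    ∀ᶠ t in atBot, 0 < c.D (y t - η) := by
  obtain ⟨T, hT⟩ := eventually_atBot.1 (hlim.eventually (c.box_mem_nhds c.a_pos))
  filter_upwards [eventually_le_atBot T, eventually_le_atBot 0] with t ht ht0
  have h1 := c.D_pos_of_backward hG (ν := ν₀) (by simp [c.ε_pos.le]) h0
    (x := fun u => y (u + t)) (hy.shift t fun u hu => by
      have := hu.out; simp only [mem_Iic]; linarith) (fun u hu => hT _ (by linarith))
    (hlim.comp (tendsto_atBot_add_const_right _ _ tendsto_id))
  simp only [zero_add] at h1
  refine h1 fun h => hne ?_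
  exact Sol.unique hG ordConnected_Iic continuousOn_const hy (sol_const h0 (Iic 0)) (t₀ := t) ht0 h 0
    self_mem_Iic

/-- Every nontrivial orbit in the unstable manifold lies on one of the two sides: `ℓ` does not vanish in
the cone `0 < D`, hence has a constant sign. -/
theorem emanates_or_neg (hG : ContDiff ℝ 1 G) (h0 : G (η, ν₀) = 0) {y : ℝ → E n}
    (hy : Sol G (fun _ => ν₀) (Iic 0) y) (hlim : Tendsto y atBot (𝓝 η)) (hne : y 0 ≠ η) :
    c.Emanates y ∨ c.neg.Emanates y := by
  obtain ⟨T, hT⟩ := eventually_atBot.1 ((c.eventually_D_pos hG h0 hy hlim hne).and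
    (eventually_le_atBot 0))
  have hl : ∀ t ≤ T, c.ℓ (y t - η) ≠ 0 := by
    intro t ht h
    have := (hT t ht).1
    rw [D, h] at this
    nlinarith [sq_nonneg ‖c.S (y t - η)‖]
  have hcont : ContinuousOn (fun t => c.ℓ (y t - η)) (Iic T) :=
    c.ℓ.continuous.comp_continuousOn ((hy.continuousOn.mono fun t ht => (hT t ht).2).sub
      continuousOn_const)
  have hsign : ∀ s ≤ T, ∀ t ≤ T, 0 < c.ℓ (y s - η) → 0 < c.ℓ (y t - η) := by
    intro s hs t ht hpos
    by_contra hcon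
    push Not at hcon
    obtain ⟨u, hu, hu0⟩ := isPreconnected_Iic.intermediate_value (show t ∈ Iic T from ht)
      (show s ∈ Iic T from hs) hcont ⟨hcon, hpos.le⟩
    exact hl u hu hu0
  rcases lt_or_gt_of_ne (hl T le_rfl) with h | h
  · refine Or.inr ⟨hy, hlim, ?_⟩
    filter_upwards [eventually_le_atBot T] with t ht
    show 0 < -c.ℓ (y t - η)
    by_contra hcon
    push Not at hcon
    have := hsign t ht T le_rfl (lt_of_le_of_ne (by linarith) (hl t ht).symm)
    linarith
  · refine Or.inl ⟨hy, hlim, ?_⟩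
    filter_upwards [eventually_le_atBot T] with t ht
    exact hsign T le_rfl t ht h

theorem Emanates.not_neg {c : Chart G η ν₀} {y : ℝ → E n} (h : c.Emanates y)
    (h' : c.neg.Emanates y) : False := by
  obtain ⟨t, ht, ht'⟩ := (h.pos.and h'.pos).exists
  have : 0 < -c.ℓ (y t - η) := ht'
  linarith

theorem Emanates.shift {c : Chart G η ν₀} {y : ℝ → E n} (h : c.Emanates y) {T : ℝ} (hT : T ≤ 0) :
    c.Emanates (fun t => y (t + T)) where
  sol := h.sol.shift T fun t ht => by have := ht.out; simp only [mem_Iic]; linarith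
  tendsto := h.tendsto.comp (tendsto_atBot_add_const_right _ _ tendsto_id)
  pos := (tendsto_atBot_add_const_right _ T tendsto_id).eventually h.pos

theorem Emanates.shift_full {c : Chart G η ν₀} {y : ℝ → E n} (h : c.Emanates y)
    (hy : Sol G (fun _ => ν₀) univ y) (T : ℝ) : c.Emanates (fun t => y (t + T)) where
  sol := hy.shift T fun _ _ => mem_univ _
  tendsto := h.tendsto.comp (tendsto_atBot_add_const_right _ _ tendsto_id)
  pos := (tendsto_atBot_add_const_right _ T tendsto_id).eventually h.pos

/-- On each side only one orbit emanates from the equilibrium. -/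
theorem Emanates.exists_eq (hG : ContDiff ℝ 1 G) {c : Chart G η ν₀} {y z : ℝ → E n}
    (hy : c.Emanates y) (hz : c.Emanates z) : ∃ t ≤ 0, ∃ u ≤ 0, y t = z u := by
  obtain ⟨T, hT⟩ := eventually_atBot.1 ((hy.tendsto.eventually (c.box_mem_nhds c.a_pos)).and
    ((hz.tendsto.eventually (c.box_mem_nhds c.a_pos)).and
      (hy.pos.and (hz.pos.and (eventually_le_atBot 0)))))
  obtain ⟨-, -, hy1, hz1, hT0⟩ := hT T le_rfl
  have hy' := hy.shift hT0
  have hz' := hz.shift hT0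
  have hyb : ∀ t ≤ (0 : ℝ), y (t + T) ∈ c.box c.a := fun t ht => (hT _ (by linarith)).1
  have hzb : ∀ t ≤ (0 : ℝ), z (t + T) ∈ c.box c.a := fun t ht => (hT _ (by linarith)).2.1
  have hε : ‖ν₀ - ν₀‖ ≤ c.ε := by simp [c.ε_pos.le]
  rcases le_total (c.ℓ (y T - η)) (c.ℓ (z T - η)) with h | h
  · obtain ⟨s, hs, heq⟩ := c.unstable_unique hG hε hy'.sol hyb hy'.tendsto hz'.sol hzb hz'.tendsto
      (by simpa using hy1) (by simpa using h)
    exact ⟨T, hT0, -s + T, by linarith, by simpa using heq⟩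
  · obtain ⟨s, hs, heq⟩ := c.unstable_unique hG hε hz'.sol hzb hz'.tendsto hy'.sol hyb hy'.tendsto
      (by simpa using hz1) (by simpa using h)
    exact ⟨-s + T, by linarith, T, hT0, by simpa using heq.symm⟩

/-- The forward continuation of a backward solution is a part of any full solution that emanates on
the same side. -/
theorem Emanates.exists_shift (hG : ContDiff ℝ 1 G) {c : Chart G η ν₀} {y z : ℝ → E n}
    (hz : c.Emanates z) (hy : c.Emanates y) (hy' : Sol G (fun _ => ν₀) univ y) :
    ∃ a, ∀ t ≤ 0, z t = y (t + a) := by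
  obtain ⟨t, ht, u, hu, heq⟩ := Emanates.exists_eq hG hz hy
  refine ⟨u - t, Sol.unique hG ordConnected_Iic continuousOn_const hz.sol
    (hy'.shift (u - t) fun _ _ => mem_univ _) (t₀ := t) ht ?_⟩
  simp [heq]

theorem Emanates.range_eq (hG : ContDiff ℝ 1 G) {c : Chart G η ν₀} {y z : ℝ → E n}
    (hy : c.Emanates y) (hy' : Sol G (fun _ => ν₀) univ y) (hz : c.Emanates z)
    (hz' : Sol G (fun _ => ν₀) univ z) : ∃ a, ∀ t, z t = y (t + a) := by
  obtain ⟨a, ha⟩ := Emanates.exists_shift hG hz hy hy'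
  refine ⟨a, fun t => Sol.unique hG ordConnected_univ continuousOn_const hz'
    (hy'.shift a fun _ _ => mem_univ _) (mem_univ 0) (ha 0 le_rfl) t (mem_univ t)⟩

end Chart

end Emanates

namespace Cpt

variable {P : Sys n d} (Q : Cpt P)

/-- In the slice at infinite time the compactified system is the limit system. -/
theorem sol_slice {r : ℝ} {I : Set ℝ} (hI : I.OrdConnected) (h0 : (0 : ℝ) ∈ I) {y : ℝ → E n × ℝ}
    (hy : IsSolution (Q.F r) Q.X I y) (h1 : (y 0).2 = 1) :
    Sol P.G (fun _ => (r⁻¹, P.lp)) I (fun t => (y t).1) ∧ ∀ t ∈ I, (y t).2 = 1 := by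
  refine ⟨?_, fun t ht => ?_⟩
  · have := Q.sol_of_isSolution hI h0 hy (s := 1) (by norm_num) h1
    rwa [P.sig_one] at this
  · rw [Q.snd_eq hI h0 hy t ht, h1, theta_one]

theorem isSolution_slice {r : ℝ} {I : Set ℝ} {x : ℝ → E n}
    (hx : Sol P.G (fun _ => (r⁻¹, P.lp)) I x) : IsSolution (Q.F r) Q.X I (fun t => (x t, 1)) := by
  have := Q.isSolution_of_sol (r := r) (s := 1) (by norm_num) (I := I) (x := x)
    (by rw [P.sig_one]; exact hx)
  simpa only [theta_one] using this

theorem isConnectingOrbit_slice {r : ℝ} {η : E n} {A : Set (E n × ℝ)} {y : ℝ → E n × ℝ}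
    (h : IsConnectingOrbit (Q.F r) Q.X (η, 1) A y) (hy1 : (y 0).2 = 1) :
    A = (Prod.fst '' A) ×ˢ {1} ∧
      IsConnectingOrbit (P.H r⁻¹) univ η (Prod.fst '' A) (fun t => (y t).1) := by
  obtain ⟨hs, h1⟩ := Q.sol_slice ordConnected_univ (mem_univ 0) h.solution hy1
  have hco : IsConnectingOrbit (P.H r⁻¹) univ η {q | q ∈ univ ∧ MapClusterPt q atTop
      (fun t => (y t).1)} (fun t => (y t).1) :=
    ⟨P.isSolution_H_iff.2 hs, (continuous_fst.tendsto (η, (1 : ℝ))).comp h.source, rfl⟩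
  have h2 := (Q.isConnectingOrbit_lift hco).target
  have h3 : (fun t => ((y t).1, (1 : ℝ))) = y := by
    funext t
    rw [← h1 t (mem_univ t)]
  rw [h3, h.target] at h2
  have h4 : Prod.fst '' A = {q | q ∈ univ ∧ MapClusterPt q atTop (fun t => (y t).1)} := by
    rw [h2, fst_image_prod _ (singleton_nonempty _)]
  rw [h4]
  exact ⟨h2, hco⟩

/-- The unstable manifold of `(η, 1)` lies in the slice at infinite time, where it is the unstable
manifold of `η` for the limit system. -/
theorem branches_iff {r : ℝ} {η : E n} :
    (∀ B, IsUnstableBranch (Q.F r) Q.X (η, 1) B → BranchConnects (Q.F r) Q.X (η, 1) B) ↔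
      ∀ z : ℝ → E n, Sol P.G (fun _ => (r⁻¹, P.lp)) (Iic 0) z → Tendsto z atBot (𝓝 η) → z 0 ≠ η →
        ∃ A y, IsAttractor (P.H r⁻¹) univ A ∧ η ∉ A ∧ IsConnectingOrbit (P.H r⁻¹) univ η A y ∧
          z 0 ∈ range y := by
  constructor
  · intro h z hz hlim hne
    have hzs := Q.isSolution_slice hz
    obtain ⟨A, hA, hηA, y, hy, hB⟩ := h _ ⟨(z 0, 1), ⟨_, hzs, rfl, hlim.prodMk_nhds tendsto_const_nhds⟩,
      fun h => hne (congrArg Prod.fst h), rfl⟩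
    have hmem : ((z 0, (1 : ℝ)) : E n × ℝ) ∈ range y := by
      rw [← hB]
      refine ⟨0, Or.inl ⟨le_rfl, _, ⟨hzs.1.mono fun t ht => ht.2, fun t ht => hzs.2 t ht.2⟩, rfl, rfl⟩⟩
    obtain ⟨t₀, ht₀⟩ := hmem
    have hy1 : (y 0).2 = 1 := by
      have h1 := Q.snd_eq ordConnected_univ (mem_univ 0) hy.solution t₀ (mem_univ _)
      rw [ht₀] at h1
      exact theta_eq_one (Q.subset_Icc (hy.solution.2 0 (mem_univ 0))) h1.symm
    obtain ⟨hA1, hy'⟩ := Q.isConnectingOrbit_slice hy hy1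
    rw [hA1] at hA hηA
    exact ⟨_, _, Q.isAttractor_iff.1 hA, fun h => hηA ⟨h, rfl⟩, hy', t₀, by simp [ht₀]⟩
  · rintro h B ⟨⟨q, s⟩, ⟨y, hy, hy0, hlim⟩, hne, rfl⟩
    have hs1 : s = 1 := by
      have h1 : Tendsto (fun t => (y t).2) atBot (𝓝 1) :=
        (continuous_snd.tendsto (η, (1 : ℝ))).comp hlim
      have hsI := Q.subset_Icc (hy.2 0 self_mem_Iic)
      rw [hy0] at hsI
      refine eq_one_of_tendsto_theta P.α_pos hsI (h1.congr' ?_)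
      filter_upwards [eventually_le_atBot 0] with t ht
      rw [Q.snd_eq ordConnected_Iic self_mem_Iic hy t ht, hy0]
    subst hs1
    obtain ⟨hz, -⟩ := Q.sol_slice ordConnected_Iic self_mem_Iic hy (by rw [hy0])
    have hz0 : (y 0).1 = q := by rw [hy0]
    obtain ⟨A, x, hA, hηA, hx, t₀, ht₀⟩ := h _ hz ((continuous_fst.tendsto (η, (1 : ℝ))).comp hlim)
      (fun h => hne (by rw [← hz0, h]))
    simp only [hz0] at ht₀
    refine ⟨A ×ˢ {1}, Q.isAttractor_iff.2 hA, fun h => hηA h.1, _, Q.isConnectingOrbit_lift hx, ?_⟩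
    have hxs := P.isSolution_H_iff.1 hx.solution
    ext ⟨p, s⟩
    constructor
    · rintro ⟨t, ⟨ht, w, hw, hw0, hwt⟩ | ⟨ht, w, hw, hw0, hwt⟩⟩
      · -- forward part of the trajectory
        obtain ⟨hw1, hw2⟩ := Q.sol_slice ordConnected_Icc ⟨le_rfl, ht⟩ hw (by rw [hw0])
        refine ⟨t + t₀, ?_⟩
        have h1 := Sol.unique P.contDiff_G ordConnected_Icc continuousOn_const hw1
          (hxs.shift t₀ fun _ _ => mem_univ _) (t₀ := 0) ⟨le_rfl, ht⟩ (by simp [hw0, ht₀]) t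
          ⟨ht, le_rfl⟩
        have h2 := hw2 t ⟨ht, le_rfl⟩
        rw [hwt] at h1 h2
        exact Prod.ext h1.symm h2.symm
      · -- backward part of the trajectory
        have hs : s = 1 := by
          have h1 := Q.snd_eq ordConnected_Icc ⟨le_rfl, ht⟩ hw t ⟨ht, le_rfl⟩
          have h2 := Q.subset_Icc (hw.2 0 ⟨le_rfl, ht⟩)
          rw [hw0] at h1 h2
          rw [hwt] at h1
          exact theta_eq_one h2 h1.symm
        obtain ⟨hw1, hw2⟩ := Q.sol_slice ordConnected_Icc ⟨le_rfl, ht⟩ hw (by rw [hw0, hs])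
        refine ⟨t₀ - t, ?_⟩
        have h1 := Sol.unique P.contDiff_G ordConnected_Icc continuousOn_const hw1
          (hxs.shift (t₀ - t) fun _ _ => mem_univ _) (t₀ := t) ⟨ht, le_rfl⟩ (by simp [hwt, ht₀]) 0
          ⟨le_rfl, ht⟩
        rw [hw0, zero_add] at h1
        exact Prod.ext h1.symm hs.symm
    · rintro ⟨t, ht⟩
      obtain rfl : x t = p := congrArg Prod.fst ht
      obtain rfl : 1 = s := congrArg Prod.snd ht
      rcases le_total t₀ t with h1 | h1
      · refine ⟨t - t₀, Or.inl ⟨by linarith, _, Q.isSolution_slice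
          (hxs.shift t₀ (J := Icc 0 (t - t₀)) fun _ _ => mem_univ _), by simp [ht₀], by simp⟩⟩
      · refine ⟨t₀ - t, Or.inr ⟨by linarith, _, Q.isSolution_slice
          (hxs.shift t (J := Icc 0 (t₀ - t)) fun _ _ => mem_univ _), by simp, by simp [ht₀]⟩⟩

end Cpt

/-! ### The sides of the stable manifold -/

section Components

variable {Y : Type*} [MetricSpace Y]

theorem connectedComponentIn_eq_left {A B : Set Y} (hA : IsPreconnected A)
    (h1 : Disjoint (closure A) B) (h2 : Disjoint A (closure B)) {z : Y} (hz : z ∈ A) :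
    connectedComponentIn (A ∪ B) z = A := by
  have hsep : SeparatedNhds A B := separatedNhds_iff_disjoint.2
    (CompletelyNormalSpace.completely_normal h1 h2)
  obtain ⟨U, V, hU, hV, hAU, hBV, hUV⟩ := hsep
  refine Subset.antisymm ?_ (hA.subset_connectedComponentIn hz subset_union_left)
  have hC := isPreconnected_connectedComponentIn (F := A ∪ B) (x := z)
  have hsub := connectedComponentIn_subset (A ∪ B) z
  have hCU : connectedComponentIn (A ∪ B) z ⊆ U :=
    hC.subset_left_of_subset_union hU hV hUV (hsub.trans (union_subset_union hAU hBV))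
      ⟨z, mem_connectedComponentIn (Or.inl hz), hAU hz⟩
  intro x hx
  rcases hsub hx with h | h
  · exact h
  · exact absurd (hBV h) (disjoint_left.1 hUV (hCU hx))

/-- Two separated nonempty connected sets are the connected components of their union. -/
theorem image_connectedComponentIn_union {A B : Set Y} (hA : IsPreconnected A)
    (hB : IsPreconnected B) (hAne : A.Nonempty) (hBne : B.Nonempty) (h1 : Disjoint (closure A) B)
    (h2 : Disjoint A (closure B)) :
    (fun z => connectedComponentIn (A ∪ B) z) '' (A ∪ B) = {A, B} := by
  have hl : ∀ z ∈ A, connectedComponentIn (A ∪ B) z = A := fun z hz =>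
    connectedComponentIn_eq_left hA h1 h2 hz
  have hr : ∀ z ∈ B, connectedComponentIn (A ∪ B) z = B := fun z hz => by
    rw [union_comm]
    exact connectedComponentIn_eq_left hB h2.symm h1.symm hz
  ext C
  constructor
  · rintro ⟨z, hz | hz, rfl⟩
    · exact Or.inl (hl z hz)
    · exact Or.inr (hr z hz)
  · rintro (rfl | rfl)
    · obtain ⟨z, hz⟩ := hAne
      exact ⟨z, Or.inl hz, hl z hz⟩
    · obtain ⟨z, hz⟩ := hBne
      exact ⟨z, Or.inr hz, hr z hz⟩

end Components

variable {n d : ℕ} {P : Sys n d} {η : E n} {ρ₀ : ℝ}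

namespace Chart

theorem convex_obox {W : Type*} [NormedAddCommGroup W] [NormedSpace ℝ W] {G : E n × W → E n} {ν₀ : W}
    (c : Chart G η ν₀) (b : ℝ) : Convex ℝ (c.obox b) := by
  have h1 : c.obox b = c.ℓ ⁻¹' Metric.ball (c.ℓ η) b ∩ c.S ⁻¹' Metric.ball (c.S η) b := by
    ext x
    simp only [obox, mem_inter_iff, mem_preimage, Metric.mem_ball, dist_eq_norm,
      map_sub]
    rfl
  rw [h1]
  exact ((convex_ball _ _).linear_preimage c.ℓ.toLinearMap).inter
    ((convex_ball _ _).linear_preimage c.S.toLinearMap)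

variable (c : Chart P.G η (ρ₀, P.lp))

/-- All states in the block of size `b`, with times and rates, from which the block of size `b'` is
left through the face where `ℓ` is positive. -/
def exitSet (rc ε δ b b' : ℝ) : Set ((E n × ℝ) × ℝ) :=
  {z | z.1.1 ∈ c.obox b ∧ z.1.2 ∈ Ioc (1 - ε) 1 ∧ z.2 ∈ Ioo (rc - δ) (rc + δ) ∧
    ∃ t, c.ExitsAt (P.sig z.2⁻¹ z.1.2) z.1.1 b' t}

/-- For rates `ε`-close to `rc` and times after `1 - ε` the input is close to its limit. -/
def Uniform (rc ε b : ℝ) : Prop :=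
  0 < ε ∧ ε ≤ 1 ∧ ∀ r ∈ Ioo (rc - ε) (rc + ε), 0 < r ∧
    ∀ s ∈ Ioc (1 - ε) 1, ∀ t ≥ 0, c.Good b (P.sig r⁻¹ s t)

theorem mem_Ioc_of_le {ε s : ℝ} (hε : ε ≤ 1) (hs : s ∈ Ioc (1 - ε) 1) : s ∈ Ioc (-1 : ℝ) 1 :=
  ⟨by linarith [hs.1], hs.2⟩

theorem Uniform.at_rate {c : Chart P.G η (ρ₀, P.lp)} {rc ε δ b r : ℝ} (h : c.Uniform rc ε b)
    (hδ : δ ≤ ε) (hr : r ∈ Ioo (rc - δ) (rc + δ)) :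
    0 < r ∧ ∀ s ∈ Ioc (1 - ε) 1, ∀ t ≥ 0, c.Good b (P.sig r⁻¹ s t) :=
  h.2.2 r ⟨by linarith [hr.1], by linarith [hr.2]⟩

theorem Uniform.neg {c : Chart P.G η (ρ₀, P.lp)} {rc ε b : ℝ} (h : c.Uniform rc ε b) :
    c.neg.Uniform rc ε b :=
  ⟨h.1, h.2.1, fun r hr => ⟨(h.2.2 r hr).1, fun s hs t ht =>
    c.good_neg.2 ((h.2.2 r hr).2 s hs t ht)⟩⟩

theorem Uniform.mono {c : Chart P.G η (ρ₀, P.lp)} {rc ε ε' b b' : ℝ} (h : c.Uniform rc ε b)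
    (hε' : 0 < ε') (hε : ε' ≤ ε) (hb : b ≤ b') : c.Uniform rc ε' b' :=
  ⟨hε', hε.trans h.2.1, fun r hr => by
    have hr' : r ∈ Ioo (rc - ε) (rc + ε) := ⟨by linarith [hr.1], by linarith [hr.2]⟩
    exact ⟨(h.2.2 r hr').1, fun s hs t ht =>
      ((h.2.2 r hr').2 s ⟨by linarith [hs.1], hs.2⟩ t ht).mono c hb⟩⟩

theorem exists_uniform {rc : ℝ} (hrc : 0 < rc) {c : Chart P.G η (rc⁻¹, P.lp)} (h0 : P.f (η, P.lp) = 0)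
    {b : ℝ} (hb : 0 < b) : ∃ ε, c.Uniform rc ε b := by
  have hG0 : P.G (η, (rc⁻¹, P.lp)) = 0 := by
    show rc⁻¹ • P.f (η, P.lp) = 0
    rw [h0, smul_zero]
  obtain ⟨δ, hδ, h⟩ := P.eventually_sig (c.eventually_good P.contDiff_G.continuous hG0 hb)
  have h1 : ∀ᶠ r in 𝓝 rc, |r⁻¹ - rc⁻¹| < δ :=
    ((continuousAt_inv₀ hrc.ne').tendsto).eventually (Metric.ball_mem_nhds rc⁻¹ hδ)
  obtain ⟨δ', hδ', h2⟩ := Metric.eventually_nhds_iff.1 (h1.and (lt_mem_nhds hrc))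
  refine ⟨min (min δ δ') 1, lt_min (lt_min hδ hδ') one_pos, min_le_right _ _, fun r hr => ?_⟩
  have h3 : min (min δ δ') 1 ≤ δ' := (min_le_left _ _).trans (min_le_right _ _)
  have h4 : min (min δ δ') 1 ≤ δ := (min_le_left _ _).trans (min_le_left _ _)
  have hr' : dist r rc < δ' := by
    rw [Real.dist_eq, abs_lt]
    constructor <;> linarith [hr.1, hr.2]
  refine ⟨(h2 hr').2, fun s hs t ht => h _ _ (h2 hr').1 (by linarith [hs.1]) ?_ t ht⟩
  exact mem_Ioc_of_le (min_le_right _ _) hs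

/-- The set of states that exit through one face is connected: each state is moved in the unstable
direction into the part of the block that lies near the face. -/
theorem isPreconnected_exitSet {rc ε δ b b' : ℝ} (hb : 0 < b) (hbb : b ≤ b') (hba : b' ≤ c.a)
    (hε : c.Uniform rc ε b) (hδ0 : 0 < δ) (hδ : δ ≤ ε) {w : E n} (hw1 : c.ℓ w = 1) (hw2 : c.S w = 0) :
    IsPreconnected (c.exitSet rc ε δ b b') := by
  set top : Set ((E n × ℝ) × ℝ) := ((c.obox b ∩ {x | b / 2 ≤ c.ℓ (x - η)}) ×ˢ Ioc (1 - ε) 1) ×ˢ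
    Ioo (rc - δ) (rc + δ) with htop
  have htopc : IsPreconnected top := by
    refine Convex.isPreconnected (((Convex.inter (c.convex_obox b) ?_).prod (convex_Ioc _ _)).prod
      (convex_Ioo _ _))
    have : {x | b / 2 ≤ c.ℓ (x - η)} = c.ℓ ⁻¹' Ici (b / 2 + c.ℓ η) := by
      ext x
      simp only [mem_ofPred_eq, map_sub, mem_preimage, mem_Ici]
      constructor <;> intro h <;> linarith
    rw [this]
    exact (convex_Ici _).linear_preimage c.ℓ.toLinearMap
  -- states with `b / 2 ≤ ℓ` lie in the cone around the unstable direction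
  have htopsub : top ⊆ c.exitSet rc ε δ b b' := by
    rintro ⟨⟨p, s⟩, r⟩ ⟨⟨⟨hp, hp2⟩, hs⟩, hr⟩
    have hp2' : b / 2 ≤ c.ℓ (p - η) := hp2
    refine ⟨hp, hs, hr, c.exits_of_cone P.contDiff_G hb hbb hba ((hε.at_rate hδ hr).2 s hs)
      (c.obox_mono hbb hp) ?_ hp2'⟩
    linarith [hp.2]
  have hsw : ∀ (x : E n) (u : ℝ), c.ℓ (x + u • w - η) = c.ℓ (x - η) + u ∧
      c.S (x + u • w - η) = c.S (x - η) := by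
    intro x u
    have : x + u • w - η = (x - η) + u • w := by abel
    rw [this, map_add, map_add, map_smul, map_smul, hw1, hw2]
    simp
  have hbase : ((η + (b / 2) • w, (1 : ℝ)), rc) ∈ top := by
    obtain ⟨h1, h2⟩ := hsw η (b / 2)
    rw [sub_self, map_zero, zero_add] at h1
    rw [sub_self, map_zero] at h2
    have hε0 := hε.1
    refine ⟨⟨⟨⟨?_, ?_⟩, h1.ge⟩, by simpa using hε0, le_rfl⟩, by simpa using hδ0, by simpa using hδ0⟩
    · rw [h1, abs_of_pos (by positivity)]; linarith
    · rw [h2, norm_zero]; exact hb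
  refine isPreconnected_of_forall ((η + (b / 2) • w, (1 : ℝ)), rc) ?_
  rintro ⟨⟨p, s⟩, r⟩ ⟨hp, hs, hr, t, ht⟩
  simp only at hp hs hr ht
  -- the distance to `top` along `w`
  set m := max 0 (b / 2 - c.ℓ (p - η)) with hm
  have hm0 : 0 ≤ m := le_max_left _ _
  have hobox : ∀ u ∈ Icc 0 m, p + u • w ∈ c.obox b := by
    intro u hu
    obtain ⟨h1, h2⟩ := hsw p u
    refine ⟨?_, by rw [h2]; exact hp.2⟩
    have h3 := abs_lt.1 hp.1
    rw [h1, abs_lt]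
    refine ⟨by linarith [hu.1, h3.1], ?_⟩
    have h4 : u ≤ m := hu.2
    rcases le_total 0 (b / 2 - c.ℓ (p - η)) with h5 | h5
    · rw [hm, max_eq_right h5] at h4; linarith
    · rw [hm, max_eq_left h5] at h4; linarith [h3.2]
  set seg : Set ((E n × ℝ) × ℝ) := (fun u : ℝ => ((p + u • w, s), r)) '' Icc 0 m
  have hsegc : IsPreconnected seg :=
    isPreconnected_Icc.image _ (by fun_prop)
  have hsegsub : seg ⊆ c.exitSet rc ε δ b b' := by
    rintro _ ⟨u, hu, rfl⟩
    refine ⟨hobox u hu, hs, hr, ?_⟩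
    have hgood := fun t ht => ((hε.at_rate hδ hr).2 s hs t ht).mono c hbb
    exact c.exits_of_add P.contDiff_G (hb.trans_le hbb) hba hgood hw1 hw2 hu.1
      (c.obox_mono hbb (hobox u hu)) ht
  have hend : ((p + m • w, s), r) ∈ top := by
    refine ⟨⟨⟨hobox m ⟨hm0, le_rfl⟩, ?_⟩, hs⟩, hr⟩
    show b / 2 ≤ c.ℓ (p + m • w - η)
    rw [(hsw p m).1]
    linarith [le_max_right 0 (b / 2 - c.ℓ (p - η))]
  refine ⟨seg ∪ top, union_subset hsegsub htopsub, Or.inr hbase, Or.inl ⟨0, ⟨le_rfl, hm0⟩, by simp⟩,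
    hsegc.union _ ⟨m, ⟨hm0, le_rfl⟩, rfl⟩ hend htopc⟩

theorem isPreconnected_exitSet_neg {rc ε δ b b' : ℝ} (hb : 0 < b) (hbb : b ≤ b') (hba : b' ≤ c.a)
    (hε : c.Uniform rc ε b) (hδ0 : 0 < δ) (hδ : δ ≤ ε) {w : E n} (hw1 : c.ℓ w = 1) (hw2 : c.S w = 0) :
    IsPreconnected (c.neg.exitSet rc ε δ b b') := by
  refine c.neg.isPreconnected_exitSet hb hbb hba hε.neg hδ0 hδ (w := -w) ?_ ?_
  · show -c.ℓ (-w) = 1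
    rw [map_neg, _root_.neg_neg, hw1]
  · show c.S (-w) = 0
    rw [map_neg, hw2, _root_.neg_zero]

theorem exitSet_nonempty {rc ε δ b b' : ℝ} (hb : 0 < b) (hbb : b ≤ b') (hba : b' ≤ c.a)
    (hε : c.Uniform rc ε b) (hδ0 : 0 < δ) (hδ : δ ≤ ε) {w : E n} (hw1 : c.ℓ w = 1) (hw2 : c.S w = 0) :
    (c.exitSet rc ε δ b b').Nonempty := by
  have hε0 := hε.1
  have hs : (1 : ℝ) ∈ Ioc (1 - ε) 1 := ⟨by linarith, le_rfl⟩
  have hr : rc ∈ Ioo (rc - δ) (rc + δ) := ⟨by linarith, by linarith⟩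
  have h1 : c.ℓ (η + (b / 2) • w - η) = b / 2 := by simp [hw1]
  have h2 : c.S (η + (b / 2) • w - η) = 0 := by simp [hw2]
  have hp : η + (b / 2) • w ∈ c.obox b := by
    refine ⟨?_, by rw [h2, norm_zero]; exact hb⟩
    rw [h1, abs_of_pos (by positivity)]; linarith
  refine ⟨((η + (b / 2) • w, 1), rc), hp, hs, hr, c.exits_of_cone P.contDiff_G hb hbb hba
    ((hε.at_rate hδ hr).2 1 hs) (c.obox_mono hbb hp) ?_ h1.ge⟩
  rw [h1, h2, norm_zero]
  positivity

/-- The states that leave through one face are separated from those that leave through the other,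
because an exit persists under small perturbations (`not_tendsto_exits_neg`). -/
theorem disjoint_closure_exitSet {rc ε δ b b' : ℝ} (hb : 0 < b') (hba : b' < c.a)
    (hε : c.Uniform rc ε b') (hδ : δ ≤ ε) : Disjoint (c.exitSet rc ε δ b b') (closure (c.neg.exitSet rc ε δ b b')) := by
  rw [disjoint_left]
  rintro ⟨⟨p, s⟩, r⟩ ⟨hp, hs, hr, t₀, h₀⟩ hcl
  obtain ⟨z, hz, hlim⟩ := mem_closure_iff_seq_limit.1 hcl
  choose hzp hzs hzr t ht using hz
  have l1 : Tendsto (fun k => (z k).1) atTop (𝓝 (p, s)) := (continuous_fst.tendsto _).comp hlim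
  have lp : Tendsto (fun k => (z k).1.1) atTop (𝓝 p) := (continuous_fst.tendsto _).comp l1
  have ls : Tendsto (fun k => (z k).1.2) atTop (𝓝 s) := (continuous_snd.tendsto _).comp l1
  have lr : Tendsto (fun k => (z k).2) atTop (𝓝 r) := (continuous_snd.tendsto _).comp hlim
  have hr0 : 0 < r := (hε.at_rate hδ hr).1
  exact c.not_tendsto_exits_neg P.contDiff_G
    (P.tendsto_sig (lr.inv₀ hr0.ne') ls (fun k => mem_Ioc_of_le hε.2.1 (hzs k))
      (mem_Ioc_of_le hε.2.1 hs)) hb hba (fun k => (hε.at_rate hδ (hzr k)).2 _ (hzs k))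
    ((hε.at_rate hδ hr).2 s hs) lp h₀ ht

end Chart

/-- If the block is small, the points off the local stable manifold are those whose trajectory
leaves the block through one of the two faces. -/
theorem offStable_eq (Q : Cpt P) {rc ε δ b : ℝ} {c : Chart P.G η (ρ₀, P.lp)}
    (h0 : P.f (η, P.lp) = 0) (hb : 0 < b) (hba : b ≤ c.a) (hε : c.Uniform rc ε b) (hδ : δ ≤ ε) :
    offStable Q.F Q.X (c.obox b ×ˢ Ioi (1 - ε)) (η, 1) rc δ =
      c.exitSet rc ε δ b b ∪ c.neg.exitSet rc ε δ b b := by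
  ext ⟨⟨p, s⟩, r⟩
  constructor
  · rintro ⟨⟨⟨hp, hs⟩, hX⟩, hr, hoff⟩
    have hs' : s ∈ Ioc (1 - ε) 1 := ⟨hs, (Q.subset_Icc hX).2⟩
    have hs1 := Chart.mem_Ioc_of_le hε.2.1 hs'
    have hgood := (hε.at_rate hδ hr).2 s hs'
    rcases c.stays_or_exits P.contDiff_G hb hba hgood hp with ⟨y, hy, hy0, hyb⟩ | h | h
    · exfalso
      have hν₁ : ‖((r⁻¹, P.lp) : ℝ × E d) - (ρ₀, P.lp)‖ ≤ c.ε := by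
        have := ((hε.at_rate hδ hr).2 1 ⟨by linarith [hε.1], le_rfl⟩ 0 le_rfl).1
        rwa [P.sig_one] at this
      have hlim := c.tendsto_atTop_of_stays P.contDiff_G (P.tendsto_sig_atTop r⁻¹ hs1) hν₁
        (by show r⁻¹ • P.f (η, P.lp) = 0; rw [h0, smul_zero]) hy
        (fun t ht => c.box_mono hba (c.obox_subset_box _ (hyb t ht))) (fun t ht => (hgood t ht).1)
      refine hoff ⟨_, Q.isSolution_of_sol hs1 hy, by simp [hy0, theta_zero], fun t ht =>
        ⟨hyb t ht, ?_⟩, hlim.prodMk_nhds (tendsto_theta_atTop P.α_pos hs1)⟩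
      exact lt_of_lt_of_le hs (le_theta P.α_pos ht (Ioc_subset_Icc_self hs1))
    · exact Or.inl ⟨hp, hs', hr, h⟩
    · exact Or.inr ⟨by rw [c.obox_neg]; exact hp, hs', hr, h⟩
  · have key : ∀ c : Chart P.G η (ρ₀, P.lp), c.Uniform rc ε b →
        ((p, s), r) ∈ c.exitSet rc ε δ b b →
          ((p, s), r) ∈ offStable Q.F Q.X (c.obox b ×ˢ Ioi (1 - ε)) (η, 1) rc δ := by
      rintro c hε ⟨hp, hs, hr, t, ht⟩
      have hs1 := Chart.mem_Ioc_of_le hε.2.1 hs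
      refine ⟨⟨⟨hp, hs.1⟩, Q.mem_X hs1⟩, hr, ?_⟩
      rintro ⟨y, hy, hy0, hyN, -⟩
      exact c.not_stays_of_exits P.contDiff_G ht
        (Q.sol_of_isSolution ordConnected_Ici self_mem_Ici hy hs1 (by rw [hy0])) (by simp [hy0])
        (fun t ht => (hyN t ht).1)
    rintro (h | h)
    · exact key c hε h
    · have := key c.neg hε.neg h
      rwa [c.obox_neg] at this

/-- If the solutions for the rates below and above `rc` leave a block through different faces,
their trajectories lie on different sides of the stable manifold. -/
theorem sides_of_exits (Q : Cpt P) {S : Start n} {rc : ℝ} (hrc : 0 < rc) (hS : P.Determined S rc)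
    (h0 : P.f (η, P.lp) = 0) (hconv : SolConverges P.f P.Λ S rc η) {c : Chart P.G η (rc⁻¹, P.lp)}
    {w : E n} (hw1 : c.ℓ w = 1) (hw2 : c.S w = 0) {b : ℝ} (hb : 0 < b) (hba : b < c.a)
    {trj : ℝ → Set (E n × ℝ)} (htrj : ∀ r > 0, ∀ q, q ∈ trj r ↔
      ∃ τ p, SolAt P.f P.Λ S r τ p ∧ q = (p, gα P.α τ)) {T δ : ℝ} (hδ : 0 < δ)
    (hlow : ∀ r ∈ Ioo (rc - δ) rc, 0 < r → ∀ τ > T, ∀ p ∈ c.obox b, SolAt P.f P.Λ S r τ p →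
      ∃ t, c.neg.ExitsAt (P.sig r⁻¹ (gα P.α τ)) p b t)
    (hup : ∀ r ∈ Ioo rc (rc + δ), ∀ τ > T, ∀ p ∈ c.obox b, SolAt P.f P.Λ S r τ p →
      ∃ t, c.ExitsAt (P.sig r⁻¹ (gα P.α τ)) p b t) :
    LiesOnDifferentSides Q.F Q.X (η, 1) trj rc := by
  obtain ⟨ε₀, hε₀⟩ := Chart.exists_uniform hrc (c := c) h0 hb
  have hT1 : 0 < 1 - gα P.α T := by linarith [(gα_mem P.α T).2]
  obtain ⟨τ₁, p₁, h₁⟩ := hS.exists_solAt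
  obtain ⟨x, hx, hx0, hxlim⟩ := hS.tendsto_of_solConverges hrc hconv h₁
  -- times after `T` are singled out by `s > 1 - ε`
  set ε := min ε₀ (1 - gα P.α T)
  have hε0 : 0 < ε := lt_min hε₀.1 hT1
  have hε : c.Uniform rc ε b := hε₀.mono hε0 (min_le_left _ _) le_rfl
  have hTε : ∀ τ, 1 - ε < gα P.α τ → T < τ := by
    intro τ hτ
    have := min_le_right ε₀ (1 - gα P.α T)
    exact (gα_lt_iff P.α_pos).1 (by linarith)
  -- at the time `τ₂` the solutions for all rates near `rc` lie in the block
  obtain ⟨u, hu1, hu2, hu0⟩ := ((hxlim.eventually ((c.isOpen_obox b).mem_nhds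
    (c.mem_obox_self hb))).and ((((tendsto_gα_atTop P.α_pos).comp (tendsto_atTop_add_const_left _ τ₁
      tendsto_id)).eventually_const_lt (show 1 - ε < 1 by linarith)).and
        (eventually_ge_atTop 0))).exists
  have h₂ : SolAt P.f P.Λ S rc (τ₁ + u) (x u) := (hS.solAt_add_iff hrc h₁ hu0).2
    ⟨x, hx.mono Icc_subset_Ici_self, hx0, rfl⟩
  obtain ⟨δ₂, hδ₂, h₃⟩ := Metric.eventually_nhds_iff.1
    (hS.continuous _ _ h₂ _ ((c.isOpen_obox b).mem_nhds hu1))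
  set δ' := min (min δ δ₂) ε
  have hδ' : 0 < δ' := lt_min (lt_min hδ hδ₂) hε0
  have hδε : δ' ≤ ε := min_le_right _ _
  have hδδ : δ' ≤ δ := (min_le_left _ _).trans (min_le_left _ _)
  have hδδ₂ : δ' ≤ δ₂ := (min_le_left _ _).trans (min_le_right _ _)
  have hpos : ∀ r ∈ Ioo (rc - δ') (rc + δ'), 0 < r := fun r hr => (hε.at_rate hδε hr).1
  have hδrc : δ' ≤ rc := by
    by_contra hcon
    push Not at hcon
    exact lt_irrefl _ (hpos 0 ⟨by linarith, by linarith⟩)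
  have hne : ∀ r ∈ Ioo (rc - δ') (rc + δ'),
      (trj r ∩ c.obox b ×ˢ Ioi (1 - ε)).Nonempty := by
    intro r hr
    have hd : dist r rc < δ₂ := by
      rw [Real.dist_eq, abs_lt]
      constructor <;> linarith [hr.1, hr.2]
    obtain ⟨q, hq, hq'⟩ := h₃ hd
    exact ⟨(q, gα P.α (τ₁ + u)), (htrj r (hpos r hr) _).2 ⟨_, _, hq', rfl⟩, hq, hu2⟩
  have hN : ∀ τ p, (p, gα P.α τ) ∈ c.obox b ×ˢ Ioi (1 - ε) →
      T < τ ∧ p ∈ c.obox b ∧ gα P.α τ ∈ Ioc (1 - ε) 1 :=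
    fun τ p h => ⟨hTε τ h.2, h.1, h.2, (gα_mem P.α τ).2.le⟩
  refine ⟨δ', hδ', hδrc, c.obox b ×ˢ Ioi (1 - ε), (c.isOpen_obox b).prod isOpen_Ioi,
    ⟨c.mem_obox_self hb, by simpa using hε0⟩, c.neg.exitSet rc ε δ' b b, c.exitSet rc ε δ' b b, ?_, ?_,
    fun r hr => ⟨hne r ⟨hr.1, by linarith [hr.2]⟩, ?_⟩,
    fun r hr => ⟨hne r ⟨by linarith [hr.1], hr.2⟩, ?_⟩⟩
  · intro heq
    obtain ⟨z, hz⟩ := c.exitSet_nonempty hb le_rfl hba.le hε hδ' hδε hw1 hw2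
    have h1 := c.disjoint_closure_exitSet hb hba hε hδε (b := b)
    rw [heq] at h1
    exact disjoint_left.1 h1 hz (subset_closure hz)
  · rw [offStable_eq Q h0 hb hba.le hε hδε, union_comm, pair_comm, pair_comm]
    refine image_connectedComponentIn_union
      (c.isPreconnected_exitSet_neg hb le_rfl hba.le hε hδ' hδε hw1 hw2)
      (c.isPreconnected_exitSet hb le_rfl hba.le hε hδ' hδε hw1 hw2)
      (c.neg.exitSet_nonempty hb le_rfl hba.le hε.neg hδ' hδε (w := -w) ?_ ?_)
      (c.exitSet_nonempty hb le_rfl hba.le hε hδ' hδε hw1 hw2) ?_ ?_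
    · show -c.ℓ (-w) = 1
      rw [map_neg, neg_neg, hw1]
    · show c.S (-w) = 0
      rw [map_neg, hw2, neg_zero]
    · exact (c.disjoint_closure_exitSet hb hba hε hδε).symm
    · have := c.neg.disjoint_closure_exitSet (b := b) hb hba hε.neg hδε
      rwa [c.neg_neg] at this
  · rintro q ⟨hq, hqN⟩
    have hr' : r ∈ Ioo (rc - δ') (rc + δ') := ⟨hr.1, by linarith [hr.2]⟩
    obtain ⟨τ, p, hp, rfl⟩ := (htrj r (hpos r hr') q).1 hq
    obtain ⟨h1, h2, h3⟩ := hN τ p hqN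
    exact ⟨by rw [c.obox_neg]; exact h2, h3, hr',
      hlow r ⟨by linarith [hr.1], hr.2⟩ (hpos r hr') τ h1 p h2 hp⟩
  · rintro q ⟨hq, hqN⟩
    have hr' : r ∈ Ioo (rc - δ') (rc + δ') := ⟨by linarith [hr.1], hr.2⟩
    obtain ⟨τ, p, hp, rfl⟩ := (htrj r (hpos r hr') q).1 hq
    obtain ⟨h1, h2, h3⟩ := hN τ p hqN
    exact ⟨h2, h3, hr', hup r ⟨hr.1, by linarith [hr.2]⟩ τ h1 p h2 hp⟩

/-! ### Limits of solutions that leave a block -/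

section ExitLimits

variable {n : ℕ} {W : Type*} [NormedAddCommGroup W] [NormedSpace ℝ W] [FiniteDimensional ℝ W]
  {G : E n × W → E n} {η : E n} {ν₀ : W}

namespace Chart

/-- States that converge to a state that stays in the block need longer and longer times to leave the
block. -/
theorem tendsto_exit_time (c : Chart G η ν₀) (hG : ContDiff ℝ 1 G) {ν : ℕ → C(ℝ, W)} {ν₁ : C(ℝ, W)}
    (hν : Tendsto ν atTop (𝓝 ν₁)) {b : ℝ} (hba : b ≤ c.a)
    (hgood : ∀ k, ∀ t ≥ 0, ‖ν k t - ν₀‖ ≤ c.ε) {p : ℕ → E n} {p₀ : E n}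
    (hp : Tendsto p atTop (𝓝 p₀)) {t : ℕ → ℝ} (h : ∀ k, c.ExitsAt (ν k) (p k) b (t k))
    {y : ℝ → E n} (hy : Sol G ν₁ (Ici 0) y) (hy0 : y 0 = p₀) (hyb : ∀ t ≥ 0, y t ∈ c.obox b) :
    Tendsto t atTop atTop := by
  by_contra hcon
  rw [tendsto_atTop] at hcon
  push Not at hcon
  obtain ⟨M, hM⟩ := hcon
  have hM' : ∃ᶠ k in atTop, t k ∈ Icc 0 M :=
    hM.mono fun k hk => ⟨(h k).1, hk.le⟩
  obtain ⟨t₀, -, φ, hφ, hφt⟩ := isCompact_Icc.tendsto_subseq' hM'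
  exact c.not_stays_of_exits hG (c.exitsAt_of_tendsto hG (hν.comp hφ.tendsto_atTop) hba
    (fun k => hgood (φ k)) (hp.comp hφ.tendsto_atTop) hφt fun k => h (φ k)) hy hy0 hyb

/-- On an orbit of the unstable manifold in the block the sign of `ℓ` is constant, so that its sign at
time `0` decides the side. -/
theorem emanates_of_mem_box (c : Chart G η ν₀) (hG : ContDiff ℝ 1 G) (h0 : G (η, ν₀) = 0)
    {z : ℝ → E n} (hz : Sol G (fun _ => ν₀) (Iic 0) z) (hzb : ∀ t ≤ 0, z t ∈ c.box c.a)
    (hlim : Tendsto z atBot (𝓝 η)) (hpos : 0 < c.ℓ (z 0 - η)) : c.Emanates z := by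
  have hne : z 0 ≠ η := by
    intro h
    rw [h, sub_self, map_zero] at hpos
    exact lt_irrefl _ hpos
  have hl : ∀ t ≤ 0, c.ℓ (z t - η) ≠ 0 := by
    intro t ht h
    have h1 := c.D_pos_of_backward hG (ν := ν₀) (by simp [c.ε_pos.le]) h0
      (x := fun u => z (u + t)) (hz.shift t fun u hu => by
        have := hu.out; simp only [mem_Iic]; linarith) (fun u hu => hzb _ (by linarith))
      (hlim.comp (tendsto_atBot_add_const_right _ _ tendsto_id)) (by
        simp only [zero_add]
        intro h2
        exact hne (Sol.unique hG ordConnected_Iic continuousOn_const hz (sol_const h0 (Iic 0))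
          (t₀ := t) ht h2 0 self_mem_Iic))
    simp only [zero_add] at h1
    rw [D, h] at h1
    nlinarith [sq_nonneg ‖c.S (z t - η)‖]
  refine ⟨hz, hlim, ?_⟩
  filter_upwards [eventually_le_atBot 0] with t ht
  by_contra hcon
  push Not at hcon
  have hcont : ContinuousOn (fun t => c.ℓ (z t - η)) (Iic 0) :=
    c.ℓ.continuous.comp_continuousOn (hz.continuousOn.sub continuousOn_const)
  obtain ⟨u, hu, hu0⟩ := isPreconnected_Iic.intermediate_value (show t ∈ Iic 0 from ht)
    (self_mem_Iic : (0 : ℝ) ∈ Iic 0) hcont ⟨hcon, hpos.le⟩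
  exact hl u hu hu0

/-- Solutions that leave the block after longer and longer times accumulate, seen from the exit, at a
solution in the unstable manifold. -/
theorem exists_emanating_limit (c : Chart G η ν₀) (hG : ContDiff ℝ 1 G) (h0 : G (η, ν₀) = 0)
    {ν : ℕ → C(ℝ, W)} {b : ℝ} (hb : 0 < b) (hba : b ≤ c.a)
    (hgood : ∀ k, ∀ t ≥ 0, ‖ν k t - ν₀‖ ≤ c.ε) {t : ℕ → ℝ} (ht0 : ∀ k, 0 ≤ t k)
    (ht : Tendsto t atTop atTop)
    (hν : Tendsto (fun k => shiftSig (t k) (ν k)) atTop (𝓝 (ContinuousMap.const ℝ ν₀)))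
    {x : ℕ → ℝ → E n} (hx : ∀ k, Sol G (ν k) (Icc 0 (t k)) (x k))
    (hxb : ∀ k, ∀ s ∈ Icc 0 (t k), x k s ∈ c.box b) (hxe : ∀ k, c.ℓ (x k (t k) - η) = b) :
    ∃ φ : ℕ → ℕ, StrictMono φ ∧ ∃ z : ℝ → E n, c.Emanates z ∧
      Tendsto (fun k => x (φ k) (t (φ k))) atTop (𝓝 (z 0)) := by
  obtain ⟨R, hR1, hR2⟩ := c.exists_radius
  obtain ⟨q, -, φ, hφ, hφq⟩ := (c.isCompact_box b).tendsto_subseq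
    (x := fun k => x k (t k)) (fun k => hxb k _ ⟨ht0 k, le_rfl⟩)
  refine ⟨φ, hφ, ?_⟩
  have hmem : ∀ k, ∀ s ∈ Icc (-t (φ k)) 0, s + t (φ k) ∈ Icc 0 (t (φ k)) := fun k s hs =>
    ⟨by linarith [hs.1], by linarith [hs.2]⟩
  have hev : ∀ s ≤ (0 : ℝ), ∀ᶠ k in atTop, s ∈ Icc (-t (φ k)) 0 := by
    intro s hs
    filter_upwards [(ht.comp hφ.tendsto_atTop).eventually_ge_atTop (-s)] with k hk
    exact ⟨by simp only [Function.comp_apply] at hk; linarith, hs⟩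
  obtain ⟨z, hz0, hzc, hzlim, hzsol⟩ := exists_limit_solution hG (hν.comp hφ.tendsto_atTop)
    (I := fun k => Icc (-t (φ k)) 0) (x := fun k s => x (φ k) (s + t (φ k)))
    (fun k => ordConnected_Icc) (fun k => ⟨by linarith [ht0 (φ k)], le_rfl⟩)
    (fun k => (hx (φ k)).shift (t (φ k)) (hmem k)) (R := R)
    (fun k s hs => hR1 _ (c.box_mono hba (hxb _ _ (hmem k s hs))))
    (fun k s hs => hR2 _ (hgood _ _ (hmem k s hs).1)) (q := q) (by simpa [Function.comp_def] using hφq)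
  have hz : Sol G (fun _ => ν₀) (Iic 0) z :=
    hzsol _ fun s hs => ⟨fun _ => s, tendsto_const_nhds, hev s hs⟩
  have hzb : ∀ s ≤ 0, z s ∈ c.box c.a := fun s hs =>
    (c.isClosed_box c.a).mem_of_tendsto (hzlim (fun _ => s) s tendsto_const_nhds (hev s hs))
      ((hev s hs).mono fun k hk => c.box_mono hba (hxb _ _ (hmem k s hk)))
  have hlim := c.tendsto_atBot_of_stays hG (ν := ContinuousMap.const ℝ ν₀) (ν₁ := ν₀)
    tendsto_const_nhds (by simp [c.ε_pos.le]) h0 hz hzb (fun _ _ => by simp [c.ε_pos.le])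
  have hq : c.ℓ (z 0 - η) = b := by
    have h2 : Tendsto (fun k => c.ℓ (x (φ k) (t (φ k)) - η)) atTop (𝓝 (c.ℓ (q - η))) :=
      (c.ℓ.continuous.tendsto _).comp (hφq.sub_const η)
    simp only [hxe] at h2
    rw [hz0]
    exact tendsto_nhds_unique h2 tendsto_const_nhds
  refine ⟨z, c.emanates_of_mem_box hG h0 hz hzb hlim (by rw [hq]; exact hb), ?_⟩
  rw [hz0]
  exact hφq

end Chart

/-- Solutions close to a solution that accumulates at `A` stay close to `A` after some time. -/
theorem Traps.exists_time {A U O : Set (E n)} (hG : ContDiff ℝ 1 G)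
    (h : Traps G ν₀ A U) (hO : IsOpen O) (hAO : A ⊆ O) {y : ℝ → E n}
    (hy : Sol G (fun _ => ν₀) (Ici 0) y) {q : E n} (hqA : q ∈ A) (hq : MapClusterPt q atTop y)
    {ν : ℕ → C(ℝ, W)} (hν : Tendsto ν atTop (𝓝 (ContinuousMap.const ℝ ν₀)))
    (hν' : ∀ ε > 0, ∀ᶠ k in atTop, ∀ t ≥ 0, ‖ν k t - ν₀‖ ≤ ε) {I : ℕ → Set ℝ}
    (hI : ∀ k, (I k).OrdConnected) (hI0 : ∀ k, (0 : ℝ) ∈ I k) {x : ℕ → ℝ → E n}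
    (hx : ∀ k, Sol G (ν k) (I k) (x k)) (hx0 : Tendsto (fun k => x k 0) atTop (𝓝 (y 0))) :
    ∃ M ≥ 0, ∀ᶠ k in atTop, ∀ t ∈ I k, M ≤ t → x k t ∈ O := by
  obtain ⟨O', hO', hAO', -, ε, hε, hstay⟩ := h.exists_nhd hG hO hAO
  obtain ⟨M, hM, hM0⟩ := ((hq.frequently (hO'.mem_nhds (hAO' hqA))).and_eventually
    (eventually_ge_atTop 0)).exists
  refine ⟨M, hM0, ?_⟩
  obtain ⟨z, hz0, hz, hzlim⟩ := exists_nearby_solution hG hν (S := 0) (T := M) ⟨le_rfl, hM0⟩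
    (hy.mono Icc_subset_Ici_self) hx0
  filter_upwards [hz, hν' ε hε, (hzlim (fun _ => M) M ⟨hM0, le_rfl⟩
    tendsto_const_nhds).eventually (hO'.mem_nhds hM)] with k hk hkν hkO t ht hMt
  have hsub : Icc 0 t ⊆ I k := (hI k).out (hI0 k) ht
  have h1 := Sol.unique hG ordConnected_Icc (ν k).continuous.continuousOn hk
    ((hx k).mono ((Icc_subset_Icc_right hMt).trans hsub)) (t₀ := 0) ⟨le_rfl, hM0⟩ (hz0 k) M
    ⟨hM0, le_rfl⟩
  have h2 := hstay (shiftSig M (ν k)) (fun s hs => hkν _ (add_nonneg hs hM0)) (t - M) (by linarith)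
    (fun s => x k (s + M)) ((hx k).shift M fun s hs => hsub
      ⟨by linarith [hs.1], by linarith [hs.2]⟩) (by simp only [zero_add]; rw [← h1]; exact hkO)
  simpa using h2

end ExitLimits

/-! ### Edge tails -/

variable {n d : ℕ}

namespace Sys

/-- The edge tail for the rates in `R` that converge to `rc`. -/
def tail (P : Sys n d) (S : Start n) (rc : ℝ) (R : Set ℝ) : Set (E n) :=
  {q | ∀ T > 0, ∀ δ > 0, q ∈ closure {p | ∃ τ > T, ∃ r ∈ R, 0 < r ∧ |r - rc| < δ ∧
    SolAt P.f P.Λ S r τ p}}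

variable {P : Sys n d} {S : Start n} {rc : ℝ} {R : Set ℝ}

theorem upperEdgeTail_eq (hrc : 0 < rc) : upperEdgeTail P.f P.Λ S rc = P.tail S rc (Ioi rc) := by
  have h : ∀ T δ : ℝ, {p | ∃ τ > T, ∃ r ∈ Ioo rc (rc + δ), SolAt P.f P.Λ S r τ p} =
      {p | ∃ τ > T, ∃ r ∈ Ioi rc, 0 < r ∧ |r - rc| < δ ∧ SolAt P.f P.Λ S r τ p} := by
    intro T δ
    ext p
    constructor
    · rintro ⟨τ, hτ, r, hr, hp⟩
      refine ⟨τ, hτ, r, hr.1, hrc.trans hr.1, ?_, hp⟩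
      rw [abs_of_pos (by linarith [hr.1])]
      linarith [hr.2]
    · rintro ⟨τ, hτ, r, hr, -, hδ, hp⟩
      exact ⟨τ, hτ, r, ⟨hr, by linarith [(abs_lt.1 hδ).2]⟩, hp⟩
  simp only [upperEdgeTail, tail, h]

theorem lowerEdgeTail_eq : lowerEdgeTail P.f P.Λ S rc = P.tail S rc (Iio rc) := by
  have h : ∀ T δ : ℝ, {p | ∃ τ > T, ∃ r ∈ Ioo (rc - δ) rc, 0 < r ∧ SolAt P.f P.Λ S r τ p} =
      {p | ∃ τ > T, ∃ r ∈ Iio rc, 0 < r ∧ |r - rc| < δ ∧ SolAt P.f P.Λ S r τ p} := by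
    intro T δ
    ext p
    constructor
    · rintro ⟨τ, hτ, r, hr, hr0, hp⟩
      refine ⟨τ, hτ, r, hr.2, hr0, ?_, hp⟩
      rw [abs_of_neg (by linarith [hr.2])]
      linarith [hr.1]
    · rintro ⟨τ, hτ, r, hr, hr0, hδ, hp⟩
      exact ⟨τ, hτ, r, ⟨by linarith [(abs_lt.1 hδ).1], hr⟩, hr0, hp⟩
  simp only [lowerEdgeTail, tail, h]

theorem isClosed_tail : IsClosed (P.tail S rc R) := by
  have : P.tail S rc R = ⋂ T > (0 : ℝ), ⋂ δ > (0 : ℝ), closure {p | ∃ τ > T, ∃ r ∈ R, 0 < r ∧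
      |r - rc| < δ ∧ SolAt P.f P.Λ S r τ p} := by
    ext q
    simp [tail]
  rw [this]
  exact isClosed_biInter fun _ _ => isClosed_biInter fun _ _ => isClosed_closure

theorem exists_seq_of_mem_tail {q : E n} (h : q ∈ P.tail S rc R) : ∃ (r τ : ℕ → ℝ) (p : ℕ → E n),
    (∀ k, r k ∈ R ∧ 0 < r k ∧ SolAt P.f P.Λ S (r k) (τ k) (p k)) ∧ Tendsto r atTop (𝓝 rc) ∧
      Tendsto τ atTop atTop ∧ Tendsto p atTop (𝓝 q) := by
  have key : ∀ k : ℕ, ∃ p, dist p q < 1 / ((k : ℝ) + 1) ∧ ∃ τ > (k : ℝ) + 1, ∃ r ∈ R, 0 < r ∧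
      |r - rc| < 1 / ((k : ℝ) + 1) ∧ SolAt P.f P.Λ S r τ p := by
    intro k
    have hk : (0 : ℝ) < 1 / ((k : ℝ) + 1) := by positivity
    obtain ⟨p, hp, hd⟩ := Metric.mem_closure_iff.1 (h (k + 1) (by positivity) _ hk) _ hk
    exact ⟨p, by rwa [dist_comm], hp⟩
  choose p hp τ hτ r hr hr0 hrd hs using key
  refine ⟨r, τ, p, fun k => ⟨hr k, hr0 k, hs k⟩, ?_, ?_, ?_⟩
  · rw [tendsto_iff_dist_tendsto_zero]
    exact squeeze_zero (fun _ => dist_nonneg) (fun k => (hrd k).le)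
      tendsto_one_div_add_atTop_nhds_zero_nat
  · refine tendsto_atTop_mono (fun k => ?_) (tendsto_natCast_atTop_atTop (R := ℝ))
    linarith [hτ k]
  · rw [tendsto_iff_dist_tendsto_zero]
    exact squeeze_zero (fun _ => dist_nonneg) (fun k => (hp k).le)
      tendsto_one_div_add_atTop_nhds_zero_nat

theorem mem_tail_of_seq {q : E n} {r τ : ℕ → ℝ} {p : ℕ → E n}
    (h : ∀ᶠ k in atTop, r k ∈ R ∧ 0 < r k ∧ SolAt P.f P.Λ S (r k) (τ k) (p k))
    (hr : Tendsto r atTop (𝓝 rc)) (hτ : Tendsto τ atTop atTop) (hp : Tendsto p atTop (𝓝 q)) :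
    q ∈ P.tail S rc R := by
  intro T hT δ hδ
  refine mem_closure_of_tendsto hp ?_
  filter_upwards [h, hr.eventually (Metric.ball_mem_nhds rc hδ), hτ.eventually_gt_atTop T] with
    k h1 h2 h3
  exact ⟨τ k, h3, r k, h1.1, h1.2.1, h2, h1.2.2⟩

end Sys

variable {P : Sys n d} {η : E n} {ρ₀ : ℝ}

/-- Solutions `x^{[r k]}`, for rates that converge to `rc`, that stay in a block from the time `T₀`
until the time `T₀ + t k`, when they reach the face where `ℓ` is positive. -/
structure ExitSeq (c : Chart P.G η (ρ₀, P.lp)) (S : Start n) (rc T₀ b : ℝ) (r t : ℕ → ℝ)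
    (x : ℕ → ℝ → E n) : Prop where
  r_pos : ∀ k, 0 < r k
  r_tendsto : Tendsto r atTop (𝓝 rc)
  t_nonneg : ∀ k, 0 ≤ t k
  t_tendsto : Tendsto t atTop atTop
  sol : ∀ k, Sol P.G (P.sig (r k)⁻¹ (gα P.α T₀)) (Icc 0 (t k)) (x k)
  mem : ∀ k, ∀ s ∈ Icc 0 (t k), x k s ∈ c.box b
  solAt : ∀ k, SolAt P.f P.Λ S (r k) T₀ (x k 0)
  good : ∀ k, ∀ s ≥ 0, c.Good b (P.sig (r k)⁻¹ (gα P.α T₀) s)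

theorem Sys.shiftSig_sig_gα (P : Sys n d) (ρ T t : ℝ) :
    shiftSig t (P.sig ρ (gα P.α T)) = P.sig ρ (gα P.α (T + t)) := by
  rw [P.shiftSig_sig _ _ (gα_mem_Ioc _ _), theta_gα]

theorem Sys.tendsto_sig_gα (P : Sys n d) {ρ τ : ℕ → ℝ} {ρ' : ℝ} (hρ : Tendsto ρ atTop (𝓝 ρ'))
    (hτ : Tendsto τ atTop atTop) : Tendsto (fun k => P.sig (ρ k) (gα P.α (τ k))) atTop
      (𝓝 (ContinuousMap.const ℝ (ρ', P.lp))) :=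
  P.tendsto_sig_one hρ ((tendsto_gα_atTop P.α_pos).comp hτ) fun _ => gα_mem_Ioc _ _

theorem Sys.eventually_norm_sig_sub_le (P : Sys n d) {ρ s : ℕ → ℝ} {ρ' : ℝ}
    (hρ : Tendsto ρ atTop (𝓝 ρ')) (hs : Tendsto s atTop (𝓝 1)) (hmem : ∀ k, s k ∈ Ioc (-1 : ℝ) 1) :
    ∀ ε > 0, ∀ᶠ k in atTop, ∀ t ≥ 0, ‖P.sig (ρ k) (s k) t - (ρ', P.lp)‖ ≤ ε := by
  intro ε hε
  obtain ⟨δ, hδ, h1⟩ := P.eventually_sig (Metric.closedBall_mem_nhds (ρ', P.lp) hε)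
  filter_upwards [hρ.eventually (Metric.ball_mem_nhds ρ' hδ),
    hs.eventually_const_lt (show 1 - δ < 1 by linarith)] with k h2 h3 t ht
  have := h1 _ _ h2 h3 (hmem k) t ht
  rwa [dist_eq_norm] at this

namespace ExitSeq

variable {rc : ℝ} {c : Chart P.G η (rc⁻¹, P.lp)} {S : Start n} {T₀ b : ℝ} {r t : ℕ → ℝ}
  {x : ℕ → ℝ → E n} (h : ExitSeq c S rc T₀ b r t x)
include h

theorem comp {φ : ℕ → ℕ} (hφ : StrictMono φ) :
    ExitSeq c S rc T₀ b (r ∘ φ) (t ∘ φ) (fun k => x (φ k)) :=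
  ⟨fun _ => h.r_pos _, h.r_tendsto.comp hφ.tendsto_atTop, fun _ => h.t_nonneg _,
    h.t_tendsto.comp hφ.tendsto_atTop, fun _ => h.sol _, fun _ => h.mem _, fun _ => h.solAt _,
    fun _ => h.good _⟩

theorem tendsto_inv (hrc : 0 < rc) : Tendsto (fun k => (r k)⁻¹) atTop (𝓝 rc⁻¹) :=
  h.r_tendsto.inv₀ hrc.ne'

theorem tendsto_sig (hrc : 0 < rc) :
    Tendsto (fun k => shiftSig (t k) (P.sig (r k)⁻¹ (gα P.α T₀))) atTop
      (𝓝 (ContinuousMap.const ℝ (rc⁻¹, P.lp))) := by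
  simp only [P.shiftSig_sig_gα]
  exact P.tendsto_sig_gα (h.tendsto_inv hrc) (tendsto_atTop_add_const_left _ T₀ h.t_tendsto)

variable (hS : P.Determined S rc)
include hS

theorem solAt_exit (k : ℕ) : SolAt P.f P.Λ S (r k) (T₀ + t k) (x k (t k)) :=
  (hS.solAt_add_iff (h.r_pos k) (h.solAt k) (h.t_nonneg k)).2 ⟨x k, h.sol k, rfl, rfl⟩

/-- Around the exit, the solutions follow the limit of the exit points. -/
theorem nearby (hrc : 0 < rc) {y : ℝ → E n} (hy : Sol P.G (fun _ => (rc⁻¹, P.lp)) univ y) {a : ℝ}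
    (hlim : Tendsto (fun k => x k (t k)) atTop (𝓝 (y a))) {L : ℝ} (hL : 0 ≤ L) :
    ∃ w : ℕ → ℝ → E n, (∀ (u : ℕ → ℝ) (u₀ : ℝ), u₀ ∈ Icc (-L) L → Tendsto u atTop (𝓝 u₀) →
        Tendsto (fun k => w k (u k)) atTop (𝓝 (y (u₀ + a)))) ∧
      ∀ᶠ k in atTop, ∀ u ∈ Icc (-L) L, SolAt P.f P.Λ S (r k) (T₀ + t k + u) (w k u) := by
  obtain ⟨w, hw0, hw, hwlim⟩ := exists_nearby_solution P.contDiff_G (h.tendsto_sig hrc) (S := -L)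
    (T := L) ⟨by linarith, hL⟩ ((hy.shift a fun _ _ => mem_univ _).mono (subset_univ _))
    (p := fun k => x k (t k)) (by simpa using hlim)
  refine ⟨w, fun u u₀ h1 h2 => hwlim u u₀ h1 h2, ?_⟩
  filter_upwards [hw, h.t_tendsto.eventually_ge_atTop L] with k hk hkt u hu
  rcases le_total 0 u with hu0 | hu0
  · refine (hS.solAt_add_iff (h.r_pos k) (h.solAt_exit hS k) hu0).2 ⟨w k, ?_, hw0 k, rfl⟩
    rw [P.shiftSig_sig_gα] at hk
    exact hk.mono fun s hs => ⟨by linarith [hs.1], hs.2.trans hu.2⟩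
  · have htu : 0 ≤ t k + u := by linarith [hu.1]
    have h1 := Sol.unique P.contDiff_G ordConnected_Icc (ContinuousMap.continuous _).continuousOn
      ((h.sol k).shift (t k) (J := Icc u 0) fun s hs =>
        ⟨by linarith [hs.1], by linarith [hs.2]⟩)
      (hk.mono fun s hs => ⟨by linarith [hs.1, hu.1], by linarith [hs.2]⟩) (t₀ := 0)
      ⟨hu0, le_rfl⟩ (by simp [hw0]) u ⟨le_rfl, hu0⟩
    rw [add_assoc, hS.solAt_add_iff (h.r_pos k) (h.solAt k) htu]
    refine ⟨x k, (h.sol k).mono (Icc_subset_Icc_right (by linarith)), rfl, ?_⟩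
    rw [← h1, add_comm]

/-- Long before the exit, the solutions are close to the equilibrium. -/
theorem eq_of_tendsto_atBot (hrc : 0 < rc) (h0 : P.f (η, P.lp) = 0) (hba : b ≤ c.a) {τ : ℕ → ℝ}
    {p : ℕ → E n} {q : E n} (hτ : Tendsto τ atTop atTop)
    (hp : ∀ k, SolAt P.f P.Λ S (r k) (τ k) (p k)) (hq : Tendsto p atTop (𝓝 q))
    (hu : Tendsto (fun k => τ k - (T₀ + t k)) atTop atBot) : q = η := by
  obtain ⟨φ, hφ, hφ'⟩ := extraction_of_eventually_atTop
    ((hτ.eventually_ge_atTop T₀).and (hu.eventually_le_atBot 0))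
  have hτφ := hτ.comp hφ.tendsto_atTop
  have huφ := hu.comp hφ.tendsto_atTop
  have hsub : ∀ k, ∀ s ∈ Icc (-(τ (φ k) - T₀)) (-(τ (φ k) - (T₀ + t (φ k)))),
      s + (τ (φ k) - T₀) ∈ Icc 0 (t (φ k)) := fun k s hs =>
    ⟨by linarith [hs.1], by linarith [hs.2]⟩
  refine c.limit_eq P.contDiff_G
    (ν := fun k => P.sig (r (φ k))⁻¹ (gα P.α (τ (φ k)))) (ν₁ := (rc⁻¹, P.lp))
    (P.tendsto_sig_gα ((h.tendsto_inv hrc).comp hφ.tendsto_atTop) hτφ) (by simp [c.ε_pos.le])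
    (by show rc⁻¹ • P.f (η, P.lp) = 0; rw [h0, smul_zero])
    (I := fun k => Icc (-(τ (φ k) - T₀)) (-(τ (φ k) - (T₀ + t (φ k)))))
    (x := fun k s => x (φ k) (s + (τ (φ k) - T₀)))
    (fun k => ordConnected_Icc) (fun k => ⟨by linarith [(hφ' k).1], by linarith [(hφ' k).2]⟩)
    (fun s => ?_) (fun k => ?_) (fun k s hs => c.box_mono hba (h.mem _ _ (hsub k s hs)))
    (fun k s hs => ?_) ?_
  · filter_upwards [hτφ.eventually_ge_atTop (T₀ - s), huφ.eventually_le_atBot (-s)] with k h1 h2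
    simp only [Function.comp_apply] at h1 h2
    exact ⟨by linarith, by linarith⟩
  · have h1 : P.sig (r (φ k))⁻¹ (gα P.α (τ (φ k))) =
        shiftSig (τ (φ k) - T₀) (P.sig (r (φ k))⁻¹ (gα P.α T₀)) := by
      rw [P.shiftSig_sig_gα]; congr 2; ring
    rw [h1]
    exact (h.sol (φ k)).shift _ (hsub k)
  · have h1 : P.sig (r (φ k))⁻¹ (gα P.α (τ (φ k))) =
        shiftSig (τ (φ k) - T₀) (P.sig (r (φ k))⁻¹ (gα P.α T₀)) := by
      rw [P.shiftSig_sig_gα]; congr 2; ring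
    rw [h1]
    exact (h.good (φ k) _ (hsub k s hs).1).1
  · refine (hq.comp hφ.tendsto_atTop).congr fun k => ?_
    have h1 := (hφ' k).1
    have h2 := (hφ' k).2
    refine hS.solAt_unique (h.r_pos (φ k)) (hp (φ k)) ?_
    have h3 := (hS.solAt_add_iff (t := τ (φ k) - T₀) (h.r_pos (φ k)) (h.solAt (φ k))
      (by linarith)).2 ⟨x (φ k), (h.sol (φ k)).mono (Icc_subset_Icc_right (by linarith)), rfl, rfl⟩
    simpa using h3

/-- Long after the exit, the solutions are close to the attractor. -/
theorem mem_of_tendsto_atTop (hrc : 0 < rc) {A U : Set (E n)}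
    (hA : Traps P.G (rc⁻¹, P.lp) A U) {y : ℝ → E n} (hy : Sol P.G (fun _ => (rc⁻¹, P.lp)) univ y)
    {z : E n} (hz : z ∈ A) (hzy : MapClusterPt z atTop y) {a : ℝ}
    (hlim : Tendsto (fun k => x k (t k)) atTop (𝓝 (y a))) {τ : ℕ → ℝ}
    {p : ℕ → E n} {q : E n} (hτ : Tendsto τ atTop atTop)
    (hp : ∀ k, SolAt P.f P.Λ S (r k) (τ k) (p k)) (hq : Tendsto p atTop (𝓝 q))
    (hu : Tendsto (fun k => τ k - (T₀ + t k)) atTop atTop) : q ∈ A := by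
  obtain ⟨O, hO, hAO, hOU, hOc⟩ := exists_open_between_and_isCompact_closure hA.compact
    isOpen_interior hA.nhd
  obtain ⟨φ₀, hφ₀, hφ₀'⟩ := extraction_of_eventually_atTop (hu.eventually_ge_atTop 0)
  have hw : ∀ k, ∃ w : ℝ → E n, Sol P.G (P.sig (r (φ₀ k))⁻¹ (gα P.α (T₀ + t (φ₀ k))))
      (Icc 0 (τ (φ₀ k) - (T₀ + t (φ₀ k)))) w ∧ w 0 = x (φ₀ k) (t (φ₀ k)) ∧
        w (τ (φ₀ k) - (T₀ + t (φ₀ k))) = p (φ₀ k) := by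
    intro k
    refine (hS.solAt_add_iff (h.r_pos (φ₀ k)) (h.solAt_exit hS (φ₀ k)) (hφ₀' k)).1 ?_
    simpa using hp (φ₀ k)
  choose w hw hw0 hwp using hw
  have hsig : Tendsto (fun k => P.sig (r (φ₀ k))⁻¹ (gα P.α (T₀ + t (φ₀ k)))) atTop
      (𝓝 (ContinuousMap.const ℝ (rc⁻¹, P.lp))) :=
    P.tendsto_sig_gα ((h.tendsto_inv hrc).comp hφ₀.tendsto_atTop)
      (tendsto_atTop_add_const_left _ T₀ (h.t_tendsto.comp hφ₀.tendsto_atTop))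
  have hsig' := P.eventually_norm_sig_sub_le ((h.tendsto_inv hrc).comp hφ₀.tendsto_atTop)
    ((tendsto_gα_atTop P.α_pos).comp
      (tendsto_atTop_add_const_left _ T₀ (h.t_tendsto.comp hφ₀.tendsto_atTop)))
    (fun _ => gα_mem_Ioc _ _)
  simp only [Function.comp_apply] at hsig'
  obtain ⟨M, hM0, hM⟩ := hA.exists_time P.contDiff_G hO hAO
    ((hy.shift a fun _ _ => mem_univ _).mono (subset_univ (Ici (0 : ℝ)))) hz
    (q := z) (by
      have h1 : map (fun s : ℝ => s + a) atTop = atTop := map_add_atTop_eq a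
      rw [MapClusterPt, show (fun s => y (s + a)) = y ∘ (fun s => s + a) from rfl, ← map_map, h1]
      exact hzy) hsig hsig'
    (fun k => ordConnected_Icc) (fun k => ⟨le_rfl, hφ₀' k⟩) hw
    (by simpa [hw0, Function.comp_def] using hlim.comp hφ₀.tendsto_atTop)
  obtain ⟨φ₁, hφ₁, hφ₁'⟩ := extraction_of_eventually_atTop
    ((hM.and (hsig' 1 one_pos)).and ((hu.comp hφ₀.tendsto_atTop).eventually_ge_atTop M))
  have hφ : StrictMono (φ₀ ∘ φ₁) := hφ₀.comp hφ₁
  set u : ℕ → ℝ := fun k => τ (φ₀ (φ₁ k)) - (T₀ + t (φ₀ (φ₁ k))) with hudef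
  have hu' : Tendsto u atTop atTop := hu.comp hφ.tendsto_atTop
  have huM : ∀ k, M ≤ u k := fun k => (hφ₁' k).2
  have hsub : ∀ k, ∀ s ∈ Icc 0 (u k - M), s + M ∈ Icc 0 (u k) := fun k s hs =>
    ⟨by linarith [hs.1], by linarith [hs.2]⟩
  refine hA.mem_of_tendsto P.contDiff_G hOc (hOU.trans interior_subset)
    (ν := fun k => shiftSig M (P.sig (r (φ₀ (φ₁ k)))⁻¹ (gα P.α (T₀ + t (φ₀ (φ₁ k))))))
    (T := fun k => u k - M) (tendsto_atTop_add_const_right _ (-M) hu')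
    (fun k => by linarith [huM k]) ?_ (R := ‖((rc⁻¹, P.lp) : ℝ × E d)‖ + 1)
    (fun k s hs => ?_) (x := fun k s => w (φ₁ k) (s + M))
    (fun k => (hw (φ₁ k)).shift M (hsub k))
    (fun k s hs => subset_closure ((hφ₁' k).1.1 _ (hsub k s hs) (by linarith [hs.1]))) ?_
  · simp only [P.shiftSig_sig_gα]
    refine P.tendsto_sig_gα ((h.tendsto_inv hrc).comp hφ.tendsto_atTop) ?_
    refine (hτ.comp hφ.tendsto_atTop).congr fun k => ?_
    simp only [hudef, Function.comp_apply]
    ring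
  · have h1 := (hφ₁' k).1.2 (s + M) (hsub k s hs).1
    have h2 := norm_sub_norm_le (P.sig (r (φ₀ (φ₁ k)))⁻¹ (gα P.α (T₀ + t (φ₀ (φ₁ k)))) (s + M))
      (rc⁻¹, P.lp)
    rw [shiftSig_apply]
    linarith
  · refine (hq.comp hφ.tendsto_atTop).congr fun k => ?_
    simp only [sub_add_cancel]
    exact (hwp (φ₁ k)).symm

/-- The limits of the solutions belong to the equilibrium, the orbit of the exit points, and the
attractor. -/
theorem mem_of_tendsto (hrc : 0 < rc) (h0 : P.f (η, P.lp) = 0) (hba : b ≤ c.a) {A U : Set (E n)}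
    (hA : Traps P.G (rc⁻¹, P.lp) A U) {y : ℝ → E n} (hy : Sol P.G (fun _ => (rc⁻¹, P.lp)) univ y)
    {z : E n} (hz : z ∈ A) (hzy : MapClusterPt z atTop y) {a : ℝ}
    (hlim : Tendsto (fun k => x k (t k)) atTop (𝓝 (y a))) {τ : ℕ → ℝ}
    {p : ℕ → E n} {q : E n} (hτ : Tendsto τ atTop atTop)
    (hp : ∀ k, SolAt P.f P.Λ S (r k) (τ k) (p k)) (hq : Tendsto p atTop (𝓝 q)) :
    q ∈ {η} ∪ range y ∪ A := by
  obtain ⟨φ, hφ, ⟨u₀, hu⟩ | hu | hu⟩ := exists_subseq_tendsto (fun k => τ k - (T₀ + t k))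
  · refine Or.inl (Or.inr ?_)
    obtain ⟨w, hw, hw'⟩ := (h.comp hφ).nearby hS hrc hy (hlim.comp hφ.tendsto_atTop)
      (L := |u₀| + 1) (by positivity)
    have h1 := hw _ u₀ ⟨by linarith [neg_abs_le u₀], by linarith [le_abs_self u₀]⟩ hu
    have h2 := hq.comp hφ.tendsto_atTop
    refine ⟨u₀ + a, tendsto_nhds_unique (h1.congr' ?_) h2⟩
    filter_upwards [hw', hu.eventually (Icc_mem_nhds (show -(|u₀| + 1) < u₀ by
      linarith [neg_abs_le u₀]) (show u₀ < |u₀| + 1 by linarith [le_abs_self u₀]))] with k h3 h4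
    have h5 := h3 _ h4
    simp only [Function.comp_apply] at h5 ⊢
    rw [show T₀ + t (φ k) + (τ (φ k) - (T₀ + t (φ k))) = τ (φ k) by ring] at h5
    exact hS.solAt_unique (h.r_pos _) h5 (hp _)
  · exact Or.inr ((h.comp hφ).mem_of_tendsto_atTop hS hrc hA hy hz hzy
      (hlim.comp hφ.tendsto_atTop) (hτ.comp hφ.tendsto_atTop) (fun k => hp (φ k))
      (hq.comp hφ.tendsto_atTop) hu)
  · exact Or.inl (Or.inl ((h.comp hφ).eq_of_tendsto_atBot hS hrc h0 hba
      (hτ.comp hφ.tendsto_atTop) (fun k => hp (φ k)) (hq.comp hφ.tendsto_atTop) hu))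

end ExitSeq

variable {n d : ℕ} {P : Sys n d} {η : E n} {rc : ℝ}

/-- The solution `x^{[rc]}` stays in a block after the time `T₀` and converges to the equilibrium,
whereas the solutions for the rates in `R` leave the block through the face where `ℓ` is
positive. -/
structure Leaves (c : Chart P.G η (rc⁻¹, P.lp)) (S : Start n) (T₀ b : ℝ) (R : Set ℝ) : Prop where
  b_pos : 0 < b
  b_le : b ≤ c.a
  stays : ∃ y : ℝ → E n, SolAt P.f P.Λ S rc T₀ (y 0) ∧
    Sol P.G (P.sig rc⁻¹ (gα P.α T₀)) (Ici 0) y ∧ (∀ t ≥ 0, y t ∈ c.obox b) ∧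
      Tendsto y atTop (𝓝 η)
  exits : ∀ᶠ r in 𝓝[R] rc, 0 < r ∧ (∀ t ≥ 0, c.Good b (P.sig r⁻¹ (gα P.α T₀) t)) ∧
    ∃ p, SolAt P.f P.Λ S r T₀ p ∧ ∃ t, c.ExitsAt (P.sig r⁻¹ (gα P.α T₀)) p b t
  mem_closure : rc ∈ closure R

namespace Leaves

variable {c : Chart P.G η (rc⁻¹, P.lp)} {S : Start n} {T₀ b : ℝ} {R : Set ℝ}
  (h : Leaves c S T₀ b R) (hrc : 0 < rc) (hS : P.Determined S rc) (h0 : P.f (η, P.lp) = 0)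
include h hrc hS h0

/-- Along any sequence of rates in `R` the exits subconverge, and their limit lies on an orbit of the
unstable manifold of `η` on the side of the face. -/
theorem exists_exitSeq {r : ℕ → ℝ} (hrR : ∀ k, r k ∈ R) (hr : Tendsto r atTop (𝓝 rc)) :
    ∃ φ : ℕ → ℕ, StrictMono φ ∧ ∃ (t : ℕ → ℝ) (x : ℕ → ℝ → E n),
      ExitSeq c S rc T₀ b (r ∘ φ) t x ∧ ∃ z, c.Emanates z ∧
        Tendsto (fun k => x k (t k)) atTop (𝓝 (z 0)) := by
  have hr' : Tendsto r atTop (𝓝[R] rc) := tendsto_nhdsWithin_iff.2 ⟨hr, Eventually.of_forall hrR⟩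
  obtain ⟨φ, hφ, hφ'⟩ := extraction_of_eventually_atTop (hr'.eventually h.exits)
  have hrφ := hr.comp hφ.tendsto_atTop
  choose hpos hgood p hp t ht using hφ'
  obtain ⟨y, hy0, hy, hyb, -⟩ := h.stays
  have hinv : Tendsto (fun k => (r (φ k))⁻¹) atTop (𝓝 rc⁻¹) := hrφ.inv₀ hrc.ne'
  have hplim : Tendsto p atTop (𝓝 (y 0)) := by
    refine tendsto_def.2 fun O hO => ?_
    filter_upwards [hrφ.eventually (hS.continuous _ _ hy0 O hO)] with k hk
    obtain ⟨q, hq, hq'⟩ := hk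
    rw [mem_preimage, hS.solAt_unique (hpos k) (hp k) hq']
    exact hq
  have htt := c.tendsto_exit_time P.contDiff_G
    (P.tendsto_sig hinv tendsto_const_nhds (fun _ => gα_mem_Ioc P.α T₀) (gα_mem_Ioc P.α T₀)) h.b_le
    (fun k s hs => (hgood k s hs).1) hplim ht hy rfl hyb
  choose ht0 x hx hx0 hxb hxe using ht
  have hsig : Tendsto (fun k => shiftSig (t k) (P.sig (r (φ k))⁻¹ (gα P.α T₀))) atTop
      (𝓝 (ContinuousMap.const ℝ (rc⁻¹, P.lp))) := by
    simp only [P.shiftSig_sig_gα]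
    exact P.tendsto_sig_gα hinv (tendsto_atTop_add_const_left _ T₀ htt)
  obtain ⟨ψ, hψ, z, hz, hlim⟩ := c.exists_emanating_limit P.contDiff_G
    (by show rc⁻¹ • P.f (η, P.lp) = 0; rw [h0, smul_zero]) h.b_pos h.b_le
    (fun k s hs => (hgood k s hs).1) ht0 htt hsig hx hxb hxe
  have hes : ExitSeq c S rc T₀ b (r ∘ φ) t x :=
    ⟨hpos, hrφ, ht0, htt, hx, hxb, fun k => by rw [hx0]; exact hp k, hgood⟩
  exact ⟨φ ∘ ψ, hφ.comp hψ, t ∘ ψ, fun k => x (ψ k), hes.comp hψ, z, hz, hlim⟩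

variable {A : Set (E n)} {y : ℝ → E n}

/-- After the exit the solutions first follow the connecting orbit and are then trapped by the
attractor. -/
theorem tail_subset (hA : IsAttractor (P.H rc⁻¹) univ A)
    (hy : IsConnectingOrbit (P.H rc⁻¹) univ η A y) (hye : c.Emanates y) :
    P.tail S rc R ⊆ {η} ∪ range y ∪ A := by
  intro q hq
  obtain ⟨r, τ, p, hp, hr, hτ, hpq⟩ := Sys.exists_seq_of_mem_tail hq
  obtain ⟨φ, hφ, t, x, hes, z, hz, hlim⟩ := h.exists_exitSeq hrc hS h0 (fun k => (hp k).1) hr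
  have hys := P.isSolution_H_iff.1 hy.solution
  obtain ⟨a, ha⟩ := Chart.Emanates.exists_shift P.contDiff_G hz hye hys
  rw [ha 0 le_rfl] at hlim
  obtain ⟨U, hU⟩ := Cpt.exists_traps hA
  obtain ⟨z', hz'⟩ := hA.omega.1
  have hcl := hz'
  rw [← hy.target] at hcl
  exact hes.mem_of_tendsto hS hrc h0 h.b_le hU hys hz' hcl.2 hlim (hτ.comp hφ.tendsto_atTop)
    (fun k => (hp (φ k)).2.2) (hpq.comp hφ.tendsto_atTop)

theorem mem_tail : η ∈ P.tail S rc R := by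
  obtain ⟨y, hy0, hy, -, hlim⟩ := h.stays
  have key : ∀ k : ℕ, ∃ r ∈ R, 0 < r ∧ |r - rc| < 1 / ((k : ℝ) + 1) ∧
      ∃ q, dist q (y k) < 1 / ((k : ℝ) + 1) ∧ SolAt P.f P.Λ S r (T₀ + k) q := by
    intro k
    have hk : (0 : ℝ) < 1 / ((k : ℝ) + 1) := by positivity
    have h1 : SolAt P.f P.Λ S rc (T₀ + k) (y k) := (hS.solAt_add_iff hrc hy0 (Nat.cast_nonneg k)).2
      ⟨y, hy.mono Icc_subset_Ici_self, rfl, rfl⟩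
    have h2 := hS.continuous _ _ h1 _ (Metric.ball_mem_nhds _ hk)
    have hne : (𝓝[R] rc).NeBot := mem_closure_iff_nhdsWithin_neBot.1 h.mem_closure
    obtain ⟨r, ⟨h3, h4, h5⟩, h6⟩ := ((eventually_nhdsWithin_of_eventually_nhds (h2.and
      ((lt_mem_nhds hrc).and (Metric.ball_mem_nhds rc hk)))).and (eventually_mem_nhdsWithin (a := rc) (s := R))).exists
    obtain ⟨q, hq, hq'⟩ := h3
    exact ⟨r, h6, h4, h5, q, hq, hq'⟩
  choose r hrR hr0 hrd q hq hqs using key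
  refine Sys.mem_tail_of_seq (r := r) (τ := fun k : ℕ => T₀ + k) (p := q)
    (Eventually.of_forall fun k => ⟨hrR k, hr0 k, hqs k⟩) ?_
    (tendsto_atTop_add_const_left _ _ tendsto_natCast_atTop_atTop) ?_
  · rw [tendsto_iff_dist_tendsto_zero]
    exact squeeze_zero (fun _ => dist_nonneg) (fun k => (hrd k).le)
      tendsto_one_div_add_atTop_nhds_zero_nat
  · have h1 : Tendsto (fun k => dist (q k) (y k)) atTop (𝓝 0) :=
      squeeze_zero (fun _ => dist_nonneg) (fun k => (hq k).le)
        tendsto_one_div_add_atTop_nhds_zero_nat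
    exact tendsto_of_tendsto_of_dist (hlim.comp tendsto_natCast_atTop_atTop)
      (by simpa [dist_comm] using h1)

/-- There is a connecting orbit on the side of the exits, and the edge tail is the connection that it
forms. -/
theorem exists_tail_eq (hbr : ∀ z : ℝ → E n, Sol P.G (fun _ => (rc⁻¹, P.lp)) (Iic 0) z →
      Tendsto z atBot (𝓝 η) → z 0 ≠ η → ∃ A y, IsAttractor (P.H rc⁻¹) univ A ∧ η ∉ A ∧
        IsConnectingOrbit (P.H rc⁻¹) univ η A y ∧ z 0 ∈ range y) :
    ∃ A y, IsAttractor (P.H rc⁻¹) univ A ∧ η ∉ A ∧ IsConnectingOrbit (P.H rc⁻¹) univ η A y ∧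
      c.Emanates y ∧ P.tail S rc R = {η} ∪ range y ∪ A := by
  obtain ⟨r, hrR, hr⟩ := mem_closure_iff_seq_limit.1 h.mem_closure
  obtain ⟨φ, hφ, t, x, hes, z, hz, hlim⟩ := h.exists_exitSeq hrc hS h0 hrR hr
  have hG0 : P.G (η, (rc⁻¹, P.lp)) = 0 := by
    show rc⁻¹ • P.f (η, P.lp) = 0
    rw [h0, smul_zero]
  have hne : z 0 ≠ η := by
    intro h1
    have h2 := Sol.unique P.contDiff_G ordConnected_Iic continuousOn_const hz.sol
      (Chart.sol_const hG0 (Iic 0)) (t₀ := 0) self_mem_Iic h1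
    obtain ⟨u, hu, hu0⟩ := (hz.pos.and (eventually_le_atBot 0)).exists
    rw [h2 u hu0, sub_self, map_zero] at hu
    exact lt_irrefl _ hu
  obtain ⟨A, y, hA, hηA, hy, a, ha⟩ := hbr z hz.sol hz.tendsto hne
  have hys := P.isSolution_H_iff.1 hy.solution
  have hzy := Sol.unique P.contDiff_G ordConnected_Iic continuousOn_const hz.sol
    (hys.shift a fun _ _ => mem_univ _) (t₀ := 0) self_mem_Iic (by simp [ha])
  have hye : c.Emanates y := by
    refine ⟨hys.mono (subset_univ _), hy.source, ?_⟩
    have h1 := (tendsto_atBot_add_const_right _ (-a) tendsto_id).eventually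
      (hz.pos.and (eventually_le_atBot 0))
    filter_upwards [h1] with s hs
    have h2 := hzy (s + -a) hs.2
    have h3 := hs.1
    simp only [id] at h3
    rw [h2] at h3
    simpa using h3
  refine ⟨A, y, hA, hηA, hy, hye, Subset.antisymm (h.tail_subset hrc hS h0 hA hy hye) ?_⟩
  -- the solutions pass near every point of the connecting orbit, and the tail is closed
  have hrange : range y ⊆ P.tail S rc R := by
    rintro _ ⟨v, rfl⟩
    rw [← ha] at hlim
    have hva : v - a ∈ Icc (-|v - a|) |v - a| := ⟨neg_abs_le _, le_abs_self _⟩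
    obtain ⟨w, hw, hw'⟩ := hes.nearby hS hrc hys hlim (abs_nonneg (v - a))
    have h1 := hw (fun _ => v - a) (v - a) hva tendsto_const_nhds
    rw [sub_add_cancel] at h1
    refine Sys.mem_tail_of_seq (r := r ∘ φ) (τ := fun k => T₀ + t k + (v - a)) ?_ hes.r_tendsto
      (tendsto_atTop_add_const_right _ _ (tendsto_atTop_add_const_left _ _ hes.t_tendsto)) h1
    filter_upwards [hw'] with k hk
    exact ⟨hrR _, hes.r_pos k, hk _ hva⟩
  refine union_subset (union_subset (singleton_subset_iff.2 (h.mem_tail hrc hS h0)) hrange) ?_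
  rw [← hy.target]
  rintro q ⟨-, hq⟩
  exact Sys.isClosed_tail.closure_subset_iff.2 hrange (mem_closure_iff_clusterPt.2
    (ClusterPt.mono hq (le_principal_iff.2 (mem_map.2 (univ_mem' fun t => mem_range_self t)))))

end Leaves

/-! ### Connecting orbits on the two sides -/

variable {n d : ℕ} {P : Sys n d} {η : E n} {rc : ℝ}

section Connecting

variable {A A' : Set (E n)} {y y' : ℝ → E n}

theorem IsConnectingOrbit.ne_source (h0 : P.f (η, P.lp) = 0) (hηA : η ∉ A)
    (hy : IsConnectingOrbit (P.H rc⁻¹) univ η A y) (t : ℝ) : y t ≠ η := by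
  intro ht
  have hG0 : P.G (η, (rc⁻¹, P.lp)) = 0 := by
    show rc⁻¹ • P.f (η, P.lp) = 0
    rw [h0, smul_zero]
  have h1 := Sol.unique P.contDiff_G ordConnected_univ continuousOn_const
    (P.isSolution_H_iff.1 hy.solution) (Chart.sol_const hG0 univ) (mem_univ t) ht
  refine hηA ?_
  rw [← hy.target]
  refine ⟨mem_univ _, ?_⟩
  have h2 : y = fun _ => η := funext fun s => h1 s (mem_univ s)
  rw [h2]
  exact tendsto_const_nhds.mapClusterPt

/-- Connecting orbits on the same side agree up to a shift of time. -/
theorem connection_congr {c : Chart P.G η (rc⁻¹, P.lp)} (hy : IsConnectingOrbit (P.H rc⁻¹) univ η A y)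
    (hye : c.Emanates y) (hy' : IsConnectingOrbit (P.H rc⁻¹) univ η A' y') (hye' : c.Emanates y') :
    range y = range y' ∧ A = A' := by
  obtain ⟨a, ha⟩ := Chart.Emanates.range_eq P.contDiff_G hye (P.isSolution_H_iff.1 hy.solution) hye'
    (P.isSolution_H_iff.1 hy'.solution)
  have h1 : y' = y ∘ fun t => t + a := funext ha
  constructor
  · rw [h1, (add_right_surjective a).range_comp]
  · have h2 : map (fun t : ℝ => t + a) atTop = atTop := map_add_atTop_eq a
    rw [← hy.target, ← hy'.target, h1]
    simp only [MapClusterPt, ← map_map, h2]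

/-- The orbit on one side is not contained in the connection on the other side: an attractor that
meets the orbit contains all of it by invariance, hence also its backward limit. -/
theorem notMem_of_opposite (h0 : P.f (η, P.lp) = 0) {c : Chart P.G η (rc⁻¹, P.lp)}
    (hA : IsAttractor (P.H rc⁻¹) univ A) (hηA : η ∉ A) (hy : IsConnectingOrbit (P.H rc⁻¹) univ η A y)
    (hye : c.Emanates y) (hηA' : η ∉ A') (hy' : IsConnectingOrbit (P.H rc⁻¹) univ η A' y')
    (hye' : c.neg.Emanates y') : y' 0 ∉ {η} ∪ range y ∪ A := by
  have hys := P.isSolution_H_iff.1 hy.solution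
  have hys' := P.isSolution_H_iff.1 hy'.solution
  rintro ((h | ⟨a, ha⟩) | h)
  · exact hy'.ne_source h0 hηA' 0 h
  · have h1 := Sol.unique P.contDiff_G ordConnected_univ continuousOn_const
      (hys.shift a (J := univ) fun _ _ => mem_univ _) hys' (mem_univ 0) (by simpa using ha)
    have h2 : y' = fun t => y (t + a) := funext fun t => (h1 t (mem_univ t)).symm
    rw [h2] at hye'
    exact (hye.shift_full hys a).not_neg hye'
  · obtain ⟨z, hz, hz0, hzA⟩ := hA.invariant _ h
    have h1 := Sol.unique P.contDiff_G ordConnected_univ continuousOn_const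
      (P.isSolution_H_iff.1 hz) hys' (mem_univ 0) hz0
    refine hηA (hA.compact.isClosed.mem_of_tendsto hy'.source (Eventually.of_forall fun t => ?_))
    rw [← h1 t (mem_univ t)]
    exact hzA t

/-- Near the equilibrium, a connection only has points on one side. -/
theorem exists_box_inter_connection (h0 : P.f (η, P.lp) = 0) {c : Chart P.G η (rc⁻¹, P.lp)}
    (hA : IsAttractor (P.H rc⁻¹) univ A) (hηA : η ∉ A) (hy : IsConnectingOrbit (P.H rc⁻¹) univ η A y)
    (hye : c.Emanates y) : ∃ b > 0, ∀ q ∈ {η} ∪ range y ∪ A, q ∈ c.box b → 0 ≤ c.ℓ (q - η) := by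
  obtain ⟨t₁, ht₁⟩ := eventually_atBot.1 hye.pos
  have hys := P.isSolution_H_iff.1 hy.solution
  have hyc : Continuous y := continuousOn_univ.1 hys.continuousOn
  have hη : η ∉ closure (y '' Ici t₁) := by
    intro hη
    obtain ⟨u, hu, hlim⟩ := mem_closure_iff_seq_limit.1 hη
    choose t ht hty using hu
    obtain ⟨φ, hφ, ⟨a, ha⟩ | h | h⟩ := exists_subseq_tendsto t
    · have h1 := (hyc.tendsto a).comp ha
      have h2 : Tendsto (y ∘ (t ∘ φ)) atTop (𝓝 η) := by
        simpa [Function.comp_def, hty] using hlim.comp hφ.tendsto_atTop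
      exact hy.ne_source h0 hηA a (tendsto_nhds_unique h1 h2)
    · refine hηA ?_
      rw [← hy.target]
      refine ⟨mem_univ _, MapClusterPt.of_comp h ?_⟩
      have h2 : Tendsto (y ∘ (t ∘ φ)) atTop (𝓝 η) := by
        simpa [Function.comp_def, hty] using hlim.comp hφ.tendsto_atTop
      exact h2.mapClusterPt
    · obtain ⟨k, hk⟩ := (h.eventually_lt_atBot t₁).exists
      exact absurd (ht (φ k)) (not_le.2 hk)
  obtain ⟨b, hb, -, hbO⟩ := c.exists_box_subset
    ((isClosed_closure.union hA.compact.isClosed).isOpen_compl.mem_nhds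
      (show η ∈ (closure (y '' Ici t₁) ∪ A)ᶜ from fun h => h.elim hη hηA))
  refine ⟨b, hb, ?_⟩
  rintro q ((rfl | ⟨t, rfl⟩) | hq) hqb
  · simp
  · rcases le_total t₁ t with h | h
    · exact (hbO hqb (Or.inl (subset_closure ⟨t, h, rfl⟩))).elim
    · exact (ht₁ t h).le
  · exact (hbO hqb (Or.inr hq)).elim

/-- If both halves of the unstable manifold contain a connecting orbit, there are no other orbits in
it. -/
theorem exists_connecting_of_opposite (h0 : P.f (η, P.lp) = 0) {c : Chart P.G η (rc⁻¹, P.lp)}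
    (hA : IsAttractor (P.H rc⁻¹) univ A) (hηA : η ∉ A) (hy : IsConnectingOrbit (P.H rc⁻¹) univ η A y)
    (hye : c.Emanates y) (hA' : IsAttractor (P.H rc⁻¹) univ A') (hηA' : η ∉ A')
    (hy' : IsConnectingOrbit (P.H rc⁻¹) univ η A' y') (hye' : c.neg.Emanates y') {z : ℝ → E n}
    (hz : Sol P.G (fun _ => (rc⁻¹, P.lp)) (Iic 0) z) (hlim : Tendsto z atBot (𝓝 η)) (hne : z 0 ≠ η) :
    ∃ A y, IsAttractor (P.H rc⁻¹) univ A ∧ η ∉ A ∧ IsConnectingOrbit (P.H rc⁻¹) univ η A y ∧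
      z 0 ∈ range y := by
  rcases c.emanates_or_neg P.contDiff_G (by show rc⁻¹ • P.f (η, P.lp) = 0; rw [h0, smul_zero])
    hz hlim hne with h | h
  · obtain ⟨a, ha⟩ := Chart.Emanates.exists_shift P.contDiff_G h hye (P.isSolution_H_iff.1 hy.solution)
    exact ⟨A, y, hA, hηA, hy, 0 + a, (ha 0 le_rfl).symm⟩
  · obtain ⟨a, ha⟩ := Chart.Emanates.exists_shift P.contDiff_G h hye'
      (P.isSolution_H_iff.1 hy'.solution)
    exact ⟨A', y', hA', hηA', hy', 0 + a, (ha 0 le_rfl).symm⟩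

end Connecting

/-! ### From the edge tails to the compactified system -/

section Forward

variable {S : Start n}

/-- Compact sets that do not meet the edge tail are avoided at late times, for rates close to
`rc`. -/
theorem Sys.exists_avoid {R : Set ℝ} {F : Set (E n)} (hF : IsCompact F)
    (hd : ∀ q ∈ F, q ∉ P.tail S rc R) : ∃ T, ∃ δ > 0, ∀ r ∈ R, 0 < r → |r - rc| < δ → ∀ τ > T, ∀ p,
      SolAt P.f P.Λ S r τ p → p ∉ F := by
  by_contra hcon
  push Not at hcon
  choose r hrR hr0 hrd τ hτ p hp hpF using fun k : ℕ =>
    hcon k (1 / ((k : ℝ) + 1)) (by positivity)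
  obtain ⟨q, hq, φ, hφ, hlim⟩ := hF.tendsto_subseq hpF
  have hr : Tendsto r atTop (𝓝 rc) := by
    rw [tendsto_iff_dist_tendsto_zero]
    exact squeeze_zero (fun _ => dist_nonneg) (fun k => (hrd k).le)
      tendsto_one_div_add_atTop_nhds_zero_nat
  have hτ' : Tendsto τ atTop atTop :=
    tendsto_atTop_mono (fun k => (hτ k).le) tendsto_natCast_atTop_atTop
  exact hd q hq (Sys.mem_tail_of_seq (Eventually.of_forall fun k => ⟨hrR (φ k), hr0 _, hp _⟩)
    (hr.comp hφ.tendsto_atTop) (hτ'.comp hφ.tendsto_atTop) hlim)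

/-- Solutions whose edge tail lies on one side leave the block on this side. -/
theorem exists_exits_of_tail (hrc : 0 < rc) (hS : P.Determined S rc) (h0 : P.f (η, P.lp) = 0)
    (hcrit : IsCriticalRate P.f P.Λ S η rc) {c : Chart P.G η (rc⁻¹, P.lp)} {b : ℝ} (hb : 0 < b)
    (hba : b ≤ c.a) {R : Set ℝ} (hR : rc ∉ R)
    (htail : ∀ q ∈ P.tail S rc R, q ∈ c.box b → 0 ≤ c.ℓ (q - η)) :
    ∃ T, ∃ δ > 0, ∀ r ∈ R, 0 < r → |r - rc| < δ → ∀ τ > T, ∀ p ∈ c.obox b,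
      SolAt P.f P.Λ S r τ p → ∃ t, c.ExitsAt (P.sig r⁻¹ (gα P.α τ)) p b t := by
  obtain ⟨ε, hε⟩ := Chart.exists_uniform hrc (c := c) h0 hb
  -- the opposite face, which the tail does not meet
  have hF : IsCompact (c.box b ∩ {x | c.ℓ (x - η) = -b}) :=
    (c.isCompact_box b).inter_right (isClosed_eq (by fun_prop) continuous_const)
  obtain ⟨T₁, δ₁, hδ₁, h1⟩ := Sys.exists_avoid (P := P) (S := S) (rc := rc) (R := R) hF
    (fun q hq hq' => by
      have h2 := htail q hq' hq.1
      have h3 : c.ℓ (q - η) = -b := hq.2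
      linarith)
  obtain ⟨δ₂, hδ₂, h2⟩ := hcrit.2.2
  obtain ⟨T₂, hT₂⟩ := ((tendsto_gα_atTop P.α_pos).eventually_const_lt
    (show 1 - ε < 1 by linarith [hε.1])).exists
  refine ⟨max T₁ T₂, min δ₁ (min δ₂ ε), lt_min hδ₁ (lt_min hδ₂ hε.1), ?_⟩
  intro r hrR hr0 hrd τ hτ p hp hpS
  obtain ⟨hd1, hd2, hd3⟩ : |r - rc| < δ₁ ∧ |r - rc| < δ₂ ∧ |r - rc| < ε :=
    ⟨hrd.trans_le (min_le_left _ _), hrd.trans_le ((min_le_right _ _).trans (min_le_left _ _)),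
      hrd.trans_le ((min_le_right _ _).trans (min_le_right _ _))⟩
  have hr : r ∈ Ioo (rc - ε) (rc + ε) :=
    ⟨by linarith [(abs_lt.1 hd3).1], by linarith [(abs_lt.1 hd3).2]⟩
  have hs : gα P.α τ ∈ Ioc (1 - ε) 1 := ⟨hT₂.trans ((gα_lt_iff P.α_pos).2
    ((le_max_right _ _).trans_lt hτ)), (gα_mem P.α τ).2.le⟩
  have hgood := (hε.2.2 r hr).2 _ hs
  rcases c.stays_or_exits P.contDiff_G hb hba hgood hp with ⟨y, hy, hy0, hyb⟩ | h |
    ⟨t, ht, x, hx, hx0, hxb, hxe⟩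
  · exfalso
    -- a solution that stays would converge to `η`, which is excluded for noncritical rates
    have hν₁ : ‖((r⁻¹, P.lp) : ℝ × E d) - (rc⁻¹, P.lp)‖ ≤ c.ε := by
      have := ((hε.2.2 r hr).2 1 ⟨by linarith [hε.1], le_rfl⟩ 0 le_rfl).1
      rwa [P.sig_one] at this
    have hlim := c.tendsto_atTop_of_stays P.contDiff_G
      (P.tendsto_sig_atTop r⁻¹ (gα_mem_Ioc P.α τ)) hν₁
      (by show r⁻¹ • P.f (η, P.lp) = 0; rw [h0, smul_zero]) hy
      (fun t ht => c.box_mono hba (c.obox_subset_box _ (hyb t ht))) (fun t ht => (hgood t ht).1)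
    refine h2 r hr0 (abs_pos.2 (sub_ne_zero.2 fun h => hR (h ▸ hrR))) hd2 ?_
    exact Sys.Determined.solConverges_of_tendsto hpS hy hy0 hlim
  · exact h
  · exfalso
    -- an exit through the opposite face is excluded by the edge tail
    have hx' := (hS.solAt_add_iff hr0 hpS ht).2 ⟨x, hx, hx0, rfl⟩
    refine h1 r hrR hr0 hd1 (τ + t) (by linarith [le_max_left T₁ T₂]) _ hx'
      ⟨by simpa using hxb t ⟨ht, le_rfl⟩, ?_⟩
    have hxe' : -(c.ℓ (x t - η)) = b := hxe
    show c.ℓ (x t - η) = -b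
    linarith

variable (Q : Cpt P)

theorem subset_stableSet (hrc : 0 < rc) (hS : P.Determined S rc)
    (hconv : SolConverges P.f P.Λ S rc η) {trj : ℝ → Set (E n × ℝ)} (htrj : ∀ r > 0, ∀ q, q ∈ trj r ↔
      ∃ τ p, SolAt P.f P.Λ S r τ p ∧ q = (p, gα P.α τ)) :
    trj rc ⊆ stableSet (Q.F rc) Q.X (η, 1) := by
  intro q hq
  obtain ⟨τ, p, hp, rfl⟩ := (htrj rc hrc q).1 hq
  obtain ⟨x, hx, hx0, hlim⟩ := hS.tendsto_of_solConverges hrc hconv hp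
  exact ⟨_, Q.isSolution_of_sol (gα_mem_Ioc P.α τ) hx, by simp [hx0, theta_zero],
    hlim.prodMk_nhds (tendsto_theta_atTop P.α_pos (gα_mem_Ioc P.α τ))⟩

/-- If the upper edge tail is a connection on the side of `ℓ > 0` and the lower one on the other side,
the trajectories lie on different sides of the stable manifold. -/
theorem sides_of_tails (hrc : 0 < rc) (hS : P.Determined S rc) (h0 : P.f (η, P.lp) = 0)
    (hcrit : IsCriticalRate P.f P.Λ S η rc) {c : Chart P.G η (rc⁻¹, P.lp)} {w : E n}
    (hw1 : c.ℓ w = 1) (hw2 : c.S w = 0) {trj : ℝ → Set (E n × ℝ)} (htrj : ∀ r > 0, ∀ q, q ∈ trj r ↔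
      ∃ τ p, SolAt P.f P.Λ S r τ p ∧ q = (p, gα P.α τ)) {A A' : Set (E n)} {y y' : ℝ → E n}
    (hA : IsAttractor (P.H rc⁻¹) univ A) (hηA : η ∉ A) (hy : IsConnectingOrbit (P.H rc⁻¹) univ η A y)
    (hye : c.Emanates y) (hA' : IsAttractor (P.H rc⁻¹) univ A') (hηA' : η ∉ A')
    (hy' : IsConnectingOrbit (P.H rc⁻¹) univ η A' y') (hye' : c.neg.Emanates y')
    (hup : P.tail S rc (Ioi rc) = {η} ∪ range y ∪ A)
    (hlow : P.tail S rc (Iio rc) = {η} ∪ range y' ∪ A') :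
    LiesOnDifferentSides Q.F Q.X (η, 1) trj rc := by
  obtain ⟨b₁, hb₁, h1⟩ := exists_box_inter_connection h0 hA hηA hy hye
  obtain ⟨b₂, hb₂, h2⟩ := exists_box_inter_connection h0 hA' hηA' hy' hye'
  have ha := c.a_pos
  set b := min (min b₁ b₂) (c.a / 2)
  have hb : 0 < b := lt_min (lt_min hb₁ hb₂) (by linarith)
  have hba : b < c.a := (min_le_right _ _).trans_lt (by linarith)
  have hbb₁ : b ≤ b₁ := (min_le_left _ _).trans (min_le_left _ _)
  have hbb₂ : b ≤ b₂ := (min_le_left _ _).trans (min_le_right _ _)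
  obtain ⟨T₁, δ₁, hδ₁, h3⟩ := exists_exits_of_tail hrc hS h0 hcrit hb hba.le (c := c) (R := Ioi rc)
    (lt_irrefl rc) (fun q hq hqb => h1 q (hup ▸ hq) (c.box_mono hbb₁ hqb))
  obtain ⟨T₂, δ₂, hδ₂, h4⟩ := exists_exits_of_tail hrc hS h0 hcrit hb (c := c.neg) hba.le
    (R := Iio rc) (lt_irrefl rc) (fun q hq hqb => h2 q (hlow ▸ hq) (c.neg.box_mono hbb₂ hqb))
  refine sides_of_exits Q hrc hS h0 hcrit.2.1 hw1 hw2 hb hba htrj (T := max T₁ T₂)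
    (δ := min δ₁ δ₂) (lt_min hδ₁ hδ₂) ?_ ?_
  · intro r hr hr0 τ hτ p hp hpS
    refine h4 r hr.2 hr0 ?_ τ ((le_max_right _ _).trans_lt hτ) p (by simpa using hp) hpS
    rw [abs_of_neg (by linarith [hr.2])]
    linarith [hr.1, min_le_right δ₁ δ₂]
  · intro r hr τ hτ p hp hpS
    refine h3 r hr.1 (hrc.trans hr.1) ?_ τ ((le_max_left _ _).trans_lt hτ) p hp hpS
    rw [abs_of_pos (by linarith [hr.1])]
    linarith [hr.2, min_le_left δ₁ δ₂]

/-- Tipping implies a nondegenerate connection. As the edge tails differ, so do their connecting orbits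
or attractors, which therefore lie on opposite sides of the stable manifold. -/
theorem isNondegenerateConnection_of_tipping (hrc : 0 < rc) (hS : P.Determined S rc)
    (h0 : P.f (η, P.lp) = 0) {c : Chart P.G η (rc⁻¹, P.lp)} {w : E n}
    (hw1 : c.ℓ w = 1) (hw2 : c.S w = 0) {trj : ℝ → Set (E n × ℝ)} (htrj : ∀ r > 0, ∀ q, q ∈ trj r ↔
      ∃ τ p, SolAt P.f P.Λ S r τ p ∧ q = (p, gα P.α τ))
    (h : NondegenerateRTipping P.f P.Λ P.lp S η rc) :
    IsNondegenerateConnection Q.F Q.X (η, 1) trj rc := by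
  have hinv : 0 < rc⁻¹ := inv_pos.2 hrc
  have hG0 : P.G (η, (rc⁻¹, P.lp)) = 0 := by
    show rc⁻¹ • P.f (η, P.lp) = 0
    rw [h0, smul_zero]
  have hne := h.different
  obtain ⟨A, hA, hηA, y, hy, hup⟩ := (setConnects_smul hinv).2 h.upper
  obtain ⟨A', hA', hηA', y', hy', hlow⟩ := (setConnects_smul hinv).2 h.lower
  change IsConnectingOrbit (P.H rc⁻¹) univ η A y at hy
  change IsConnectingOrbit (P.H rc⁻¹) univ η A' y' at hy'
  have hneq : ¬ (range y = range y' ∧ A = A') := by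
    rintro ⟨h1, h2⟩
    exact hne (by rw [hup, hlow, h1, h2])
  rw [Sys.upperEdgeTail_eq hrc] at hup
  rw [Sys.lowerEdgeTail_eq] at hlow
  have hys := (P.isSolution_H_iff.1 hy.solution).mono (subset_univ (Iic 0))
  have hys' := (P.isSolution_H_iff.1 hy'.solution).mono (subset_univ (Iic 0))
  have hconn := subset_stableSet Q hrc hS h.critical.2.1 htrj
  rcases c.emanates_or_neg P.contDiff_G hG0 hys hy.source (hy.ne_source h0 hηA 0) with hye | hye <;>
  rcases c.emanates_or_neg P.contDiff_G hG0 hys' hy'.source (hy'.ne_source h0 hηA' 0) with hye' | hye'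
  · exact absurd (connection_congr hy hye hy' hye') hneq
  · exact ⟨hconn, sides_of_tails Q hrc hS h0 h.critical hw1 hw2 htrj hA hηA hy hye hA' hηA' hy' hye'
      hup hlow, Q.branches_iff.2 fun z => exists_connecting_of_opposite h0 hA hηA hy hye hA' hηA' hy'
        hye'⟩
  · -- the same with the opposite orientation of the unstable direction
    have hye'' : c.neg.neg.Emanates y' := by rwa [c.neg_neg]
    refine ⟨hconn, sides_of_tails Q hrc hS h0 h.critical (c := c.neg) (w := -w) ?_ ?_ htrj hA hηA hy
      hye hA' hηA' hy' hye'' hup hlow, Q.branches_iff.2 fun z => exists_connecting_of_opposite h0 hA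
        hηA hy hye hA' hηA' hy' hye''⟩
    · show -c.ℓ (-w) = 1
      rw [map_neg, neg_neg, hw1]
    · show c.S (-w) = 0
      rw [map_neg, hw2, neg_zero]
  · exact absurd (connection_congr hy hye hy' hye') hneq

end Forward

/-! ### From the compactified system to the edge tails -/

variable {n d : ℕ} {P : Sys n d} {η : E n} {rc : ℝ}

/-- If the unstable manifold of the equilibrium is connected to attractors that do not contain it,
solutions that pass close to the equilibrium and leave the block do not come back to it. -/
theorem not_tendsto_of_exits (hrc : 0 < rc) (h0 : P.f (η, P.lp) = 0) (c : Chart P.G η (rc⁻¹, P.lp))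
    {b ε : ℝ} (hb : 0 < b) (hba : b ≤ c.a) (hε : c.Uniform rc ε b)
    (hbr : ∀ z : ℝ → E n, Sol P.G (fun _ => (rc⁻¹, P.lp)) (Iic 0) z →
      Tendsto z atBot (𝓝 η) → z 0 ≠ η → ∃ A y, IsAttractor (P.H rc⁻¹) univ A ∧ η ∉ A ∧
        IsConnectingOrbit (P.H rc⁻¹) univ η A y ∧ z 0 ∈ range y) :
    ∃ δ > 0, ∀ p ∈ c.obox δ, ∀ s ∈ Ioc (1 - δ) 1, ∀ r ∈ Ioo (rc - δ) (rc + δ), ∀ t,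
      c.ExitsAt (P.sig r⁻¹ s) p b t → ∀ y : ℝ → E n, Sol P.G (P.sig r⁻¹ s) (Ici 0) y → y 0 = p →
        ¬ Tendsto y atTop (𝓝 η) := by
  have hG0 : P.G (η, (rc⁻¹, P.lp)) = 0 := by
    show rc⁻¹ • P.f (η, P.lp) = 0
    rw [h0, smul_zero]
  -- otherwise there is a sequence of solutions that exit and return, starting closer and closer to `η`
  by_contra hcon
  push Not at hcon
  choose p hp s hs r hr t ht y hy hy0 hlim using fun k : ℕ =>
    hcon (min ε (1 / ((k : ℝ) + 1))) (lt_min hε.1 (by positivity))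
  have hle : ∀ k : ℕ, min ε (1 / ((k : ℝ) + 1)) ≤ 1 / ((k : ℝ) + 1) := fun k => min_le_right _ _
  have hsε : ∀ k, s k ∈ Ioc (1 - ε) 1 := fun k =>
    ⟨by linarith [(hs k).1, min_le_left ε (1 / ((k : ℝ) + 1))], (hs k).2⟩
  have hs1 : ∀ k, s k ∈ Ioc (-1 : ℝ) 1 := fun k => Chart.mem_Ioc_of_le hε.2.1 (hsε k)
  have hgood := fun k => (hε.2.2 (r k) ⟨by linarith [(hr k).1, min_le_left ε (1 / ((k : ℝ) + 1))],
    by linarith [(hr k).2, min_le_left ε (1 / ((k : ℝ) + 1))]⟩).2 _ (hsε k)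
  have hdist : ∀ {u : ℕ → ℝ} {u₀ : ℝ}, (∀ k, |u k - u₀| ≤ 1 / ((k : ℝ) + 1)) →
      Tendsto u atTop (𝓝 u₀) := by
    intro u u₀ h
    rw [tendsto_iff_dist_tendsto_zero]
    exact squeeze_zero (fun _ => dist_nonneg) h tendsto_one_div_add_atTop_nhds_zero_nat
  have hrlim : Tendsto r atTop (𝓝 rc) := hdist fun k =>
    abs_le.2 ⟨by linarith [(hr k).1, hle k], by linarith [(hr k).2, hle k]⟩
  have hslim : Tendsto s atTop (𝓝 1) := hdist fun k =>
    abs_le.2 ⟨by linarith [(hs k).1, hle k],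
      by linarith [(hs k).2, show (0 : ℝ) ≤ 1 / ((k : ℝ) + 1) by positivity]⟩
  have hplim : Tendsto p atTop (𝓝 η) := by
    refine tendsto_def.2 fun O hO => ?_
    obtain ⟨b', hb', -, hbO⟩ := c.exists_box_subset hO
    filter_upwards [tendsto_one_div_add_atTop_nhds_zero_nat.eventually_lt_const hb'] with k hk
    exact hbO (c.box_mono ((hle k).trans hk.le) (c.obox_subset_box _ (hp k)))
  have hinv : Tendsto (fun k => (r k)⁻¹) atTop (𝓝 rc⁻¹) := hrlim.inv₀ hrc.ne'
  -- the limit system starts at rest, so that the exit times are unbounded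
  have htt := c.tendsto_exit_time P.contDiff_G (P.tendsto_sig_one hinv hslim hs1) hba
    (fun k u hu => (hgood k u hu).1) hplim ht (Chart.sol_const hG0 (Ici 0)) rfl
    (fun _ _ => c.mem_obox_self hb)
  choose ht0 x hx hx0 hxb hxe using ht
  have hθmem : ∀ k, theta P.α (t k) (s k) ∈ Ioc (-1 : ℝ) 1 := fun k => theta_mem _ _ (hs1 k)
  have hθ : Tendsto (fun k => theta P.α (t k) (s k)) atTop (𝓝 1) :=
    tendsto_of_tendsto_of_tendsto_of_le_of_le hslim tendsto_const_nhds
      (fun k => le_theta P.α_pos (ht0 k) (Ioc_subset_Icc_self (hs1 k))) fun k => (hθmem k).2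
  have hsig : Tendsto (fun k => shiftSig (t k) (P.sig (r k)⁻¹ (s k))) atTop
      (𝓝 (ContinuousMap.const ℝ (rc⁻¹, P.lp))) := by
    simp only [fun k => P.shiftSig_sig (r k)⁻¹ (t k) (hs1 k)]
    exact P.tendsto_sig_one hinv hθ hθmem
  obtain ⟨φ, hφ, z, hz, hzlim⟩ := c.exists_emanating_limit P.contDiff_G hG0 hb hba
    (fun k u hu => (hgood k u hu).1) ht0 htt hsig hx hxb hxe
  have hne : z 0 ≠ η := by
    intro h
    have h2 : Tendsto (fun k => c.ℓ (x (φ k) (t (φ k)) - η)) atTop (𝓝 (c.ℓ (z 0 - η))) :=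
      (c.ℓ.continuous.tendsto _).comp (hzlim.sub_const η)
    simp only [hxe, h, sub_self, map_zero] at h2
    exact hb.ne' (tendsto_nhds_unique tendsto_const_nhds h2)
  obtain ⟨A, w, hA, hηA, hw, a, ha⟩ := hbr z hz.sol hz.tendsto hne
  have hws := P.isSolution_H_iff.1 hw.solution
  obtain ⟨U, hU⟩ := Cpt.exists_traps hA
  obtain ⟨q, hq⟩ := hA.omega.1
  have hcl := hq
  rw [← hw.target] at hcl
  obtain ⟨e, he, heA⟩ := Metric.nhds_basis_closedBall.mem_iff.1
    (hA.compact.isClosed.isOpen_compl.mem_nhds hηA)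
  obtain ⟨M, hM0, hM⟩ := hU.exists_time P.contDiff_G (O := (Metric.closedBall η e)ᶜ)
    Metric.isClosed_closedBall.isOpen_compl (subset_compl_comm.1 heA)
    ((hws.shift a fun _ _ => mem_univ _).mono (subset_univ (Ici (0 : ℝ)))) hq
    (by
      have h1 : map (fun s : ℝ => s + a) atTop = atTop := map_add_atTop_eq a
      rw [MapClusterPt, show (fun s => w (s + a)) = w ∘ (fun s => s + a) from rfl, ← map_map, h1]
      exact hcl.2) (hsig.comp hφ.tendsto_atTop)
    (by
      have := P.eventually_norm_sig_sub_le (hinv.comp hφ.tendsto_atTop) (hθ.comp hφ.tendsto_atTop)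
        (fun k => hθmem (φ k))
      simpa only [Function.comp_apply, fun k => P.shiftSig_sig (r k)⁻¹ (t k) (hs1 k)] using this)
    (I := fun _ => Ici 0) (x := fun k u => y (φ k) (u + t (φ k))) (fun _ => ordConnected_Ici)
    (fun _ => self_mem_Ici)
    (fun k => (hy (φ k)).shift (t (φ k)) fun u hu => add_nonneg hu (ht0 _))
    (by
      simp only [zero_add, ha]
      refine hzlim.congr fun k => ?_
      exact Sol.unique P.contDiff_G ordConnected_Icc (ContinuousMap.continuous _).continuousOn
        (hx (φ k)) ((hy (φ k)).mono Icc_subset_Ici_self) (t₀ := 0) ⟨le_rfl, ht0 _⟩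
        ((hx0 _).trans (hy0 _).symm) _ ⟨ht0 _, le_rfl⟩)
  obtain ⟨k, hk⟩ := hM.exists
  have h1 : Tendsto (fun u => y (φ k) (u + t (φ k))) atTop (𝓝 η) :=
    (hlim (φ k)).comp (tendsto_atTop_add_const_right _ _ tendsto_id)
  obtain ⟨u, hu1, hu2⟩ := ((h1.eventually (Metric.closedBall_mem_nhds η he)).and
    (eventually_ge_atTop M)).exists
  exact hk u (hM0.trans hu2) hu2 hu1

section Backward

variable {S : Start n} (Q : Cpt P)

theorem solConverges_of_subset (hrc : 0 < rc) (hS : P.Determined S rc) {trj : ℝ → Set (E n × ℝ)}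
    (htrj : ∀ r > 0, ∀ q, q ∈ trj r ↔ ∃ τ p, SolAt P.f P.Λ S r τ p ∧ q = (p, gα P.α τ))
    (h : trj rc ⊆ stableSet (Q.F rc) Q.X (η, 1)) : SolConverges P.f P.Λ S rc η := by
  obtain ⟨τ, p, hp⟩ := hS.exists_solAt
  obtain ⟨y, hy, hy0, hlim⟩ := h ((htrj rc hrc _).2 ⟨τ, p, hp, rfl⟩)
  exact Sys.Determined.solConverges_of_tendsto hp (Q.sol_of_isSolution ordConnected_Ici self_mem_Ici
    hy (gα_mem_Ioc P.α τ) (by rw [hy0])) (by simp [hy0])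
    ((continuous_fst.tendsto (η, (1 : ℝ))).comp hlim)

/-- A trajectory that converges to the equilibrium runs into every local stable manifold. -/
theorem exists_mem_localStableSet {r : ℝ} (hr : 0 < r) (hS : P.Determined S rc)
    {trj : ℝ → Set (E n × ℝ)} (htrj : ∀ r > 0, ∀ q, q ∈ trj r ↔
      ∃ τ p, SolAt P.f P.Λ S r τ p ∧ q = (p, gα P.α τ)) {N : Set (E n × ℝ)} (hN : N ∈ 𝓝 (η, (1 : ℝ)))
    (hne : (trj r).Nonempty) (h : SolConverges P.f P.Λ S r η) :
    ∃ q ∈ trj r ∩ N, q ∈ localStableSet (Q.F r) Q.X N (η, 1) := by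
  obtain ⟨q, hq⟩ := hne
  obtain ⟨τ, p, hp, rfl⟩ := (htrj r hr q).1 hq
  obtain ⟨x, hx, hx0, hlim⟩ := hS.tendsto_of_solConverges hr h hp
  have hsol := Q.isSolution_of_sol (gα_mem_Ioc P.α τ) hx
  have hlim' : Tendsto (fun t => (x t, theta P.α t (gα P.α τ))) atTop (𝓝 (η, 1)) :=
    hlim.prodMk_nhds (tendsto_theta_atTop P.α_pos (gα_mem_Ioc P.α τ))
  obtain ⟨T, hT⟩ := eventually_atTop.1 ((hlim'.eventually hN).and (eventually_ge_atTop 0))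
  obtain ⟨hTN, hT0⟩ := hT T le_rfl
  refine ⟨(x T, gα P.α (τ + T)), ⟨(htrj r hr _).2 ⟨_, _, (hS.solAt_add_iff hr hp hT0).2
    ⟨x, hx.mono Icc_subset_Ici_self, hx0, rfl⟩, rfl⟩, by rwa [theta_gα] at hTN⟩, ?_⟩
  have hsh : Sol P.G (P.sig r⁻¹ (gα P.α (τ + T))) (Ici 0) (fun t => x (t + T)) := by
    rw [← P.shiftSig_sig_gα]
    exact hx.shift T fun t ht => add_nonneg ht hT0
  have hθ : ∀ t, theta P.α t (gα P.α (τ + T)) = theta P.α (t + T) (gα P.α τ) := by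
    intro t
    rw [theta_gα, theta_gα, add_assoc, add_comm t T]
  refine ⟨_, Q.isSolution_of_sol (gα_mem_Ioc P.α _) hsh, by simp [theta_zero], fun t ht => ?_, ?_⟩
  · simp only [hθ]
    exact (hT (t + T) (by linarith)).1
  · simp only [hθ]
    exact hlim'.comp (tendsto_atTop_add_const_right _ _ tendsto_id)

/-- If the trajectories for the rates below and above `rc` lie on different sides of the stable
manifold, `rc` is critical, and the solutions leave a block through different faces. -/
theorem leaves_of_sides (hrc : 0 < rc) (hS : P.Determined S rc) (h0 : P.f (η, P.lp) = 0)
    {c : Chart P.G η (rc⁻¹, P.lp)} {w : E n} (hw1 : c.ℓ w = 1) (hw2 : c.S w = 0)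
    {trj : ℝ → Set (E n × ℝ)} (htrj : ∀ r > 0, ∀ q, q ∈ trj r ↔
      ∃ τ p, SolAt P.f P.Λ S r τ p ∧ q = (p, gα P.α τ)) (hconv : SolConverges P.f P.Λ S rc η)
    (hbr : ∀ z : ℝ → E n, Sol P.G (fun _ => (rc⁻¹, P.lp)) (Iic 0) z →
      Tendsto z atBot (𝓝 η) → z 0 ≠ η → ∃ A y, IsAttractor (P.H rc⁻¹) univ A ∧ η ∉ A ∧
        IsConnectingOrbit (P.H rc⁻¹) univ η A y ∧ z 0 ∈ range y)
    (h : LiesOnDifferentSides Q.F Q.X (η, 1) trj rc) : IsCriticalRate P.f P.Λ S η rc ∧ ∃ T b,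
      (Leaves c S T b (Ioi rc) ∧ Leaves c.neg S T b (Iio rc)) ∨
        (Leaves c.neg S T b (Ioi rc) ∧ Leaves c S T b (Iio rc)) := by
  obtain ⟨δ, hδ, hδrc, N, hN, hηN, Sm, Sp, hne, himg, hm, hp⟩ := h
  have hoff : ∀ C ∈ ({Sm, Sp} : Set (Set ((E n × ℝ) × ℝ))), C ⊆ offStable Q.F Q.X N (η, 1) rc δ ∧
      ∀ z ∈ C, connectedComponentIn (offStable Q.F Q.X N (η, 1) rc δ) z = C := by
    intro C hC
    rw [← himg] at hC
    obtain ⟨z, -, rfl⟩ := hC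
    exact ⟨connectedComponentIn_subset _ _, fun z' hz' => (connectedComponentIn_eq hz').symm⟩
  have hSm := hoff Sm (Or.inl rfl)
  have hSp := hoff Sp (Or.inr rfl)
  -- a converging solution would have points on the local stable manifold
  have hcrit : ∀ r ∈ Ioo (rc - δ) (rc + δ), r ≠ rc → ¬ SolConverges P.f P.Λ S r η := by
    intro r hr hrne hcv
    have hr0 : 0 < r := by linarith [hr.1]
    have hNn : N ∈ 𝓝 (η, (1 : ℝ)) := hN.mem_nhds hηN
    rcases lt_or_gt_of_ne hrne with hlt | hgt
    · obtain ⟨q, hq, hqs⟩ := exists_mem_localStableSet Q hr0 hS htrj hNn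
        ((hm r ⟨hr.1, hlt⟩).1.mono inter_subset_left) hcv
      exact (hSm.1 ((hm r ⟨hr.1, hlt⟩).2 q hq)).2.2 hqs
    · obtain ⟨q, hq, hqs⟩ := exists_mem_localStableSet Q hr0 hS htrj hNn
        ((hp r ⟨hgt, hr.2⟩).1.mono inter_subset_left) hcv
      exact (hSp.1 ((hp r ⟨hgt, hr.2⟩).2 q hq)).2.2 hqs
  have hcrit' : IsCriticalRate P.f P.Λ S η rc := by
    refine ⟨hrc, hconv, δ, hδ, fun r _ h1 h2 => hcrit r ?_ ?_⟩
    · exact ⟨by linarith [(abs_lt.1 h2).1], by linarith [(abs_lt.1 h2).2]⟩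
    · rintro rfl
      simp at h1
  refine ⟨hcrit', ?_⟩
  have ha := c.a_pos
  set b := c.a with hbdef
  have hb : 0 < b := ha
  have hba : b ≤ c.a := le_rfl
  obtain ⟨ε₁, hε₁⟩ := Chart.exists_uniform hrc (c := c) h0 hb
  obtain ⟨δ₁, hδ₁, hret₁⟩ := not_tendsto_of_exits hrc h0 c hb hba hε₁ hbr
  obtain ⟨δ₂, hδ₂, hret₂⟩ := not_tendsto_of_exits hrc h0 c.neg hb hba hε₁.neg hbr
  -- a small product neighbourhood inside `N`
  obtain ⟨O, hO, V, hV, hOV⟩ := mem_nhds_prod_iff.1 (hN.mem_nhds hηN)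
  obtain ⟨b₁, hb₁, -, hbO⟩ := c.exists_box_subset hO
  obtain ⟨ε₂, hε₂, hεV⟩ := Metric.mem_nhds_iff.1 hV
  set m := min (min b₁ (c.a)) (min δ₁ δ₂) with hmdef
  have hm0 : 0 < m := lt_min (lt_min hb₁ ha) (lt_min hδ₁ hδ₂)
  have hmb₁ : m ≤ b₁ := (min_le_left _ _).trans (min_le_left _ _)
  have hma : m ≤ b := (min_le_left _ _).trans (min_le_right _ _)
  have hmδ₁ : m ≤ δ₁ := (min_le_right _ _).trans (min_le_left _ _)
  have hmδ₂ : m ≤ δ₂ := (min_le_right _ _).trans (min_le_right _ _)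
  obtain ⟨ε₃, hε₃⟩ := Chart.exists_uniform hrc (c := c) h0 hm0
  set ε := min (min (min ε₁ ε₂) (min δ₁ δ₂)) (min ε₃ δ) with hεdef
  have hε0 : 0 < ε := lt_min (lt_min (lt_min hε₁.1 hε₂) (lt_min hδ₁ hδ₂)) (lt_min hε₃.1 hδ)
  have hεε₁ : ε ≤ ε₁ := (min_le_left _ _).trans ((min_le_left _ _).trans (min_le_left _ _))
  have hεε₂ : ε ≤ ε₂ := (min_le_left _ _).trans ((min_le_left _ _).trans (min_le_right _ _))
  have hεδ₁ : ε ≤ δ₁ := (min_le_left _ _).trans ((min_le_right _ _).trans (min_le_left _ _))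
  have hεδ₂ : ε ≤ δ₂ := (min_le_left _ _).trans ((min_le_right _ _).trans (min_le_right _ _))
  have hεε₃ : ε ≤ ε₃ := (min_le_right _ _).trans (min_le_left _ _)
  have hεδ : ε ≤ δ := (min_le_right _ _).trans (min_le_right _ _)
  have hunif : c.Uniform rc ε m := hε₃.mono hε0 hεε₃ le_rfl
  have hmemN : ∀ p ∈ c.obox m, ∀ s ∈ Ioc (1 - ε) 1, (p, s) ∈ N := by
    intro p hp s hs
    refine hOV ⟨hbO (c.box_mono hmb₁ (c.obox_subset_box _ hp)), hεV ?_⟩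
    rw [Metric.mem_ball, Real.dist_eq, abs_lt]
    exact ⟨by linarith [hs.1], by linarith [hs.2]⟩
  -- each of the two exit sets lies in one component
  have hexit : ∀ c' : Chart P.G η (rc⁻¹, P.lp), c'.obox m = c.obox m → c'.Uniform rc ε m →
      (∀ p ∈ c'.obox m, ∀ s ∈ Ioc (1 - ε) 1, ∀ r ∈ Ioo (rc - ε) (rc + ε), ∀ t,
        c'.ExitsAt (P.sig r⁻¹ s) p b t → ∀ y : ℝ → E n, Sol P.G (P.sig r⁻¹ s) (Ici 0) y → y 0 = p →
          ¬ Tendsto y atTop (𝓝 η)) → IsPreconnected (c'.exitSet rc ε ε m b) →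
      ∀ z ∈ c'.exitSet rc ε ε m b, ∀ z' ∈ c'.exitSet rc ε ε m b, ∀ C ∈ ({Sm, Sp} : Set _),
        ∀ C' ∈ ({Sm, Sp} : Set _), z ∈ C → z' ∈ C' → C = C' := by
    intro c' hob hun hret hpre z hz z' hz' C hC C' hC' hzC hzC'
    have hsub : c'.exitSet rc ε ε m b ⊆ offStable Q.F Q.X N (η, 1) rc δ := by
      rintro ⟨⟨p, s⟩, r⟩ ⟨hpm, hs, hr, t, ht⟩
      have hs1 := Chart.mem_Ioc_of_le hun.2.1 hs
      refine ⟨⟨hmemN p (hob ▸ hpm) s hs, Q.mem_X hs1⟩,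
        ⟨by linarith [hr.1], by linarith [hr.2]⟩, ?_⟩
      rintro ⟨y, hy, hy0, -, hlim⟩
      exact hret p hpm s hs r hr t ht (fun t => (y t).1)
        (Q.sol_of_isSolution ordConnected_Ici self_mem_Ici hy hs1 (by rw [hy0])) (by simp [hy0])
        ((continuous_fst.tendsto (η, (1 : ℝ))).comp hlim)
    have h1 := hpre.subset_connectedComponentIn hz hsub hz'
    rw [← (hoff C hC).2 z hzC, ← (hoff C' hC').2 z' hzC', connectedComponentIn_eq h1]
  have hexp := hexit c rfl hunif (fun p hp s hs r hr t ht => hret₁ p (c.obox_mono hmδ₁ hp) s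
      ⟨by linarith [hs.1], hs.2⟩ r ⟨by linarith [hr.1], by linarith [hr.2]⟩ t ht)
    (c.isPreconnected_exitSet hm0 hma hba hunif hε0 le_rfl hw1 hw2)
  have hexn := hexit c.neg (c.obox_neg m) hunif.neg (fun p hp s hs r hr t ht =>
      hret₂ p (c.neg.obox_mono hmδ₂ hp) s ⟨by linarith [hs.1], hs.2⟩ r
        ⟨by linarith [hr.1], by linarith [hr.2]⟩ t ht)
    (c.isPreconnected_exitSet_neg hm0 hma hba hunif hε0 le_rfl hw1 hw2)
  -- at the time `T` the solutions for all rates near `rc` lie in the small block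
  obtain ⟨τ₁, p₁, h₁⟩ := hS.exists_solAt
  obtain ⟨x, hx, hx0, hxlim⟩ := hS.tendsto_of_solConverges hrc hconv h₁
  obtain ⟨u, hu⟩ := eventually_atTop.1 ((hxlim.eventually ((c.isOpen_obox m).mem_nhds
    (c.mem_obox_self hm0))).and ((((tendsto_gα_atTop P.α_pos).comp (tendsto_atTop_add_const_left _ τ₁
      tendsto_id)).eventually_const_lt (show 1 - ε < 1 by linarith)).and
        (eventually_ge_atTop 0)))
  obtain ⟨hu1, hu2, hu0⟩ := hu u le_rfl
  set T := τ₁ + u with hTdef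
  have hT : gα P.α T ∈ Ioc (1 - ε) 1 := ⟨hu2, (gα_mem P.α T).2.le⟩
  have h₂ : SolAt P.f P.Λ S rc T (x u) := (hS.solAt_add_iff hrc h₁ hu0).2
    ⟨x, hx.mono Icc_subset_Ici_self, hx0, rfl⟩
  have hstay : ∃ y : ℝ → E n, SolAt P.f P.Λ S rc T (y 0) ∧
      Sol P.G (P.sig rc⁻¹ (gα P.α T)) (Ici 0) y ∧ (∀ t ≥ 0, y t ∈ c.obox b) ∧
        Tendsto y atTop (𝓝 η) := by
    refine ⟨fun t => x (t + u), by simpa using h₂, ?_,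
      fun t ht => c.obox_mono hma (hu (t + u) (by linarith)).1,
      hxlim.comp (tendsto_atTop_add_const_right _ _ tendsto_id)⟩
    rw [hTdef, ← P.shiftSig_sig_gα]
    exact hx.shift u fun t ht => add_nonneg ht hu0
  obtain ⟨δ₃, hδ₃, h₃⟩ := Metric.eventually_nhds_iff.1
    (hS.continuous _ _ h₂ _ ((c.isOpen_obox m).mem_nhds hu1))
  have hr : ∀ r, |r - rc| < min ε δ₃ → r ∈ Ioo (rc - ε) (rc + ε) ∧ 0 < r ∧
      (∀ t ≥ 0, c.Good b (P.sig r⁻¹ (gα P.α T) t)) ∧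
        ∃ p ∈ c.obox m, SolAt P.f P.Λ S r T p := by
    intro r hr
    have h1 := abs_lt.1 (hr.trans_le (min_le_left _ _))
    have h2 : r ∈ Ioo (rc - ε) (rc + ε) := ⟨by linarith [h1.1], by linarith [h1.2]⟩
    obtain ⟨q, hq, hq'⟩ := h₃ (y := r) (hr.trans_le (min_le_right _ _))
    exact ⟨h2, (hunif.2.2 r h2).1, fun t ht => ((hunif.2.2 r h2).2 _ hT t ht).mono c hma, q, hq, hq'⟩
  -- the solutions for the other rates leave the block
  have hdich : ∀ r, |r - rc| < min ε δ₃ → r ≠ rc → ∀ p ∈ c.obox m, SolAt P.f P.Λ S r T p →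
      (∃ t, c.ExitsAt (P.sig r⁻¹ (gα P.α T)) p b t) ∨
        ∃ t, c.neg.ExitsAt (P.sig r⁻¹ (gα P.α T)) p b t := by
    intro r hrd hrne p hpm hpS
    obtain ⟨h1, h2, h3, -⟩ := hr r hrd
    rcases c.stays_or_exits P.contDiff_G hb hba h3 (c.obox_mono hma hpm) with ⟨y, hy, hy0, hyb⟩ | h4
    · exfalso
      have hν₁ : ‖((r⁻¹, P.lp) : ℝ × E d) - (rc⁻¹, P.lp)‖ ≤ c.ε := by
        have := ((hunif.2.2 r h1).2 1 ⟨by linarith, le_rfl⟩ 0 le_rfl).1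
        rwa [P.sig_one] at this
      have hlim := c.tendsto_atTop_of_stays P.contDiff_G
        (P.tendsto_sig_atTop r⁻¹ (gα_mem_Ioc P.α T)) hν₁
        (by show r⁻¹ • P.f (η, P.lp) = 0; rw [h0, smul_zero]) hy
        (fun t ht => c.box_mono hba (c.obox_subset_box _ (hyb t ht))) (fun t ht => (h3 t ht).1)
      exact hcrit r ⟨by linarith [h1.1], by linarith [h1.2]⟩ hrne
        (Sys.Determined.solConverges_of_tendsto hpS hy hy0 hlim)
    · exact h4
  have hmem : ∀ r, |r - rc| < min ε δ₃ → ∀ p ∈ c.obox m, SolAt P.f P.Λ S r T p →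
      (rc < r → ((p, gα P.α T), r) ∈ Sp) ∧ (r < rc → ((p, gα P.α T), r) ∈ Sm) := by
    intro r hrd p hpm hpS
    obtain ⟨h1, h2, -, -⟩ := hr r hrd
    have h3 : (p, gα P.α T) ∈ trj r ∩ N := ⟨(htrj r h2 _).2 ⟨T, p, hpS, rfl⟩, hmemN p hpm _ hT⟩
    exact ⟨fun h => (hp r ⟨h, by linarith [h1.2]⟩).2 _ h3,
      fun h => (hm r ⟨by linarith [h1.1], h⟩).2 _ h3⟩
  have hmin : 0 < min ε δ₃ := lt_min hε0 hδ₃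
  have hSmmem : Sm ∈ ({Sm, Sp} : Set (Set ((E n × ℝ) × ℝ))) := Or.inl rfl
  have hSpmem : Sp ∈ ({Sm, Sp} : Set (Set ((E n × ℝ) × ℝ))) := Or.inr rfl
  -- rates above and below `rc` do not leave through the same face
  have hopp : ∀ c' : Chart P.G η (rc⁻¹, P.lp), c'.obox m = c.obox m →
      (∀ z ∈ c'.exitSet rc ε ε m b, ∀ z' ∈ c'.exitSet rc ε ε m b, ∀ C ∈ ({Sm, Sp} : Set _),
        ∀ C' ∈ ({Sm, Sp} : Set _), z ∈ C → z' ∈ C' → C = C') →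
      ∀ r, |r - rc| < min ε δ₃ → rc < r → ∀ p ∈ c.obox m, SolAt P.f P.Λ S r T p →
        (∃ t, c'.ExitsAt (P.sig r⁻¹ (gα P.α T)) p b t) →
      ∀ r', |r' - rc| < min ε δ₃ → r' < rc → ∀ p' ∈ c.obox m, SolAt P.f P.Λ S r' T p' →
        ¬ ∃ t, c'.ExitsAt (P.sig r'⁻¹ (gα P.α T)) p' b t := by
    intro c' hob hC r hrd hrr p hpm hpS hex r' hrd' hrr' p' hpm' hpS' hex'
    refine hne (hC ((p', gα P.α T), r') ⟨by rw [hob]; exact hpm', hT, (hr r' hrd').1, hex'⟩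
      ((p, gα P.α T), r) ⟨by rw [hob]; exact hpm, hT, (hr r hrd).1, hex⟩ Sm hSmmem Sp hSpmem
      ((hmem r' hrd' p' hpm' hpS').2 hrr') ((hmem r hrd p hpm hpS).1 hrr))
  have hoppp := hopp c rfl hexp
  have hoppn := hopp c.neg (c.obox_neg m) hexn
  have hleaves : ∀ c' : Chart P.G η (rc⁻¹, P.lp), c'.a = c.a → (∀ x, x ∈ c'.obox b ↔ x ∈ c.obox b) →
      (∀ ν, c'.Good b ν ↔ c.Good b ν) → ∀ R : Set ℝ, rc ∈ closure R → (∀ r ∈ R, |r - rc| < min ε δ₃ →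
        ∀ p ∈ c.obox m, SolAt P.f P.Λ S r T p →
          ∃ t, c'.ExitsAt (P.sig r⁻¹ (gα P.α T)) p b t) → Leaves c' S T b R := by
    intro c' hca hob hgd R hR hex
    refine ⟨hb, by rw [hca], ?_, ?_, hR⟩
    · simpa only [hob] using hstay
    · have hev : ∀ᶠ r in 𝓝[R] rc, |r - rc| < min ε δ₃ :=
        eventually_nhdsWithin_of_eventually_nhds (Metric.ball_mem_nhds rc hmin)
      filter_upwards [hev, eventually_mem_nhdsWithin] with r hrd hrR
      obtain ⟨-, h2, h3, p, hpm, hpS⟩ := hr r hrd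
      exact ⟨h2, fun t ht => (hgd _).2 (h3 t ht), p, hpS, hex r hrR hrd p hpm hpS⟩
  have hleavesp := hleaves c rfl (fun _ => Iff.rfl) (fun _ => Iff.rfl)
  have hleavesn := hleaves c.neg rfl (fun x => by rw [c.obox_neg]) (fun ν => c.good_neg)
  have hclu : rc ∈ closure (Ioi rc) := by rw [closure_Ioi]; exact self_mem_Ici
  have hcll : rc ∈ closure (Iio rc) := by rw [closure_Iio]; exact self_mem_Iic
  -- sample rates above and below `rc`
  have hμ : 0 < min ε δ₃ / 2 := by positivity
  have hup : |rc + min ε δ₃ / 2 - rc| < min ε δ₃ := by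
    rw [add_sub_cancel_left, abs_of_pos hμ]; linarith
  have hlo : |rc - min ε δ₃ / 2 - rc| < min ε δ₃ := by
    rw [sub_sub_cancel_left, abs_neg, abs_of_pos hμ]; linarith
  obtain ⟨-, -, -, p, hpm, hpS⟩ := hr _ hup
  obtain ⟨-, -, -, p', hpm', hpS'⟩ := hr _ hlo
  have hup' : rc < rc + min ε δ₃ / 2 := by linarith
  have hlo' : rc - min ε δ₃ / 2 < rc := by linarith
  refine ⟨T, b, ?_⟩
  rcases hdich _ hup hup'.ne' p hpm hpS with hex | hex
  · refine Or.inl ⟨?_, ?_⟩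
    · refine hleavesp _ hclu fun r hrR hrd q hqm hqS => ?_
      refine (hdich r hrd (ne_of_gt hrR) q hqm hqS).resolve_right fun hq => ?_
      rcases hdich _ hlo hlo'.ne p' hpm' hpS' with hex' | hex'
      · exact hoppp _ hup hup' p hpm hpS hex _ hlo hlo' p' hpm' hpS' hex'
      · exact hoppn r hrd hrR q hqm hqS hq _ hlo hlo' p' hpm' hpS' hex'
    · refine hleavesn _ hcll fun r hrR hrd q hqm hqS => ?_
      exact (hdich r hrd (ne_of_lt hrR) q hqm hqS).resolve_left
        (hoppp _ hup hup' p hpm hpS hex r hrd hrR q hqm hqS)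
  · refine Or.inr ⟨?_, ?_⟩
    · refine hleavesn _ hclu fun r hrR hrd q hqm hqS => ?_
      refine (hdich r hrd (ne_of_gt hrR) q hqm hqS).resolve_left fun hq => ?_
      rcases hdich _ hlo hlo'.ne p' hpm' hpS' with hex' | hex'
      · exact hoppp r hrd hrR q hqm hqS hq _ hlo hlo' p' hpm' hpS' hex'
      · exact hoppn _ hup hup' p hpm hpS hex _ hlo hlo' p' hpm' hpS' hex'
    · refine hleavesp _ hcll fun r hrR hrd q hqm hqS => ?_
      exact (hdich r hrd (ne_of_lt hrR) q hqm hqS).resolve_right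
        (hoppn _ hup hup' p hpm hpS hex r hrd hrR q hqm hqS)

/-- Exits through opposite faces have different connections as edge tails. -/
theorem tails_of_leaves (hrc : 0 < rc) (hS : P.Determined S rc) (h0 : P.f (η, P.lp) = 0)
    (hbr : ∀ z : ℝ → E n, Sol P.G (fun _ => (rc⁻¹, P.lp)) (Iic 0) z →
      Tendsto z atBot (𝓝 η) → z 0 ≠ η → ∃ A y, IsAttractor (P.H rc⁻¹) univ A ∧ η ∉ A ∧
        IsConnectingOrbit (P.H rc⁻¹) univ η A y ∧ z 0 ∈ range y)
    {c : Chart P.G η (rc⁻¹, P.lp)} {T b : ℝ} {R R' : Set ℝ} (hR : Leaves c S T b R)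
    (hR' : Leaves c.neg S T b R') : P.tail S rc R ≠ P.tail S rc R' ∧
      SetConnects (fun x => P.f (x, P.lp)) univ η (P.tail S rc R) ∧
      SetConnects (fun x => P.f (x, P.lp)) univ η (P.tail S rc R') := by
  obtain ⟨A, y, hA, hηA, hy, hye, ht⟩ := hR.exists_tail_eq hrc hS h0 hbr
  obtain ⟨A', y', hA', hηA', hy', hye', ht'⟩ := hR'.exists_tail_eq hrc hS h0 hbr
  have hinv : 0 < rc⁻¹ := inv_pos.2 hrc
  refine ⟨fun h => ?_, (setConnects_smul hinv).1 ⟨A, hA, hηA, y, hy, ht⟩,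
    (setConnects_smul hinv).1 ⟨A', hA', hηA', y', hy', ht'⟩⟩
  refine notMem_of_opposite h0 hA hηA hy hye hηA' hy' hye' ?_
  rw [← ht, h, ht']
  exact Or.inl (Or.inr ⟨0, rfl⟩)

/-- A nondegenerate connection implies tipping: the solutions for rates above and below `rc` leave
through opposite faces, so that the edge tails are different connections. -/
theorem tipping_of_isNondegenerateConnection (hrc : 0 < rc) (hS : P.Determined S rc)
    (hη : IsRegularEdgeEquilibrium (fun x => P.f (x, P.lp)) η)
    {c : Chart P.G η (rc⁻¹, P.lp)} {w : E n}
    (hw1 : c.ℓ w = 1) (hw2 : c.S w = 0) {trj : ℝ → Set (E n × ℝ)} (htrj : ∀ r > 0, ∀ q, q ∈ trj r ↔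
      ∃ τ p, SolAt P.f P.Λ S r τ p ∧ q = (p, gα P.α τ))
    (h : IsNondegenerateConnection Q.F Q.X (η, 1) trj rc) :
    NondegenerateRTipping P.f P.Λ P.lp S η rc := by
  have hbr := Q.branches_iff.1 h.branches
  have hconv := solConverges_of_subset Q hrc hS htrj h.connection
  obtain ⟨hcrit, T, b, ⟨hu, hl⟩ | ⟨hu, hl⟩⟩ :=
    leaves_of_sides Q hrc hS hη.1 hw1 hw2 htrj hconv hbr h.sides
  · obtain ⟨h1, h2, h3⟩ := tails_of_leaves hrc hS hη.1 hbr hu hl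
    rw [← Sys.upperEdgeTail_eq hrc, ← Sys.lowerEdgeTail_eq] at h1
    rw [← Sys.upperEdgeTail_eq hrc] at h2
    rw [← Sys.lowerEdgeTail_eq] at h3
    exact ⟨hcrit, hη, h1, h2, h3⟩
  · obtain ⟨h1, h2, h3⟩ := tails_of_leaves hrc hS hη.1 hbr hl hu
    rw [← Sys.upperEdgeTail_eq hrc, ← Sys.lowerEdgeTail_eq] at h1
    rw [← Sys.lowerEdgeTail_eq] at h2
    rw [← Sys.upperEdgeTail_eq hrc] at h3
    exact ⟨hcrit, hη, h1.symm, h3, h2⟩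

end Backward

/-! ### The equivalence -/

section Equivalence

variable {n d : ℕ} {P : Sys n d} {η : E n} {rc : ℝ}

theorem tipping_iff (Q : Cpt P) {S : Start n} (hrc : 0 < rc) (hS : P.Determined S rc)
    (hη : IsRegularEdgeEquilibrium (fun x => P.f (x, P.lp)) η) {trj : ℝ → Set (E n × ℝ)}
    (htrj : ∀ r > 0, ∀ q, q ∈ trj r ↔ ∃ τ p, SolAt P.f P.Λ S r τ p ∧ q = (p, gα P.α τ)) :
    NondegenerateRTipping P.f P.Λ P.lp S η rc ↔
      IsNondegenerateConnection Q.F Q.X (η, 1) trj rc := by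
  obtain ⟨c, w, hw1, hw2⟩ := exists_edge_chart P.contDiff_f hη (inv_pos.2 hrc)
  exact ⟨isNondegenerateConnection_of_tipping Q hrc hS hη.1 hw1 hw2 htrj,
    tipping_of_isNondegenerateConnection Q hrc hS hη hw1 hw2 htrj⟩

theorem tipping_iff_point (Q : Cpt P) (hrc : 0 < rc)
    (hη : IsRegularEdgeEquilibrium (fun x => P.f (x, P.lp)) η) (x₀ : E n) (τ₀ : ℝ) :
    NondegenerateRTipping P.f P.Λ P.lp (Start.point x₀ τ₀) η rc ↔
      IsNondegenerateConnection Q.F Q.X (η, 1)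
        (fun r => compactTrj (Q.F r) Q.X P.α (Start.point x₀ τ₀)) rc :=
  tipping_iff Q hrc (P.determined_point x₀ τ₀ hrc) hη fun _ hr _ =>
    Q.mem_compactTrj_point (P.determined_point x₀ τ₀ hrc) hr

theorem tipping_iff_past (Q : Cpt P) (hrc : 0 < rc)
    (hη : IsRegularEdgeEquilibrium (fun x => P.f (x, P.lp)) η) {lm : E d}
    (hlm : Tendsto P.Λ atBot (𝓝 lm)) {e : E n} (he : IsHyperbolicSink (fun x => P.f (x, lm)) e) :
    NondegenerateRTipping P.f P.Λ P.lp (Start.past e) η rc ↔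
      IsNondegenerateConnection Q.F Q.X (η, 1)
        (fun r => compactTrj (Q.F r) Q.X P.α (Start.past e)) rc := by
  -- the unstable direction of the edge state shows that the phase space is not trivial
  have hn : 0 < n := by
    obtain ⟨c, w, hw1, -⟩ := exists_edge_chart P.contDiff_f hη (inv_pos.2 hrc)
    rcases Nat.eq_zero_or_pos n with rfl | h
    · rw [Subsingleton.elim w 0, map_zero] at hw1
      exact absurd hw1 zero_ne_one
    · exact h
  exact tipping_iff Q hrc (P.determined_past hlm he.1
    (fun _ hρ => exists_sink_chart hn P.contDiff_f he hρ) hrc) hη fun _ _ _ => Q.mem_compactTrj_past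

end Equivalence

/-- The compactification with the phase space `ℝⁿ × (-1,1]`. -/
def Sys.cptOne {n d : ℕ} (P : Sys n d) : Cpt P where
  J := Ioc (-1) 1
  input := inputOne P.Λ P.α P.lp
  Ioc_subset := Subset.rfl
  subset_Icc := Ioc_subset_Icc_self
  input_eq _ _ := rfl

/-- The compactification with the phase space `ℝⁿ × [-1,1]`. -/
def Sys.cptTwo {n d : ℕ} (P : Sys n d) (lm : E d) : Cpt P where
  J := Icc (-1) 1
  input := inputTwo P.Λ P.α lm P.lp
  Ioc_subset := Ioc_subset_Icc_self
  subset_Icc := Subset.rfl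
  input_eq _ hs := if_neg hs.1.ne'

end RTip

end

theorem mainTheorem2 {n d : ℕ}
    (f : RTip.E n × RTip.E d → RTip.E n) (hf : ContDiff ℝ 1 f)
    (Λ : ℝ → RTip.E d) (hΛ : ContDiff ℝ 1 Λ)
    (lp : RTip.E d) (ρ : ℝ) (hρ : 0 < ρ) (hfuture : RTip.ExpConstFuture Λ ρ lp)
    (η : RTip.E n) (hη : RTip.IsRegularEdgeEquilibrium (fun x => f (x, lp)) η)
    (α : ℝ) (hα₀ : 0 < α) (hα : α ≤ ρ) (rc : ℝ) (hrc : 0 < rc) :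
    (∀ (x₀ : RTip.E n) (τ₀ : ℝ),
      RTip.NondegenerateRTipping f Λ lp (RTip.Start.point x₀ τ₀) η rc ↔
        RTip.IsNondegenerateConnection
          (RTip.compactField f (RTip.inputOne Λ α lp) α) (RTip.phaseOne n) (η, 1)
          (fun r => RTip.compactTrj (RTip.compactField f (RTip.inputOne Λ α lp) α r)
            (RTip.phaseOne n) α (RTip.Start.point x₀ τ₀)) rc) ∧
    (∀ (lm : RTip.E d) (e : RTip.E n), RTip.ExpConstPast Λ ρ lm →
      RTip.IsHyperbolicSink (fun x => f (x, lm)) e →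
      ∀ S : RTip.Start n, ((∃ x₀ τ₀, S = RTip.Start.point x₀ τ₀) ∨ S = RTip.Start.past e) →
        (RTip.NondegenerateRTipping f Λ lp S η rc ↔
          RTip.IsNondegenerateConnection
            (RTip.compactField f (RTip.inputTwo Λ α lm lp) α) (RTip.phaseTwo n) (η, 1)
            (fun r => RTip.compactTrj (RTip.compactField f (RTip.inputTwo Λ α lm lp) α r)
              (RTip.phaseTwo n) α S) rc)) := by
  let P : RTip.Sys n d := ⟨f, hf, Λ, hΛ.continuous, lp, hfuture.1, α, hα₀⟩
  refine ⟨RTip.tipping_iff_point P.cptOne hrc hη, fun lm e hpast he S hS => ?_⟩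
  rcases hS with ⟨x₀, τ₀, rfl⟩ | rfl
  · exact RTip.tipping_iff_point (P.cptTwo lm) hrc hη x₀ τ₀
  · exact RTip.tipping_iff_past (P.cptTwo lm) hrc hη hpast.1 he
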